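/- **Setting.** Let $K$ be a finite-dimensional Hopf algebra over a field $\mathbb F$ of characteristic zero, with $R$-matrix $R=R_1\otimes R_2$ and ribbon element $\nu$ (central, invertible, $\nu^2=uS(u)$, $\epsilon(\nu)=1$, $S(\nu)=\nu$, $\Delta(\nu)=R^{-1}R_{21}^{-1}(\nu\otimes\nu)$, where $u=S(R_2)R_1$), and let $g=u^{-1}\nu$. Let $\Gamma$ be a finite directed graph (loops, multiple edges and isolated vertices allowed) with vertex set $V$ and edge set $E$. Each edge $e$ has an outgoing end $s(e)$ at its starting vertex $\mathrm{st}(e)$ and an incoming end $t(e)$ at its target vertex $\mathrm{ta}(e)$; the ends at each vertex are linearly ordered. For a finite index set $X$ and $x\in X$, $(\alpha)_x\in K^{*\otimes X}$ has $\alpha$ in the factor $x$ and the unit $\epsilon$ elsewhere. **Algebras.** Put $\tau(h)=0$ for incoming and $\tau(h)=1$ for outgoing ends. Choose for each edge one of its ends, $\rho(e)$; put $\sigma(h)=0$ if $h$ is a chosen end and $\sigma(h)=1$ otherwise. Let $\bigotimes_v\mathcal A^*_v$ be $K^{*\otimes 2E}$ with unit $\epsilon^{\otimes 2E}$ and the associative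 product for which elements at different vertices commute and, at a common vertex, $$(\alpha)_i(\beta)_i=\begin{cases}\langle\beta_{(1)}\otimes\alpha_{(1)},R\rangle(\beta_{(2)}\alpha_{(2)})_i&\sigma=0,\tau=0\\ \langle\beta_{(2)}\otimes\alpha_{(2)},R\rangle(\alpha_{(1)}\beta_{(1)})_i&\sigma=0,\tau=1\\ (\alpha\beta)_i&\sigma=1,\tau=0\\ (\beta\alpha)_i&\sigma=1,\tau=1,\end{cases}$$ $(\alpha)_i(\beta)_j=(\alpha\otimes\beta)_{ij}$ for $i<j$, and for $i>j$ $$(\alpha)_i(\beta)_j=\langle\beta_{(1+\tau(j))}\otimes\alpha_{(1+\tau(i))},(S^{\tau(j)}\otimes S^{\tau(i)})(R)\rangle\,(\alpha_{(2-\tau(i))}\otimes\beta_{(2-\tau(j))})_{ij}.$$ For $h\in K$ at a vertex with ends $1<\dots<n$, let $h$ act from the right by letting $h_{(i)}$ act on the $i$th factor, with $\alpha\lhd h=\langle\alpha_{(1)},h\rangle\alpha_{(2)}$ at incoming and $\alpha\lhd h=\langle\alpha_{(2)},S(h)\rangle\alpha_{(1)}$ at outgoing ends; this makes $\bigotimes_v\mathcal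 A_v^*$ a right $K^{\otimes V}$-module. Let $G^*_\Gamma:K^{*\otimes E}\to K^{*\otimes 2E}$ be the linear map that applies $\alpha\mapsto(\alpha_{(2)}\otimes\alpha_{(1)})_{s(e)t(e)}$ to the factor of each edge $e$. **Theorem.** The map $G^*_\Gamma$ is injective and its image is a unital subalgebra and a $K^{\otimes V}$-submodule; let $\mathcal A^*_\Gamma$ be $K^{*\otimes E}$ with the induced algebra and $K^{\otimes V}$-module structures. Let $\Gamma'$ be obtained from $\Gamma$ by one of the operations below, with an arbitrary choice $\rho'$ for $\Gamma'$. There is a unique linear map $f^*:\bigotimes_{v\in V'}\mathcal A'^*_v\to\bigotimes_{v\in V}\mathcal A^*_v$ that takes the listed values on the elements $(\alpha)_{h'}$ and is multiplicative on every product $(\alpha^1)_{h_1'}\cdots(\alpha^n)_{h_n'}$ (including the empty one) in which, for $i<j$, the ends $h'_i,h'_j$ are at different vertices or $h_i'<h_j'$. There is a unique linear map $F^*:\mathcal A^*_{\Gamma'}\to\mathcal A^*_\Gamma$ with $G^*_\Gamma\circ F^*=f^*\circ G^*_{\Gamma'}$. This $F^*$ is a homomorphism of unital algebras and of $K^{\otimes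 V}$-modules, where on $\mathcal A^*_{\Gamma'}$ the factors of $K^{\otimes V}$ at the removed vertices act by $\epsilon$. An end $h'$ of $\Gamma'$ coming from an end $h$ of $\Gamma$ has the value $(\alpha)_{h'}\mapsto(\alpha)_h$ unless stated otherwise. Below, $\alpha[w]$, for a word $w$ in symbols $k_h$, denotes the functional $\bigotimes_h k_h\mapsto\alpha(w)\prod\epsilon(k_{h})$ on $K^{\otimes 2E}$, with the product over the ends $h$ that do not occur in $w$. (a) *Deleting an edge $e$*, together with the vertices at which all ends, at least one, belong to $e$. (b) *Contracting a non-loop $e$ towards $\mathrm{st}(e)$.* If the orderings are $m_1,t(e),m_2$ at $\mathrm{ta}(e)$ and $l_1,s(e),l_2$ at $\mathrm{st}(e)$, then $\mathrm{ta}(e)$ is removed and the new ordering at $\mathrm{st}(e)$ is $l_1,m_2,m_1,l_2$. For the other ends $h$ at $\mathrm{ta}(e)$, with $s=s(e)$, $t=t(e)$, the value of $(\alpha)_{h'}$ is - $h$ outgoing: $\alpha[k_hk_tk_s]$ if $h<t$, and $\alpha[k_hg^{-1}k_tk_s]$ if $h>t$; - $h$ incoming: $\alpha[S^{-1}(k_s)S^{-1}(k_t)k_h]$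 if $h<t$, and $\alpha[S^{-1}(k_s)S^{-1}(k_t)g\,k_h]$ if $h>t$. (c) *Contracting a non-loop $e$ towards $\mathrm{ta}(e)$.* If the orderings are $m_1,s(e),m_2$ at $\mathrm{st}(e)$ and $l_1,t(e),l_2$ at $\mathrm{ta}(e)$, then $\mathrm{st}(e)$ is removed and the new ordering at $\mathrm{ta}(e)$ is $l_1,m_2,m_1,l_2$. For the other ends $h$ at $\mathrm{st}(e)$ the value of $(\alpha)_{h'}$ is - $h$ incoming: $\alpha[k_tk_sk_h]$ if $h>s$, and $\alpha[k_tk_sg^{-1}k_h]$ if $h<s$; - $h$ outgoing: $\alpha[k_hS(k_s)S(k_t)]$ if $h>s$, and $\alpha[k_h\,g\,S(k_s)S(k_t)]$ if $h<s$. (d) *Adding a loop $e''$ at a vertex*, with $t(e'')$ directly before $s(e'')$, at any position of the ordering; $(\alpha)_{h'}\mapsto\epsilon(\alpha)1$ for $h'\in\{s(e''),t(e'')\}$. (e) *Detaching adjacent edge ends.* Let $e_1\ne e_2$ and $\mathrm{ta}(e_1)=\mathrm{st}(e_2)=v$, with $t(e_1),s(e_2)$ adjacent in the ordering at $v$ and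 $v$ of valence at least $3$. These two ends are removed and $e_1,e_2$ are replaced by one edge $e'$, with $s(e'),t(e')$ in the places of $s(e_1),t(e_2)$. Then $(\alpha)_{t(e')}\mapsto(\alpha)_{t(e_2)}$, and $(\alpha)_{s(e')}$ is sent to $\alpha[k_{s(e_2)}k_{t(e_1)}k_{s(e_1)}]$ if $s(e_2)<t(e_1)$ and to $\alpha[k_{s(e_2)}g^{-1}k_{t(e_1)}k_{s(e_1)}]$ if $s(e_2)>t(e_1)$. (f) *Doubling an edge $e$.* It is replaced by $e',e''$, with $t(e)$ replaced by the adjacent ends $t(e')<t(e'')$ and $s(e)$ by the adjacent ends $s(e'')<s(e')$. Then $(\alpha)_{t(e')},(\alpha)_{t(e'')}\mapsto(\alpha)_{t(e)}$ and $(\alpha)_{s(e')},(\alpha)_{s(e'')}\mapsto(\alpha)_{s(e)}$. In the definition of $f^*$ in this case, the products of images are taken with $\sigma(s(e))=\sigma(t(e))=1$. -/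

import Mathlib

open scoped TensorProduct

noncomputable section

namespace HopfGauge

/-! ### Ribbon Hopf algebras -/

section Ribbon

variable {F K : Type*} [Field F] [Ring K] [HopfAlgebra F K]

/-- The flip `k ⊗ k' ↦ k' ⊗ k`. -/
def flip : K ⊗[F] K →ₗ[F] K ⊗[F] K := (TensorProduct.comm F K K).toLinearMap

/-- `R₁₂`, `R₁₃` and `R₂₃` in `K ⊗ (K ⊗ K)`. -/
def leg12 (R : K ⊗[F] K) : K ⊗[F] (K ⊗[F] K) :=
  Algebra.TensorProduct.map (AlgHom.id F K)
    (Algebra.TensorProduct.includeLeft : K →ₐ[F] K ⊗[F] K) R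

def leg13 (R : K ⊗[F] K) : K ⊗[F] (K ⊗[F] K) :=
  Algebra.TensorProduct.map (AlgHom.id F K)
    (Algebra.TensorProduct.includeRight : K →ₐ[F] K ⊗[F] K) R

def leg23 (R : K ⊗[F] K) : K ⊗[F] (K ⊗[F] K) := (1 : K) ⊗ₜ[F] R

/-- `R` is a universal R-matrix of the Hopf algebra `K`. -/
structure IsRMatrix (R : K ⊗[F] K) : Prop where
  isUnit : IsUnit R
  mul_comul : ∀ h : K, R * Coalgebra.comul (R := F) h = flip (Coalgebra.comul (R := F) h) * R
  comul_left : TensorProduct.assoc F K K K ((Coalgebra.comul (R := F) (A := K)).rTensor K R) =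
    leg13 R * leg23 R
  comul_right : (Coalgebra.comul (R := F) (A := K)).lTensor K R = leg13 R * leg12 R

/-- The Drinfeld element `u = ∑ S(R₂) R₁`. -/
def drinfeld (R : K ⊗[F] K) : K :=
  LinearMap.mul' F K ((HopfAlgebra.antipode F (A := K)).rTensor K (flip R))

/-- `ν` is a ribbon element of the quasitriangular Hopf algebra `(K, R)`. -/
structure IsRibbon (R : K ⊗[F] K) (ν : K) : Prop where
  isUnit : IsUnit ν
  central : ∀ h : K, ν * h = h * ν
  sq : ν * ν = drinfeld R * HopfAlgebra.antipode F (drinfeld R)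
  counit : Coalgebra.counit (R := F) ν = 1
  antipode : HopfAlgebra.antipode F ν = ν
  comul : flip R * R * Coalgebra.comul (R := F) ν = ν ⊗ₜ[F] ν

/-- The grouplike element `g = u⁻¹ ν`; `u` is invertible if `R` is an R-matrix. -/
def grp (R : K ⊗[F] K) (ν : K) : K := Ring.inverse (drinfeld R) * ν

/-- The inverse of `g`. -/
def grpInv (R : K ⊗[F] K) (ν : K) : K := Ring.inverse (grp R ν)

variable (F K) in
/-- The inverse of the antipode, which is bijective if `K` is finite-dimensional. -/
def antipodeInv : K →ₗ[F] K :=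
  Ring.inverse (HopfAlgebra.antipode F (A := K) : Module.End F K)

end Ribbon

/-! ### Tensor powers of `K` and of its dual -/

section Tensor

variable (F K : Type*) [Field F] [Ring K] [HopfAlgebra F K]

/-- The tensor power `K^{⊗X}`, with the tensor product algebra structure. -/
abbrev Ten (X : Type*) := PiTensorProduct F (fun _ : X => K)

/-- The tensor power `K*^{⊗X}`, identified with the dual of `K^{⊗X}` (for finite-dimensional `K` and
finite `X`). -/
abbrev DTen (X : Type*) := Module.Dual F (Ten F K X)

variable {F K}

/-- `k ↦ (k)_x`, which is `k` in the tensor factor `x` and `1` in all the others. -/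
def single {X : Type*} [DecidableEq X] (x : X) : K →ₗ[F] Ten F K X :=
  (PiTensorProduct.singleAlgHom (R := F) (A := fun _ : X => K) x).toLinearMap

/-- `k ↦ ε(k) 1`. -/
def epsOne {B : Type*} [Ring B] [Algebra F B] : K →ₗ[F] B :=
  (Algebra.linearMap F B).comp (Coalgebra.counit (R := F) (A := K))

/-- `⊗ₓ kₓ ↦ ∏ₓ φₓ(kₓ)`. This is used only for families of maps `φₓ` whose images commute pairwise,
so that the order of the factors does not matter. -/
def prodLift {X B : Type*} [Fintype X] [Ring B] [Algebra F B] (φ : X → K →ₗ[F] B) :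
    Ten F K X →ₗ[F] B :=
  PiTensorProduct.lift
    (((MultilinearMap.mkPiAlgebraFin F (Fintype.card X) B).domDomCongr
      (Fintype.equivFin X).symm).compLinearMap φ)

/-- The projection `id ⊗ ε ⊗ ⋯ ⊗ ε` on the factor `x`; for `α ∈ K*`, the element `(α)_x` of
`K*^{⊗X}` is `α ∘ coord x`. -/
def coord {X : Type*} [Fintype X] [DecidableEq X] (x : X) : Ten F K X →ₗ[F] K :=
  prodLift (fun y => if y = x then LinearMap.id else epsOne)

/-- `(α)_x`. -/
def elt {X : Type*} [Fintype X] [DecidableEq X] (x : X) (α : Module.Dual F K) : DTen F K X :=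
  α.comp (coord x)

/-- The counit `ε^{⊗X}`; it is also the unit `1^{⊗X}` of `K*^{⊗X}`. -/
def counitTen (X : Type*) [Fintype X] : DTen F K X :=
  prodLift (fun _ => Coalgebra.counit (R := F) (A := K))

/-- Applies to each tensor factor of `K^{⊗X}` a map `K → K ⊗ K`. -/
def splitTen {X : Type*} [Fintype X] [DecidableEq X] (δ : X → K →ₗ[F] K ⊗[F] K) :
    Ten F K X →ₗ[F] Ten F K X ⊗[F] Ten F K X :=
  prodLift (fun x => (TensorProduct.map (single x) (single x)).comp (δ x))

/-- The convolution product `k ↦ ∑ p(k₁) q(k₂)` of two maps `K^{⊗X} → K`. -/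
def conv {X : Type*} [Fintype X] [DecidableEq X] (p q : Ten F K X →ₗ[F] K) :
    Ten F K X →ₗ[F] K :=
  (LinearMap.mul' F K).comp
    ((TensorProduct.map p q).comp (splitTen (fun _ => Coalgebra.comul (R := F) (A := K))))

/-- The iterated comultiplication `k ↦ (k₁ ⊗ ⋯ ⊗ kₙ)_{x₁ ⋯ xₙ}` for a list `x₁, …, xₙ`. -/
def comulList {X : Type*} [DecidableEq X] : List X → (K →ₗ[F] Ten F K X)
  | [] => epsOne
  | x :: l => (LinearMap.mul' F (Ten F K X)).comp
      ((TensorProduct.map (single x) (comulList l)).comp (Coalgebra.comul (R := F) (A := K)))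

end Tensor

/-! ### Ciliated ribbon graphs -/

/-- A ciliated ribbon graph: a directed graph, whose edge ends are the pairs `(e, b)`, where
`s(e) = (e, false)` is outgoing at the starting vertex of `e` and `t(e) = (e, true)` is incoming at
its target vertex, together with a linear ordering of the edge ends at each vertex, given by a
list. Loops, multiple edges and isolated vertices are allowed. -/
structure CilGraph (V E : Type*) where
  base : E × Bool → V
  cil : V → List (E × Bool)
  nodup : ∀ v, (cil v).Nodup
  mem_cil : ∀ v h, h ∈ cil v ↔ base h = v

namespace CilGraph

variable {V E : Type*} (Γ : CilGraph V E)

/-- The starting vertex of an edge. -/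
def st (e : E) : V := Γ.base (e, false)

/-- The target vertex of an edge. -/
def ta (e : E) : V := Γ.base (e, true)

/-- `h < h'` for two edge ends at the same vertex. -/
abbrev Lt (h h' : E × Bool) : Prop := List.Sublist [h, h'] (Γ.cil (Γ.base h))

/-- The same graph with each edge end `h` replaced by a list `c h` of adjacent edge ends. -/
def replaceEnds {E' : Type*} (c : E × Bool → List (E' × Bool)) (p : E' × Bool → E × Bool)
    (hc : ∀ h, (c h).Nodup) (hp : ∀ h h', h' ∈ c h ↔ p h' = h) : CilGraph V E' where
  base h' := Γ.base (p h')
  cil v := (Γ.cil v).flatMap c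
  nodup v := by
    rw [List.nodup_flatMap]
    refine ⟨fun h _ => hc h, (Γ.nodup v).imp ?_⟩
    intro a b hab x hx hx'
    exact hab (((hp a x).1 hx).symm.trans ((hp b x).1 hx'))
  mem_cil v h' := by
    simp [List.mem_flatMap, hp, Γ.mem_cil]

/-- The edge ends that replace the edge end `h` when the edge `e` is removed: none or `h` itself. -/
def stripEnd [DecidableEq E] (e : E) (h : E × Bool) : List ({f : E // f ≠ e} × Bool) :=
  if hh : h.1 ≠ e then [(⟨h.1, hh⟩, h.2)] else []

theorem mem_stripEnd [DecidableEq E] (e : E) (h : E × Bool) (h' : {f : E // f ≠ e} × Bool) :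
    h' ∈ stripEnd e h ↔ (h'.1.1, h'.2) = h := by
  obtain ⟨⟨f, hf⟩, b⟩ := h'
  obtain ⟨f', b'⟩ := h
  by_cases hh : f' = e
  · subst hh
    simp [stripEnd, hf]
  · simp [stripEnd, hh]

theorem nodup_stripEnd [DecidableEq E] (e : E) (h : E × Bool) : (stripEnd e h).Nodup := by
  unfold stripEnd
  split <;> simp

/-- The vertices that remain if the edge `e` is deleted: a vertex is removed if all its incident
edge ends belong to `e` and there is at least one. -/
abbrev DelVertex [DecidableEq E] (e : E) :=
  {v : V // ¬ (Γ.cil v ≠ [] ∧ ∀ h ∈ Γ.cil v, h.1 = e)}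

/-- Deleting the edge `e`. -/
def delete [DecidableEq E] (e : E) : CilGraph (Γ.DelVertex e) {f : E // f ≠ e} where
  base h := ⟨Γ.base (h.1.1, h.2), fun hv =>
    h.1.2 (hv.2 (h.1.1, h.2) ((Γ.mem_cil _ _).2 rfl))⟩
  cil v := (Γ.cil v.1).flatMap (stripEnd e)
  nodup v := by
    rw [List.nodup_flatMap]
    refine ⟨fun h _ => nodup_stripEnd e h, (Γ.nodup v.1).imp ?_⟩
    intro a b hab x hx hx'
    exact hab (((mem_stripEnd e a x).1 hx).symm.trans ((mem_stripEnd e b x).1 hx'))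
  mem_cil v h' := by
    simp [List.mem_flatMap, mem_stripEnd, Γ.mem_cil, Subtype.ext_iff]

/-- The merged ordering in a contraction of `e`, where the edge end `(e, a)` lies at the vertex that
is removed and `(e, !a)` at the one that survives. If the orderings at these two vertices are
`m₁, (e, a), m₂` and `l₁, (e, !a), l₂`, then the merged one is `l₁, m₂, m₁, l₂`, here with
`(e, a)` still in front of `m₂`. -/
def mergedCil [DecidableEq E] (e : E) (a : Bool) : List (E × Bool) :=
  (Γ.cil (Γ.base (e, !a))).flatMap (fun h => if h = (e, !a) then
    (Γ.cil (Γ.base (e, a))).rotate ((Γ.cil (Γ.base (e, a))).idxOf (e, a)) else [h])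

theorem mem_mergedCil [DecidableEq E] (e : E) (a : Bool) (h : E × Bool) (hh : h.1 ≠ e) :
    h ∈ Γ.mergedCil e a ↔ Γ.base h = Γ.base (e, !a) ∨ Γ.base h = Γ.base (e, a) := by
  have h1 : h ≠ (e, !a) := fun hc => hh (by rw [hc])
  simp only [mergedCil, List.mem_flatMap]
  constructor
  · rintro ⟨x, hx, hx'⟩
    split at hx'
    · exact Or.inr ((Γ.mem_cil _ _).1 (List.mem_rotate.1 hx'))
    · rw [List.mem_singleton] at hx'
      subst hx'
      exact Or.inl ((Γ.mem_cil _ _).1 hx)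
  · rintro (hb | hb)
    · exact ⟨h, (Γ.mem_cil _ _).2 hb, by simp [h1]⟩
    · exact ⟨(e, !a), (Γ.mem_cil _ _).2 rfl, by simp [Γ.mem_cil, hb]⟩

theorem nodup_mergedCil [DecidableEq E] (e : E) (a : Bool)
    (hl : Γ.base (e, !a) ≠ Γ.base (e, a)) : (Γ.mergedCil e a).Nodup := by
  rw [mergedCil, List.nodup_flatMap]
  constructor
  · intro h _
    split
    · exact List.nodup_rotate.2 (Γ.nodup _)
    · simp
  · refine List.Pairwise.imp_of_mem ?_ (Γ.nodup _)
    intro x y hx hy hxy z hz hz'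
    rw [Γ.mem_cil] at hx hy
    dsimp only at hz hz'
    split at hz <;> split at hz'
    · exact hxy (by simp_all)
    · rw [List.mem_rotate, Γ.mem_cil] at hz
      rw [List.mem_singleton] at hz'
      subst hz'
      exact hl (hy.symm.trans hz)
    · rw [List.mem_rotate, Γ.mem_cil] at hz'
      rw [List.mem_singleton] at hz
      subst hz
      exact hl (hx.symm.trans hz')
    · rw [List.mem_singleton] at hz hz'
      exact hxy (hz.symm.trans hz')

/-- Contracting the edge `e`, which is not a loop. The vertex of the edge end `(e, a)` is removed:
`a = false` is the contraction towards the target vertex of `e`, and `a = true` the one towards its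
starting vertex. -/
def contract [DecidableEq V] [DecidableEq E] (e : E) (a : Bool)
    (hl : Γ.base (e, !a) ≠ Γ.base (e, a)) :
    CilGraph {v : V // v ≠ Γ.base (e, a)} {f : E // f ≠ e} where
  base h := if hb : Γ.base (h.1.1, h.2) = Γ.base (e, a) then ⟨Γ.base (e, !a), hl⟩
    else ⟨Γ.base (h.1.1, h.2), hb⟩
  cil v := (if v.1 = Γ.base (e, !a) then Γ.mergedCil e a else Γ.cil v.1).flatMap (stripEnd e)
  nodup v := by
    rw [List.nodup_flatMap]
    refine ⟨fun h _ => nodup_stripEnd e h, List.Pairwise.imp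
      (R := fun x y : E × Bool => x ≠ y) ?_ ?_⟩
    · intro x y hxy z hz hz'
      exact hxy (((mem_stripEnd e x z).1 hz).symm.trans ((mem_stripEnd e y z).1 hz'))
    · split
      · exact Γ.nodup_mergedCil e a hl
      · exact Γ.nodup _
  mem_cil v h' := by
    obtain ⟨v, hv⟩ := v
    have key : ∀ l : List (E × Bool),
        h' ∈ l.flatMap (stripEnd e) ↔ (h'.1.1, h'.2) ∈ l := by
      intro l
      simp [List.mem_flatMap, mem_stripEnd]
    rw [key]
    by_cases h1 : v = Γ.base (e, !a)
    · rw [if_pos h1, Γ.mem_mergedCil e a _ h'.1.2]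
      subst h1
      by_cases h2 : Γ.base (h'.1.1, h'.2) = Γ.base (e, a)
      · simp [h2]
      · simp [h2]
    · rw [if_neg h1, Γ.mem_cil]
      by_cases h2 : Γ.base (h'.1.1, h'.2) = Γ.base (e, a)
      · simp only [h2, dif_pos, Subtype.mk.injEq]
        exact ⟨fun h => absurd h.symm hv, fun h => absurd h.symm h1⟩
      · simp [h2]

/-- Adding a loop at the vertex `v`, whose edge ends are inserted with the incoming one directly
before the outgoing one, after the first `n` edge ends at `v`. The new edge is `none`. -/
def addLoop [DecidableEq V] (v : V) (n : ℕ) : CilGraph V (Option E) where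
  base h := h.1.elim v (fun f => Γ.base (f, h.2))
  cil w := if w = v then
      ((Γ.cil v).take n).map (fun h => (some h.1, h.2)) ++ [(none, true), (none, false)] ++
        ((Γ.cil v).drop n).map (fun h => (some h.1, h.2))
    else (Γ.cil w).map (fun h => (some h.1, h.2))
  nodup w := by
    have hinj : Function.Injective (fun h : E × Bool => ((some h.1, h.2) : Option E × Bool)) := by
      rintro ⟨a, b⟩ ⟨c, d⟩ h
      simpa using h
    split
    · have h0 := (List.nodup_map_iff hinj).2 (Γ.nodup v)
      have h1 : (((Γ.cil v).take n ++ (Γ.cil v).drop n).map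
        (fun h : E × Bool => ((some h.1, h.2) : Option E × Bool))).Nodup := by
        rwa [List.take_append_drop]
      rw [List.map_append, List.nodup_append] at h1
      rw [List.append_assoc, List.nodup_append]
      refine ⟨h1.1, ?_, ?_⟩
      · rw [List.nodup_append]
        refine ⟨by simp, h1.2.1, ?_⟩
        intro x hx y hy hxy
        subst hxy
        rw [List.mem_map] at hy
        obtain ⟨z, _, rfl⟩ := hy
        simp at hx
      · intro x hx y hy hxy
        subst hxy
        rw [List.mem_append] at hy
        rcases hy with hy | hy
        · rw [List.mem_map] at hx
          obtain ⟨z, _, rfl⟩ := hx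
          simp at hy
        · exact h1.2.2 x hx x hy rfl
    · exact (List.nodup_map_iff hinj).2 (Γ.nodup w)
  mem_cil w h := by
    have key : ∀ l : List (E × Bool), h ∈ l.map (fun h => ((some h.1, h.2) : Option E × Bool)) ↔
        ∃ f, h.1 = some f ∧ (f, h.2) ∈ l := by
      intro l
      obtain ⟨f, b⟩ := h
      cases f <;> simp
    obtain ⟨f, b⟩ := h
    by_cases hw : w = v
    · subst hw
      rw [if_pos rfl]
      cases f with
      | none => cases b <;> simp
      | some f =>
        have h2 : (f, b) ∈ Γ.cil w ↔ (f, b) ∈ (Γ.cil w).take n ∨ (f, b) ∈ (Γ.cil w).drop n := by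
          rw [← List.mem_append, List.take_append_drop]
        rw [List.mem_append, List.mem_append, key, key]
        simp [← Γ.mem_cil, h2]
    · rw [if_neg hw, key]
      cases f with
      | none => simpa using fun h => hw h.symm
      | some f => simp [Γ.mem_cil]

/-- The edges of the graph with the edges `e₁` and `e₂` combined into one, which is `none`. -/
abbrev DetEdge (e₁ e₂ : E) := Option {f : E // f ≠ e₁ ∧ f ≠ e₂}

/-- Detaching the edge ends `t(e₁)` and `s(e₂)` and combining `e₁` and `e₂` into a single edge from
the starting vertex of `e₁` to the target vertex of `e₂`. -/
def detach [DecidableEq E] (e₁ e₂ : E) (hne : e₁ ≠ e₂) : CilGraph V (DetEdge e₁ e₂) :=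
  Γ.replaceEnds
    (fun h => if hh : h.1 ≠ e₁ ∧ h.1 ≠ e₂ then [(some ⟨h.1, hh⟩, h.2)]
      else if h = (e₁, false) then [(none, false)]
      else if h = (e₂, true) then [(none, true)]
      else [])
    (fun h' => h'.1.elim (if h'.2 then (e₂, true) else (e₁, false)) (fun f => (f.1, h'.2)))
    (fun h => by split_ifs <;> simp)
    (fun h h' => by
      obtain ⟨f, b⟩ := h
      obtain ⟨f', b'⟩ := h'
      by_cases h1 : f = e₁
      · subst h1
        cases f' with
        | none => cases b <;> cases b' <;> simp [hne, hne.symm]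
        | some f' =>
          have := f'.2.1
          have := f'.2.2
          cases b <;> cases b' <;> simp [*]
      · by_cases h2 : f = e₂
        · subst h2
          cases f' with
          | none => cases b <;> cases b' <;> simp [hne, hne.symm]
          | some f' =>
            have := f'.2.1
            have := f'.2.2
            cases b <;> cases b' <;> simp [hne.symm, *]
        · cases f' with
          | none => cases b' <;> simp [h1, h2, Ne.symm h1, Ne.symm h2, eq_comm]
          | some f' =>
            simp [h1, h2, Subtype.ext_iff])

/-- Doubling the edge `e`: it is replaced by `e' = some e` and `e'' = none` with `t(e')` directly
before `t(e'')` and `s(e'')` directly before `s(e')`. -/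
def double [DecidableEq E] (e : E) : CilGraph V (Option E) :=
  Γ.replaceEnds
    (fun h => if h = (e, true) then [(some e, true), (none, true)]
      else if h = (e, false) then [(none, false), (some e, false)]
      else [(some h.1, h.2)])
    (fun h' => (h'.1.getD e, h'.2))
    (fun h => by split_ifs <;> simp)
    (fun h h' => by
      obtain ⟨f, b⟩ := h
      obtain ⟨f', b'⟩ := h'
      by_cases h1 : f = e
      · subst h1
        cases f' <;> cases b <;> cases b' <;> simp
      · have h2 := Ne.symm h1
        cases f' <;> cases b <;> cases b' <;> simp [h2, eq_comm])

end CilGraph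

/-! ### The algebras of a Hopf algebra gauge theory -/

section GaugeTheory

variable {F K V E : Type*} [Field F] [Ring K] [HopfAlgebra F K] [Fintype V] [DecidableEq V]
  [Fintype E] [DecidableEq E]

/-- `K^{⊗ 2E}` acts on itself: `y ▷ k` is `y k` at incoming edge ends, and `k S(y)` at outgoing
ones. Dually, pairing `y` with `(α)_h ◁ y` gives `⟨α₁, y⟩ (α₂)_h` and `⟨α₂, S(y)⟩ (α₁)_h`. -/
def act : Ten F K (E × Bool) →ₗ[F] Ten F K (E × Bool) →ₗ[F] Ten F K (E × Bool) :=
  PiTensorProduct.map₂ (fun h => if h.2 then LinearMap.mul F K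
    else (LinearMap.mul F K).flip.comp (HopfAlgebra.antipode F (A := K)))

/-- The comultiplication on `K` dual to the product `(α)_h (β)_h` for a single edge end. The
first argument says if this product is twisted by the R-matrix (`σ = 0`), the second one if the
edge end is incoming (`τ = 0`). The products are `⟨β₁ ⊗ α₁, R⟩ β₂α₂` (twisted, incoming),
`⟨β₂ ⊗ α₂, R⟩ α₁β₁` (twisted, outgoing), `αβ` (untwisted, incoming) and `βα`
(untwisted, outgoing). -/
def endComul (R : K ⊗[F] K) : Bool → Bool → (K →ₗ[F] K ⊗[F] K)
  | true, true => (LinearMap.mulLeft F (flip R)).comp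
      (flip.comp (Coalgebra.comul (R := F) (A := K)))
  | true, false => (LinearMap.mulRight F (flip R)).comp (Coalgebra.comul (R := F) (A := K))
  | false, true => Coalgebra.comul (R := F) (A := K)
  | false, false => flip.comp (Coalgebra.comul (R := F) (A := K))

/-- The pairs `(j, i)` with `j` before `i` in a list `x₁, …, xₙ`, listed as
`(x₁, xₙ), …, (x₁, x₂), (x₂, xₙ), …, (x₂, x₃), …, (xₙ₋₁, xₙ)`. -/
def pairsOf {X : Type*} : List X → List (X × X)
  | [] => []
  | x :: l => l.reverse.map (fun y => (x, y)) ++ pairsOf l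

/-- For a map `ρ` that selects an end of each edge (`t(e)` if `ρ e = true`), the edge ends whose
product is twisted, which are the selected ones. -/
def twistOf (ρ : E → Bool) (h : E × Bool) : Bool := h.2 == ρ h.1

/-- `k ↦ k_{t(e)} k_{s(e)}` on each edge `e`. -/
def glue : Ten F K (E × Bool) →ₗ[F] Ten F K E :=
  PiTensorProduct.lift
    { toFun := fun x => PiTensorProduct.tprod F (fun e => x (e, true) * x (e, false))
      map_update_add' := by
        intro _ m i x y
        obtain ⟨e, b⟩ := i
        have key : ∀ z : K, (fun f => Function.update m (e, b) z (f, true) *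
            Function.update m (e, b) z (f, false)) =
            Function.update (fun f => m (f, true) * m (f, false)) e
              (if b then z * m (e, false) else m (e, true) * z) := by
          intro z
          funext f
          by_cases hf : f = e
          · subst hf
            cases b <;> simp
          · simp [hf]
        rw [key, key, key, ← MultilinearMap.map_update_add]
        congr 2
        cases b <;> simp [mul_add, add_mul]
      map_update_smul' := by
        intro _ m i c x
        obtain ⟨e, b⟩ := i
        have key : ∀ z : K, (fun f => Function.update m (e, b) z (f, true) *
            Function.update m (e, b) z (f, false)) =
            Function.update (fun f => m (f, true) * m (f, false)) e
              (if b then z * m (e, false) else m (e, true) * z) := by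
          intro z
          funext f
          by_cases hf : f = e
          · subst hf
            cases b <;> simp
          · simp [hf]
        rw [key, key, ← MultilinearMap.map_update_smul]
        congr 2
        cases b <;> simp }

/-- The map `G* : K*^{⊗E} → K*^{⊗2E}`, `(α)_e ↦ (α₂ ⊗ α₁)_{s(e) t(e)}`. -/
def gStar : DTen F K E →ₗ[F] DTen F K (E × Bool) :=
  Module.Dual.transpose (R := F) glue

/-- `(k)_e ↦ (k ⊗ 1)_{t(e) s(e)}`, a section of `glue`. -/
def unglue : Ten F K E →ₗ[F] Ten F K (E × Bool) :=
  prodLift (fun e => single (e, true))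

namespace CilGraph

variable (Γ : CilGraph V E)

/-- The product over all pairs `j < i` of edge ends at the same vertex of the R-matrices, acting
with `R₂` in the factor `i` of the first copy of `K^{⊗2E}` and with `R₁` in the factor `j` of the
second copy. -/
def braid (R : K ⊗[F] K) : Ten F K (E × Bool) ⊗[F] Ten F K (E × Bool) :=
  (((Finset.univ : Finset V).toList.flatMap (fun v => pairsOf (Γ.cil v))).map
    (fun p => TensorProduct.map (single p.2) (single p.1) (flip R))).prod

/-- The comultiplication on `K^{⊗2E}` dual to the product of the vertex algebras. -/
def vertexComul (R : K ⊗[F] K) (tw : E × Bool → Bool) :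
    Ten F K (E × Bool) →ₗ[F] Ten F K (E × Bool) ⊗[F] Ten F K (E × Bool) :=
  (TensorProduct.map₂ act act (Γ.braid R)).comp (splitTen (fun h => endComul R (tw h) h.2))

/-- The product of the algebra `⊗ᵥ A*ᵥ` of the vertex neighbourhoods, on `K*^{⊗2E}`. For edge ends
`i`, `j` at the same vertex it satisfies `(α)_i (β)_j = (α ⊗ β)_{ij}` if `i < j`, and if `i > j`,
`(α)_i (β)_j` is obtained from `(α ⊗ β)_{ij}` by acting with the two legs of `R` on `β` and `α`.
Elements at different vertices commute. -/
def vertexMul (R : K ⊗[F] K) (tw : E × Bool → Bool) (φ ψ : DTen F K (E × Bool)) :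
    DTen F K (E × Bool) :=
  (TensorProduct.dualDistrib F _ _ (φ ⊗ₜ[F] ψ)).comp (Γ.vertexComul R tw)

/-- The product of a list in the algebra of the vertex neighbourhoods. -/
def vertexProd (R : K ⊗[F] K) (tw : E × Bool → Bool) (l : List (DTen F K (E × Bool))) :
    DTen F K (E × Bool) :=
  l.foldr (Γ.vertexMul R tw) (counitTen (E × Bool))

/-- The iterated comultiplications at all vertices. -/
def gaugeComul : Ten F K V →ₗ[F] Ten F K (E × Bool) :=
  prodLift (fun v => comulList (Γ.cil v))

/-- The right action of `K^{⊗V}` on the algebra of the vertex neighbourhoods. -/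
def vertexAct (φ : DTen F K (E × Bool)) (h : Ten F K V) : DTen F K (E × Bool) :=
  φ.comp (act (Γ.gaugeComul h))

/-- The product of `A*_Γ`, pulled back along `G*`. -/
def edgeMul (R : K ⊗[F] K) (ρ : E → Bool) (x y : DTen F K E) : DTen F K E :=
  (Γ.vertexMul R (twistOf ρ) (gStar x) (gStar y)).comp unglue

/-- The right action of `K^{⊗V}` on `A*_Γ`, pulled back along `G*`. -/
def edgeAct (x : DTen F K E) (h : Ten F K V) : DTen F K E :=
  (Γ.vertexAct (gStar x) h).comp unglue

/-- `G*` is injective and a homomorphism of algebras and of modules, so that the structures of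
`A*_Γ` are the ones induced by `G*`. -/
structure GStarHom (R : K ⊗[F] K) (ρ : E → Bool) : Prop where
  injective : Function.Injective (gStar : DTen F K E →ₗ[F] DTen F K (E × Bool))
  map_one : gStar (counitTen E : DTen F K E) = counitTen (E × Bool)
  map_mul : ∀ x y : DTen F K E,
    gStar (Γ.edgeMul R ρ x y) = Γ.vertexMul R (twistOf ρ) (gStar x) (gStar y)
  map_act : ∀ (x : DTen F K E) (h : Ten F K V), gStar (Γ.edgeAct x h) = Γ.vertexAct (gStar x) h

end CilGraph

/-! ### Maps induced by graph operations -/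

variable {V' E' : Type*} [Fintype V'] [DecidableEq V'] [Fintype E'] [DecidableEq E']

/-- `K^{⊗V} → K^{⊗V'}` for a partial map from `V` to `V'`, applying `ε` in the tensor factors of the
vertices where it is not defined. -/
def resVertex (g : V → Option V') : Ten F K V →ₗ[F] Ten F K V' :=
  prodLift (fun v => (g v).elim epsOne single)

/-- `f : K*^{⊗2E'} → K*^{⊗2E}` sends `(α)_{h'}` to `α ∘ W h'` for all edge ends `h'` of `Γ'`, and it
respects products of such elements in which each factor is at a different vertex than any later
one or precedes it in the ordering at the common vertex. The products are taken for the twists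
`tw'` and `tw`. -/
def IsVertexMap (R : K ⊗[F] K) (Γ : CilGraph V E) (Γ' : CilGraph V' E')
    (tw : E × Bool → Bool) (tw' : E' × Bool → Bool)
    (W : E' × Bool → (Ten F K (E × Bool) →ₗ[F] K))
    (f : DTen F K (E' × Bool) →ₗ[F] DTen F K (E × Bool)) : Prop :=
  ∀ l : List ((E' × Bool) × Module.Dual F K),
    l.Pairwise (fun p q => Γ'.base p.1 ≠ Γ'.base q.1 ∨ Γ'.Lt p.1 q.1) →
    f (Γ'.vertexProd R tw' (l.map (fun p => elt p.1 p.2))) =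
      Γ.vertexProd R tw (l.map (fun p => p.2.comp (W p.1)))

/-- The linear map `f` on vertex neighbourhoods exists and is unique, there is a unique linear map
`Φ : A*_{Γ'} → A*_Γ` with `G*_Γ ∘ Φ = f ∘ G*_{Γ'}`, and `Φ` is a homomorphism of algebras and of
`K^{⊗V}`-modules. -/
structure Induces (R : K ⊗[F] K) (Γ : CilGraph V E) (Γ' : CilGraph V' E')
    (ρ : E → Bool) (ρ' : E' → Bool) (tw : E × Bool → Bool) (g : V → Option V')
    (W : E' × Bool → (Ten F K (E × Bool) →ₗ[F] K)) : Prop where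
  existsUnique_vertexMap : ∃! f, IsVertexMap R Γ Γ' tw (twistOf ρ') W f
  existsUnique_edgeMap : ∀ f, IsVertexMap R Γ Γ' tw (twistOf ρ') W f →
    ∃! Φ : DTen F K E' →ₗ[F] DTen F K E, ∀ x, gStar (Φ x) = f (gStar x)
  hom : ∀ f, IsVertexMap R Γ Γ' tw (twistOf ρ') W f →
    ∀ Φ : DTen F K E' →ₗ[F] DTen F K E, (∀ x, gStar (Φ x) = f (gStar x)) →
      Φ (counitTen E') = counitTen E ∧
      (∀ x y, Φ (Γ'.edgeMul R ρ' x y) = Γ.edgeMul R ρ (Φ x) (Φ y)) ∧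
      (∀ x (h : Ten F K V), Φ (Γ'.edgeAct x (resVertex g h)) = Γ.edgeAct (Φ x) h)

/-! ### Values of the vertex neighbourhood maps on generators -/

/-- Deleting `e`: `(α)_{h'} ↦ (α)_h`. -/
def deleteVal (e : E) (h' : {f : E // f ≠ e} × Bool) : Ten F K (E × Bool) →ₗ[F] K :=
  coord (h'.1.1, h'.2)

/-- Contracting `e`: `(α)_{h'}` is sent to `(α)_h` if `h` is not at the removed vertex, and otherwise
to `α` composed with one of the following maps `K^{⊗2E} → K`, where `s`, `t` are the ends of `e`.
Towards the target vertex (`a = false`):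
`k_t k_s k_h` (`h` incoming, `h > s`), `k_t k_s g⁻¹ k_h` (`h` incoming, `h < s`),
`k_h S(k_s) S(k_t)` (`h` outgoing, `h > s`), `k_h g S(k_s) S(k_t)` (`h` outgoing, `h < s`).
Towards the starting vertex (`a = true`):
`k_h k_t k_s` (`h` outgoing, `h < t`), `k_h g⁻¹ k_t k_s` (`h` outgoing, `h > t`),
`S⁻¹(k_s) S⁻¹(k_t) k_h` (`h` incoming, `h < t`), `S⁻¹(k_s) S⁻¹(k_t) g k_h`
(`h` incoming, `h > t`). -/
def contractVal (R : K ⊗[F] K) (ν : K) (Γ : CilGraph V E) (e : E) (a : Bool)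
    (h' : {f : E // f ≠ e} × Bool) : Ten F K (E × Bool) →ₗ[F] K :=
  let h : E × Bool := (h'.1.1, h'.2)
  let k : E × Bool → (Ten F K (E × Bool) →ₗ[F] K) := coord
  let s : E × Bool := (e, false)
  let t : E × Bool := (e, true)
  let S : K →ₗ[F] K := HopfAlgebra.antipode F
  let S' : K →ₗ[F] K := antipodeInv F K
  if Γ.base h ≠ Γ.base (e, a) then k h
  else match a, h'.2 with
    | false, true => conv (k t) (conv (k s)
        ((LinearMap.mulLeft F (if Γ.Lt h s then grpInv R ν else 1)).comp (k h)))
    | false, false => conv (k h)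
        ((LinearMap.mulLeft F (if Γ.Lt h s then grp R ν else 1)).comp
          (conv (S.comp (k s)) (S.comp (k t))))
    | true, false => conv (k h)
        ((LinearMap.mulLeft F (if Γ.Lt t h then grpInv R ν else 1)).comp (conv (k t) (k s)))
    | true, true => conv (S'.comp (k s)) (conv (S'.comp (k t))
        ((LinearMap.mulLeft F (if Γ.Lt t h then grp R ν else 1)).comp (k h)))

/-- Adding a loop: `(α)_{h'} ↦ (α)_h`, and `(α)_{h'} ↦ ε(α) 1` for the ends of the loop, where
`ε(α) = α(1)`. -/
def loopVal (h' : Option E × Bool) : Ten F K (E × Bool) →ₗ[F] K :=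
  h'.1.elim ((LinearMap.toSpanSingleton F K 1).comp (counitTen (E × Bool)))
    (fun f => coord (f, h'.2))

/-- Detaching `t(e₁)` and `s(e₂)`: the target end of the new edge is sent to the one of `e₂`, and
`(α)_{s(e')}` to `α` composed with `k_{s(e₂)} k_{t(e₁)} k_{s(e₁)}` if `s(e₂) < t(e₁)` and with
`k_{s(e₂)} g⁻¹ k_{t(e₁)} k_{s(e₁)}` if `s(e₂) > t(e₁)`. -/
def detachVal (R : K ⊗[F] K) (ν : K) (Γ : CilGraph V E) (e₁ e₂ : E)
    (h' : CilGraph.DetEdge e₁ e₂ × Bool) : Ten F K (E × Bool) →ₗ[F] K :=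
  h'.1.elim
    (if h'.2 then coord (e₂, true)
      else conv (coord (e₂, false))
        ((LinearMap.mulLeft F (if Γ.Lt (e₁, true) (e₂, false) then grpInv R ν else 1)).comp
          (conv (coord (e₁, true)) (coord (e₁, false)))))
    (fun f => coord (f.1, h'.2))

/-- Doubling `e`: the ends of both new edges are sent to the corresponding ends of `e`. -/
def doubleVal (e : E) (h' : Option E × Bool) : Ten F K (E × Bool) →ₗ[F] K :=
  coord (h'.1.getD e, h'.2)

end GaugeTheory

end HopfGauge

end

open scoped TensorProduct

noncomputable section

namespace HopfGauge

open HopfAlgebra (antipode_mul_antidistrib)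
open HopfAlgebra renaming antipode → apd
open TensorProduct renaming map → tmap, lid → tlid, rid → trid, map_tmul → tmap_tmul, induction_on → tind, map_comp → tmap_comp
open Algebra.TensorProduct (tmul_mul_tmul)
open Algebra.TensorProduct renaming map → amap, comm → acomm, includeLeft → inL, includeRight → inR, one_def → tone_def, map_tmul → amap_tmul, lift → alift
open LinearMap (mul' mulLeft mulRight convMul_apply mulLeft_apply mulRight_apply
  mul'_apply)
open LinearMap renaming add_apply → ladd, id → lid, ext → lext, comp_apply → lcomp_apply
open List (nodup_cons prod_cons map_cons mem_map map_map map_congr_left mem_cons_of_mem Sublist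
  singleton_sublist mem_cons prod_eq_one nodup_append cons_append map_append nil_append
  mem_cons_self flatMap_cons prod_append mem_append prod_singleton mem_reverse map_singleton
  mem_singleton reverse_cons nodup_reverse)
open AlgHom (comp_assoc comp_apply toLinearMap_apply)
open PiTensorProduct (tprod_mul_tprod map_tprod)
open PiTensorProduct renaming tprod → ptprod, map → pmap, induction_on → pind
open Commute (one_left one_right list_prod_right)
open Module.End (mul_apply)
open Algebra (algebraMap_eq_smul_one)
open WithConv Coalgebra Bialgebra
variable {F K C A B B' V E V' E' X I I' : Type*} [Field F] [Ring K] [HopfAlgebra F K] [Ring A]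
  [Algebra F A] [Ring B] [Algebra F B] [Ring B'] [Algebra F B'] [AddCommGroup C] [Module F C]
  [Coalgebra F C] [Fintype V] [DecidableEq V] [Fintype E] [DecidableEq E] [Fintype V']
  [DecidableEq V'] [Fintype E'] [DecidableEq E'] [Fintype X] [DecidableEq X] {R : K ⊗[F] K} {ν : K}
  {Γ : CilGraph V E} {Γ' : CilGraph V' E'} {tw : E × Bool → Bool} {base : I → V}

/-! ### Convolution algebras -/

section Convolution

variable {D : Type*}

variable (F C B) in
/-- The convolution algebra of linear maps from a coalgebra to an algebra. -/
abbrev Cv := WithConv (C →ₗ[F] B)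

/-- Composition with an algebra homomorphism, on convolution algebras. -/
def pc (φ : B →ₐ[F] B') : Cv F C B →+* Cv F C B' where
  toFun f := toConv (φ.toLinearMap.comp f.ofConv)
  map_one' := by ext c; simp
  map_mul' f g := by
    have := LinearMap.algHom_comp_convMul_distrib φ f g
    exact WithConv.ext this
  map_zero' := by ext; simp
  map_add' f g := by ext; simp

@[simp] lemma pc_apply (φ : B →ₐ[F] B') (f : Cv F C B) (c : C) : pc φ f c = φ (f c) := rfl

/-- The constants of a convolution algebra. -/
def cst : B →+* Cv F C B where
  toFun b := toConv ((LinearMap.toSpanSingleton F B b).comp (counit (R := F) (A := C)))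
  map_one' := by ext c; simp [algebraMap_eq_smul_one]
  map_mul' a b := by
    have h : toConv ((LinearMap.toSpanSingleton F B a).comp (counit (R := F) (A := C))) *
        toConv ((LinearMap.toSpanSingleton F B b).comp (counit (R := F) (A := C))) =
        toConv ((LinearMap.toSpanSingleton F B (a * b)).comp (counit (R := F) (A := C))) := by
      ext c
      rw [convMul_apply]
      have h2 : (mul' F B).comp (tmap
          ((LinearMap.toSpanSingleton F B a).comp (counit (R := F) (A := C)))
          ((LinearMap.toSpanSingleton F B b).comp (counit (R := F) (A := C)))) =
          ((mulLeft F a).comp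
            ((LinearMap.toSpanSingleton F B b).comp (counit (R := F) (A := C)))).comp
          ((tlid F C).toLinearMap.comp
            ((counit (R := F) (A := C)).rTensor C)) := by
        ext x y; simp [smul_smul, mul_comm]
      have := congr($h2 (comul (R := F) c))
      simpa using this
    exact h.symm
  map_zero' := by ext; simp
  map_add' a b := by ext; simp

@[simp] lemma cst_apply (b : B) (c : C) : (cst b : Cv F C B) c = counit (R := F) c • b := rfl

lemma cst_mul_apply (b : B) (f : Cv F C B) (c : C) : (cst b * f : Cv F C B) c = b * f c := by
  rw [convMul_apply]
  have h2 : (mul' F B).comp (tmap (cst b : Cv F C B).ofConv f.ofConv) =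
      ((mulLeft F b).comp f.ofConv).comp
      ((tlid F C).toLinearMap.comp ((counit (R := F) (A := C)).rTensor C)) := by
    ext x y; simp
  have := congr($h2 (comul (R := F) c))
  simpa using this

lemma mul_cst_apply (b : B) (f : Cv F C B) (c : C) : (f * cst b : Cv F C B) c = f c * b := by
  rw [convMul_apply]
  have h2 : (mul' F B).comp (tmap f.ofConv (cst b : Cv F C B).ofConv) =
      ((mulRight F b).comp f.ofConv).comp
      ((trid F C).toLinearMap.comp ((counit (R := F) (A := C)).lTensor C)) := by
    ext x y; simp
  have := congr($h2 (comul (R := F) c))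
  simpa using this

@[simp] lemma pc_cst (φ : B →ₐ[F] B') (b : B) : pc φ (cst b : Cv F C B) = cst (φ b) := by
  ext c; simp

lemma pc_pc {B'' : Type*} [Ring B''] [Algebra F B''] (φ : B' →ₐ[F] B'') (ψ : B →ₐ[F] B')
    (f : Cv F C B) : pc φ (pc ψ f) = pc (φ.comp ψ) f := rfl

lemma commute_cst {f : Cv F C B} {b : B} (h : ∀ c, Commute b (f c)) : Commute (cst b) f := by
  ext c; rw [cst_mul_apply, mul_cst_apply]; exact h c

/-- An identity between products of values of linear maps gives one between convolutions. -/
lemma lin_comp_mul {B₁ B₂ : Type*} [Ring B₁] [Algebra F B₁] [Ring B₂] [Algebra F B₂]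
    (Θ : B₁ →ₗ[F] B₂) (f g : Cv F C B₁) (f' g' : Cv F C B₂)
    (h : ∀ a b, Θ (f a * g b) = f' a * g' b) :
    toConv (Θ.comp (f * g).ofConv) = f' * g' := by
  ext c
  have h2 : Θ.comp ((mul' F B₁).comp (tmap f.ofConv g.ofConv)) =
      (mul' F B₂).comp (tmap f'.ofConv g'.ofConv) := by
    ext a b; simpa using h a b
  exact congr($h2 (comul (R := F) c))

end Convolution

/-! ### Pairings with an R-matrix -/

section RMatrix

/-- `∑ φ(R₁) ψ(R₂)`. -/
def rr (R : K ⊗[F] K) (φ ψ : K →ₗ[F] B) : B := mul' F B (tmap φ ψ R)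

lemma rr_tmul (x y : K) (φ ψ : K →ₗ[F] B) : rr (x ⊗ₜ[F] y) φ ψ = φ x * ψ y := by simp [rr]

lemma rr_add (R R' : K ⊗[F] K) (φ ψ : K →ₗ[F] B) :
    rr (R + R') φ ψ = rr R φ ψ + rr R' φ ψ := by simp [rr]

lemma rr_zero (φ ψ : K →ₗ[F] B) : rr (0 : K ⊗[F] K) φ ψ = 0 := by simp [rr]

lemma map_rr (R : K ⊗[F] K) (φ ψ : K →ₗ[F] B) (f : B →ₐ[F] B') :
    f (rr R φ ψ) = rr R (f.toLinearMap.comp φ) (f.toLinearMap.comp ψ) := by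
  induction R <;> simp_all [rr_zero, rr_tmul, rr_add]

lemma commute_rr {R : K ⊗[F] K} {φ ψ : K →ₗ[F] B} {b : B} (h1 : ∀ x, Commute b (φ x))
    (h2 : ∀ x, Commute b (ψ x)) : Commute b (rr R φ ψ) := by
  induction R <;> simp_all [rr_zero, rr_tmul, rr_add]

lemma commute_rr_rr {R R' : K ⊗[F] K} {φ ψ φ' ψ' : K →ₗ[F] B}
    (h1 : ∀ x y, Commute (φ x) (φ' y)) (h2 : ∀ x y, Commute (φ x) (ψ' y))
    (h3 : ∀ x y, Commute (ψ x) (φ' y)) (h4 : ∀ x y, Commute (ψ x) (ψ' y)) :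
    Commute (rr R φ ψ) (rr R' φ' ψ') :=
  commute_rr (fun x => (commute_rr (fun y => (h1 y x).symm) (fun y => (h3 y x).symm)).symm)
    (fun x => (commute_rr (fun y => (h2 y x).symm) (fun y => (h4 y x).symm)).symm)

lemma rr_flip (R : K ⊗[F] K) (φ ψ : K →ₗ[F] B) (h : ∀ x y, Commute (φ x) (ψ y)) :
    rr (flip R) φ ψ = rr R ψ φ := by
  induction R with
  | tmul x y =>
    have : flip (x ⊗ₜ[F] y) = y ⊗ₜ[F] x := by simp [flip]
    rw [this, rr_tmul, rr_tmul]; exact h _ _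
  | _ => simp_all [rr_zero, rr_add]

/-- The first embedding of `K` in `K ⊗ K`. -/
abbrev inl : K →ₐ[F] K ⊗[F] K := inL
/-- The second embedding of `K` in `K ⊗ K`. -/
abbrev inr : K →ₐ[F] K ⊗[F] K := inR

lemma rr_inl_inr (R : K ⊗[F] K) : rr R (inl : K →ₐ[F] _).toLinearMap inr.toLinearMap = R := by
  induction R <;> simp_all [rr_zero, rr_tmul, rr_add]

lemma map_eq_rr (R : K ⊗[F] K) {B₂ : Type*} [Ring B₂] [Algebra F B₂] (φ : K →ₗ[F] B)
    (ψ : K →ₗ[F] B₂) : tmap φ ψ R =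
      rr R ((inL : B →ₐ[F] B ⊗[F] B₂).toLinearMap.comp φ)
        ((inR : B₂ →ₐ[F] B ⊗[F] B₂).toLinearMap.comp ψ) := by
  induction R <;> simp_all [rr_zero, rr_tmul, rr_add]

/-- The convolution product of two linear maps on `K`. -/
abbrev cmul (φ ψ : K →ₗ[F] B) : K →ₗ[F] B := (toConv φ * toConv ψ).ofConv

lemma cmul_eq_rr (φ ψ : K →ₗ[F] B) (k : K) : cmul φ ψ k = rr (comul (R := F) k) φ ψ := rfl

lemma leg_lift_left (R R' : K ⊗[F] K) (φ φ' : K →ₗ[F] B) (ψ : K →ₐ[F] B)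
    (h : ∀ x y, Commute (φ' x) (ψ y)) :
    mul' F B (tmap φ (mul' F B ∘ₗ
      (tmap φ' ψ.toLinearMap)) (leg13 R * leg23 R')) =
      rr R φ ψ.toLinearMap * rr R' φ' ψ.toLinearMap := by
  induction R with
  | tmul a b =>
    induction R' with
    | zero => simp [rr_zero, leg23]
    | add x y hx hy => simp_all [leg23, TensorProduct.tmul_add, mul_add, rr_add]
    | tmul c d =>
      simp only [leg13, leg23, amap_tmul, AlgHom.coe_id, id_eq,
        Algebra.TensorProduct.includeRight_apply, tmul_mul_tmul, mul_one, one_mul, tmap_tmul,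
        LinearMap.coe_comp, Function.comp_apply, mul'_apply, toLinearMap_apply, map_mul, rr_tmul]
      rw [← mul_assoc (φ' c), (h c b).eq]
      simp only [mul_assoc]
  | _ => simp_all [rr_zero, leg13, add_mul, rr_add]

lemma leg_lift_right (R R' : K ⊗[F] K) (φ : K →ₐ[F] B) (ψ ψ' : K →ₗ[F] B)
    (h : ∀ x y, Commute (ψ' x) (φ y)) (h' : ∀ x y, Commute (ψ x) (ψ' y)) :
    mul' F B (tmap φ.toLinearMap (mul' F B ∘ₗ
      (tmap ψ ψ')) (leg13 R * leg12 R')) =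
      rr R φ.toLinearMap ψ' * rr R' φ.toLinearMap ψ := by
  induction R with
  | tmul a b =>
    induction R' with
    | zero => simp [rr_zero, leg12]
    | add x y hx hy => simp_all [leg12, mul_add, rr_add]
    | tmul c d =>
      simp only [leg13, leg12, amap_tmul, AlgHom.coe_id, id_eq,
        Algebra.TensorProduct.includeRight_apply, tmul_mul_tmul, mul_one,
        Algebra.TensorProduct.includeLeft_apply, one_mul, tmap_tmul, LinearMap.coe_comp,
        Function.comp_apply, mul'_apply, toLinearMap_apply, map_mul, rr_tmul]
      rw [mul_assoc (φ a) (ψ' b), ← mul_assoc (ψ' b) (φ c), (h b c).eq, mul_assoc (φ c),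
        (h' d b).eq, mul_assoc]
  | _ => simp_all [rr_zero, leg13, add_mul, rr_add]

lemma IsRMatrix.rr_cmul_left (hR : IsRMatrix R) (φ φ' : K →ₗ[F] B) (ψ : K →ₐ[F] B)
    (h : ∀ x y, Commute (φ' x) (ψ y)) :
    rr R (cmul φ φ') ψ.toLinearMap = rr R φ ψ.toLinearMap * rr R φ' ψ.toLinearMap := by
  rw [← leg_lift_left R R φ φ' ψ h, ← hR.comul_left]
  generalize R = R
  induction R with
  | tmul a b =>
    rw [rr_tmul, cmul_eq_rr, LinearMap.rTensor_tmul]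
    generalize comul (R := F) a = t
    induction t with
    | zero => simp [rr_zero]
    | add x y hx hy => rw [rr_add, add_mul, hx, hy]; simp only [TensorProduct.add_tmul, map_add]
    | tmul c d => simp [rr_tmul, mul_assoc]
  | _ => simp_all [rr_zero, rr_add]

lemma IsRMatrix.rr_cmul_right (hR : IsRMatrix R) (φ : K →ₐ[F] B) (ψ ψ' : K →ₗ[F] B)
    (h : ∀ x y, Commute (ψ' x) (φ y)) (h' : ∀ x y, Commute (ψ x) (ψ' y)) :
    rr R φ.toLinearMap (cmul ψ ψ') = rr R φ.toLinearMap ψ' * rr R φ.toLinearMap ψ := by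
  rw [← leg_lift_right R R φ ψ ψ' h h', ← hR.comul_right]
  generalize R = R
  induction R <;>
    simp_all [rr_zero, rr_add, rr_tmul, cmul_eq_rr, LinearMap.lTensor_tmul, mul_add, TensorProduct.tmul_add]

lemma rr_mul (R R' : K ⊗[F] K) (φ ψ : K →ₐ[F] B) (h : ∀ x y, Commute (φ x) (ψ y)) :
    rr (R * R') φ.toLinearMap ψ.toLinearMap =
      rr R φ.toLinearMap ψ.toLinearMap * rr R' φ.toLinearMap ψ.toLinearMap := by
  have : ∀ R : K ⊗[F] K, rr R φ.toLinearMap ψ.toLinearMap =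
      alift φ ψ h R := by
    intro R
    induction R <;> simp_all [rr_zero, rr_add, rr_tmul]
  simp only [this, map_mul]

/-- The exchange property of the R-matrix. -/
lemma IsRMatrix.exchange (hR : IsRMatrix R) (φ ψ : K →ₐ[F] B) (h : ∀ x y, Commute (φ x) (ψ y))
    (k : K) : rr R φ.toLinearMap ψ.toLinearMap * cmul φ.toLinearMap ψ.toLinearMap k =
      cmul ψ.toLinearMap φ.toLinearMap k * rr R φ.toLinearMap ψ.toLinearMap := by
  rw [cmul_eq_rr, ← rr_mul _ _ _ _ h, hR.mul_comul, rr_mul _ _ _ _ h, rr_flip _ _ _ h, cmul_eq_rr]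

end RMatrix

/-! ### Identities in quasitriangular and ribbon Hopf algebras -/

section Hopf

/-- `k ↦ ε(k) 1` as an algebra homomorphism. -/
def epsAlg : K →ₐ[F] B := (Algebra.ofId F B).comp (counitAlgHom F K)

lemma epsAlg_toLinearMap : (epsAlg : K →ₐ[F] B).toLinearMap = epsOne := rfl

@[simp] lemma epsAlg_apply (k : K) :
    (epsAlg : K →ₐ[F] B) k = algebraMap F B (counit (R := F) k) := rfl

lemma toConv_epsOne : toConv (epsOne : K →ₗ[F] B) = 1 := rfl

@[simp] lemma flip_tmul (x y : K) : flip (x ⊗ₜ[F] y) = y ⊗ₜ[F] x := by simp [flip]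

lemma flip_flip (t : K ⊗[F] K) : flip (flip t) = t := by induction t <;> simp_all

lemma flip_mul (s t : K ⊗[F] K) : flip (s * t) = flip s * flip t :=
  map_mul (acomm F K K) s t

lemma flip_one : flip (1 : K ⊗[F] K) = 1 := map_one (acomm F K K)

/-- The antipode is an antihomomorphism of coalgebras. -/
lemma comul_antipode (k : K) : comul (R := F) (apd F k) =
    flip (tmap (apd F) (apd F) (comul (R := F) k)) := by
  have e1 : toConv (comul (R := F) (A := K)) =
      pc inl (toConv lid) * pc inr (toConv lid) := by
    ext x
    rw [convMul_apply]
    exact (rr_inl_inr (comul (R := F) x)).symm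
  have e2 : (pc inr (toConv (apd F)) * pc inl (toConv (apd F))) * toConv (comul (R := F) (A := K)) = 1 := by
    have h : ∀ φ : K →ₐ[F] K ⊗[F] K, pc φ (toConv (apd F)) * pc φ (toConv lid) = 1 := by
      intro φ
      rw [← map_mul, LinearMap.antipode_mul_id, map_one]
    rw [e1, mul_assoc, ← mul_assoc (pc inl (toConv (apd F (A := K)))), h, one_mul, h]
  have := left_inv_eq_right_inv e2 LinearMap.comul_right_inv
  have := congr(($this).ofConv k)
  rw [convMul_apply] at this
  refine this.symm.trans ?_
  generalize comul (R := F) k = t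
  induction t <;> simp_all

lemma cmul_antipode_left (φ : K →ₐ[F] B) :
    cmul (φ.toLinearMap.comp (apd F)) φ.toLinearMap = epsOne := by
  have : pc φ (toConv (apd F)) * pc φ (toConv lid) = 1 := by
    rw [← map_mul, LinearMap.antipode_mul_id, map_one]
  exact congrArg WithConv.ofConv this

lemma cmul_antipode_right (φ : K →ₐ[F] B) :
    cmul φ.toLinearMap (φ.toLinearMap.comp (apd F)) = epsOne := by
  have : pc φ (toConv lid) * pc φ (toConv (apd F)) = 1 := by
    rw [← map_mul, LinearMap.id_mul_antipode, map_one]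
  exact congrArg WithConv.ofConv this

lemma cmul_epsOne (φ : K →ₗ[F] B) : cmul φ epsOne = φ := by
  simp only [cmul, toConv_epsOne, mul_one]

lemma epsOne_cmul (φ : K →ₗ[F] B) : cmul epsOne φ = φ := by
  simp only [cmul, toConv_epsOne, one_mul]

lemma commute_epsOne (x : K) (b : B) : Commute (epsOne (F := F) x : B) b := Algebra.commutes _ _

lemma IsRMatrix.isUnit_rr (hR : IsRMatrix R) (φ ψ : K →ₐ[F] B)
    (h : ∀ x y, Commute (φ x) (ψ y)) : IsUnit (rr R φ.toLinearMap ψ.toLinearMap) := by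
  obtain ⟨u, hu⟩ := hR.isUnit
  have h1 : rr (1 : K ⊗[F] K) φ.toLinearMap ψ.toLinearMap = 1 := by rw [tone_def, rr_tmul]; simp
  refine ⟨⟨rr R φ.toLinearMap ψ.toLinearMap, rr (↑u⁻¹ : K ⊗[F] K) φ.toLinearMap ψ.toLinearMap,
    ?_, ?_⟩, rfl⟩
  · rw [← rr_mul _ _ _ _ h, ← hu, u.mul_inv, h1]
  · rw [← rr_mul _ _ _ _ h, ← hu, u.inv_mul, h1]

lemma IsRMatrix.rr_eps_left (hR : IsRMatrix R) (ψ : K →ₐ[F] B) :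
    rr R epsOne ψ.toLinearMap = 1 := by
  have h := hR.rr_cmul_left (B := B) epsOne epsOne ψ (fun x y => commute_epsOne x _)
  rw [cmul_epsOne] at h
  have h2 := hR.isUnit_rr (B := B) epsAlg ψ (fun x y => commute_epsOne x _)
  rw [epsAlg_toLinearMap] at h2
  exact (h2.mul_right_cancel (by rw [one_mul]; exact h)).symm

lemma IsRMatrix.rr_eps_right (hR : IsRMatrix R) (φ : K →ₐ[F] B) :
    rr R φ.toLinearMap epsOne = 1 := by
  have h := hR.rr_cmul_right (B := B) φ epsOne epsOne (fun x y => commute_epsOne x _)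
    (fun x y => commute_epsOne x _)
  rw [cmul_epsOne] at h
  have h2 := hR.isUnit_rr (B := B) φ epsAlg (fun x y => (commute_epsOne y _).symm)
  rw [epsAlg_toLinearMap] at h2
  exact (h2.mul_right_cancel (by rw [one_mul]; exact h)).symm

/-- `(S ⊗ id)(R)` is the inverse of `R`. -/
lemma IsRMatrix.rr_antipode_mul (hR : IsRMatrix R) (φ ψ : K →ₐ[F] B)
    (h : ∀ x y, Commute (φ x) (ψ y)) :
    rr R (φ.toLinearMap.comp (apd F)) ψ.toLinearMap * rr R φ.toLinearMap ψ.toLinearMap = 1 := by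
  rw [← hR.rr_cmul_left _ _ _ h, cmul_antipode_left, hR.rr_eps_left]

lemma IsRMatrix.rr_mul_antipode (hR : IsRMatrix R) (φ ψ : K →ₐ[F] B)
    (h : ∀ x y, Commute (φ x) (ψ y)) :
    rr R φ.toLinearMap ψ.toLinearMap * rr R (φ.toLinearMap.comp (apd F)) ψ.toLinearMap = 1 := by
  rw [← hR.rr_cmul_left _ _ _ (fun x y => h _ _), cmul_antipode_right, hR.rr_eps_left]

/-- `∑ R₁ R'₁ ⊗ R'₂ S(R₂) = 1`. -/
lemma IsRMatrix.rr_sandwich (hR : IsRMatrix R) (φ ψ : K →ₐ[F] B)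
    (h : ∀ x y, Commute (φ x) (ψ y)) :
    rr R ((mulRight F (rr R φ.toLinearMap ψ.toLinearMap)).comp φ.toLinearMap)
      (ψ.toLinearMap.comp (apd F)) = 1 := by
  have h1 : mul' F B (tmap φ.toLinearMap (mul' F B ∘ₗ
      (tmap ψ.toLinearMap (ψ.toLinearMap.comp (apd F))))
      ((comul (R := F) (A := K)).lTensor K R)) = 1 := by
    rw [← hR.rr_eps_right φ, ← cmul_antipode_right ψ]
    generalize R = R
    induction R <;> simp_all [rr_zero, rr_add, rr_tmul, cmul_eq_rr, LinearMap.lTensor_tmul]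
  rw [hR.comul_right] at h1
  rw [← h1]
  clear h1
  have key : ∀ R' : K ⊗[F] K,
      rr R' ((mulRight F (rr R φ.toLinearMap ψ.toLinearMap)).comp φ.toLinearMap)
      (ψ.toLinearMap.comp (apd F)) = mul' F B (tmap φ.toLinearMap
      (mul' F B ∘ₗ (tmap ψ.toLinearMap (ψ.toLinearMap.comp (apd F))))
      (leg13 R' * leg12 R)) := by
    intro R'
    induction R' with
    | tmul a b =>
      rw [rr_tmul]
      simp only [LinearMap.coe_comp, Function.comp_apply, mulRight_apply]
      generalize R = R
      induction R with
      | zero => simp [rr_zero, leg12]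
      | add x y hx hy => simp_all [leg12, mul_add, add_mul, rr_add]
      | tmul c d => simp [leg13, leg12, rr_tmul, mul_assoc]
    | _ => simp_all [rr_zero, leg13, add_mul, rr_add]
  exact key R

/-- `(S ⊗ S)(R) = R`. -/
lemma IsRMatrix.map_antipode (hR : IsRMatrix R) : tmap (apd F) (apd F) R = R := by
  let χ : K ⊗[F] K →ₐ[F] K ⊗[F] Kᵐᵒᵖ := amap (AlgHom.id F K) (HopfAlgebra.antipodeAlgHomOp F K)
  let o : K →ₗ[F] Kᵐᵒᵖ := (MulOpposite.opLinearEquiv F).toLinearMap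
  have hc : ∀ x y, Commute ((inl : K →ₐ[F] K ⊗[F] K) x) ((inr : K →ₐ[F] K ⊗[F] K) y) := by
    intro x y; simp [Commute, SemiconjBy]
  have h1 : χ (tmap (apd F) lid R) * χ R = 1 := by
    rw [← map_mul, ← map_one χ]
    congr 1
    have := hR.rr_antipode_mul inl inr hc
    rwa [rr_inl_inr, show rr R ((inl : K →ₐ[F] _).toLinearMap.comp (apd F)) inr.toLinearMap =
      tmap (apd F) lid R by rw [map_eq_rr]; rfl] at this
  have h2 : χ R * tmap lid o R = 1 := by
    have := congrArg (tmap (lid : K →ₗ[F] K) o)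
      (hR.rr_sandwich inl inr hc)
    refine Eq.trans ?_ (this.trans ?_)
    · rw [rr_inl_inr]
      have key : ∀ R' R : K ⊗[F] K, χ R' * tmap lid o R =
          tmap (lid : K →ₗ[F] K) o
          (rr R' ((mulRight F R).comp (inl : K →ₐ[F] _).toLinearMap)
          ((inr : K →ₐ[F] _).toLinearMap.comp (apd F))) := by
        intro R' R
        induction R' with
        | tmul a b =>
          rw [rr_tmul]
          induction R with
          | zero => simp
          | add x y hx hy =>
            simp_all [LinearMap.coe_comp, Function.comp_apply, mulRight_apply, mul_add, add_mul]
          | tmul c d => simp [χ, o]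
        | _ => simp_all [rr_zero, rr_add, add_mul]
      exact key R R
    · simp [tone_def, o]
  have h3 := left_inv_eq_right_inv h1 h2
  have h4 := congrArg (tmap (lid : K →ₗ[F] K)
    (MulOpposite.opLinearEquiv F).symm.toLinearMap) h3
  refine Eq.trans ?_ (h4.trans ?_)
  · generalize R = R
    induction R <;> simp_all [χ]
  · generalize R = R
    induction R <;> simp_all [o]

/-- `∑ S(R₂) x R₁` is the Drinfeld element for `x = 1`. -/
lemma drinfeld_eq (R : K ⊗[F] K) : drinfeld R =
    mul' F K (tmap (apd F) lid (flip R)) := rfl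

/-- `∑ R₂ u R₁ = 1`. -/
lemma IsRMatrix.drinfeld_sandwich (hR : IsRMatrix R) :
    mul' F K (tmap lid (mulLeft F (drinfeld R))
      (flip R)) = 1 := by
  have hc : ∀ x y, Commute ((inl : K →ₐ[F] K ⊗[F] K) x) ((inr : K →ₐ[F] K ⊗[F] K) y) := by
    intro x y; simp [Commute, SemiconjBy]
  have := congrArg (fun t => mul' F K (flip t)) (hR.rr_sandwich inl inr hc)
  simp only [flip_one] at this
  refine Eq.trans ?_ (this.trans (by simp [tone_def]))
  rw [rr_inl_inr]
  have key : ∀ R' R : K ⊗[F] K,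
      mul' F K (tmap lid (mulLeft F (drinfeld R'))
      (flip R)) = mul' F K (flip
      (rr R' ((mulRight F R).comp (inl : K →ₐ[F] _).toLinearMap)
          ((inr : K →ₐ[F] _).toLinearMap.comp (apd F)))) := by
    intro R' R
    induction R with
    | zero => simp [rr]
    | add x y hx hy =>
      have : ∀ R' : K ⊗[F] K, rr R' ((mulRight F (x + y)).comp
          (inl : K →ₐ[F] _).toLinearMap) ((inr : K →ₐ[F] _).toLinearMap.comp (apd F)) =
          rr R' ((mulRight F x).comp
          (inl : K →ₐ[F] _).toLinearMap) ((inr : K →ₐ[F] _).toLinearMap.comp (apd F)) +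
          rr R' ((mulRight F y).comp
          (inl : K →ₐ[F] _).toLinearMap) ((inr : K →ₐ[F] _).toLinearMap.comp (apd F)) := by
        intro R'
        induction R' with
        | add x y hx hy => simp only [rr_add, hx, hy]; abel
        | _ => simp_all [rr_zero, rr_tmul, mul_add, add_mul, rr_add]
      rw [this, map_add, map_add, map_add, map_add, map_add, hx, hy]
    | tmul c d =>
      induction R' <;> simp_all [rr_zero, drinfeld, rr_add, add_mul, mul_add, rr_tmul, mul_assoc]
  exact key R R

/-- `S²(k) u = u k`. -/
lemma IsRMatrix.antipode_sq_mul (hR : IsRMatrix R) (k : K) :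
    (apd F) (apd F k) * drinfeld R = drinfeld R * k := by
  let m : K ⊗[F] K →ₗ[F] K := mul' F K ∘ₗ tmap (apd F) lid ∘ₗ flip
  have hm : ∀ x y, m (x ⊗ₜ y) = (apd F) y * x := fun x y => by simp [m]
  have m1 : ∀ t, m (R * t) = mul' F K (tmap (apd F)
      (mulLeft F (drinfeld R)) (flip t)) := by
    intro t
    induction t with
    | tmul c d =>
      generalize R = R
      induction R with
      | zero => simp [drinfeld]
      | add x y hx hy => rw [add_mul, map_add, hx, hy]; simp [drinfeld, add_mul, mul_add]
      | tmul a b => simp [hm, drinfeld, antipode_mul_antidistrib, mul_assoc]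
    | _ => simp_all [mul_add]
  have m2 : ∀ x, m (flip (comul (R := F) x) * R) = counit (R := F) x • drinfeld R := by
    intro x
    have : ∀ (t R : K ⊗[F] K), m (flip t * R) = mul' F K (tmap (apd F)
        (mulLeft F (mul' F K (((apd F)).rTensor K t))) (flip R)) := by
      intro t R
      induction t with
      | zero => simp
      | add x y hx hy =>
        rw [map_add, add_mul, map_add, hx, hy, map_add, map_add]
        generalize R = R
        induction R with
        | add x y hx hy => simp only [map_add] at *; rw [← hx, ← hy]; abel
        | _ => simp_all [add_mul, mul_add]
      | tmul c d => induction R <;> simp_all [mul_add, antipode_mul_antidistrib, mul_assoc]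
    rw [this, HopfAlgebra.mul_antipode_rTensor_comul_apply]
    have h2 : mulLeft F (algebraMap F K (counit (R := F) x)) =
        counit (R := F) x • lid := by
      ext y; simp [Algebra.smul_def]
    rw [h2, TensorProduct.map_smul_right]
    simp [drinfeld, LinearMap.rTensor]
  let Φ : (K ⊗[F] K) ⊗[F] K →ₗ[F] K :=
    mul' F K ∘ₗ (TensorProduct.comm F K K).toLinearMap ∘ₗ
      tmap m ((apd F) ∘ₗ (apd F))
  have e1 : Φ ((mulLeft F R).rTensor K ((comul (R := F)).rTensor K (comul (R := F) k)))
      = Φ ((mulRight F R ∘ₗ flip).rTensor K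
        ((comul (R := F)).rTensor K (comul (R := F) k))) := by
    congr 1
    rw [← LinearMap.rTensor_comp_apply, ← LinearMap.rTensor_comp_apply]
    congr 2
    ext x
    exact hR.mul_comul x
  have e2 : Φ ((mulRight F R ∘ₗ flip).rTensor K
        ((comul (R := F)).rTensor K (comul (R := F) k))) = (apd F) (apd F k) * drinfeld R := by
    have : (Φ ∘ₗ (mulRight F R ∘ₗ flip).rTensor K) ∘ₗ (comul (R := F)).rTensor K =
        (mulRight F (drinfeld R) ∘ₗ (apd F) ∘ₗ (apd F)) ∘ₗ (tlid F K).toLinearMap ∘ₗ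
        (counit (R := F) (A := K)).rTensor K := by
      ext x y
      simp [Φ, m2]
    have := congr($this (comul (R := F) k))
    simpa using this
  have e3 : Φ ((mulLeft F R).rTensor K ((comul (R := F)).rTensor K (comul (R := F) k)))
      = drinfeld R * k := by
    rw [← Coalgebra.coassoc_symm_apply]
    have : ((Φ ∘ₗ (mulLeft F R).rTensor K) ∘ₗ
        (TensorProduct.assoc F K K K).symm.toLinearMap) ∘ₗ (comul (R := F)).lTensor K =
        mulLeft F (drinfeld R) ∘ₗ (trid F K).toLinearMap ∘ₗ
        (counit (R := F) (A := K)).lTensor K := by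
      ext x y
      have h1 : ∀ t : K ⊗[F] K, Φ ((mulLeft F R).rTensor K
          ((TensorProduct.assoc F K K K).symm (x ⊗ₜ t))) =
          (apd F) (mul' F K (((apd F)).lTensor K t)) * (drinfeld R * x) := by
        intro t
        induction t <;>
          simp_all [TensorProduct.tmul_add, add_mul, Φ, m1, antipode_mul_antidistrib, mul_assoc]
      have h2 := h1 (comul (R := F) y)
      rw [HopfAlgebra.mul_antipode_lTensor_comul_apply] at h2
      simpa [algebraMap_eq_smul_one] using h2
    have := congr($this (comul (R := F) k))
    simpa using this
  rw [← e2, ← e1, e3]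

end Hopf

section Ribbon

lemma IsRibbon.isUnit_drinfeld (hR : IsRMatrix R) (hν : IsRibbon R ν) :
    IsUnit (drinfeld R) := by
  obtain ⟨n, hn⟩ := hν.isUnit
  have h1 : drinfeld R * ((apd F) (drinfeld R) * (↑n⁻¹ * ↑n⁻¹)) = 1 := by
    rw [← mul_assoc, ← hν.sq, ← hn, mul_assoc, ← mul_assoc (n : K) ↑n⁻¹, n.mul_inv, one_mul,
      n.mul_inv]
  have h2 : mul' F K (tmap lid ((apd F) ∘ₗ (apd F)) (flip R)) *
      drinfeld R = 1 := by
    refine Eq.trans ?_ hR.drinfeld_sandwich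
    have : ∀ t : K ⊗[F] K, mul' F K (tmap lid ((apd F) ∘ₗ (apd F)) t) *
      drinfeld R = mul' F K (tmap lid
        (mulLeft F (drinfeld R)) t) := by
      intro t
      induction t <;> simp_all [add_mul, mul_assoc, hR.antipode_sq_mul]
    exact this _
  exact ⟨⟨_, _, h1, by rw [left_inv_eq_right_inv h2 h1] at h2; exact h2⟩, rfl⟩

lemma isUnit_antipode (hR : IsRMatrix R) (hν : IsRibbon R ν) :
    IsUnit ((apd F) : Module.End F K) := by
  obtain ⟨u, hu⟩ := hν.isUnit_drinfeld hR
  have h2 : ∀ k : K, (apd F) (apd F k) = u * k * ↑u⁻¹ := fun k => by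
    rw [hu, ← hR.antipode_sq_mul, ← hu, mul_assoc, u.mul_inv, mul_one]
  rw [Module.End.isUnit_iff]
  constructor
  · intro x y hxy
    have := (h2 x).symm.trans ((congrArg (apd F) hxy).trans (h2 y))
    exact u.isUnit.mul_left_cancel (u⁻¹.isUnit.mul_right_cancel this)
  · intro y
    refine ⟨(apd F) (↑u⁻¹ * y * u), ?_⟩
    rw [h2, ← mul_assoc, ← mul_assoc, u.mul_inv, one_mul, mul_assoc, u.mul_inv, mul_one]

/-- The data of a ribbon Hopf algebra. -/
structure RibbonData (R : K ⊗[F] K) (ν : K) : Prop where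
  rMat : IsRMatrix R
  isRibbon : IsRibbon R ν

namespace RibbonData

lemma antipodeInv_antipode (h : RibbonData R ν) (k : K) : antipodeInv F K (apd F k) = k :=
  congr($(Ring.inverse_mul_cancel _ (isUnit_antipode h.rMat h.isRibbon)) k)

lemma antipode_antipodeInv (h : RibbonData R ν) (k : K) : (apd F) (antipodeInv F K k) = k :=
  congr($(Ring.mul_inverse_cancel _ (isUnit_antipode h.rMat h.isRibbon)) k)

lemma antipode_injective (h : RibbonData R ν) : Function.Injective (apd F (A := K)) :=
  Function.LeftInverse.injective h.antipodeInv_antipode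

lemma antipodeInv_mul (h : RibbonData R ν) (x y : K) :
    antipodeInv F K (x * y) = antipodeInv F K y * antipodeInv F K x := by
  apply h.antipode_injective
  rw [antipode_mul_antidistrib]
  simp only [h.antipode_antipodeInv]

lemma antipodeInv_one (h : RibbonData R ν) : antipodeInv F K (1 : K) = 1 := by
  apply h.antipode_injective
  rw [h.antipode_antipodeInv, HopfAlgebra.antipode_one]

lemma counit_antipodeInv (h : RibbonData R ν) (x : K) :
    counit (R := F) (antipodeInv F K x) = counit (R := F) x := by
  conv_rhs => rw [← h.antipode_antipodeInv x]
  rw [HopfAlgebra.counit_antipode]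

lemma map_antipodeInv_antipode (h : RibbonData R ν) (t : K ⊗[F] K) :
    tmap (antipodeInv F K) (antipodeInv F K) (tmap (apd F) (apd F) t) = t := by
  induction t <;> simp_all [h.antipodeInv_antipode]

lemma flip_map {F K : Type*} [Field F] [Ring K] [HopfAlgebra F K] (f : K →ₗ[F] K)
    (t : K ⊗[F] K) :
    flip (tmap f f t) = tmap f f (flip t) := by
  induction t <;> simp_all

lemma comul_antipodeInv (h : RibbonData R ν) (x : K) : comul (R := F) (antipodeInv F K x) =
    flip (tmap (antipodeInv F K) (antipodeInv F K) (comul (R := F) x)) := by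
  conv_rhs => rw [← h.antipode_antipodeInv x, comul_antipode, flip_map, flip_map, flip_map,
    flip_flip, h.map_antipodeInv_antipode]

lemma map_antipodeInv (h : RibbonData R ν) :
    tmap (antipodeInv F K) (antipodeInv F K) R = R := by
  conv_lhs => rw [← h.rMat.map_antipode, h.map_antipodeInv_antipode]

lemma inverse_mul (h : RibbonData R ν) : Ring.inverse ν * ν = 1 := Ring.inverse_mul_cancel _ h.isRibbon.isUnit

lemma mul_inverse (h : RibbonData R ν) : ν * Ring.inverse ν = 1 := Ring.mul_inverse_cancel _ h.isRibbon.isUnit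

lemma inverse_central (h : RibbonData R ν) (x : K) : Commute (Ring.inverse ν) x := by
  obtain ⟨n, hn⟩ := h.isRibbon.isUnit
  rw [← hn, Ring.inverse_unit]
  exact Commute.units_inv_left (by rw [hn]; exact h.isRibbon.central x)

lemma grpInv_eq (h : RibbonData R ν) : grpInv R ν = Ring.inverse ν * drinfeld R := by
  have hu := h.isRibbon.isUnit_drinfeld h.rMat
  unfold grpInv grp
  apply left_inv_eq_right_inv (a := Ring.inverse (drinfeld R) * ν)
  · apply Ring.inverse_mul_cancel
    obtain ⟨u, hu⟩ := hu
    rw [← hu, Ring.inverse_unit]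
    exact u⁻¹.isUnit.mul h.isRibbon.isUnit
  · grind [mul_assoc, h.mul_inverse, one_mul, Ring.inverse_mul_cancel]

lemma antipode_grpInv (h : RibbonData R ν) : (apd F) (grpInv R ν) = grp R ν := by
  have hu := h.isRibbon.isUnit_drinfeld h.rMat
  have hn : (apd F) (Ring.inverse ν) = Ring.inverse ν := by
    have : (apd F) (Ring.inverse ν) * ν = 1 := by
      nth_rewrite 2 [← h.isRibbon.antipode]
      rw [← antipode_mul_antidistrib, h.mul_inverse, HopfAlgebra.antipode_one]
    exact left_inv_eq_right_inv this h.mul_inverse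
  rw [h.grpInv_eq, antipode_mul_antidistrib, hn, grp]
  have e : (apd F) (drinfeld R) = Ring.inverse (drinfeld R) * (ν * ν) := by
    grind [h.isRibbon.sq, Ring.inverse_mul_cancel, one_mul]
  rw [e, mul_assoc, mul_assoc, h.mul_inverse, mul_one]

/-- The comultiplication of the inverse of the ribbon element. -/
lemma comul_inverse (h : RibbonData R ν) : comul (R := F) (Ring.inverse ν) =
    (Ring.inverse ν ⊗ₜ[F] Ring.inverse ν) * (flip R * R) := by
  have h1 : comul (R := F) ν * comul (R := F) (Ring.inverse ν) = 1 := by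
    rw [← Bialgebra.comul_mul, h.mul_inverse, Bialgebra.comul_one]
  have h2 : (Ring.inverse ν ⊗ₜ[F] Ring.inverse ν) * (flip R * R) * comul (R := F) ν = 1 := by
    rw [mul_assoc, h.isRibbon.comul, tmul_mul_tmul, h.inverse_mul]
    rfl
  exact (left_inv_eq_right_inv h2 h1).symm

lemma counit_inverse (h : RibbonData R ν) : counit (R := F) (Ring.inverse ν) = 1 := by
  have := congrArg (counit (R := F)) h.inverse_mul
  rw [Bialgebra.counit_mul, h.isRibbon.counit, mul_one, Bialgebra.counit_one] at this
  exact this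

end RibbonData

end Ribbon

/-! ### Products over lists -/

section ListProd

lemma list_prod_map_eq_single {X M : Type*} [Monoid M] {l : List X} (hl : l.Nodup) (f : X → M)
    {x : X} (hx : x ∈ l) (h : ∀ y ∈ l, y ≠ x → f y = 1) : (l.map f).prod = f x := by
  induction l with
  | cons a l ih =>
    rw [nodup_cons] at hl
    rw [map_cons, prod_cons]
    by_cases hax : a = x
    · grind [prod_eq_one, mul_one]
    · grind
  | _ => simp_all

lemma list_prod_map_mul {X M : Type*} [Monoid M] {l : List X} (hl : l.Nodup) (f g : X → M)
    (h : ∀ x ∈ l, ∀ y ∈ l, x ≠ y → Commute (f x) (g y)) :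
    (l.map (fun x => f x * g x)).prod = (l.map f).prod * (l.map g).prod := by
  induction l with
  | nil => simp
  | cons a l ih =>
    rw [nodup_cons] at hl
    simp only [map_cons, prod_cons]
    rw [ih hl.2 (fun x hx y hy => h x (mem_cons_of_mem _ hx) y (mem_cons_of_mem _ hy))]
    have : Commute (g a) (l.map f).prod := by
      apply list_prod_right
      intro z hz
      obtain ⟨y, hy, rfl⟩ := mem_map.1 hz
      exact (h y (mem_cons_of_mem _ hy) a mem_cons_self
        (fun hya => hl.1 (hya ▸ hy))).symm
    rw [mul_assoc, ← mul_assoc (g a), this.eq]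
    simp only [mul_assoc]

lemma list_prod_perm {X M : Type*} [Monoid M] {l l' : List X} (hl : l.Nodup)
    (hp : l.Perm l') (f : X → M) (h : ∀ x ∈ l, ∀ y ∈ l, x ≠ y → Commute (f x) (f y)) :
    (l.map f).prod = (l'.map f).prod := by
  apply List.Perm.prod_eq' (hp.map f)
  rw [List.pairwise_map]
  exact List.Pairwise.imp_of_mem (fun hx hy hxy => h _ hx _ hy hxy) hl

end ListProd

/-! ### Tensor powers -/

section Tensor

/-- `k ↦ (k)_x` as an algebra homomorphism. -/
def sing (x : X) : K →ₐ[F] Ten F K X :=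
  PiTensorProduct.singleAlgHom (R := F) (A := fun _ : X => K) x

lemma single_eq (x : X) (k : K) : (single x k : Ten F K X) = sing x k := rfl

lemma sing_eq_tprod (x : X) (k : K) :
    (sing x k : Ten F K X) = ptprod F (Pi.mulSingle x k) := rfl

lemma sing_commute {x y : X} (h : x ≠ y) (k k' : K) :
    Commute (sing x k : Ten F K X) (sing y k') := by
  have := Pi.mulSingle_commute (f := fun _ : X => K) h k k'
  rw [sing_eq_tprod, sing_eq_tprod, Commute, SemiconjBy, tprod_mul_tprod, tprod_mul_tprod, this.eq]

/-- A list of all elements without repetitions. -/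
structure IsFull (l : List X) : Prop where
  nodup : l.Nodup
  mem : ∀ x, x ∈ l

lemma isFull_univ : IsFull (Finset.univ : Finset X).toList :=
  ⟨Finset.nodup_toList _, fun x => by simp⟩

lemma IsFull.perm {l l' : List X} (h : IsFull l) (h' : IsFull l') : l.Perm l' :=
  (List.perm_ext_iff_of_nodup h.nodup h'.nodup).2 (fun x => by simp [h.mem, h'.mem])

lemma tprod_eq_prod {l : List X} (hl : IsFull l) (m : X → K) :
    (ptprod F m : Ten F K X) = (l.map (fun x => sing x (m x))).prod := by
  have h1 : (l.map (fun x => (Pi.mulSingle x (m x) : X → K))).prod = m := by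
    funext y
    have h2 := map_list_prod (Pi.evalMonoidHom (fun _ : X => K) y)
      (l.map (fun x => (Pi.mulSingle x (m x) : X → K)))
    rw [map_map] at h2
    refine h2.trans ?_
    rw [list_prod_map_eq_single hl.nodup _ (hl.mem y)]
    · simp
    · intro z _ hz
      simp [hz.symm]
  conv_lhs => rw [← h1]
  have := map_list_prod (PiTensorProduct.tprodMonoidHom (A := fun _ : X => K) F)
    (l.map (fun x => (Pi.mulSingle x (m x) : X → K)))
  rw [map_map] at this
  exact this

lemma ten_induction {P : Ten F K X → Prop} (one : P 1)
    (smul : ∀ (c : F) z, P z → P (c • z)) (add : ∀ z w, P z → P w → P (z + w))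
    (mul : ∀ x k z, P z → P (sing x k * z)) (z : Ten F K X) : P z := by
  induction z using pind with
  | smul_tprod r f =>
    apply smul
    rw [tprod_eq_prod isFull_univ]
    generalize (Finset.univ : Finset X).toList = l
    induction l with
    | nil => simpa using one
    | cons a l ih => simpa using mul _ _ _ ih
  | _ => simp_all

lemma prodLift_tprod {l : List X} (hl : IsFull l) (φ : X → K →ₗ[F] B) (m : X → K)
    (h : ∀ x y, x ≠ y → ∀ a b, Commute (φ x a) (φ y b)) :
    prodLift φ (ptprod F m) = (l.map (fun x => φ x (m x))).prod := by
  have hf : IsFull (List.ofFn (Fintype.equivFin X).symm) :=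
    ⟨List.nodup_ofFn.2 (Equiv.injective _), fun x => by
      rw [List.mem_ofFn]; exact ⟨Fintype.equivFin X x, by simp⟩⟩
  rw [list_prod_perm hl.nodup (hl.perm hf) _ (fun x _ y _ hxy => h x y hxy _ _)]
  simp only [prodLift, PiTensorProduct.lift.tprod, MultilinearMap.compLinearMap_apply,
    MultilinearMap.domDomCongr_apply, MultilinearMap.mkPiAlgebraFin_apply, List.map_ofFn]
  rfl

/-- `prodLift` for algebra homomorphisms. -/
def prodLiftAlg (φ : X → K →ₐ[F] B) (h : ∀ x y, x ≠ y → ∀ a b, Commute (φ x a) (φ y b)) :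
    Ten F K X →ₐ[F] B :=
  PiTensorProduct.liftAlgHom (((MultilinearMap.mkPiAlgebraFin F (Fintype.card X) B).domDomCongr
      (Fintype.equivFin X).symm).compLinearMap (fun x => (φ x).toLinearMap))
    (by
      have := prodLift_tprod isFull_univ (fun x => (φ x).toLinearMap) 1 h
      rw [prodLift, PiTensorProduct.lift.tprod] at this
      rw [this]
      simp)
    (by
      intro x y
      have key : ∀ z : X → K, (((MultilinearMap.mkPiAlgebraFin F (Fintype.card X) B).domDomCongr
        (Fintype.equivFin X).symm).compLinearMap (fun x => (φ x).toLinearMap)) z =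
        ((Finset.univ : Finset X).toList.map (fun x => φ x (z x))).prod := by
        intro z
        have := prodLift_tprod isFull_univ (fun x => (φ x).toLinearMap) z h
        rw [prodLift, PiTensorProduct.lift.tprod] at this
        rw [this]
        rfl
      rw [key, key, key, ← list_prod_map_mul isFull_univ.nodup]
      · simp
      · intro x _ y _ hxy
        exact h x y hxy _ _)

lemma prodLiftAlg_toLinearMap (φ : X → K →ₐ[F] B)
    (h : ∀ x y, x ≠ y → ∀ a b, Commute (φ x a) (φ y b)) :
    (prodLiftAlg φ h).toLinearMap = prodLift (fun x => (φ x).toLinearMap) := by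
  ext m
  rfl

lemma prodLift_eq (φ : X → K →ₐ[F] B) (φ' : X → K →ₗ[F] B)
    (h : ∀ x y, x ≠ y → ∀ a b, Commute (φ x a) (φ y b)) (h' : ∀ x, φ' x = (φ x).toLinearMap) :
    prodLift φ' = (prodLiftAlg φ h).toLinearMap := by
  rw [prodLiftAlg_toLinearMap]
  congr 1
  funext x
  exact h' x

@[simp] lemma prodLiftAlg_sing (φ : X → K →ₐ[F] B)
    (h : ∀ x y, x ≠ y → ∀ a b, Commute (φ x a) (φ y b)) (x : X) (k : K) :
    prodLiftAlg φ h (sing x k) = φ x k := by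
  have h1 : prodLiftAlg φ h (sing x k) = prodLift (fun x => (φ x).toLinearMap) (sing x k) := by
    rw [← prodLiftAlg_toLinearMap φ h]; rfl
  rw [h1, sing_eq_tprod, prodLift_tprod isFull_univ _ _ h,
    list_prod_map_eq_single isFull_univ.nodup _ (isFull_univ.mem x)]
  · simp
  · intro y _ hy
    simp [hy]

lemma ten_algHom_ext {f g : Ten F K X →ₐ[F] B} (h : ∀ x k, f (sing x k) = g (sing x k)) :
    f = g :=
  PiTensorProduct.algHom_ext (fun x => AlgHom.ext (h x))

/-- The counit of `K^{⊗X}`. -/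
def epsT : Ten F K X →ₐ[F] F :=
  prodLiftAlg (fun _ => counitAlgHom F K) (fun _ _ _ _ _ => Commute.all _ _)

@[simp] lemma epsT_sing (x : X) (k : K) :
    epsT (sing x k : Ten F K X) = counit (R := F) k := by
  rw [epsT, prodLiftAlg_sing]; rfl

lemma counitTen_eq : (counitTen X : DTen F K X) = epsT.toLinearMap :=
  prodLift_eq _ _ _ (fun _ => rfl)

lemma epsAlg_commute (x : K) (b : B) : Commute (epsAlg (F := F) x : B) b := Algebra.commutes _ _

lemma commute_epsAlg (x : K) (b : B) : Commute b (epsAlg (F := F) x : B) :=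
  (Algebra.commutes _ _).symm

/-- The projection on the factor `x` as an algebra homomorphism. -/
def co (x : X) : Ten F K X →ₐ[F] K :=
  prodLiftAlg (fun y => if y = x then AlgHom.id F K else epsAlg) (by
    intro y z hyz a b
    by_cases hy : y = x
    · rw [if_neg (fun hz : z = x => hyz (hy.trans hz.symm))]
      exact commute_epsAlg _ _
    · rw [if_neg hy]
      exact epsAlg_commute _ _)

lemma co_sing (x y : X) (k : K) :
    co x (sing y k : Ten F K X) = if y = x then k else algebraMap F K (counit (R := F) k) := by
  rw [co, prodLiftAlg_sing]
  split <;> simp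

@[simp] lemma co_sing_self (x : X) (k : K) : co x (sing x k : Ten F K X) = k := by simp [co_sing]

lemma co_sing_ne {x y : X} (h : y ≠ x) (k : K) :
    co x (sing y k : Ten F K X) = algebraMap F K (counit (R := F) k) := by
  simp [co_sing, h]

lemma coord_eq (x : X) : (coord x : Ten F K X →ₗ[F] K) = (co x).toLinearMap := by
  rw [co]
  apply prodLift_eq
  intro y
  split <;> rfl

/-- The projection that applies the counit outside of a list of tensor factors. -/
def pj (l : List X) : Ten F K X →ₐ[F] Ten F K X :=
  prodLiftAlg (fun x => if x ∈ l then sing x else epsAlg) (by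
    intro y z hyz a b
    by_cases hy : y ∈ l
    · by_cases hz : z ∈ l
      · rw [if_pos hy, if_pos hz]
        exact sing_commute hyz _ _
      · rw [if_neg hz]
        exact commute_epsAlg _ _
    · rw [if_neg hy]
      exact epsAlg_commute _ _)

lemma pj_sing_of_mem {l : List X} {x : X} (h : x ∈ l) (k : K) :
    pj l (sing x k : Ten F K X) = sing x k := by
  rw [pj, prodLiftAlg_sing, if_pos h]

lemma pj_sing_of_notMem {l : List X} {x : X} (h : x ∉ l) (k : K) :
    pj l (sing x k : Ten F K X) = algebraMap F _ (counit (R := F) k) := by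
  rw [pj, prodLiftAlg_sing, if_neg h, epsAlg_apply]

lemma pj_tprod (l : List X) (m : X → K) : pj l (ptprod F m : Ten F K X) =
    ptprod F
      (fun x => if x ∈ l then m x else algebraMap F K (counit (R := F) (m x))) := by
  rw [tprod_eq_prod isFull_univ, tprod_eq_prod isFull_univ, map_list_prod, map_map]
  congr 1
  apply map_congr_left
  intro x _
  by_cases hx : x ∈ l
  · simp [hx, pj_sing_of_mem hx]
  · simp_all [Function.comp_apply, pj_sing_of_notMem, if_false]

/-- Splitting off a tensor factor from `prodLift`. -/
lemma prodLift_sing_mul {β : X → K →ₗ[F] B}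
    (h : ∀ x y, x ≠ y → ∀ a b, Commute (β x a) (β y b)) {l : List X} {x : X} (hx : x ∉ l) (k : K)
    (z : Ten F K X) : prodLift β (sing x k * pj l z) =
      β x k * prodLift (Function.update β x epsOne) (pj l z) := by
  have h' : ∀ y z, y ≠ z → ∀ a b, Commute (Function.update β x epsOne y a)
      (Function.update β x epsOne z b) := by
    intro y z hyz a b
    by_cases hy : y = x
    · subst hy; rw [Function.update_self]; exact commute_epsOne _ _
    · by_cases hz : z = x
      · subst hz; rw [Function.update_self]; exact (commute_epsOne _ _).symm
      · simp_all
  induction z using pind with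
  | smul_tprod r m =>
    simp only [map_smul, mul_smul_comm]
    congr 1
    rw [pj_tprod, sing_eq_tprod, tprod_mul_tprod]
    have hf : IsFull (x :: ((Finset.univ : Finset X).erase x).toList) :=
      ⟨nodup_cons.2 ⟨by simp, Finset.nodup_toList _⟩, fun y => by simp [em]⟩
    rw [prodLift_tprod hf _ _ h, prodLift_tprod hf _ _ h', map_cons, prod_cons,
      map_cons, prod_cons, ← mul_assoc]
    congr 1
    · simp_all [Pi.mul_apply, Pi.mulSingle_eq_same, if_neg, Function.update_self, map_smul, epsOne, algebraMap_eq_smul_one]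
    · congr 1
      apply map_congr_left
      intro y hy
      have hy : y ≠ x := by simpa using hy
      simp [hy]
  | _ => simp_all [mul_add]

/-- Restricting a family of linear maps to a list. -/
def resFam (β : X → K →ₗ[F] B) (l : List X) (x : X) : K →ₗ[F] B := if x ∈ l then β x else epsOne

lemma resFam_commute {β : X → K →ₗ[F] B}
    (h : ∀ x y, x ≠ y → ∀ a b, Commute (β x a) (β y b)) (l : List X) (x y : X) (hxy : x ≠ y)
    (a b : K) : Commute (resFam β l x a) (resFam β l y b) := by
  unfold resFam
  split
  · split
    · exact h x y hxy a b
    · exact (commute_epsOne _ _).symm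
  · exact commute_epsOne _ _

lemma prodLift_resFam_sing_mul {β : X → K →ₗ[F] B}
    (h : ∀ x y, x ≠ y → ∀ a b, Commute (β x a) (β y b)) {l : List X} {x : X} (hx : x ∉ l) (k : K)
    (z : Ten F K X) : prodLift (resFam β (x :: l)) (sing x k * pj l z) =
      β x k * prodLift (resFam β l) (pj l z) := by
  rw [prodLift_sing_mul (resFam_commute h _) hx]
  congr 2
  · simp [resFam]
  · congr 1
    funext y
    by_cases hy : y = x
    · subst hy; simp [resFam, hx]
    · simp [resFam, hy]

lemma prodLift_resFam_nil (β : X → K →ₗ[F] B) (z : Ten F K X) :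
    prodLift (resFam β []) z = algebraMap F B (epsT z) := by
  have : prodLift (resFam β []) = (prodLiftAlg (fun _ => epsAlg (B := B))
      (fun _ _ _ _ _ => epsAlg_commute _ _) : Ten F K X →ₐ[F] B).toLinearMap :=
    prodLift_eq _ _ _ (fun x => by simp [resFam, epsAlg_toLinearMap])
  rw [this]
  have h2 : (prodLiftAlg (fun _ => epsAlg (B := B))
      (fun _ _ _ _ _ => epsAlg_commute _ _) : Ten F K X →ₐ[F] B) =
      (Algebra.ofId F B).comp epsT := ten_algHom_ext (fun x k => by simp [Algebra.ofId_apply])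
  rw [h2]; rfl

lemma prodLift_resFam_pj {β : X → K →ₗ[F] B}
    (h : ∀ x y, x ≠ y → ∀ a b, Commute (β x a) (β y b)) (l : List X) (z : Ten F K X) :
    prodLift (resFam β l) (pj l z) = prodLift (resFam β l) z := by
  induction z using pind with
  | smul_tprod r m =>
    simp only [map_smul]
    congr 1
    rw [pj_tprod, prodLift_tprod isFull_univ _ _ (resFam_commute h l),
      prodLift_tprod isFull_univ _ _ (resFam_commute h l)]
    congr 1
    apply map_congr_left
    intro y _
    by_cases hy : y ∈ l
    · simp [hy]
    · simp [hy, resFam, epsOne]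
  | _ => simp_all

variable (F K X) in
/-- The comultiplication of `K^{⊗X}`. -/
def dlt : Ten F K X →ₐ[F] Ten F K X ⊗[F] Ten F K X :=
  prodLiftAlg (fun x => (amap (sing x) (sing x)).comp (comulAlgHom F K)) (by
    intro x y hxy a b
    simp only [comp_apply]
    generalize comulAlgHom F K a = s
    generalize comulAlgHom F K b = t
    induction s with
    | zero => simp
    | add s s' hs hs' => rw [map_add]; exact hs.add_left hs'
    | tmul a a' =>
      induction t with
      | zero => simp
      | add s s' hs hs' => rw [map_add]; exact hs.add_right hs'
      | tmul b b' => exact (sing_commute hxy _ _).tmul (sing_commute hxy _ _))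

lemma dlt_sing (x : X) (k : K) : dlt F K X (sing x k) =
    tmap (sing x).toLinearMap (sing x).toLinearMap (comul (R := F) k) := by
  rw [dlt, prodLiftAlg_sing]; rfl

variable (F K X) in
/-- Two copies of `K^{⊗X}`. -/
abbrev Ten2 := Ten F K X ⊗[F] Ten F K X

variable (F K) in
/-- The first and second embeddings of the tensor factor `x` in `K^{⊗X} ⊗ K^{⊗X}`. -/
def s1 (x : X) : K →ₐ[F] Ten F K X ⊗[F] Ten F K X := inL.comp (sing x)

variable (F K) in
def s2 (x : X) : K →ₐ[F] Ten F K X ⊗[F] Ten F K X := inR.comp (sing x)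

lemma tmul_commute {a a' : B} {b b' : B'} (h : Commute a a') (h' : Commute b b') :
    Commute (a ⊗ₜ[F] b) (a' ⊗ₜ[F] b') := by simp [Commute, SemiconjBy, tmul_mul_tmul, h.eq, h'.eq]

variable (F) in
lemma s1_apply (x : X) (k : K) : s1 F K x k = sing x k ⊗ₜ 1 := rfl

variable (F) in
lemma s2_apply (x : X) (k : K) : s2 F K x k = 1 ⊗ₜ sing x k := rfl

variable (F) in
lemma s1_commute {x y : X} (h : x ≠ y) (k k' : K) :
    Commute (s1 F K x k) (s1 F K y k') :=
  tmul_commute (sing_commute h _ _) (one_left _)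

variable (F) in
lemma s2_commute {x y : X} (h : x ≠ y) (k k' : K) :
    Commute (s2 F K x k) (s2 F K y k') :=
  tmul_commute (one_left _) (sing_commute h _ _)

variable (F) in
lemma s1_s2_commute (x y : X) (k k' : K) :
    Commute (s1 F K x k) (s2 F K y k') :=
  tmul_commute (one_right _) (one_left _)

lemma dlt_sing_eq_rr (x : X) (k : K) : dlt F K X (sing x k) =
    cmul (s1 F K x).toLinearMap (s2 F K x).toLinearMap k := by
  rw [dlt_sing, map_eq_rr]; rfl

lemma splitTen_comul_eq :
    splitTen (fun _ : X => comul (R := F) (A := K)) = (dlt F K X).toLinearMap := by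
  rw [dlt]
  apply prodLift_eq
  intro x
  rfl

end Tensor

/-! ### Reordering products -/

section Reorder

variable {X M : Type*} [Monoid M]

lemma pairsOf_cons_prod (r : X → X → M) (x : X) (l : List X) :
    ((pairsOf (x :: l)).map (fun p => r p.1 p.2)).prod =
      (l.reverse.map (r x)).prod * ((pairsOf l).map (fun p => r p.1 p.2)).prod := by
  simp [pairsOf, map_append, Function.comp_def]

lemma mem_of_mem_pairsOf {l : List X} {p : X × X} (h : p ∈ pairsOf l) : p.1 ∈ l ∧ p.2 ∈ l := by
  induction l with
  | cons x l ih => grind [pairsOf, mem_append, mem_map, mem_reverse]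
  | _ => simp_all [pairsOf]

lemma sublist_of_mem_pairsOf {l : List X} {p : X × X} (h : p ∈ pairsOf l) :
    Sublist [p.1, p.2] l := by
  induction l with
  | cons x l ih => grind [pairsOf, mem_append, mem_map, mem_reverse]
  | _ => simp_all [pairsOf]

lemma mem_pairsOf_of_sublist {l : List X} {x y : X} (h : Sublist [x, y] l) :
    (x, y) ∈ pairsOf l := by
  induction l with
  | cons z l ih => grind [pairsOf, mem_append, mem_map, mem_reverse]
  | _ => simp_all

lemma nodup_pairsOf {l : List X} (h : l.Nodup) : (pairsOf l).Nodup := by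
  induction l with
  | nil => simp [pairsOf]
  | cons x l ih =>
    rw [nodup_cons] at h
    rw [pairsOf, nodup_append]
    refine ⟨(List.nodup_map_iff (fun a b hab => by simpa using hab)).2
      (nodup_reverse.2 h.2), ih h.2, ?_⟩
    intro p hp q hq hpq
    subst hpq
    obtain ⟨y, _, rfl⟩ := mem_map.1 hp
    exact h.1 (mem_of_mem_pairsOf hq).1

lemma prod_mul_reorder_row {p q : X → M} {r r' : X → X → M} {x : X} {l : List X}
    (hl : (x :: l).Nodup)
    (hrel : ∀ h ∈ l, p h * q x * r' x h = r x h * q x * p h)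
    (hrp : ∀ x h y, y ≠ h → Commute (r x h) (p y)) (hrp' : ∀ x h y, y ≠ h → Commute (r' x h) (p y)) :
    (l.map p).prod * q x * (l.reverse.map (r' x)).prod =
      (l.reverse.map (r x)).prod * q x * (l.map p).prod := by
  induction l with
  | nil => simp
  | cons y m ih =>
    have hl' : y ∉ m := (nodup_cons.1 (nodup_cons.1 hl).2).1
    have ih := ih (hl.sublist ((List.sublist_cons_self y m).cons₂ x))
      (fun h hh => hrel h (mem_cons_of_mem _ hh))
    have h0 := hrel y mem_cons_self
    have h1 : Commute (m.reverse.map (r x)).prod (p y) := by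
      apply Commute.list_prod_left
      intro z hz
      obtain ⟨w, hw, rfl⟩ := mem_map.1 hz
      exact hrp _ _ _ (fun h => hl' (by rw [h]; exact mem_reverse.1 hw))
    have h2 : Commute (r' x y) (m.map p).prod := by
      apply list_prod_right
      intro z hz
      obtain ⟨w, hw, rfl⟩ := mem_map.1 hz
      exact hrp' _ _ _ (fun h => hl' (h ▸ hw))
    simp only [map_cons, prod_cons, reverse_cons, map_append, prod_append,
      List.map_nil, List.prod_nil, mul_one]
    calc _ = p y * ((m.map p).prod * q x * (m.reverse.map (r' x)).prod) * r' x y := by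
          simp only [mul_assoc]
      _ = (p y * (m.reverse.map (r x)).prod) * q x * ((m.map p).prod * r' x y) := by
          rw [ih]; simp only [mul_assoc]
      _ = (m.reverse.map (r x)).prod * (p y * q x * r' x y) * (m.map p).prod := by
          rw [← h1.eq, ← h2.eq]; simp only [mul_assoc]
      _ = _ := by rw [h0]; simp only [mul_assoc]

/-- Merging two products, where exchanging factors produces the elements `r`. -/
lemma prod_mul_reorder {p q : X → M} {r r' : X → X → M} {l : List X} (hl : l.Nodup)
    (hrel : l.Pairwise (fun x h => p h * q x * r' x h = r x h * q x * p h))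
    (hrp : ∀ x h y, y ≠ h → Commute (r x h) (p y)) (hrp' : ∀ x h y, y ≠ h → Commute (r' x h) (p y))
    (hrq : ∀ x h y, y ≠ x → Commute (r x h) (q y))
    (hrq' : ∀ x h y, y ≠ x → Commute (r' x h) (q y)) :
    (l.map p).prod * (l.map q).prod * ((pairsOf l).map (fun z => r' z.1 z.2)).prod =
      ((pairsOf l).map (fun z => r z.1 z.2)).prod * (l.map (fun x => p x * q x)).prod := by
  induction l with
  | nil => simp [pairsOf]
  | cons x l ih =>
    have ih := ih (nodup_cons.1 hl).2 (List.pairwise_cons.1 hrel).2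
    have row := prod_mul_reorder_row hl (List.pairwise_cons.1 hrel).1 hrp hrp'
    have hx : x ∉ l := (nodup_cons.1 hl).1
    rw [pairsOf_cons_prod, pairsOf_cons_prod]
    simp only [map_cons, prod_cons]
    have h1 : Commute (l.reverse.map (r' x)).prod (l.map q).prod := by
      apply Commute.list_prod_left
      intro z hz
      obtain ⟨w, hw, rfl⟩ := mem_map.1 hz
      apply list_prod_right
      intro z hz
      obtain ⟨w', hw', rfl⟩ := mem_map.1 hz
      exact hrq' _ _ _ (fun h => hx (by rw [← h]; exact hw'))
    have h2 : Commute (p x) (l.reverse.map (r x)).prod := by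
      apply list_prod_right
      intro z hz
      obtain ⟨w, hw, rfl⟩ := mem_map.1 hz
      exact (hrp _ _ _ (fun h => hx (by rw [h]; exact mem_reverse.1 hw))).symm
    have h3 : Commute (p x * q x) ((pairsOf l).map (fun z => r z.1 z.2)).prod := by
      apply list_prod_right
      intro z hz
      obtain ⟨w, hw, rfl⟩ := mem_map.1 hz
      have := mem_of_mem_pairsOf hw
      exact ((hrp _ _ _ (fun h => hx (by rw [h]; exact this.2))).mul_right
        (hrq _ _ _ (fun h => hx (by rw [h]; exact this.1)))).symm
    generalize ((pairsOf l).map (fun z => r z.1 z.2)).prod = ρl at *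
    generalize ((pairsOf l).map (fun z => r' z.1 z.2)).prod = ρl' at *
    generalize (l.reverse.map (r x)).prod = ρ at *
    generalize (l.reverse.map (r' x)).prod = ρ' at *
    generalize (l.map q).prod = Q at *
    generalize (l.map p).prod = P at *
    calc p x * P * (q x * Q) * (ρ' * ρl') = p x * P * q x * (Q * ρ') * ρl' := by
          simp only [mul_assoc]
      _ = p x * (P * q x * ρ') * Q * ρl' := by rw [← h1.eq]; simp only [mul_assoc]
      _ = (p x * ρ) * q x * (P * Q * ρl') := by rw [row]; simp only [mul_assoc]
      _ = ρ * ((p x * q x) * ρl) * (l.map (fun x => p x * q x)).prod := by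
          rw [ih, h2.eq]; simp only [mul_assoc]
      _ = _ := by rw [h3.eq]; simp only [mul_assoc]

end Reorder

/-! ### Products of R-matrices -/

section Braid

/-- Homomorphisms with pairwise commuting images. -/
structure Slots (a : I → K →ₐ[F] B) : Prop where
  commute : ∀ i j, i ≠ j → ∀ x y, Commute (a i x) (a j y)

/-- Homomorphisms from two families have commuting images. -/
structure Across (a b : I → K →ₐ[F] B) : Prop where
  commute : ∀ i j x y, Commute (a i x) (b j y)

/-- The convolution product of two algebra homomorphisms with commuting images. -/
def cmulAlg (φ ψ : K →ₐ[F] B) (h : ∀ x y, Commute (φ x) (ψ y)) : K →ₐ[F] B :=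
  (alift φ ψ h).comp (comulAlgHom F K)

lemma cmulAlg_toLinearMap (φ ψ : K →ₐ[F] B) (h : ∀ x y, Commute (φ x) (ψ y)) :
    (cmulAlg φ ψ h).toLinearMap = cmul φ.toLinearMap ψ.toLinearMap := by
  ext k
  rw [cmul_eq_rr]
  change alift φ ψ h (comul (R := F) k) = _
  generalize comul (R := F) k = t
  induction t <;> simp_all [rr_zero, rr_tmul, rr_add]

lemma cmulAlg_apply (φ ψ : K →ₐ[F] B) (h : ∀ x y, Commute (φ x) (ψ y)) (k : K) :
    cmulAlg φ ψ h k = cmul φ.toLinearMap ψ.toLinearMap k :=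
  congr($(cmulAlg_toLinearMap φ ψ h) k)

lemma commute_cmul {φ ψ : K →ₗ[F] B} {z : B} (h : ∀ x, Commute z (φ x))
    (h' : ∀ x, Commute z (ψ x)) (k : K) : Commute z (cmul φ ψ k) := by
  rw [cmul_eq_rr]; exact commute_rr h h'

/-- The family `aᵢ ⋆ bᵢ`. -/
def star (a b : I → K →ₐ[F] B) (h : Across a b) (i : I) : K →ₐ[F] B :=
  cmulAlg (a i) (b i) (h.commute i i)

lemma star_toLinearMap (a b : I → K →ₐ[F] B) (h : Across a b) (i : I) :
    (star a b h i).toLinearMap = cmul (a i).toLinearMap (b i).toLinearMap :=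
  cmulAlg_toLinearMap _ _ _

lemma commute_star {a b : I → K →ₐ[F] B} {h : Across a b} {i : I} {z : B}
    (h1 : ∀ k, Commute z (a i k)) (h2 : ∀ k, Commute z (b i k)) (k : K) :
    Commute z (star a b h i k) := by
  rw [star, cmulAlg_apply]; exact commute_cmul h1 h2 k

lemma Across.star_left {a b c : I → K →ₐ[F] B} (h : Across a b) (hac : Across a c)
    (hbc : Across b c) : Across (HopfGauge.star a b h) c :=
  ⟨fun _ _ _ _ => (commute_star (fun _ => (hac.commute _ _ _ _).symm)
    (fun _ => (hbc.commute _ _ _ _).symm) _).symm⟩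

lemma Across.star_right {a b c : I → K →ₐ[F] B} (h : Across b c) (hab : Across a b)
    (hac : Across a c) : Across a (HopfGauge.star b c h) :=
  ⟨fun _ _ _ _ => commute_star (fun _ => hab.commute _ _ _ _) (fun _ => hac.commute _ _ _ _) _⟩

lemma Slots.star {a b : I → K →ₐ[F] B} (ha : Slots a) (hb : Slots b) (h : Across a b) :
    Slots (star a b h) :=
  ⟨fun i j hij _ y => commute_star
    (fun _ => (commute_star (fun _ => ha.commute j i hij.symm _ _)
      (fun _ => h.commute j i _ _) _).symm)
    (fun _ => (commute_star (fun _ => (h.commute i j _ _).symm)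
      (fun _ => hb.commute j i hij.symm _ _) _).symm) y⟩

variable (base)

/-- The homomorphism `aᵢ` if `i` lies at `v`, and the counit otherwise. -/
def atV (a : I → K →ₐ[F] B) (v : V) (i : I) : K →ₐ[F] B := if base i = v then a i else epsAlg

variable {base}

lemma commute_atV {a : I → K →ₐ[F] B} {v : V} {i : I} {z : B} (h : ∀ k, Commute z (a i k))
    (k : K) : Commute z (atV base a v i k) := by
  unfold atV
  split
  · exact h k
  · exact commute_epsAlg _ _

variable (base) in
/-- The iterated comultiplication at the vertex `v` on the slots in a list. -/
def om (a : I → K →ₐ[F] B) (v : V) (l : List I) : K →ₗ[F] B :=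
  (l.map (fun h => (toConv (atV base a v h).toLinearMap : Cv F K B))).prod.ofConv

lemma om_cons (a : I → K →ₐ[F] B) (v : V) (x : I) (l : List I) :
    om base a v (x :: l) = cmul (atV base a v x).toLinearMap (om base a v l) := rfl

lemma toConv_om (a : I → K →ₐ[F] B) (v : V) (l : List I) : toConv (om base a v l) =
    (l.map (fun h => (toConv (atV base a v h).toLinearMap : Cv F K B))).prod := rfl

lemma commute_om {a : I → K →ₐ[F] B} {v : V} {l : List I} {z : B}
    (h : ∀ i ∈ l, ∀ k, Commute z (a i k)) (k : K) : Commute z (om base a v l k) := by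
  induction l generalizing k with
  | nil => exact (commute_epsOne _ _).symm
  | cons x l ih =>
    rw [om_cons]
    exact commute_cmul (commute_atV (h x mem_cons_self))
      (ih (fun i hi => h i (mem_cons_of_mem _ hi))) k

lemma commute_om_om {a b : I → K →ₐ[F] B} {v w : V} {l l' : List I}
    (h : ∀ i ∈ l, ∀ j ∈ l', ∀ k k', Commute (a i k) (b j k')) (k k' : K) :
    Commute (om base a v l k) (om base b w l' k') :=
  commute_om (fun j hj k' => (commute_om (fun i hi k => (h i hi j hj k k').symm) k).symm) k'

lemma exists_om {a : I → K →ₐ[F] B} (ha : Slots a) (v : V) {l : List I} (hl : l.Nodup) :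
    ∃ φ : K →ₐ[F] B, φ.toLinearMap = om base a v l := by
  induction l with
  | nil => exact ⟨epsAlg, rfl⟩
  | cons x l ih =>
    rw [nodup_cons] at hl
    obtain ⟨φ, hφ⟩ := ih hl.2
    refine ⟨cmulAlg (atV base a v x) φ ?_, ?_⟩
    · intro y z
      refine Commute.symm (commute_atV (fun k => ?_) y)
      rw [← toLinearMap_apply φ, hφ]
      exact (commute_om (fun i hi k' =>
        ha.commute _ _ (fun hxi => hl.1 (by rw [hxi]; exact hi)) _ _) z).symm
    · rw [cmulAlg_toLinearMap, hφ, om_cons]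

variable (base) in
/-- The product of the R-matrices over the pairs `j` before `i` of slots at the same vertex. -/
def braidL (R : K ⊗[F] K) (a b : I → K →ₐ[F] B) (l : List I) : B :=
  ((pairsOf l).map (fun p => if base p.1 = base p.2 then
    rr R (b p.1).toLinearMap (a p.2).toLinearMap else 1)).prod

lemma map_braidL (f : B →ₐ[F] B') (R : K ⊗[F] K) (a b : I → K →ₐ[F] B) (l : List I) :
    f (braidL base R a b l) = braidL base R (fun i => f.comp (a i)) (fun i => f.comp (b i)) l := by
  rw [braidL, map_list_prod, map_map, braidL]
  congr 2
  funext p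
  simp only [Function.comp_apply]
  split
  · rw [map_rr]; rfl
  · rw [map_one]

lemma commute_braidL {R : K ⊗[F] K} {a b : I → K →ₐ[F] B} {l : List I} {z : B}
    (h : ∀ i ∈ l, ∀ k, Commute z (a i k)) (h' : ∀ i ∈ l, ∀ k, Commute z (b i k)) :
    Commute z (braidL base R a b l) := by
  apply list_prod_right
  intro w hw
  obtain ⟨p, hp, rfl⟩ := mem_map.1 hw
  have := mem_of_mem_pairsOf hp
  split
  · exact commute_rr (h' _ this.1) (h _ this.2)
  · exact one_right _

lemma braidL_cons {R : K ⊗[F] K} (hR : IsRMatrix R) {a b : I → K →ₐ[F] B} (ha : Slots a)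
    (hab : Across a b) {x : I} {l : List I} (hl : l.Nodup) : braidL base R a b (x :: l) =
      rr R (b x).toLinearMap (om base a (base x) l) * braidL base R a b l := by
  rw [braidL, pairsOf_cons_prod (fun y z => if base y = base z then
    rr R (b y).toLinearMap (a z).toLinearMap else 1), braidL]
  congr 1
  induction l with
  | nil => simp [show om base a _ [] = epsOne from rfl, hR.rr_eps_right]
  | cons y l ih =>
    rw [nodup_cons] at hl
    rw [reverse_cons, map_append, prod_append, ih hl.2, om_cons, hR.rr_cmul_right]
    · congr 1
      simp only [map_cons, List.map_nil, prod_cons, List.prod_nil, mul_one, atV]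
      by_cases h : base x = base y
      · rw [if_pos h, if_pos h.symm]
      · rw [if_neg h, if_neg (Ne.symm h), epsAlg_toLinearMap, hR.rr_eps_right]
    · intro k k'
      exact (commute_om (fun i _ k => (hab.commute _ _ _ _).symm) k).symm
    · intro k k'
      refine Commute.symm (commute_atV (fun k => (commute_om (fun i hi k => ?_) _).symm) k)
      exact ha.commute _ _ (fun h => hl.1 (by rw [h]; exact hi)) _ _

/-- The products of R-matrices intertwine the comultiplications at a vertex. -/
lemma braidL_mul_om_star {R : K ⊗[F] K} (hR : IsRMatrix R) {a b : I → K →ₐ[F] B} (ha : Slots a)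
    (hb : Slots b) (hab : Across a b) (v : V) {l : List I} (hl : l.Nodup) (k : K) :
    braidL base R a b l * om base (star a b hab) v l k =
      cmul (om base a v l) (om base b v l) k * braidL base R a b l := by
  let r : I → I → Cv F K B := fun x h => cst (if base x = base h then
    rr R (b x).toLinearMap (a h).toLinearMap else 1)
  let p : I → Cv F K B := fun h => toConv (atV base a v h).toLinearMap
  let q : I → Cv F K B := fun h => toConv (atV base b v h).toLinearMap
  have hr : ((pairsOf l).map (fun z => r z.1 z.2)).prod = cst (braidL base R a b l) := by
    rw [braidL, map_list_prod, map_map]; rfl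
  have hrp : ∀ x h y, y ≠ h → Commute (r x h) (p y) := by
    intro x h y hyh
    refine commute_cst (fun c => ?_)
    refine commute_atV (fun k => ?_) c
    split
    · exact (commute_rr (fun z => hab.commute _ _ _ _) (fun z => ha.commute _ _ hyh _ _)).symm
    · exact one_left _
  have hrq : ∀ x h y, y ≠ x → Commute (r x h) (q y) := by
    intro x h y hyh
    refine commute_cst (fun c => ?_)
    refine commute_atV (fun k => ?_) c
    split
    · exact (commute_rr (fun z => hb.commute _ _ hyh _ _)
        (fun z => (hab.commute _ _ _ _).symm)).symm
    · exact one_left _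
  have hrel : ∀ x h, p h * q x * r x h = r x h * q x * p h := by
    intro x h
    have heps : (toConv (epsAlg : K →ₐ[F] B).toLinearMap : Cv F K B) = 1 := rfl
    have hcc : ∀ (z : B) (f : Cv F K B), (∀ c, Commute z (f c)) → f * cst z = cst z * f :=
      fun z f hf => (commute_cst hf).eq.symm
    simp only [p, q, r, atV]
    by_cases hh : base h = v
    · by_cases hx : base x = v
      · rw [if_pos hh, if_pos hx, if_pos (hx.trans hh.symm)]
        ext k
        rw [mul_cst_apply, mul_assoc, cst_mul_apply]
        exact (hR.exchange (b x) (a h) (fun _ _ => (hab.commute _ _ _ _).symm) k).symm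
      · simp_all
    · rw [if_neg hh, heps]
      by_cases hx : base x = v
      · rw [if_pos hx, if_neg (fun h' => hh (h'.symm.trans hx))]; simp
      · rw [if_neg hx, heps]; simp
  have key := prod_mul_reorder (p := p) (q := q) (r := r) (r' := r) hl
    (List.pairwise_of_forall (fun _ _ => hrel _ _)) hrp hrp hrq hrq
  rw [hr] at key
  have h2 := congr($key k)
  rw [mul_cst_apply, cst_mul_apply] at h2
  refine Eq.trans ?_ h2.symm
  congr 1
  change _ = (l.map (fun x => p x * q x)).prod k
  rw [← WithConv.ofConv_toConv (om base (star a b hab) v l), toConv_om]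
  refine congrArg (fun f : Cv F K B => f k) (congrArg List.prod (map_congr_left ?_))
  intro h _
  simp only [p, q, atV]
  split
  · rw [star_toLinearMap]
  · exact (mul_one (1 : Cv F K B)).symm

lemma mul_rr_right {R : K ⊗[F] K} {z : B} {c φ ψ : K →ₗ[F] B} (h : ∀ k, Commute z (c k))
    (h' : ∀ k, z * φ k = ψ k * z) : z * rr R c φ = rr R c ψ * z := by
  induction R with
  | tmul x y => rw [rr_tmul, rr_tmul, ← mul_assoc, (h x).eq, mul_assoc, h', mul_assoc]
  | _ => simp_all [rr_zero, rr_add, mul_add, add_mul]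

lemma mul_rr_left {R : K ⊗[F] K} {z : B} {c φ ψ : K →ₗ[F] B} (h : ∀ k, Commute z (c k))
    (h' : ∀ k, z * φ k = ψ k * z) : z * rr R φ c = rr R ψ c * z := by
  induction R with
  | tmul x y => rw [rr_tmul, rr_tmul, ← mul_assoc, h', mul_assoc, (h y).eq, mul_assoc]
  | _ => simp_all [rr_zero, rr_add, mul_add, add_mul]

lemma braidL_cocycle {R : K ⊗[F] K} (hR : IsRMatrix R) {a b c : I → K →ₐ[F] B} (ha : Slots a)
    (hb : Slots b) (hc : Slots c) (hab : Across a b) (hac : Across a c) (hbc : Across b c)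
    (habc : Across (star a b hab) c) (habc' : Across a (star b c hbc))
    {l : List I} (hl : l.Nodup) :
    braidL base R a b l * braidL base R (star a b hab) c l =
      braidL base R b c l * braidL base R a (star b c hbc) l := by
  induction l with
  | nil => simp [braidL, pairsOf]
  | cons x l ih =>
    rw [nodup_cons] at hl
    have ih := ih hl.2
    have hne : ∀ i ∈ l, x ≠ i := fun i hi h => hl.1 (h ▸ hi)
    have hI := braidL_mul_om_star (base := base) hR ha hb hab (base x) hl.2
    rw [braidL_cons hR ha hab hl.2, braidL_cons hR (ha.star hb hab) habc hl.2,
      braidL_cons hR hb hbc hl.2, braidL_cons hR ha habc' hl.2]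
    obtain ⟨ωa, hωa⟩ := exists_om (base := base) ha (base x) hl.2
    have hca : ∀ k, ∀ k', Commute (c x k') (om base a (base x) l k) := fun k k' =>
      commute_om (fun i _ k => (hac.commute _ _ _ _).symm) k
    have hcb : ∀ k, ∀ k', Commute (c x k') (om base b (base x) l k) := fun k k' =>
      commute_om (fun i _ k => (hbc.commute _ _ _ _).symm) k
    have hB1 : ∀ k, Commute (braidL base R a b l) (c x k) := fun k =>
      (commute_braidL (fun i _ k => (hac.commute _ _ _ _).symm)
        (fun i _ k => (hbc.commute _ _ _ _).symm)).symm
    have h1 := mul_rr_right (R := R) (c := (c x).toLinearMap) hB1 hI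
    have h2 : Commute (braidL base R b c l) (rr R (star b c hbc x).toLinearMap
        (om base a (base x) l)) := by
      apply Commute.symm
      apply commute_braidL
      · intro i hi k
        apply Commute.symm
        apply commute_rr
        · exact commute_star (h := hbc) (fun k' => (hb.commute _ _ (hne i hi) _ _).symm)
            (fun k' => hbc.commute _ _ _ _)
        · exact commute_om (fun j _ k => (hab.commute _ _ _ _).symm)
      · intro i hi k
        apply Commute.symm
        apply commute_rr
        · exact commute_star (h := hbc) (fun k' => (hbc.commute _ _ _ _).symm)
            (fun k' => (hc.commute _ _ (hne i hi) _ _).symm)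
        · exact commute_om (fun j _ k => (hac.commute _ _ _ _).symm)
    have h3 : rr R (star b c hbc x).toLinearMap (om base a (base x) l) =
        rr R (b x).toLinearMap (om base a (base x) l) *
          rr R (c x).toLinearMap (om base a (base x) l) := by
      rw [star_toLinearMap, ← hωa, hR.rr_cmul_left]
      intro k k'
      rw [← toLinearMap_apply ωa, hωa]
      exact hca _ _
    have h4 := hR.rr_cmul_right (c x) (om base a (base x) l) (om base b (base x) l)
      (fun k k' => (hcb k k').symm)
      (commute_om_om (fun i _ j _ => hab.commute i j))
    have h5 : Commute (rr R (b x).toLinearMap (om base a (base x) l))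
        (rr R (c x).toLinearMap (om base b (base x) l)) := by
      apply commute_rr_rr
      · exact fun _ _ => hbc.commute _ _ _ _
      · exact fun _ _ => commute_om (fun i hi k => hb.commute _ _ (hne i hi) _ _) _
      · exact fun _ _ => (hca _ _).symm
      · exact commute_om_om (fun i _ j _ => hab.commute i j)
    rw [h4] at h1
    rw [h3] at h2 ⊢
    generalize rr R (c x).toLinearMap (om base (star a b hab) (base x) l) = ρ2 at *
    generalize rr R (c x).toLinearMap (om base a (base x) l) = ca at *
    generalize rr R (c x).toLinearMap (om base b (base x) l) = cb at *
    generalize rr R (b x).toLinearMap (om base a (base x) l) = ba at *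
    generalize braidL base R a b l = B1 at *
    generalize braidL base R b c l = B3 at *
    calc ba * B1 * (ρ2 * braidL base R (star a b hab) c l)
        = ba * (B1 * ρ2) * braidL base R (star a b hab) c l := by simp only [mul_assoc]
      _ = (ba * cb) * ca * (B1 * braidL base R (star a b hab) c l) := by
          rw [h1]; simp only [mul_assoc]
      _ = cb * (ba * ca * B3) * braidL base R a (star b c hbc) l := by
          rw [ih, h5.eq]; simp only [mul_assoc]
      _ = _ := by rw [← h2.eq]; simp only [mul_assoc]

end Braid

section BraidValues

lemma braidL_eq_one {R : K ⊗[F] K} {a b : I → K →ₐ[F] B} {l : List I}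
    (h : ∀ j i, Sublist [j, i] l → base j = base i →
      rr R (b j).toLinearMap (a i).toLinearMap = 1) : braidL base R a b l = 1 := by
  apply prod_eq_one
  intro z hz
  obtain ⟨p, hp, rfl⟩ := mem_map.1 hz
  split
  · exact h _ _ (sublist_of_mem_pairsOf hp) ‹_›
  · rfl

lemma braidL_eq_single {R : K ⊗[F] K} {a b : I → K →ₐ[F] B} {l : List I} (hl : l.Nodup)
    {j i : I} (hji : Sublist [j, i] l) (hb : base j = base i)
    (h : ∀ j' i', j' ≠ j ∨ i' ≠ i → rr R (b j').toLinearMap (a i').toLinearMap = 1) :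
    braidL base R a b l = rr R (b j).toLinearMap (a i).toLinearMap := by
  rw [braidL, list_prod_map_eq_single (nodup_pairsOf hl) _ (mem_pairsOf_of_sublist hji)]
  · rw [if_pos hb]
  · grind

/-- The products of R-matrices depend only on the orderings at the vertices. -/
lemma braidL_eq_prod_filter {R : K ⊗[F] K} {a b : I → K →ₐ[F] B} (ha : Slots a) (hb : Slots b)
    (hab : Across a b) {vs : List V} (hvs : vs.Nodup) {l : List I} (h : ∀ x ∈ l, base x ∈ vs) :
    braidL base R a b l =
      (vs.map (fun v => braidL base R a b (l.filter (fun x => decide (base x = v))))).prod := by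
  have hne : ∀ {x : I} {v : V} {l : List I} {y : I},
      y ∈ l.filter (fun x => decide (base x = v)) → v ≠ base x → x ≠ y := by grind
  induction l with
  | cons x l ih =>
    have ih := ih (fun y hy => h y (mem_cons_of_mem _ hy))
    let row : B := (l.reverse.map (fun y => if base x = base y then
      rr R (b x).toLinearMap (a y).toLinearMap else 1)).prod
    have hrow : ((l.filter (fun y => decide (base y = base x))).reverse.map
        (fun y => if base x = base y then
          rr R (b x).toLinearMap (a y).toLinearMap else 1)).prod = row := by
      simp only [row]
      generalize l = l
      induction l with
      | nil => simp
      | cons y l ih => grind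
    have h1 : ∀ v, braidL base R a b ((x :: l).filter (fun y => decide (base y = v))) =
        (if v = base x then row else 1) *
          braidL base R a b (l.filter (fun y => decide (base y = v))) := by
      intro v
      by_cases hv : v = base x
      · subst hv
        rw [List.filter_cons_of_pos (by simp), if_pos rfl, ← hrow]
        exact pairsOf_cons_prod (fun y z => if base y = base z then
          rr R (b y).toLinearMap (a z).toLinearMap else 1) _ _
      · grind
    have h2 : braidL base R a b (x :: l) = row * braidL base R a b l :=
      pairsOf_cons_prod (fun y z => if base y = base z then
          rr R (b y).toLinearMap (a z).toLinearMap else 1) _ _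
    rw [h2, ih]
    simp only [h1]
    rw [list_prod_map_mul hvs]
    · congr 1
      rw [list_prod_map_eq_single hvs _ (h x mem_cons_self), if_pos rfl]
      intro y _ hy
      rw [if_neg hy]
    · intro v _ w _ hvw
      split
      · rename_i hv
        subst hv
        have hxy : ∀ y ∈ l.filter (fun y => decide (base y = w)), x ≠ y :=
          fun y hy => hne hy hvw.symm
        rw [← hrow]
        apply Commute.list_prod_left
        intro z hz
        obtain ⟨y, hy, rfl⟩ := mem_map.1 hz
        rw [mem_reverse] at hy
        have hxy' : ∀ y' ∈ l.filter (fun y => decide (base y = w)), y ≠ y' := by grind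
        split
        · apply commute_braidL
          · intro i hi k
            exact (commute_rr (fun _ => (hab.commute _ _ _ _))
              (fun _ => ha.commute _ _ (hxy' i hi).symm _ _)).symm
          · intro i hi k
            exact (commute_rr (fun _ => hb.commute _ _ (hxy i hi).symm _ _)
              (fun _ => (hab.commute _ _ _ _).symm)).symm
        · exact one_left _
      · exact one_left _
  | _ => simp_all [braidL, pairsOf]

end BraidValues

/-! ### Orderings of all edge ends -/

namespace CilGraph

variable (Γ)

/-- A list of all edge ends that induces the given orderings at the vertices. -/
structure IsOrder (L : List (E × Bool)) : Prop where
  filter : ∀ v, L.filter (fun h => decide (Γ.base h = v)) = Γ.cil v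

variable {Γ}

lemma IsOrder.mem {L : List (E × Bool)} (h : Γ.IsOrder L) (x : E × Bool) : x ∈ L := by
  have : x ∈ L.filter (fun y => decide (Γ.base y = Γ.base x)) := by
    rw [h.filter]; exact (Γ.mem_cil _ _).2 rfl
  exact (List.mem_filter.1 this).1

lemma IsOrder.nodup {L : List (E × Bool)} (h : Γ.IsOrder L) : L.Nodup := by
  rw [List.nodup_iff_count_le_one]
  intro x
  have := List.nodup_iff_count_le_one.1 (Γ.nodup (Γ.base x)) x
  rwa [← h.filter, List.count_filter (by simp)] at this

lemma IsOrder.isFull {L : List (E × Bool)} (h : Γ.IsOrder L) : IsFull L := ⟨h.nodup, h.mem⟩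

lemma IsOrder.lt_iff {L : List (E × Bool)} (h : Γ.IsOrder L) {j i : E × Bool} :
    Γ.Lt j i ↔ Sublist [j, i] L ∧ Γ.base j = Γ.base i := by
  unfold Lt
  rw [← h.filter]
  constructor
  · intro h1
    refine ⟨h1.trans List.filter_sublist, ?_⟩
    have : i ∈ L.filter (fun y => decide (Γ.base y = Γ.base j)) := h1.subset (by simp)
    exact (of_decide_eq_true (List.mem_filter.1 this).2).symm
  · grind

variable (Γ) in
/-- The orderings at the vertices, one after another. -/
def order : List (E × Bool) := (Finset.univ : Finset V).toList.flatMap Γ.cil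

variable (Γ) in
lemma isOrder_flatMap {l : List V} (hn : l.Nodup) (hl : ∀ v, v ∈ l) :
    Γ.IsOrder (l.flatMap Γ.cil) := by
  refine ⟨fun v => ?_⟩
  rw [List.filter_flatMap]
  have : ∀ w, (Γ.cil w).filter (fun h => decide (Γ.base h = v)) = if w = v then Γ.cil v else [] := by
    grind [List.filter_eq_self, List.filter_eq_nil_iff, Γ.mem_cil]
  simp only [this]
  have hm := hl v
  clear hl
  induction l with
  | cons w l ih => aesop
  | _ => simp_all

variable (Γ) in
lemma isOrder_order : Γ.IsOrder Γ.order :=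
  Γ.isOrder_flatMap (Finset.nodup_toList _) (fun v => by simp)

lemma lt_irrefl (j : E × Bool) : ¬ Γ.Lt j j := fun h => by
  have := (Γ.nodup (Γ.base j)).sublist h
  simp at this

lemma base_eq_of_lt {j i : E × Bool} (h : Γ.Lt j i) : Γ.base j = Γ.base i :=
  (Γ.isOrder_order.lt_iff.1 h).2

lemma sublist_pair_asymm {X : Type*} {l : List X} (hl : l.Nodup) {x y : X}
    (h : Sublist [x, y] l) : ¬ Sublist [y, x] l := by
  intro h'
  induction l with
  | cons z l ih => grind
  | _ => simp_all

lemma sublist_pair_total {X : Type*} {l : List X} {x y : X} (hx : x ∈ l) (hy : y ∈ l)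
    (hxy : x ≠ y) : Sublist [x, y] l ∨ Sublist [y, x] l := by
  induction l with
  | cons z l ih => grind
  | _ => simp_all

lemma lt_asymm {j i : E × Bool} (h : Γ.Lt j i) : ¬ Γ.Lt i j := by
  intro h'
  rw [Γ.isOrder_order.lt_iff] at h h'
  exact sublist_pair_asymm Γ.isOrder_order.nodup h.1 h'.1

lemma lt_total {j i : E × Bool} (hb : Γ.base j = Γ.base i) (hne : j ≠ i) :
    Γ.Lt j i ∨ Γ.Lt i j := by
  rw [Γ.isOrder_order.lt_iff, Γ.isOrder_order.lt_iff]
  exact (sublist_pair_total (Γ.isOrder_order.mem j) (Γ.isOrder_order.mem i) hne).imp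
    (fun h => ⟨h, hb⟩) (fun h => ⟨h, hb.symm⟩)

end CilGraph

section Slots12

lemma slots_s1 : Slots (s1 F K (X := X)) := ⟨fun _ _ h _ _ => s1_commute F h _ _⟩

lemma slots_s2 : Slots (s2 F K (X := X)) := ⟨fun _ _ h _ _ => s2_commute F h _ _⟩

lemma across_s1_s2 : Across (s1 F K (X := X)) (s2 F K) := ⟨fun _ _ _ _ => s1_s2_commute F _ _ _ _⟩

end Slots12

namespace CilGraph

lemma braid_eq_braidL (R : K ⊗[F] K) {L : List (E × Bool)} (hL : Γ.IsOrder L) :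
    Γ.braid R = braidL Γ.base R (s1 F K) (s2 F K) L := by
  rw [braidL_eq_prod_filter slots_s1 slots_s2 across_s1_s2
    (Finset.nodup_toList (Finset.univ : Finset V)) (fun x _ => by simp)]
  simp only [hL.filter, braid]
  generalize (Finset.univ : Finset V).toList = l
  induction l with
  | nil => simp
  | cons v l ih =>
    rw [flatMap_cons, map_append, prod_append, ih, map_cons, prod_cons]
    congr 1
    rw [braidL]
    congr 1
    apply map_congr_left
    intro p hp
    have := mem_of_mem_pairsOf hp
    rw [Γ.mem_cil, Γ.mem_cil] at this
    rw [if_pos (this.1.trans this.2.symm), map_eq_rr, rr_flip]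
    · rfl
    · intro x y
      exact s1_s2_commute F _ _ _ _

end CilGraph

section Lam

lemma map_cmul (f : B →ₐ[F] B') (φ ψ : K →ₗ[F] B) (k : K) :
    f (cmul φ ψ k) = cmul (f.toLinearMap.comp φ) (f.toLinearMap.comp ψ) k := by
  rw [cmul_eq_rr, map_rr]; rfl

/-- The product of the R-matrices acting on both copies of the selected tensor factors. -/
def twist (R : K ⊗[F] K) (tw : X → Bool) : Ten2 F K X :=
  ((Finset.univ : Finset X).toList.map (fun x => if tw x then
    rr R (s2 F K x).toLinearMap (s1 F K x).toLinearMap else 1)).prod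

lemma map_twist (f : Ten2 F K X →ₐ[F] B) (R : K ⊗[F] K) (tw : X → Bool) :
    f (twist R tw) = ((Finset.univ : Finset X).toList.map (fun x => if tw x then
      rr R (f.comp (s2 F K x)).toLinearMap (f.comp (s1 F K x)).toLinearMap else 1)).prod := by
  rw [twist, map_list_prod, map_map]
  congr 2
  funext p
  simp only [Function.comp_apply]
  split
  · rw [map_rr]; rfl
  · rw [map_one]

/-- Algebra homomorphisms with commuting images. -/
structure CommImg (f : A →ₐ[F] B) (g : B' →ₐ[F] B) : Prop where
  commute : ∀ x y, Commute (f x) (g y)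

/-- `x ⊗ y ↦ f(x) g(y)`. -/
def lam (f : A →ₐ[F] B) (g : B' →ₐ[F] B) (h : CommImg f g) : A ⊗[F] B' →ₐ[F] B :=
  alift f g h.commute

@[simp] lemma lam_tmul (f : A →ₐ[F] B) (g : B' →ₐ[F] B) (h : CommImg f g) (x : A) (y : B') :
    lam f g h (x ⊗ₜ y) = f x * g y := by simp [lam]

lemma lam_apply (f : A →ₐ[F] B) (g : B' →ₐ[F] B) (h : CommImg f g) (z : A ⊗[F] B') :
    lam f g h z = mul' F B (tmap f.toLinearMap g.toLinearMap z) := by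
  induction z <;> simp_all

lemma lam_comp_s1 (f g : Ten F K X →ₐ[F] B) (h : CommImg f g) (x : X) :
    (lam f g h).comp (s1 F K x) = f.comp (sing x) := by
  ext k; simp [s1_apply]

lemma lam_comp_s2 (f g : Ten F K X →ₐ[F] B) (h : CommImg f g) (x : X) :
    (lam f g h).comp (s2 F K x) = g.comp (sing x) := by
  ext k; simp [s2_apply]

lemma lam_dlt_sing (f g : Ten F K X →ₐ[F] B) (h : CommImg f g) (x : X) (k : K) :
    lam f g h (dlt F K X (sing x k)) =
      cmul (f.comp (sing x)).toLinearMap (g.comp (sing x)).toLinearMap k := by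
  rw [dlt_sing_eq_rr, map_cmul, ← lam_comp_s1 f g h, ← lam_comp_s2 f g h]; rfl

lemma lam_twist_eq_one {R : K ⊗[F] K} {tw : X → Bool} (f g : Ten F K X →ₐ[F] B)
    (h : CommImg f g)
    (h1 : ∀ x, tw x → rr R (g.comp (sing x)).toLinearMap (f.comp (sing x)).toLinearMap = 1) :
    lam f g h (twist R tw) = 1 := by simp_all [map_twist, lam_comp_s1, lam_comp_s2]

end Lam

section Coassoc

variable (F K X) in
/-- Three copies of `K^{⊗X}`. -/
def Ten3 := Ten F K X ⊗[F] Ten2 F K X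

instance : Ring (Ten3 F K X) := inferInstanceAs (Ring (Ten F K X ⊗[F] Ten2 F K X))

instance : Algebra F (Ten3 F K X) := inferInstanceAs (Algebra F (Ten F K X ⊗[F] Ten2 F K X))

variable (F K X) in
/-- The identity map to `Ten3`. -/
def toTen3 : Ten F K X ⊗[F] Ten2 F K X →ₐ[F] Ten3 F K X where
  toFun x := x
  map_one' := rfl
  map_mul' _ _ := rfl
  map_zero' := rfl
  map_add' _ _ := rfl
  commutes' _ := rfl

lemma toTen3_injective : Function.Injective (toTen3 F K X) := fun _ _ h => h

variable (F K X) in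
/-- `Δ ⊗ id`. -/
def dltLeft : Ten2 F K X →ₐ[F] Ten3 F K X :=
  ((toTen3 F K X).comp
    (Algebra.TensorProduct.assoc F F F (Ten F K X) (Ten F K X) (Ten F K X)).toAlgHom).comp
    (amap (dlt F K X) (AlgHom.id F _))

variable (F K X) in
/-- `id ⊗ Δ`. -/
def dltRight : Ten2 F K X →ₐ[F] Ten3 F K X := (toTen3 F K X).comp (amap (AlgHom.id F _) (dlt F K X))

variable (F K X) in
/-- The embedding in the first two of three tensor factors. -/
def incl12 : Ten2 F K X →ₐ[F] Ten3 F K X :=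
  (toTen3 F K X).comp
    (amap (AlgHom.id F _) inL)

variable (F K X) in
/-- The embedding in the last two of three tensor factors. -/
def incl23 : Ten2 F K X →ₐ[F] Ten3 F K X := (toTen3 F K X).comp inR

/-- The embeddings in the three copies of the tensor factor `x`. -/
def t1 (x : X) : K →ₐ[F] Ten3 F K X := (toTen3 F K X).comp (inL.comp (sing x))

def t2 (x : X) : K →ₐ[F] Ten3 F K X := (toTen3 F K X).comp (inR.comp (s1 F K x))

def t3 (x : X) : K →ₐ[F] Ten3 F K X := (toTen3 F K X).comp (inR.comp (s2 F K x))

lemma slots_comp {a : I → K →ₐ[F] B} (h : Slots a) (f : B →ₐ[F] B') : Slots (fun i => f.comp (a i)) :=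
  ⟨fun i j hij x y => (h.commute i j hij x y).map f⟩

lemma across_comp {a b : I → K →ₐ[F] B} (h : Across a b) (f : B →ₐ[F] B') :
    Across (fun i => f.comp (a i)) (fun i => f.comp (b i)) :=
  ⟨fun i j x y => (h.commute i j x y).map f⟩

lemma slots_sing : Slots (sing : X → K →ₐ[F] Ten F K X) := ⟨fun _ _ h _ _ => sing_commute h _ _⟩

lemma slots_t1 : Slots (F := F) (K := K) (B := Ten3 F K X) t1 := slots_comp (slots_comp slots_sing inL) (toTen3 F K X)
lemma slots_t2 : Slots (F := F) (K := K) (B := Ten3 F K X) t2 := ⟨fun _ _ h _ _ =>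
  (tmul_commute (one_left _) (s1_commute F h _ _)).map (toTen3 F K X)⟩
lemma slots_t3 : Slots (F := F) (K := K) (B := Ten3 F K X) t3 := ⟨fun _ _ h _ _ =>
  (tmul_commute (one_left _) (s2_commute F h _ _)).map (toTen3 F K X)⟩

lemma across_t2_t3 : Across (F := F) (K := K) (B := Ten3 F K X) t2 t3 := ⟨fun _ _ _ _ =>
  (tmul_commute (one_left _) (s1_s2_commute F _ _ _ _)).map (toTen3 F K X)⟩

lemma across_t1_t2 : Across (F := F) (K := K) (B := Ten3 F K X) t1 t2 :=
  ⟨fun _ _ _ _ => (tmul_commute (one_right _) (one_left _)).map (toTen3 F K X)⟩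

lemma across_t1_t3 : Across (F := F) (K := K) (B := Ten3 F K X) t1 t3 :=
  ⟨fun _ _ _ _ => (tmul_commute (one_right _) (one_left _)).map (toTen3 F K X)⟩

variable (F K X) in
/-- The slots `t1 ⋆ t2`. -/
def t12 : X → K →ₐ[F] Ten3 F K X := star t1 t2 across_t1_t2

variable (F K X) in
/-- The slots `t2 ⋆ t3`. -/
def t23 : X → K →ₐ[F] Ten3 F K X := star t2 t3 across_t2_t3

lemma across_t12_t3 : Across (B := Ten3 F K X) (t12 F K X) t3 :=
  Across.star_left across_t1_t2 across_t1_t3 across_t2_t3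

lemma across_t1_t23 : Across (B := Ten3 F K X) t1 (t23 F K X) :=
  Across.star_right across_t2_t3 across_t1_t2 across_t1_t3

lemma t12_toLinearMap (x : X) : (t12 F K X x).toLinearMap =
    cmul (t1 x).toLinearMap (t2 x).toLinearMap := star_toLinearMap _ _ _ _

lemma t23_toLinearMap (x : X) : (t23 F K X x).toLinearMap =
    cmul (t2 x).toLinearMap (t3 x).toLinearMap := star_toLinearMap _ _ _ _

lemma incl12_comp_s1 (x : X) : (incl12 F K X).comp (s1 F K x) = t1 x := by
  ext k; simp [incl12, s1_apply, t1, tone_def]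

lemma incl12_comp_s2 (x : X) : (incl12 F K X).comp (s2 F K x) = t2 x := by
  ext k; simp [incl12, s2_apply, t2, s1_apply]

lemma assoc_tmul_one (z : Ten2 F K X) :
    toTen3 F K X (Algebra.TensorProduct.assoc F F F (Ten F K X) (Ten F K X) (Ten F K X)
      (z ⊗ₜ 1)) = incl12 F K X z := by
  induction z using tind <;> simp_all [incl12, TensorProduct.add_tmul]

lemma dltLeft_comp_s1 (x : X) : (dltLeft F K X).comp (s1 F K x) = t12 F K X x := by
  ext k
  have h : dltLeft F K X (s1 F K x k) = incl12 F K X (dlt F K X (sing x k)) := by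
    rw [← assoc_tmul_one]; simp [dltLeft, s1_apply]
  rw [comp_apply, h, dlt_sing_eq_rr, map_cmul, ← toLinearMap_apply (t12 F K X x), t12_toLinearMap, ← incl12_comp_s1,
    ← incl12_comp_s2]
  rfl

lemma dltLeft_comp_s2 (x : X) : (dltLeft F K X).comp (s2 F K x) = t3 x := by
  ext k; simp [dltLeft, s2_apply, t3, tone_def]

lemma dltRight_comp_s1 (x : X) : (dltRight F K X).comp (s1 F K x) = t1 x := by
  ext k; simp [dltRight, s1_apply, t1, tone_def]

lemma dltRight_comp_s2 (x : X) : (dltRight F K X).comp (s2 F K x) = t23 F K X x := by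
  ext k
  have h : dltRight F K X (s2 F K x k) = incl23 F K X (dlt F K X (sing x k)) := by
    simp [dltRight, s2_apply, incl23]
  rw [comp_apply, h, dlt_sing_eq_rr, map_cmul, ← toLinearMap_apply (t23 F K X x), t23_toLinearMap]
  rfl

lemma dlt_coassoc (z : Ten F K X) : dltLeft F K X (dlt F K X z) = dltRight F K X (dlt F K X z) := by
  have : (dltLeft F K X).comp (dlt F K X) = (dltRight F K X).comp (dlt F K X) := by
    refine ten_algHom_ext (fun x k => ?_)
    simp only [comp_apply, dlt_sing_eq_rr, map_cmul]
    have e1 : (dltLeft F K X).toLinearMap.comp (s1 F K x).toLinearMap =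
      cmul (t1 x).toLinearMap (t2 x).toLinearMap := by
      rw [← t12_toLinearMap, ← dltLeft_comp_s1]; rfl
    have e2 : (dltRight F K X).toLinearMap.comp (s2 F K x).toLinearMap =
      cmul (t2 x).toLinearMap (t3 x).toLinearMap := by
      rw [← t23_toLinearMap, ← dltRight_comp_s2]; rfl
    have e3 : (dltLeft F K X).toLinearMap.comp (s2 F K x).toLinearMap = (t3 x).toLinearMap := by
      rw [← dltLeft_comp_s2]; rfl
    have e4 : (dltRight F K X).toLinearMap.comp (s1 F K x).toLinearMap = (t1 x).toLinearMap := by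
      rw [← dltRight_comp_s1]; rfl
    rw [e1, e2, e3, e4]
    exact congr($(mul_assoc (toConv (t1 x).toLinearMap) (toConv (t2 x).toLinearMap)
      (toConv (t3 x).toLinearMap)) k)
  exact congr($this z)

lemma twist_cocycle {R : K ⊗[F] K} (hR : IsRMatrix R) (tw : X → Bool) :
    dltLeft F K X (twist R tw) * incl12 F K X (twist R tw) =
      dltRight F K X (twist R tw) * incl23 F K X (twist R tw) := by
  simp only [map_twist, dltLeft_comp_s1, dltLeft_comp_s2, dltRight_comp_s1, dltRight_comp_s2,
    incl12_comp_s1, incl12_comp_s2]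
  have hn := Finset.nodup_toList (Finset.univ : Finset X)
  have a12 := (across_t1_t2 (F := F) (K := K) (X := X)).commute
  have a13 := (across_t1_t3 (F := F) (K := K) (X := X)).commute
  have a23 := (across_t2_t3 (F := F) (K := K) (X := X)).commute
  have c1 := (slots_t1 (F := F) (K := K) (X := X)).commute
  have c2 := (slots_t2 (F := F) (K := K) (X := X)).commute
  have c3 := (slots_t3 (F := F) (K := K) (X := X)).commute
  rw [← list_prod_map_mul hn, ← list_prod_map_mul hn]
  · congr 1
    apply map_congr_left
    intro x _
    split
    · rw [t12_toLinearMap, t23_toLinearMap,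
        hR.rr_cmul_right (t3 x) _ _ (fun _ _ => a23 _ _ _ _) (fun _ _ => a12 _ _ _ _),
        mul_assoc, ← hR.rr_cmul_left _ _ (t1 x) (fun _ _ => (a12 _ _ _ _).symm)]
      refine mul_rr_left (fun k => ?_)
        (fun k => hR.exchange (t3 x) (t2 x) (fun _ _ => (a23 _ _ _ _).symm) k)
      exact (commute_rr (fun _ => a13 _ _ _ _) (fun _ => a12 _ _ _ _)).symm
    · rfl
  · intro x _ y _ hxy
    split
    · split
      · rw [t23_toLinearMap]
        apply commute_rr_rr
        · exact fun k k' => (commute_cmul (z := t3 y k') (φ := (t2 x).toLinearMap)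
            (fun k => (a23 x y k k').symm) (fun k => c3 y x hxy.symm k' k) k).symm
        · exact fun k k' => (commute_cmul (z := t2 y k') (φ := (t2 x).toLinearMap)
            (fun k => c2 y x hxy.symm k' k) (fun k => a23 y x k' k) k).symm
        · exact fun k k' => a13 x y k k'
        · exact fun k k' => a12 x y k k'
      · exact one_right _
    · exact one_left _
  · intro x _ y _ hxy
    split
    · split
      · rw [t12_toLinearMap]
        apply commute_rr_rr
        · exact fun k k' => (a23 y x k' k).symm
        · exact fun k k' => (a13 y x k' k).symm
        · exact fun k k' => (commute_cmul (z := t2 y k') (φ := (t1 x).toLinearMap)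
            (fun k => (a12 x y k k').symm) (fun k => c2 y x hxy.symm k' k) k).symm
        · exact fun k k' => (commute_cmul (z := t1 y k') (φ := (t1 x).toLinearMap)
            (fun k => c1 y x hxy.symm k' k) (fun k => a12 y x k' k) k).symm
      · exact one_right _
    · exact one_left _

end Coassoc

section Hat

/-- The comultiplication of the vertex neighbourhoods in the convention in which all edge ends are
incoming. -/
def hatComul (Γ : CilGraph V E) (R : K ⊗[F] K) (tw : E × Bool → Bool) :
    Ten F K (E × Bool) →ₗ[F] Ten2 F K (E × Bool) :=
  (mulRight F (twist R tw)).comp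
    ((mulLeft F (Γ.braid R)).comp (dlt F K (E × Bool)).toLinearMap)

lemma hatComul_apply (k : Ten F K (E × Bool)) :
    hatComul Γ R tw k = Γ.braid R * dlt F K (E × Bool) k * twist R tw := rfl

set_option synthInstance.maxHeartbeats 200000 in
lemma toTen3_assoc_rTensor (z : Ten2 F K (E × Bool)) :
    toTen3 F K _ (TensorProduct.assoc F _ _ _ ((hatComul Γ R tw).rTensor _ z)) =
      incl12 F K _ (Γ.braid R) * dltLeft F K _ z * incl12 F K _ (twist R tw) := by
  induction z using tind with
  | tmul x y =>
    rw [LinearMap.rTensor_tmul, hatComul_apply, ← assoc_tmul_one, ← assoc_tmul_one]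
    have : dltLeft F K _ (x ⊗ₜ[F] y) = toTen3 F K _ (Algebra.TensorProduct.assoc F F F
      (Ten F K (E × Bool)) (Ten F K (E × Bool)) (Ten F K (E × Bool)) (dlt F K _ x ⊗ₜ y)) := by
      simp [dltLeft]
    rw [this, ← map_mul, ← map_mul, ← map_mul, ← map_mul, tmul_mul_tmul,
      tmul_mul_tmul, one_mul, mul_one]
    rfl
  | _ => simp_all [LinearMap.map_zero, LinearEquiv.map_zero, mul_zero, zero_mul, LinearMap.map_add, LinearEquiv.map_add, mul_add, add_mul]

lemma toTen3_lTensor (z : Ten2 F K (E × Bool)) :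
    toTen3 F K _ ((hatComul Γ R tw).lTensor _ z) =
      incl23 F K _ (Γ.braid R) * dltRight F K _ z * incl23 F K _ (twist R tw) := by
  induction z using tind with
  | tmul x y =>
    rw [LinearMap.lTensor_tmul, hatComul_apply]
    have : dltRight F K _ (x ⊗ₜ[F] y) = toTen3 F K _ (x ⊗ₜ dlt F K _ y) := by simp [dltRight]
    rw [this, incl23, comp_apply, comp_apply, ← map_mul, ← map_mul,
      Algebra.TensorProduct.includeRight_apply, Algebra.TensorProduct.includeRight_apply,
      tmul_mul_tmul, tmul_mul_tmul, one_mul, mul_one]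
  | _ => simp_all [mul_zero, zero_mul, LinearMap.map_add, mul_add, add_mul]

lemma braid_cocycle (hR : IsRMatrix R) :
    incl12 F K _ (Γ.braid R) * dltLeft F K _ (Γ.braid R) =
      incl23 F K _ (Γ.braid R) * dltRight F K _ (Γ.braid R) := by
  have hL := Γ.isOrder_order
  simp only [Γ.braid_eq_braidL R hL, map_braidL, dltLeft_comp_s1, dltLeft_comp_s2, dltRight_comp_s1,
    dltRight_comp_s2, incl12_comp_s1, incl12_comp_s2]
  exact braidL_cocycle hR slots_t1 slots_t2 slots_t3 across_t1_t2 across_t1_t3 across_t2_t3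
    across_t12_t3 across_t1_t23 hL.nodup

lemma hatComul_coassoc (hR : IsRMatrix R) (k : Ten F K (E × Bool)) :
    TensorProduct.assoc F _ _ _ ((hatComul Γ R tw).rTensor _ (hatComul Γ R tw k)) =
      (hatComul Γ R tw).lTensor _ (hatComul Γ R tw k) := by
  apply toTen3_injective
  rw [toTen3_assoc_rTensor, toTen3_lTensor, hatComul_apply, map_mul, map_mul, map_mul, map_mul]
  calc _ = (incl12 F K _ (Γ.braid R) * dltLeft F K _ (Γ.braid R)) * dltLeft F K _ (dlt F K _ k) *
        (dltLeft F K _ (twist R tw) * incl12 F K _ (twist R tw)) := by simp only [mul_assoc]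
    _ = _ := by rw [braid_cocycle hR, twist_cocycle hR, dlt_coassoc]; simp only [mul_assoc]

lemma lam_braid_eq_one (f g : Ten F K (E × Bool) →ₐ[F] B) (h : CommImg f g)
    (h1 : ∀ j i, Γ.Lt j i →
      rr R (g.comp (sing j)).toLinearMap (f.comp (sing i)).toLinearMap = 1) :
    lam f g h (Γ.braid R) = 1 := by
  rw [Γ.braid_eq_braidL R Γ.isOrder_order, map_braidL]
  apply braidL_eq_one
  intro j i hji hb
  rw [lam_comp_s1, lam_comp_s2]
  exact h1 _ _ (Γ.isOrder_order.lt_iff.2 ⟨hji, hb⟩)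

lemma lam_braid_eq_single (f g : Ten F K (E × Bool) →ₐ[F] B) (h : CommImg f g)
    {j i : E × Bool} (hji : Γ.Lt j i)
    (h1 : ∀ j' i', j' ≠ j ∨ i' ≠ i →
      rr R (g.comp (sing j')).toLinearMap (f.comp (sing i')).toLinearMap = 1) :
    lam f g h (Γ.braid R) =
      rr R (g.comp (sing j)).toLinearMap (f.comp (sing i)).toLinearMap := by
  rw [Γ.braid_eq_braidL R Γ.isOrder_order, map_braidL, braidL_eq_single Γ.isOrder_order.nodup
    (Γ.isOrder_order.lt_iff.1 hji).1 (Γ.isOrder_order.lt_iff.1 hji).2]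
  · rw [lam_comp_s1, lam_comp_s2]
  · simp_all [lam_comp_s1, lam_comp_s2]

lemma rr_eq_one_left (hR : IsRMatrix R) {φ ψ : K →ₐ[F] B} (h : φ = epsAlg) :
    rr R φ.toLinearMap ψ.toLinearMap = 1 := by rw [h]; exact hR.rr_eps_left _

lemma rr_eq_one_right (hR : IsRMatrix R) {φ ψ : K →ₐ[F] B} (h : ψ = epsAlg) :
    rr R φ.toLinearMap ψ.toLinearMap = 1 := by rw [h]; exact hR.rr_eps_right _

lemma comp_epsAlg (f : B →ₐ[F] B') : f.comp (epsAlg : K →ₐ[F] B) = epsAlg := by ext k; simp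

lemma epsT_comp_sing (x : X) :
    (epsT : Ten F K X →ₐ[F] F).comp (sing x) = epsAlg := by
  ext k; simp

lemma co_comp_sing_self (x : X) :
    (co x : Ten F K X →ₐ[F] K).comp (sing x) = AlgHom.id F K := by
  ext k; simp

lemma co_comp_sing_ne {x y : X} (h : y ≠ x) :
    (co x : Ten F K X →ₐ[F] K).comp (sing y) = epsAlg := by
  ext k; simp [co_sing_ne h]

lemma pj_comp_sing_of_notMem {l : List X} {x : X} (h : x ∉ l) : (pj l : Ten F K X →ₐ[F] _).comp (sing x) = epsAlg := by
  ext k; simp [pj_sing_of_notMem h]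

/-- `ε ⊗ id`. -/
lemma rTensor_epsT_hatComul (hR : IsRMatrix R) (k : Ten F K (E × Bool)) :
    (epsT : Ten F K (E × Bool) →ₐ[F] F).toLinearMap.rTensor _ (hatComul Γ R tw k) =
      1 ⊗ₜ[F] k := by
  let f : Ten F K (E × Bool) →ₐ[F] Ten F K (E × Bool) := (Algebra.ofId F _).comp epsT
  have hc : CommImg f (AlgHom.id F (Ten F K (E × Bool))) := ⟨fun x y =>
    show Commute (algebraMap F _ (epsT x)) y from Algebra.commutes _ _⟩
  have hf : ∀ x, f.comp (sing x) = epsAlg := fun x => by aesop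
  have h1 : ∀ z, tlid F _ ((epsT : Ten F K (E × Bool) →ₐ[F] F).toLinearMap.rTensor _ z)
      = lam f (AlgHom.id F _) hc z := by
    intro z
    induction z using tind <;> simp_all [f, Algebra.ofId_apply, Algebra.smul_def]
  apply (tlid F (Ten F K (E × Bool))).injective
  rw [h1, hatComul_apply, map_mul, map_mul, lam_braid_eq_one, lam_twist_eq_one, one_mul, mul_one,
    TensorProduct.lid_tmul, one_smul]
  · have : (lam f (AlgHom.id F _) hc).comp (dlt F K (E × Bool)) =
        AlgHom.id F _ := by
      refine ten_algHom_ext (fun x k => ?_)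
      rw [comp_apply, lam_dlt_sing, hf, epsAlg_toLinearMap, epsOne_cmul]; rfl
    exact congr($this k)
  · intro x _
    exact rr_eq_one_right hR (hf x)
  · intro _ x _
    exact rr_eq_one_right hR (hf x)

lemma lTensor_epsT_hatComul (hR : IsRMatrix R) (k : Ten F K (E × Bool)) :
    (epsT : Ten F K (E × Bool) →ₐ[F] F).toLinearMap.lTensor _ (hatComul Γ R tw k) =
      k ⊗ₜ[F] 1 := by
  let f : Ten F K (E × Bool) →ₐ[F] Ten F K (E × Bool) := (Algebra.ofId F _).comp epsT
  have hc : CommImg (AlgHom.id F (Ten F K (E × Bool))) f := ⟨fun x y =>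
    show Commute x (algebraMap F _ (epsT y)) from (Algebra.commutes _ _).symm⟩
  have hf : ∀ x, f.comp (sing x) = epsAlg := fun x => by aesop
  have h1 : ∀ z, trid F _ ((epsT : Ten F K (E × Bool) →ₐ[F] F).toLinearMap.lTensor _ z)
      = lam (AlgHom.id F _) f hc z := by
    intro z
    induction z using tind <;> simp_all [f, Algebra.ofId_apply, Algebra.smul_def, Algebra.commutes]
  apply (trid F (Ten F K (E × Bool))).injective
  rw [h1, hatComul_apply, map_mul, map_mul, lam_braid_eq_one, lam_twist_eq_one, one_mul, mul_one,
    TensorProduct.rid_tmul, one_smul]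
  · have : (lam (AlgHom.id F _) f hc).comp (dlt F K (E × Bool)) =
        AlgHom.id F _ := by
      refine ten_algHom_ext (fun x k => ?_)
      rw [comp_apply, lam_dlt_sing, hf, epsAlg_toLinearMap, cmul_epsOne]; rfl
    exact congr($this k)
  · intro x _
    exact rr_eq_one_left hR (hf x)
  · intro j _ _
    exact rr_eq_one_left hR (hf j)

/-- The coalgebra of the vertex neighbourhoods. -/
def Hat (_ : CilGraph V E) {R : K ⊗[F] K} (_ : IsRMatrix R) (_ : E × Bool → Bool) : Type _ :=
  Ten F K (E × Bool)

instance (Γ : CilGraph V E) {R : K ⊗[F] K} (hR : IsRMatrix R) (tw : E × Bool → Bool) :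
    AddCommGroup (Hat Γ hR tw) := inferInstanceAs (AddCommGroup (Ten F K (E × Bool)))

instance (Γ : CilGraph V E) {R : K ⊗[F] K} (hR : IsRMatrix R) (tw : E × Bool → Bool) :
    Module F (Hat Γ hR tw) := inferInstanceAs (Module F (Ten F K (E × Bool)))

instance (Γ : CilGraph V E) {R : K ⊗[F] K} (hR : IsRMatrix R) (tw : E × Bool → Bool) :
    Coalgebra F (Hat Γ hR tw) where
  comul := hatComul Γ R tw
  counit := (epsT : Ten F K (E × Bool) →ₐ[F] F).toLinearMap
  coassoc := lext (hatComul_coassoc hR)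
  rTensor_counit_comp_comul := lext (rTensor_epsT_hatComul hR)
  lTensor_counit_comp_comul := lext (lTensor_epsT_hatComul hR)

end Hat

section Relations

/-- Maps from a coalgebra to `K`, indexed by the edge ends of a graph, that satisfy the dual
of the relations of the algebra of the vertex neighbourhoods. -/
structure VertexRel (Γ : CilGraph V E) (R : K ⊗[F] K) (tw : E × Bool → Bool)
    (Z : E × Bool → Cv F C K) : Prop where
  self : ∀ x, pc inl (Z x) * pc inr (Z x) =
    pc (comulAlgHom F K) (Z x) * cst (if tw x then flip R else 1)
  exch : ∀ j i, Γ.Lt j i →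
    pc inr (Z i) * pc inl (Z j) = cst R * pc inl (Z j) * pc inr (Z i)
  comm : ∀ j i, Γ.base j ≠ Γ.base i → Commute (pc inl (Z j)) (pc inr (Z i))
  counit : ∀ x, pc (counitAlgHom F K) (Z x) = 1

lemma pc_epsAlg {f : Cv F C K} (h : pc (counitAlgHom F K) f = 1) :
    pc (epsAlg : K →ₐ[F] B) f = 1 := by
  have : pc (Algebra.ofId F B) (pc (counitAlgHom F K) f) = 1 := by rw [h, map_one]
  exact this

section FromRel

variable {Z : E × Bool → Cv F C K}

/-- The map to `K^{⊗2E}` with components `Zₓ`. -/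
def combine (Γ : CilGraph V E) (Z : E × Bool → Cv F C K) : Cv F C (Ten F K (E × Bool)) :=
  (Γ.order.map (fun x => pc (sing x) (Z x))).prod

lemma pc_combine (f : Ten F K (E × Bool) →ₐ[F] B) :
    pc f (combine Γ Z) = (Γ.order.map (fun x => pc (f.comp (sing x)) (Z x))).prod := by
  rw [combine, map_list_prod, map_map]; rfl

lemma VertexRel.pc_co_combine (hZ : VertexRel Γ R tw Z) (x : E × Bool) :
    pc (co x) (combine Γ Z) = Z x := by
  rw [pc_combine, list_prod_map_eq_single Γ.isOrder_order.nodup _ (Γ.isOrder_order.mem x)]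
  · rw [co_comp_sing_self]; rfl
  · intro y _ hy
    rw [co_comp_sing_ne hy, pc_epsAlg (hZ.counit y)]

lemma VertexRel.pc_epsT_combine (hZ : VertexRel Γ R tw Z) :
    pc epsT (combine Γ Z) = 1 := by
  rw [pc_combine]
  apply prod_eq_one
  intro z hz
  obtain ⟨x, _, rfl⟩ := mem_map.1 hz
  rw [epsT_comp_sing, pc_epsAlg (hZ.counit x)]

lemma commute_pc_cst {φ : B →ₐ[F] B'} {f : Cv F C B} {b : B'} (h : ∀ k, Commute b (φ k)) :
    Commute (cst b) (pc φ f) := commute_cst (fun c => h (f c))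

/-- The embedding of `K ⊗ K` in the slots `x` and `y` of the two copies of `K^{⊗X}`. -/
def s12 (F K : Type*) [Field F] [Ring K] [HopfAlgebra F K] {X : Type*} [DecidableEq X] (x y : X) : K ⊗[F] K →ₐ[F] Ten2 F K X :=
  amap (sing x) (sing y)

lemma s12_comp_inl {X : Type*} [DecidableEq X] (x y : X) :
    (s12 F K x y).comp inl = s1 F K x := by
  ext k; simp [s12, s1_apply]

lemma s12_comp_inr {X : Type*} [DecidableEq X] (x y : X) :
    (s12 F K x y).comp inr = s2 F K y := by
  ext k; simp [s12, s2_apply]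

/-- The embedding of `K ⊗ K` in the slot `y` of the second and the slot `x` of the first copy. -/
def s21 (F K : Type*) [Field F] [Ring K] [HopfAlgebra F K] {X : Type*} [Fintype X] [DecidableEq X] (y x : X) : K ⊗[F] K →ₐ[F] Ten2 F K X :=
  alift (s2 F K y) (s1 F K x) (fun _ _ => (s1_s2_commute F _ _ _ _).symm)

lemma s21_comp_inl (x y : X) :
    (s21 F K y x).comp inl = s2 F K y := by
  ext k; simp [s21]

lemma s21_comp_inr (x y : X) :
    (s21 F K y x).comp inr = s1 F K x := by
  ext k; simp [s21]

lemma s21_apply (x y : X) (t : K ⊗[F] K) :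
    s21 F K y x t = rr t (s2 F K y).toLinearMap (s1 F K x).toLinearMap := by
  conv_lhs => rw [← rr_inl_inr t, map_rr]
  rw [← s21_comp_inl x y, ← s21_comp_inr x y]; rfl

lemma s12_apply (x y : X) (t : K ⊗[F] K) :
    s12 F K x y t = rr t (s1 F K x).toLinearMap (s2 F K y).toLinearMap := by
  conv_lhs => rw [← rr_inl_inr t, map_rr]
  rw [← s12_comp_inl x y, ← s12_comp_inr x y]; rfl

lemma s12_flip (x y : X) (t : K ⊗[F] K) :
    s12 F K x y (flip t) = s21 F K y x t := by
  rw [s12_apply, s21_apply, rr_flip _ _ _ (fun _ _ => s1_s2_commute F _ _ _ _)]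

/-- The maps with components `Zₓ` are homomorphisms of coalgebras. -/
lemma VertexRel.comul_combine (hZ : VertexRel Γ R tw Z) :
    pc inL (combine Γ Z) *
      pc inR (combine Γ Z) =
      toConv ((hatComul Γ R tw).comp (combine Γ Z).ofConv) := by
  have hL := Γ.isOrder_order
  have hrhs : toConv ((hatComul Γ R tw).comp (combine Γ Z).ofConv) =
      cst (Γ.braid R) * pc (dlt F K _) (combine Γ Z) * cst (twist R tw) := by
    ext c
    rw [mul_cst_apply, cst_mul_apply]; rfl
  rw [hrhs, pc_combine, pc_combine, pc_combine]
  let r : E × Bool → E × Bool → Cv F C (Ten2 F K (E × Bool)) := fun x h =>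
    cst (if Γ.base x = Γ.base h then rr R (s2 F K x).toLinearMap (s1 F K h).toLinearMap else 1)
  have hr : ((pairsOf Γ.order).map (fun z => r z.1 z.2)).prod =
      (cst (Γ.braid R) : Cv F C (Ten2 F K (E × Bool))) := by
    rw [Γ.braid_eq_braidL R hL, braidL, map_list_prod, map_map]; rfl
  have key := prod_mul_reorder (M := Cv F C (Ten2 F K (E × Bool))) (l := Γ.order)
    (p := fun x => pc (s1 F K x) (Z x)) (q := fun x => pc (s2 F K x) (Z x)) (r := r)
    (r' := fun _ _ => 1) hL.nodup ?_ ?_ (fun _ _ _ _ => one_left _) ?_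
    (fun _ _ _ _ => one_left _)
  · rw [hr] at key
    simp only [List.map_const', List.prod_replicate, one_pow, mul_one] at key
    refine key.trans ?_
    rw [mul_assoc]
    congr 1
    have hself : ∀ x, pc (s1 F K x) (Z x) * pc (s2 F K x) (Z x) =
        pc ((dlt F K _).comp (sing x)) (Z x) *
          cst (if tw x then rr R (s2 F K x).toLinearMap (s1 F K x).toLinearMap else 1) := by
      intro x
      have h := congrArg (pc (s12 F K x x)) (hZ.self x)
      rw [map_mul, map_mul, pc_pc, pc_pc, pc_pc, pc_cst, s12_comp_inl, s12_comp_inr] at h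
      rw [h]
      congr 1
      · congr 2
        ext k
        exact (dlt_sing x k).symm
      · grind [s12_flip, s21_apply, map_one]
    simp only [hself]
    have hn := hL.nodup
    rw [list_prod_map_mul hn]
    · congr 1
      have : twist R tw = (Γ.order.map (fun x => if tw x then
          rr R (s2 F K x).toLinearMap (s1 F K x).toLinearMap else 1)).prod := by
        rw [twist, list_prod_perm isFull_univ.nodup (isFull_univ.perm hL.isFull)]
        intro x _ y _ hxy
        split
        · split
          · exact commute_rr_rr (fun _ _ => s2_commute F hxy _ _)
              (fun _ _ => (s1_s2_commute F _ _ _ _).symm) (fun _ _ => s1_s2_commute F _ _ _ _)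
              (fun _ _ => s1_commute F hxy _ _)
          · exact one_right _
        · exact one_left _
      rw [this, map_list_prod, map_map]
      rfl
    · intro x _ y _ hxy
      refine (commute_pc_cst fun k => ?_).symm
      rw [comp_apply, dlt_sing_eq_rr]
      split
      · exact commute_cmul (fun k => (commute_rr (fun _ => s1_s2_commute F _ _ _ _)
          (fun _ => s1_commute F hxy _ _)).symm) (fun k => (commute_rr
          (fun _ => s2_commute F hxy _ _) (fun _ => (s1_s2_commute F _ _ _ _).symm)).symm) _
      · exact one_left _
  · have hcomm : ∀ x h, (¬ Γ.base x = Γ.base h) → pc (s1 F K h) (Z h) * pc (s2 F K x) (Z x) * 1 =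
        r x h * pc (s2 F K x) (Z x) * pc (s1 F K h) (Z h) := by
      intro x h hb
      have := congrArg (pc (s21 F K x h)) (hZ.comm x h hb).eq
      simp only [map_mul, pc_pc, s21_comp_inl, s21_comp_inr] at this
      simp only [r]
      rw [if_neg hb, map_one, one_mul, mul_one, this]
    have hpw : Γ.order.Pairwise (fun x h => Γ.base x = Γ.base h → Γ.Lt x h) := by
      rw [List.pairwise_iff_forall_sublist]
      intro x h hs hb
      exact hL.lt_iff.2 ⟨hs, hb⟩
    refine hpw.imp ?_
    intro x h hlt
    by_cases hb : Γ.base x = Γ.base h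
    · have := congrArg (pc (s21 F K x h)) (hZ.exch x h (hlt hb))
      simp only [map_mul, pc_pc, s21_comp_inl, s21_comp_inr, pc_cst, s21_apply] at this
      simp only [r]
      rw [if_pos hb, mul_one, this]
    · exact hcomm x h hb
  · intro x h y hy
    refine commute_pc_cst fun k => ?_
    split
    · exact (commute_rr (fun _ => s1_s2_commute F _ _ _ _)
        (fun _ => s1_commute F hy _ _)).symm
    · exact one_left _
  · intro x h y hy
    refine commute_pc_cst fun k => ?_
    split
    · exact (commute_rr (fun _ => s2_commute F hy _ _)
        (fun _ => (s1_s2_commute F _ _ _ _).symm)).symm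
    · exact one_left _

end FromRel

end Relations

/-! ### The relations between the coordinates -/

section Coordinates

variable (Γ) (hR : IsRMatrix R) (tw : E × Bool → Bool)

/-- A map on `K^{⊗2E}` as an element of the convolution algebra of the vertex neighbourhoods. -/
def ofT (f : Ten F K (E × Bool) →ₗ[F] B) : Cv F (Hat Γ hR tw) B := toConv f

/-- The coordinates. -/
def coY (x : E × Bool) : Cv F (Hat Γ hR tw) K := ofT Γ hR tw (co x).toLinearMap

lemma ofT_mul_apply (f g : Ten F K (E × Bool) →ₗ[F] B) (k : Ten F K (E × Bool)) :
    (ofT Γ hR tw f * ofT Γ hR tw g).ofConv k =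
      mul' F B (tmap f g (hatComul Γ R tw k)) := rfl

lemma ofT_mul_apply_algHom (f g : Ten F K (E × Bool) →ₐ[F] B)
    (h : CommImg f g) (k : Ten F K (E × Bool)) :
    (ofT Γ hR tw f.toLinearMap * ofT Γ hR tw g.toLinearMap).ofConv k =
      lam f g h (Γ.braid R) *
      lam f g h (dlt F K _ k) *
      lam f g h (twist R tw) := by
  rw [ofT_mul_apply, ← map_mul, ← map_mul, ← hatComul_apply, lam_apply]

lemma lam_twist_eq_single {tw : X → Bool} (f g : Ten F K X →ₐ[F] B) (h : CommImg f g) (x : X)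
    (h1 : ∀ y, y ≠ x → rr R (g.comp (sing y)).toLinearMap (f.comp (sing y)).toLinearMap = 1) :
    lam f g h (twist R tw) = if tw x then
      rr R (g.comp (sing x)).toLinearMap (f.comp (sing x)).toLinearMap else 1 := by
  rw [map_twist, list_prod_map_eq_single isFull_univ.nodup _ (isFull_univ.mem x)]
  · rw [lam_comp_s1, lam_comp_s2]
  · simp_all [lam_comp_s1, lam_comp_s2]

lemma inl_inr_commute (x y : K) : Commute ((inl : K →ₐ[F] K ⊗[F] K) x) (inr y) := by
  simp [Commute, SemiconjBy]

lemma rr_inr_inl (R : K ⊗[F] K) :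
    rr R (inr : K →ₐ[F] _).toLinearMap inl.toLinearMap = flip R := by
  rw [← rr_flip _ _ _ inl_inr_commute, rr_inl_inr]

lemma lam_co_dlt_comm {i j : X} (hne : i ≠ j)
    (h : CommImg ((inr : K →ₐ[F] K ⊗[F] K).comp (co i)) (inl.comp (co j)))
    (h' : CommImg ((inl : K →ₐ[F] K ⊗[F] K).comp (co j)) (inr.comp (co i))) (k : Ten F K X) :
    lam _ _ h (dlt F K X k) = lam _ _ h' (dlt F K X k) := by
  have : (lam _ _ h).comp (dlt F K X) = (lam _ _ h').comp (dlt F K X) := by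
    refine ten_algHom_ext (fun y k => ?_)
    rw [comp_apply, comp_apply, lam_dlt_sing, lam_dlt_sing, comp_assoc, comp_assoc]
    by_cases hy : y = i
    · simp_all [co_comp_sing_ne, comp_epsAlg, epsAlg_toLinearMap, cmul_epsOne, epsOne_cmul]
    · rw [co_comp_sing_ne hy, comp_epsAlg, epsAlg_toLinearMap, cmul_epsOne, epsOne_cmul]
  exact congr($this k)

lemma rr_comp_co_eq_one (hR : IsRMatrix R) {φ ψ : K →ₐ[F] B} {x x' y y' : X}
    (h : y ≠ x ∨ y' ≠ x') : rr R ((φ.comp (co x)).comp (sing y)).toLinearMap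
      ((ψ.comp (co x')).comp (sing y')).toLinearMap = 1 := by
  rcases h with h | h
  · exact rr_eq_one_left hR (by rw [comp_assoc, co_comp_sing_ne h, comp_epsAlg])
  · exact rr_eq_one_right hR (by rw [comp_assoc, co_comp_sing_ne h, comp_epsAlg])

lemma vertexRel_coY : VertexRel Γ R tw (coY Γ hR tw) where
  self x := by
    ext k
    have h := ofT_mul_apply_algHom Γ hR tw (inl.comp (co x)) (inr.comp (co x))
      ⟨fun _ _ => inl_inr_commute _ _⟩ k
    rw [mul_cst_apply]
    refine h.trans ?_
    rw [lam_braid_eq_one, lam_twist_eq_single _ _ _ x, one_mul]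
    · congr 1
      · have : (lam ((inl : K →ₐ[F] K ⊗[F] K).comp (co x))
            (inr.comp (co x)) ⟨fun _ _ => inl_inr_commute _ _⟩).comp (dlt F K (E × Bool)) =
            (comulAlgHom F K).comp (co x) := by
          refine ten_algHom_ext (fun y k => ?_)
          rw [comp_apply, lam_dlt_sing, comp_assoc, comp_assoc]
          by_cases hy : y = x
          · subst hy
            rw [co_comp_sing_self, comp_apply, co_sing_self, cmul_eq_rr]
            exact rr_inl_inr _
          · rw [co_comp_sing_ne hy, comp_epsAlg, comp_epsAlg, epsAlg_toLinearMap, cmul_epsOne,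
              comp_apply, co_sing_ne hy, AlgHom.commutes]
            rfl
        exact congr($this k)
      · rw [comp_assoc, comp_assoc, co_comp_sing_self]
        split
        · exact rr_inr_inl R
        · rfl
    · exact fun y hy => rr_comp_co_eq_one hR (Or.inl hy)
    · intro j i hji
      exact rr_comp_co_eq_one hR (by grind [CilGraph.lt_irrefl])
  exch j i hji := by
    have hne : j ≠ i := fun h => by rw [h] at hji; exact CilGraph.lt_irrefl _ hji
    ext k
    have h := ofT_mul_apply_algHom Γ hR tw (inr.comp (co i)) (inl.comp (co j))
      ⟨fun _ _ => (inl_inr_commute _ _).symm⟩ k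
    have h' := ofT_mul_apply_algHom Γ hR tw (inl.comp (co j)) (inr.comp (co i))
      ⟨fun _ _ => inl_inr_commute _ _⟩ k
    rw [mul_assoc, cst_mul_apply]
    refine h.trans (Eq.trans ?_ (congrArg (fun z => R * z) h').symm)
    rw [lam_twist_eq_one, mul_one, lam_twist_eq_one, mul_one]
    rotate_left
    · exact fun y _ => rr_comp_co_eq_one hR (by grind)
    · exact fun y _ => rr_comp_co_eq_one hR (by grind)
    rw [lam_braid_eq_single _ _ _ hji, lam_braid_eq_one, one_mul]
    rotate_left
    · intro j' i' hj'
      exact rr_comp_co_eq_one hR (by grind [CilGraph.lt_asymm])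
    · exact fun _ _ h => rr_comp_co_eq_one hR h
    rw [comp_assoc, comp_assoc, co_comp_sing_self, co_comp_sing_self]
    congr 1
    · exact rr_inl_inr R
    · exact lam_co_dlt_comm hne.symm _ _ k
  comm j i hb := by
    have hne : j ≠ i := fun h => hb (by rw [h])
    ext k
    have h := ofT_mul_apply_algHom Γ hR tw (inr.comp (co i)) (inl.comp (co j))
      ⟨fun _ _ => (inl_inr_commute _ _).symm⟩ k
    have h' := ofT_mul_apply_algHom Γ hR tw (inl.comp (co j)) (inr.comp (co i))
      ⟨fun _ _ => inl_inr_commute _ _⟩ k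
    refine h'.trans (Eq.trans ?_ h.symm)
    rw [lam_twist_eq_one, mul_one, lam_twist_eq_one, mul_one, lam_braid_eq_one, one_mul,
      lam_braid_eq_one, one_mul]
    · exact (lam_co_dlt_comm hne.symm _ _ k).symm
    · intro j' i' hj'
      exact rr_comp_co_eq_one hR (by grind [CilGraph.base_eq_of_lt])
    · intro j' i' hj'
      exact rr_comp_co_eq_one hR (by grind [CilGraph.base_eq_of_lt])
    · exact fun y _ => rr_comp_co_eq_one hR (by grind)
    · exact fun y _ => rr_comp_co_eq_one hR (by grind)
  counit x := by
    have : (counitAlgHom F K).comp (co x) = (epsT : Ten F K (E × Bool) →ₐ[F] F) := by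
      refine ten_algHom_ext (fun y k => ?_)
      rw [comp_apply, co_sing, epsT_sing]
      split
      · rfl
      · simp
    ext k
    exact congr($this k)

end Coordinates

section Ordered

/-- All indices other than `x`. -/
def others (x : X) : List X := (Finset.univ.erase x).toList

lemma mem_others {x y : X} : y ∈ others x ↔ y ≠ x := by simp [others]

lemma ten_induction_at (x : X) {P : Ten F K X → Prop} (add : ∀ z w, P z → P w → P (z + w))
    (mk : ∀ k z, P (sing x k * pj (others x) z)) (z : Ten F K X) : P z := by
  induction z using pind with
  | smul_tprod r m =>
    have h : r • (ptprod F m : Ten F K X) = sing x (m x) * pj (others x)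
        (r • ptprod F (Function.update m x 1)) := by
      rw [map_smul, mul_smul_comm, pj_tprod, sing_eq_tprod, tprod_mul_tprod]
      congr 2
      funext y
      by_cases hy : y = x
      · subst hy; simp [mem_others]
      · simp [mem_others, hy]
    rw [h]
    exact mk _ _
  | _ => simp_all

lemma pj_sing_mul_pj {x : X} {l : List X} (hx : x ∉ l) (k : K) (z : Ten F K X) :
    pj (x :: l) (sing x k * pj (others x) z) = sing x k * pj l (pj (others x) z) := by
  rw [map_mul, pj_sing_of_mem mem_cons_self]
  congr 1
  have : (pj (x :: l)).comp (pj (others x)) = ((pj l).comp (pj (others x)) :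
      Ten F K X →ₐ[F] Ten F K X) := by
    refine ten_algHom_ext (fun y k => ?_)
    by_cases hy : y = x
    · rw [comp_apply, comp_apply, pj_sing_of_notMem (by simp [mem_others, hy]),
        AlgHom.commutes, AlgHom.commutes]
    · rw [comp_apply, comp_apply, pj_sing_of_mem (by simp [mem_others, hy])]
      by_cases hl : y ∈ l
      · simp_all [pj_sing_of_mem]
      · simp_all [pj_sing_of_notMem]
  exact congr($this z)

lemma commImg_tensor (f : Ten F K X →ₐ[F] B) (g : Ten F K X →ₐ[F] B') :
    CommImg ((inL : B →ₐ[F] B ⊗[F] B').comp f)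
      ((inR : B' →ₐ[F] B ⊗[F] B').comp g) :=
  ⟨fun _ _ => tmul_commute (one_right _) (one_left _)⟩

lemma lam_tensor (f : Ten F K X →ₐ[F] B) (g : Ten F K X →ₐ[F] B') (z : Ten2 F K X) :
    lam _ _ (commImg_tensor f g) z = tmap f.toLinearMap g.toLinearMap z := by
  induction z using tind <;> simp_all

lemma map_co_pj_dlt {x : X} {l : List X} (hx : x ∉ l) (k : K) (z : Ten F K X) :
    tmap (co x).toLinearMap (pj l).toLinearMap
      (dlt F K X (sing x k * pj (others x) z)) = k ⊗ₜ pj l (pj (others x) z) := by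
  have h1 : (lam _ _ (commImg_tensor (co x) (pj l))).comp ((dlt F K X).comp (pj (others x))) =
      inR.comp ((pj l).comp (pj (others x)) :
        Ten F K X →ₐ[F] Ten F K X) := by
    refine ten_algHom_ext (fun y k => ?_)
    simp only [comp_apply]
    by_cases hy : y = x
    · rw [pj_sing_of_notMem (by simp [mem_others, hy])]
      simp
    · rw [pj_sing_of_mem (by simp [mem_others, hy]), lam_dlt_sing, comp_assoc,
        co_comp_sing_ne hy, comp_epsAlg, epsAlg_toLinearMap, epsOne_cmul]
      rfl
  have h2 : lam _ _ (commImg_tensor (co x) (pj l)) (dlt F K X (sing x k)) = k ⊗ₜ 1 := by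
    simp_all [lam_dlt_sing, comp_assoc, co_comp_sing_self, pj_comp_sing_of_notMem, comp_epsAlg, epsAlg_toLinearMap, cmul_epsOne]
  rw [← lam_tensor, map_mul, map_mul, h2]
  rw [show lam _ _ (commImg_tensor (co x) (pj l)) (dlt F K X (pj (others x) z)) = _ from
    congr($h1 z)]
  simp

/-- The functional `β₁(k_{x₁}) ⋯ βₙ(k_{xₙ})` on tensor powers. -/
lemma mul_prodLift_resFam_dlt (β : X → K →ₗ[F] F) {x : X} {l : List X} (hx : x ∉ l)
    (z : Ten F K X) :
    mul' F F (tmap (β x) (prodLift (resFam β l))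
      (tmap (co x).toLinearMap (pj l).toLinearMap (dlt F K X z))) =
      prodLift (resFam β (x :: l)) z := by
  have hβ : ∀ x y, x ≠ y → ∀ a b, Commute (β x a) (β y b) := fun _ _ _ _ _ => Commute.all _ _
  induction z using ten_induction_at x with
  | mk k z =>
    rw [map_co_pj_dlt hx, ← prodLift_resFam_pj hβ (x :: l), pj_sing_mul_pj hx,
      prodLift_resFam_sing_mul hβ hx]
    simp
  | _ => simp_all

variable (Γ) (hR : IsRMatrix R) (tw : E × Bool → Bool)

/-- Ordered products of elements at single edge ends are tensor products. -/
lemma prod_coY (β : E × Bool → K →ₗ[F] F) {l : List (E × Bool)} (hl : l.Nodup)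
    (ho : l.Pairwise (fun x y => Γ.base x ≠ Γ.base y ∨ Γ.Lt x y)) :
    (l.map (fun x => ofT Γ hR tw ((β x).comp (co x).toLinearMap))).prod =
      ofT Γ hR tw (prodLift (resFam β l)) := by
  have hβ : ∀ x y, x ≠ y → ∀ a b, Commute (β x a) (β y b) := fun _ _ _ _ _ => Commute.all _ _
  induction l with
  | nil =>
    ext k
    exact (prodLift_resFam_nil β k).symm
  | cons x l ih =>
    rw [nodup_cons] at hl
    rw [List.pairwise_cons] at ho
    rw [map_cons, prod_cons, ih hl.2 ho.2]
    ext k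
    refine (ofT_mul_apply Γ hR tw _ _ k).trans ?_
    have hg : prodLift (resFam β l) = (prodLift (resFam β l)).comp (pj l).toLinearMap :=
      lext (fun z => (prodLift_resFam_pj hβ l z).symm)
    rw [hg, tmap_comp]
    change mul' F F (tmap (β x) (prodLift (resFam β l))
      (tmap (co x).toLinearMap (pj l).toLinearMap (hatComul Γ R tw k))) = _
    have h1 : ∀ k : Ten F K (E × Bool),
        tmap (co x).toLinearMap (pj l).toLinearMap (hatComul Γ R tw k) =
        tmap (co x).toLinearMap (pj l).toLinearMap (dlt F K _ k) := by
      intro k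
      rw [← lam_tensor, ← lam_tensor, hatComul_apply, map_mul, map_mul, lam_braid_eq_one,
        lam_twist_eq_one, one_mul, mul_one]
      · intro y _
        by_cases hy : y = x
        · exact rr_eq_one_left hR
            (by rw [comp_assoc, pj_comp_sing_of_notMem (by rw [hy]; exact hl.1), comp_epsAlg])
        · exact rr_eq_one_right hR (by rw [comp_assoc, co_comp_sing_ne hy, comp_epsAlg])
      · intro j i hji
        by_cases hi : i = x
        · refine rr_eq_one_left hR ?_
          rw [comp_assoc, pj_comp_sing_of_notMem, comp_epsAlg]
          grind [CilGraph.base_eq_of_lt, CilGraph.lt_asymm]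
        · exact rr_eq_one_right hR (by rw [comp_assoc, co_comp_sing_ne hi, comp_epsAlg])
    exact (congrArg _ (congrArg _ (h1 k))).trans (mul_prodLift_resFam_dlt β hl.1 k)

end Ordered

section MapTen

lemma map_sing_mul_pj {f : X → K →ₗ[F] K} {x : X} {l : List X} (hx : x ∉ l)
    (h1 : ∀ x, f x 1 = 1) (k : K) (z : Ten F K X) :
    pmap f (sing x k * pj l z) = sing x (f x k) * pmap f (pj l z) := by
  induction z using pind with
  | smul_tprod r m =>
    simp only [map_smul, mul_smul_comm]
    congr 1
    rw [pj_tprod, sing_eq_tprod, sing_eq_tprod, tprod_mul_tprod,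
      map_tprod, map_tprod, tprod_mul_tprod]
    congr 1
    funext y
    by_cases hy : y = x
    · simp_all [algebraMap_eq_smul_one]
    · simp [hy]
  | _ => simp_all [mul_add]

lemma co_map {f : X → K →ₗ[F] K} (h1 : ∀ x, f x 1 = 1)
    (hε : ∀ x k, counit (R := F) (f x k) = counit (R := F) k) (x : X) (z : Ten F K X) :
    co x (pmap f z) = f x (co x z) := by
  have hco : ∀ z : Ten F K X, co x (pj (others x) z) = algebraMap F K (epsT z) := by
    intro z
    have : (co x).comp (pj (others x)) = ((Algebra.ofId F K).comp epsT : Ten F K X →ₐ[F] K) := by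
      refine ten_algHom_ext (fun y k => ?_)
      by_cases hy : y = x
      · rw [comp_apply, pj_sing_of_notMem (by simp [mem_others, hy])]
        simp [Algebra.ofId_apply]
      · rw [comp_apply, pj_sing_of_mem (by simp [mem_others, hy]), co_sing_ne hy]
        simp [Algebra.ofId_apply]
    exact congr($this z)
  have hf : ∀ z : Ten F K X, pmap f (pj (others x) z) =
      pj (others x) (pmap f z) := by
    intro z
    induction z using pind with
    | smul_tprod r m =>
      simp only [map_smul]
      congr 1
      rw [map_tprod, pj_tprod, pj_tprod, map_tprod]
      congr 1
      funext y
      split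
      · rfl
      · rw [hε, algebraMap_eq_smul_one, map_smul, h1]
    | _ => simp_all
  have hε' : ∀ z : Ten F K X, epsT (pmap f z) = epsT z := by
    intro z
    induction z using pind with
    | smul_tprod r m =>
      simp only [map_smul]
      congr 1
      rw [map_tprod, tprod_eq_prod isFull_univ, tprod_eq_prod isFull_univ,
        map_list_prod, map_list_prod, map_map, map_map]
      congr 2
      funext y
      simp [hε]
    | _ => simp_all
  induction z using ten_induction_at x with
  | mk k z =>
    rw [map_sing_mul_pj (by simp [mem_others]) h1, hf, map_mul, map_mul, hco, hco, co_sing_self,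
      co_sing_self, hε', ← Algebra.commutes, ← Algebra.commutes, ← Algebra.smul_def,
      ← Algebra.smul_def, map_smul]
  | _ => simp_all

lemma map_map_prod_s12 {f : X → K →ₗ[F] K} (h1 : ∀ x, f x 1 = 1) {l : List X} (hl : l.Nodup)
    (w : X → K ⊗[F] K) :
    tmap (pmap f) (pmap f)
      (l.map (fun x => s12 F K x x (w x))).prod =
      (l.map (fun x => s12 F K x x (tmap (f x) (f x) (w x)))).prod := by
  induction l with
  | nil =>
    simp only [List.map_nil, List.prod_nil, tone_def, tmap_tmul]
    have : pmap f (1 : Ten F K X) = 1 := by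
      rw [PiTensorProduct.one_def, map_tprod]
      congr 1
      funext x
      exact h1 x
    rw [this]
  | cons x l ih =>
    rw [nodup_cons] at hl
    rw [map_cons, prod_cons, map_cons, prod_cons, ← ih hl.2]
    have hpj : ∀ z : Ten2 F K X, ∀ t : K ⊗[F] K,
        tmap (pmap f) (pmap f)
        (s12 F K x x t * amap (pj l) (pj l) z) =
        s12 F K x x (tmap (f x) (f x) t) *
        tmap (pmap f) (pmap f)
          (amap (pj l) (pj l) z) := by
      intro z t
      induction z using tind with
      | tmul u v =>
        induction t with
        | zero => simp
        | add a b ha hb => simp only [map_add, add_mul, ha, hb]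
        | tmul a b => simp only [s12, amap_tmul, tmul_mul_tmul, tmap_tmul, map_sing_mul_pj hl.1 h1]
      | _ => simp_all [mul_add]
    have hz : (l.map (fun x => s12 F K x x (w x))).prod =
        amap (pj l) (pj l) (l.map (fun x => s12 F K x x (w x))).prod := by
      rw [map_list_prod, map_map]
      congr 1
      apply map_congr_left
      intro y hy
      have : (amap (pj l) (pj l)).comp (s12 F K y y) = s12 F K y y := by
        ext k
        · simp [s12, pj_sing_of_mem hy]
        · simp [s12, pj_sing_of_mem hy]
      exact congr($this.symm (w y))
    rw [hz, hpj]

lemma splitTen_tprod (δ : X → K →ₗ[F] K ⊗[F] K) (m : X → K) {l : List X} (hl : IsFull l) :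
    splitTen δ (ptprod F m) = (l.map (fun x => s12 F K x x (δ x (m x)))).prod := by
  rw [splitTen, prodLift_tprod hl]
  · rfl
  · intro x y hxy a b
    change Commute (s12 F K x x (δ x a)) (s12 F K y y (δ y b))
    rw [s12_apply, s12_apply]
    exact commute_rr_rr (fun _ _ => s1_commute F hxy _ _) (fun _ _ => s1_s2_commute F _ _ _ _)
      (fun _ _ => (s1_s2_commute F _ _ _ _).symm) (fun _ _ => s2_commute F hxy _ _)

lemma s12_commute {x y : X} (hxy : x ≠ y) (t u : K ⊗[F] K) :
    Commute (s12 F K x x t) (s12 F K y y u) := by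
  rw [s12_apply, s12_apply]
  exact commute_rr_rr (fun _ _ => s1_commute F hxy _ _) (fun _ _ => s1_s2_commute F _ _ _ _)
    (fun _ _ => (s1_s2_commute F _ _ _ _).symm) (fun _ _ => s2_commute F hxy _ _)

end MapTen

section Normalize

variable (F K) in
/-- The inverse of the antipode at outgoing edge ends. -/
def endN (b : Bool) : K →ₗ[F] K := if b then lid else antipodeInv F K

variable (F K) in
/-- The antipode at outgoing edge ends. -/
def endS (b : Bool) : K →ₗ[F] K := if b then lid else apd F (A := K)

variable (F K E) in
/-- The inverse of the antipode in the tensor factors of all outgoing edge ends. -/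
def tenN : Ten F K (E × Bool) →ₗ[F] Ten F K (E × Bool) :=
  pmap (fun h => endN F K h.2)

variable (F K E) in
/-- The antipode in the tensor factors of all outgoing edge ends. -/
def tenS : Ten F K (E × Bool) →ₗ[F] Ten F K (E × Bool) :=
  pmap (fun h => endS F K h.2)

namespace RibbonData

lemma endN_endS (hd : RibbonData R ν) (b : Bool) (k : K) : endN F K b (endS F K b k) = k := by
  cases b
  · exact hd.antipodeInv_antipode k
  · rfl

lemma endS_endN (hd : RibbonData R ν) (b : Bool) (k : K) : endS F K b (endN F K b k) = k := by
  cases b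
  · exact hd.antipode_antipodeInv k
  · rfl

lemma endN_one (hd : RibbonData R ν) (b : Bool) : endN F K b 1 = 1 := by
  cases b
  · exact hd.antipodeInv_one
  · rfl

lemma counit_endN (hd : RibbonData R ν) (b : Bool) (k : K) :
    counit (R := F) (endN F K b k) = counit (R := F) k := by
  cases b
  · exact hd.counit_antipodeInv k
  · rfl

lemma tenN_tenS (hd : RibbonData R ν) (z : Ten F K (E × Bool)) :
    tenN F K E (tenS F K E z) = z := by
  rw [tenN, tenS, ← lcomp_apply, ← PiTensorProduct.map_comp]
  have : (fun h : E × Bool => (endN F K h.2).comp (endS F K h.2)) = fun _ => lid :=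
    funext (fun h => lext (hd.endN_endS h.2))
  rw [this, PiTensorProduct.map_id]; rfl

lemma tenS_tenN (hd : RibbonData R ν) (z : Ten F K (E × Bool)) :
    tenS F K E (tenN F K E z) = z := by
  rw [tenN, tenS, ← lcomp_apply, ← PiTensorProduct.map_comp]
  have : (fun h : E × Bool => (endS F K h.2).comp (endN F K h.2)) = fun _ => lid :=
    funext (fun h => lext (hd.endS_endN h.2))
  rw [this, PiTensorProduct.map_id]; rfl

lemma tenN_act (hd : RibbonData R ν) (y k : Ten F K (E × Bool)) :
    tenN F K E (act y k) = y * tenN F K E k := by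
  induction y using pind with
  | smul_tprod r m =>
    simp only [map_smul, LinearMap.smul_apply, smul_mul_assoc]
    congr 1
    induction k using pind with
    | add a b ha hb => simp only [map_add, mul_add, ha, hb]
    | smul_tprod r n =>
      simp only [map_smul, mul_smul_comm]
      congr 1
      rw [act, PiTensorProduct.map₂_tprod_tprod, tenN, map_tprod, map_tprod, tprod_mul_tprod]
      congr 1
      funext h
      obtain ⟨e, b⟩ := h
      cases b
      · simp [endN, hd.antipodeInv_mul, hd.antipodeInv_antipode]
      · simp [endN]
  | _ => simp_all [ladd, add_mul]

lemma flip_mul_flip_comul (hd : RibbonData R ν) (k : K) :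
    flip R * flip (comul (R := F) k) = comul (R := F) k * flip R := by
  rw [← flip_mul, hd.rMat.mul_comul, flip_mul, flip_flip]

lemma map_endN_endComul (hd : RibbonData R ν) (t b : Bool) (k : K) :
    tmap (endN F K b) (endN F K b) (endComul R t b k) =
      comul (R := F) (endN F K b k) * (if t then flip R else 1) := by
  cases b
  · have hm : ∀ s u : K ⊗[F] K, tmap (antipodeInv F K) (antipodeInv F K) (s * u) =
        tmap (antipodeInv F K) (antipodeInv F K) u *
        tmap (antipodeInv F K) (antipodeInv F K) s := by
      intro s u
      induction s with
      | tmul a b =>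
        induction u with
        | zero => simp
        | add a b ha hb => simp only [add_mul, mul_add, map_add, ha, hb]
        | tmul c d => simp [hd.antipodeInv_mul]
      | _ => simp_all [add_mul, mul_add]
    cases t
    · simp [endN, endComul, hd.comul_antipodeInv, flip_map]
    · simp only [endN, endComul, Bool.false_eq_true, if_false, lcomp_apply,
        mulRight_apply, if_true]
      rw [hm, ← flip_map, hd.map_antipodeInv, ← hd.flip_mul_flip_comul, hd.comul_antipodeInv,
        flip_flip]
  · cases t
    · simp [endN, endComul]
    · simp [endN, endComul, hd.flip_mul_flip_comul]

lemma map_tenN_splitTen (hd : RibbonData R ν) (tw : E × Bool → Bool) (k : Ten F K (E × Bool)) :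
    tmap (tenN F K E) (tenN F K E) (splitTen (fun h => endComul R (tw h) h.2) k) =
      dlt F K _ (tenN F K E k) * twist R tw := by
  induction k using pind with
  | smul_tprod r m =>
    simp only [map_smul, smul_mul_assoc]
    congr 1
    have hn := (isFull_univ (X := E × Bool)).nodup
    rw [splitTen_tprod _ _ isFull_univ, tenN, map_map_prod_s12 (fun h => hd.endN_one h.2) hn,
      map_tprod, tprod_eq_prod isFull_univ, map_list_prod, map_map, twist, ← list_prod_map_mul hn]
    · congr 1
      apply map_congr_left
      intro x _
      rw [hd.map_endN_endComul, map_mul]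
      congr 1
      · simp only [Function.comp_apply, dlt_sing]; rfl
      · split
        · rw [s12_flip, s21_apply]
        · rw [map_one]
    · intro x _ y _ hxy
      split
      · rw [← s21_apply, ← s12_flip, Function.comp_apply, dlt_sing]
        exact s12_commute hxy _ _
      · exact one_right _
  | _ => simp_all [add_mul]

lemma map_tenN_vertexComul (hd : RibbonData R ν) (Γ : CilGraph V E) (tw : E × Bool → Bool)
    (k : Ten F K (E × Bool)) :
    tmap (tenN F K E) (tenN F K E) (Γ.vertexComul R tw k) =
      hatComul Γ R tw (tenN F K E k) := by
  rw [hatComul_apply, mul_assoc, ← hd.map_tenN_splitTen, CilGraph.vertexComul, lcomp_apply]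
  generalize splitTen (fun h => endComul R (tw h) h.2) k = z
  generalize Γ.braid R = b
  induction b using tind with
  | tmul x y =>
    induction z using tind with
    | zero => simp
    | add a b ha hb => simp only [map_add, mul_add, ha, hb]
    | tmul u v => simp [hd.tenN_act]
  | _ => simp_all [ladd, add_mul]

end RibbonData

end Normalize

section EdgeLevel

/-- Right multiplication by `S(k)` in the tensor factor `e`. -/
def mulRightS (e : E) : K →ₐ[F] Module.End F (Ten F K E) where
  toFun k := mulRight F (sing e (apd F k))
  map_one' := by ext; simp
  map_mul' x y := by
    refine lext (fun z => ?_)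
    simp [antipode_mul_antidistrib, mul_assoc]
  map_zero' := by ext; simp
  map_add' x y := by aesop
  commutes' c := by
    refine lext (fun z => ?_)
    simp [algebraMap_eq_smul_one]

variable (F K) in
/-- The action of the tensor factor of an edge end on `K^{⊗E}`. -/
def endAct (h : E × Bool) : K →ₐ[F] Module.End F (Ten F K E) :=
  if h.2 then (Algebra.lmul F _).comp (sing h.1) else mulRightS h.1

lemma endAct_true (e : E) (k : K) (z : Ten F K E) : endAct F K (e, true) k z = sing e k * z := rfl

lemma endAct_false (e : E) (k : K) (z : Ten F K E) :
    endAct F K (e, false) k z = z * sing e (apd F k) := rfl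

lemma slots_endAct : Slots (endAct F K (E := E)) := by
  refine ⟨?_⟩
  rintro ⟨e, b⟩ ⟨e', b'⟩ hne x y
  have hc : b = b' → ∀ k k' : K, Commute (sing e k : Ten F K E) (sing e' k') := fun hb k k' =>
    sing_commute (fun he => hne (by rw [he, hb])) k k'
  refine lext (fun z => ?_)
  change endAct F K (e, b) x (endAct F K (e', b') y z) =
    endAct F K (e', b') y (endAct F K (e, b) x z)
  cases b <;> cases b' <;> simp only [endAct_true, endAct_false, mul_assoc]
  · rw [(hc rfl _ _).eq]
  · rw [← mul_assoc, (hc rfl _ _).eq, mul_assoc]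

variable (F K E) in
/-- The action of `K^{⊗2E}` on `K^{⊗E}`, from the left at incoming and from the right at outgoing
edge ends. -/
def actD : Ten F K (E × Bool) →ₐ[F] Module.End F (Ten F K E) :=
  prodLiftAlg (endAct F K) slots_endAct.commute

lemma actD_sing (h : E × Bool) (k : K) : actD F K E (sing h k) = endAct F K h k :=
  prodLiftAlg_sing _ _ _ _

variable (F K E) in
/-- `k ↦ k_{t(e)} S(k_{s(e)})` on each edge `e`. -/
def glueH : Ten F K (E × Bool) →ₗ[F] Ten F K E :=
  (LinearMap.applyₗ (1 : Ten F K E)).comp (actD F K E).toLinearMap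

lemma glueH_apply (k : Ten F K (E × Bool)) : glueH F K E k = actD F K E k 1 := rfl

lemma glueH_mul (y k : Ten F K (E × Bool)) :
    glueH F K E (y * k) = actD F K E y (glueH F K E k) := by
  rw [glueH_apply, map_mul]; rfl

lemma prod_actD_tprod (m : E × Bool → K) (d : E → K) {l : List (E × Bool)} (hl : l.Nodup) :
    (l.map (fun h => endAct F K h (m h))).prod (ptprod F d) =
      ptprod F (fun e => (if (e, true) ∈ l then m (e, true) else 1) * d e *
        (if (e, false) ∈ l then apd F (m (e, false)) else 1)) := by
  induction l with
  | nil => simp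
  | cons h l ih =>
    rw [nodup_cons] at hl
    obtain ⟨e, b⟩ := h
    rw [map_cons, prod_cons, mul_apply, ih hl.2]
    cases b
    · rw [endAct_false, sing_eq_tprod, tprod_mul_tprod]
      congr 1
      funext f
      by_cases hf : f = e
      · subst hf; simp [hl.1]
      · simp [hf]
    · rw [endAct_true, sing_eq_tprod, tprod_mul_tprod]
      congr 1
      funext f
      by_cases hf : f = e
      · subst hf; simp [hl.1, mul_assoc]
      · simp [hf]

lemma actD_tprod_tprod (m : E × Bool → K) (d : E → K) :
    actD F K E (ptprod F m) (ptprod F d) =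
      ptprod F
        (fun e => m (e, true) * d e * apd F (m (e, false))) := by
  rw [tprod_eq_prod isFull_univ m, map_list_prod, map_map]
  have : (actD F K E ∘ fun h => sing h (m h)) = fun h => endAct F K h (m h) :=
    funext (fun h => actD_sing h _)
  rw [this, prod_actD_tprod m d isFull_univ.nodup]
  simp [isFull_univ.mem]

lemma glue_tprod (m : E × Bool → K) : glue (ptprod F m) =
    ptprod F (fun e => m (e, true) * m (e, false)) := by
  rw [glue, PiTensorProduct.lift.tprod]; rfl

lemma RibbonData.glueH_tenN {R : K ⊗[F] K} {ν : K} (hd : RibbonData R ν)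
    (k : Ten F K (E × Bool)) : glueH F K E (tenN F K E k) = glue k := by
  induction k using pind with
  | smul_tprod r m =>
    simp only [map_smul]
    rw [tenN, map_tprod, glueH_apply, PiTensorProduct.one_def, actD_tprod_tprod, glue_tprod]
    congr 2
    funext e
    simp [endN, hd.antipode_antipodeInv]
  | _ => simp_all

lemma unglue_tprod (d : E → K) : unglue (ptprod F d) =
    ptprod F (fun h : E × Bool => if h.2 then d h.1 else 1) := by
  have hs : ∀ x y : E, x ≠ y → ∀ a b : K, Commute (sing (x, true) a : Ten F K (E × Bool))
      (sing (y, true) b) := fun x y hxy a b => sing_commute (by simp [hxy]) _ _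
  rw [unglue, prodLift_tprod isFull_univ _ _ hs]
  have hn : (Finset.univ : Finset E).toList.Nodup := Finset.nodup_toList _
  have key : ∀ l : List E, l.Nodup →
      (l.map (fun e => (single (e, true) (d e) : Ten F K (E × Bool)))).prod =
      ptprod F (fun h : E × Bool => if h.2 ∧ h.1 ∈ l then d h.1 else 1) := by
    intro l hl
    induction l with
    | nil => simp [PiTensorProduct.one_def]; rfl
    | cons e l ih =>
      rw [nodup_cons] at hl
      rw [map_cons, prod_cons, ih hl.2, single_eq, sing_eq_tprod, tprod_mul_tprod]
      congr 1
      funext h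
      obtain ⟨f, b⟩ := h
      by_cases hf : f = e
      · subst hf
        cases b <;> simp [hl.1]
      · cases b <;> simp [hf]
  rw [key _ hn]
  simp

lemma glue_unglue (d : Ten F K E) : glue (unglue d) = d := by
  induction d using pind <;> simp_all [map_smul, unglue_tprod, glue_tprod]

variable (F K E) in
/-- The action of two copies of `K^{⊗2E}` on two copies of `K^{⊗E}`. -/
def actD2 : Ten2 F K (E × Bool) →ₐ[F] Module.End F (Ten2 F K E) :=
  Module.endTensorEndAlgHom.comp (amap (actD F K E) (actD F K E))

lemma actD2_tmul (x y : Ten F K (E × Bool)) (z : Ten2 F K E) :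
    actD2 F K E (x ⊗ₜ y) z = tmap (actD F K E x) (actD F K E y) z := by rfl

lemma map_glueH (z : Ten2 F K (E × Bool)) :
    tmap (glueH F K E) (glueH F K E) z = actD2 F K E z 1 := by
  induction z using tind with
  | tmul x y => rw [actD2_tmul, tone_def, tmap_tmul]; rfl
  | _ => simp_all

lemma actD2_s1_true (e : E) (k : K) (z : Ten2 F K E) :
    actD2 F K E (s1 F K (e, true) k) z = s1 F K e k * z := by
  rw [s1_apply, actD2_tmul, actD_sing, s1_apply]
  induction z using tind <;> simp_all [mul_add, endAct_true]

lemma actD2_s2_true (e : E) (k : K) (z : Ten2 F K E) :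
    actD2 F K E (s2 F K (e, true) k) z = s2 F K e k * z := by
  rw [s2_apply, actD2_tmul, actD_sing, s2_apply]
  induction z using tind <;> simp_all [mul_add, endAct_true]

lemma actD2_s1_false (e : E) (k : K) (z : Ten2 F K E) :
    actD2 F K E (s1 F K (e, false) k) z = z * s1 F K e (apd F k) := by
  rw [s1_apply, actD2_tmul, actD_sing, s1_apply]
  induction z using tind <;> simp_all [add_mul, endAct_false]

lemma actD2_s2_false (e : E) (k : K) (z : Ten2 F K E) :
    actD2 F K E (s2 F K (e, false) k) z = z * s2 F K e (apd F k) := by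
  rw [s2_apply, actD2_tmul, actD_sing, s2_apply]
  induction z using tind <;> simp_all [add_mul, endAct_false]

lemma s12_tmul (x y : X) (a b : K) : s12 F K x y (a ⊗ₜ b) = s1 F K x a * s2 F K y b := by
  simp [s12, s1_apply, s2_apply]

lemma actD2_s12_true (e : E) (t : K ⊗[F] K) (z : Ten2 F K E) :
    actD2 F K E (s12 F K (e, true) (e, true) t) z = s12 F K e e t * z := by
  induction t <;>
    simp_all [add_mul, ladd, s12_tmul, map_mul, mul_apply, actD2_s2_true, actD2_s1_true, mul_assoc]

lemma actD2_s12_false (e : E) (t : K ⊗[F] K) (z : Ten2 F K E) :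
    actD2 F K E (s12 F K (e, false) (e, false) t) z =
      z * s12 F K e e (tmap (apd F) (apd F) t) := by
  induction t with
  | tmul a b =>
    rw [s12_tmul, tmap_tmul, s12_tmul, map_mul, mul_apply, actD2_s2_false,
      actD2_s1_false, mul_assoc, (s1_s2_commute F _ _ _ _).eq]
  | _ => simp_all [mul_add, ladd]

lemma twist_eq_prod_s12 (R : K ⊗[F] K) (tw : X → Bool) {l : List X} (hl : IsFull l) :
    twist R tw = (l.map (fun x => if tw x then s12 F K x x (flip R) else 1)).prod := by
  rw [twist, list_prod_perm isFull_univ.nodup (isFull_univ.perm hl)]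
  · congr 2
    funext x
    rw [s12_flip, s21_apply]
  · intro x _ y _ hxy
    rw [← s21_apply, ← s12_flip, ← s21_apply, ← s12_flip]
    split
    · split
      · exact s12_commute hxy _ _
      · exact one_right _
    · exact one_left _

lemma twist_mul_s12 {R : K ⊗[F] K} {ν : K} (hd : RibbonData R ν) (tw : X → Bool) (x : X)
    (k : K) : twist R tw * s12 F K x x (if tw x then flip (comul (R := F) k) else comul k) =
      s12 F K x x (comul (R := F) k) * twist R tw := by
  have hf : IsFull (x :: others x) :=
    ⟨nodup_cons.2 ⟨by simp [mem_others], Finset.nodup_toList _⟩,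
      fun y => by simp [mem_others, em]⟩
  rw [twist_eq_prod_s12 R _ hf, map_cons, prod_cons]
  have hc : ∀ t, Commute ((others x).map (fun x => if tw x = true then
      s12 F K x x (flip R) else 1)).prod (s12 F K x x t) := by
    intro t
    apply Commute.list_prod_left
    intro z hz
    obtain ⟨y, hy, rfl⟩ := mem_map.1 hz
    rw [mem_others] at hy
    split
    · exact s12_commute hy _ _
    · exact one_left _
  rw [mul_assoc, (hc _).eq, ← mul_assoc, ← mul_assoc]
  congr 1
  split
  · rw [← map_mul (s12 F K x x), ← map_mul (s12 F K x x), hd.flip_mul_flip_comul]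
  · rw [one_mul, mul_one]

lemma list_prod_flatMap {M J : Type*} [Monoid M] (l : List I) (c : I → List J) (f : J → M) :
    ((l.flatMap c).map f).prod = (l.map (fun i => ((c i).map f).prod)).prod := by
  induction l <;> simp_all

lemma twist_twistOf (R : K ⊗[F] K) (ρ : E → Bool) :
    twist R (twistOf ρ) = ((Finset.univ : Finset E).toList.map
      (fun e => s12 F K (e, ρ e) (e, ρ e) (flip R))).prod := by
  have hf : IsFull ((Finset.univ : Finset E).toList.flatMap (fun e => [(e, true), (e, false)])) := by
    constructor
    · rw [List.nodup_flatMap]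
      refine ⟨fun e _ => by simp, (Finset.nodup_toList _).imp ?_⟩
      intro a b hab x hx hx'
      simp only [mem_cons, List.not_mem_nil, or_false] at hx hx'
      rcases hx with rfl | rfl <;> simp [hab] at hx'
    · rintro ⟨e, b⟩
      cases b <;> simp
  rw [twist_eq_prod_s12 R _ hf, list_prod_flatMap]
  congr 2
  funext e
  cases h : ρ e <;> simp [twistOf, h]

lemma actD2_twist {R : K ⊗[F] K} (hR : IsRMatrix R) (ρ : E → Bool) :
    actD2 F K E (twist R (twistOf ρ)) 1 = twist R (fun _ => true) := by
  rw [twist_twistOf, twist_eq_prod_s12 R _ isFull_univ]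
  have hn := (isFull_univ (X := E)).nodup
  generalize (Finset.univ : Finset E).toList = l at hn
  induction l with
  | nil => simp
  | cons e l ih =>
    rw [nodup_cons] at hn
    have hflip : tmap (apd F) (apd F) (flip R) =
        flip R := by rw [← RibbonData.flip_map, hR.map_antipode]
    rw [map_cons, prod_cons, map_mul, mul_apply, ih hn.2, map_cons, prod_cons]
    cases ρ e
    · rw [actD2_s12_false, hflip]
      apply Commute.list_prod_left
      intro z hz
      obtain ⟨y, hy, rfl⟩ := mem_map.1 hz
      exact s12_commute (fun h => hn.1 (by rw [← h]; exact hy)) _ _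
    · rw [actD2_s12_true]; rfl

/-- The comultiplication on `K^{⊗E}` dual to the product of `A*_Γ`. -/
def deltaD (Γ : CilGraph V E) (R : K ⊗[F] K) : Ten F K E →ₗ[F] Ten2 F K E :=
  (actD2 F K E (Γ.braid R)).comp
    ((mulRight F (twist R (fun _ => true))).comp (dlt F K E).toLinearMap)

lemma deltaD_apply (Γ : CilGraph V E) (R : K ⊗[F] K) (d : Ten F K E) :
    deltaD Γ R d = actD2 F K E (Γ.braid R) (dlt F K E d * twist R (fun _ => true)) := rfl

lemma actD2_dlt {R : K ⊗[F] K} {ν : K} (hd : RibbonData R ν) (k : Ten F K (E × Bool))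
    (d : Ten F K E) : actD2 F K E (dlt F K _ k) (dlt F K E d * twist R (fun _ => true)) =
      dlt F K E (actD F K E k d) * twist R (fun _ => true) := by
  induction k using ten_induction generalizing d with
  | mul x k z hz =>
    obtain ⟨e, b⟩ := x
    rw [map_mul (dlt F K _), map_mul (actD2 F K E), mul_apply, hz,
      map_mul (actD F K E), mul_apply, dlt_sing, actD_sing]
    change actD2 F K E (s12 F K (e, b) (e, b) (comul (R := F) k)) _ = _
    cases b
    · rw [actD2_s12_false, endAct_false, map_mul]
      have h1 : tmap (apd F) (apd F)
          (comul (R := F) k) = flip (comul (R := F) (apd F k)) := by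
        rw [comul_antipode, flip_flip]
      have h2 := twist_mul_s12 hd (fun _ => true) e (apd F k)
      rw [if_pos rfl] at h2
      rw [h1, mul_assoc, h2, ← mul_assoc, dlt_sing]
      rfl
    · rw [actD2_s12_true, endAct_true, map_mul, dlt_sing, ← mul_assoc]
      rfl
  | _ => simp_all [map_smul, LinearMap.smul_apply, smul_mul_assoc, ladd, add_mul]

lemma map_glueH_hatComul {R : K ⊗[F] K} {ν : K} (hd : RibbonData R ν) (Γ : CilGraph V E)
    (ρ : E → Bool) (k : Ten F K (E × Bool)) :
    tmap (glueH F K E) (glueH F K E) (hatComul Γ R (twistOf ρ) k) =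
      deltaD Γ R (glueH F K E k) := by
  rw [map_glueH, hatComul_apply, map_mul, map_mul, mul_apply, mul_apply,
    actD2_twist hd.rMat, deltaD_apply, glueH_apply, ← actD2_dlt hd, map_one, one_mul]

end EdgeLevel

section EdgeAlgebra

lemma dualDistrib_comp {M N : Type*} [AddCommGroup M] [Module F M] [AddCommGroup N] [Module F N]
    (x y : Module.Dual F N) (f : M →ₗ[F] N) (z : M ⊗[F] M) :
    TensorProduct.dualDistrib F M M ((x.comp f) ⊗ₜ (y.comp f)) z =
      TensorProduct.dualDistrib F N N (x ⊗ₜ y) (tmap f f z) := by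
  induction z <;> simp_all

lemma dualDistrib_eq_mul {M N : Type*} [AddCommGroup M] [Module F M] [AddCommGroup N] [Module F N]
    (x : Module.Dual F M) (y : Module.Dual F N) (z : M ⊗[F] N) :
    TensorProduct.dualDistrib F M N (x ⊗ₜ y) z = mul' F F (tmap x y z) := by
  induction z <;> simp_all

lemma gStar_apply (x : DTen F K E) (k : Ten F K (E × Bool)) : gStar x k = x (glue k) := rfl

lemma gStar_injective : Function.Injective (gStar : DTen F K E →ₗ[F] DTen F K (E × Bool)) := by
  intro x y h
  refine lext (fun d => ?_)
  have := congr($h (unglue d))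
  rwa [gStar_apply, gStar_apply, glue_unglue] at this

namespace RibbonData

lemma glueH_eq (hd : RibbonData R ν) (k : Ten F K (E × Bool)) :
    glueH F K E k = glue (tenS F K E k) := by
  rw [← hd.glueH_tenN, hd.tenN_tenS]

lemma glue_act (hd : RibbonData R ν) (y k : Ten F K (E × Bool)) :
    glue (act y k) = actD F K E y (glue k) := by
  rw [← hd.glueH_tenN, hd.tenN_act, glueH_mul, hd.glueH_tenN]

lemma map_glue_vertexComul (hd : RibbonData R ν) (Γ : CilGraph V E) (ρ : E → Bool)
    (k : Ten F K (E × Bool)) :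
    tmap glue glue (Γ.vertexComul R (twistOf ρ) k) = deltaD Γ R (glue k) := by
  have h : (glue : Ten F K (E × Bool) →ₗ[F] Ten F K E) = (glueH F K E).comp (tenN F K E) :=
    lext (fun k => (hd.glueH_tenN k).symm)
  rw [h, tmap_comp, lcomp_apply, hd.map_tenN_vertexComul,
    map_glueH_hatComul hd, lcomp_apply]

lemma gStar_edgeMul (hd : RibbonData R ν) (Γ : CilGraph V E) (ρ : E → Bool) (x y : DTen F K E)
    (k : Ten F K (E × Bool)) : Γ.vertexMul R (twistOf ρ) (gStar x) (gStar y) k =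
      TensorProduct.dualDistrib F _ _ (x ⊗ₜ y) (deltaD Γ R (glue k)) := by
  rw [← hd.map_glue_vertexComul Γ ρ, ← dualDistrib_comp]
  rfl

lemma edgeMul_apply (hd : RibbonData R ν) (Γ : CilGraph V E) (ρ : E → Bool) (x y : DTen F K E)
    (d : Ten F K E) : Γ.edgeMul R ρ x y d =
      TensorProduct.dualDistrib F _ _ (x ⊗ₜ y) (deltaD Γ R d) := by
  have := hd.gStar_edgeMul Γ ρ x y (unglue d)
  rwa [glue_unglue] at this

lemma edgeAct_apply (hd : RibbonData R ν) (Γ : CilGraph V E) (x : DTen F K E) (h : Ten F K V)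
    (d : Ten F K E) : Γ.edgeAct x h d = x (actD F K E (Γ.gaugeComul h) d) := by
  change x (glue (act (Γ.gaugeComul h) (unglue d))) = _
  rw [hd.glue_act, glue_unglue]

lemma epsT_glueH (k : Ten F K (E × Bool)) :
    epsT (glueH F K E k) = epsT k := by
  rw [glueH_apply]
  have : ∀ d : Ten F K E, epsT (actD F K E k d) = epsT k * epsT d := by
    induction k using ten_induction with
    | mul x k z hz =>
      obtain ⟨e, b⟩ := x
      intro d
      have h1 : ∀ (X : Type _) [Fintype X] [DecidableEq X] (x : X) (k : K),
          (epsT : Ten F K X →ₐ[F] F) (sing x k) = counit (R := F) k := by simp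
      rw [map_mul, mul_apply, actD_sing, map_mul, h1]
      cases b
      · grind [endAct_false, map_mul, HopfAlgebra.counit_antipode]
      · rw [endAct_true, map_mul, hz, h1]
        ring
    | _ => simp_all [mul_assoc, add_mul]
  rw [this, map_one, mul_one]

lemma epsT_tenN (hd : RibbonData R ν) (k : Ten F K (E × Bool)) :
    epsT (tenN F K E k) = epsT k := by
  have : (epsT : Ten F K (E × Bool) →ₐ[F] F).toLinearMap.comp (tenN F K E) =
      epsT.toLinearMap := by
    ext m
    simp only [LinearMap.compMultilinearMap_apply, lcomp_apply, tenN,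
      map_tprod, ← counitTen_eq]
    rw [counitTen, prodLift_tprod isFull_univ _ _ (fun _ _ _ _ _ => Commute.all _ _),
      prodLift_tprod isFull_univ _ _ (fun _ _ _ _ _ => Commute.all _ _)]
    simp only [hd.counit_endN]
  exact congr($this k)

lemma epsT_glue (hd : RibbonData R ν) (k : Ten F K (E × Bool)) : epsT (glue k) = epsT k := by
  rw [← hd.glueH_tenN, epsT_glueH, hd.epsT_tenN]

lemma gStarHom (hd : RibbonData R ν) (Γ : CilGraph V E) (ρ : E → Bool) : Γ.GStarHom R ρ where
  injective := gStar_injective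
  map_one := lext (fun k => by
    rw [gStar_apply, counitTen_eq, counitTen_eq]
    exact hd.epsT_glue k)
  map_mul x y := lext (fun k => by rw [gStar_apply, hd.edgeMul_apply, hd.gStar_edgeMul])
  map_act x h := lext (fun k => by
    rw [gStar_apply, hd.edgeAct_apply, ← hd.glue_act]
    rfl)

end RibbonData

/-- A functional on `K^{⊗2E}` as a functional on the coalgebra `Hat`. -/
def hatFun (Γ : CilGraph V E) (hR : IsRMatrix R) (tw : E × Bool → Bool) :
    DTen F K (E × Bool) →ₗ[F] Cv F (Hat Γ hR tw) F where
  toFun φ := ofT Γ hR tw (φ.comp (tenS F K E))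
  map_add' _ _ := rfl
  map_smul' _ _ := rfl

lemma RibbonData.hatFun_injective (hd : RibbonData R ν) (Γ : CilGraph V E)
    (tw : E × Bool → Bool) : Function.Injective (hatFun Γ hd.rMat tw) := by
  intro φ ψ h
  refine lext (fun k => ?_)
  have := congr(($h).ofConv (tenN F K E k))
  change φ (tenS F K E (tenN F K E k)) = ψ (tenS F K E (tenN F K E k)) at this
  rwa [hd.tenS_tenN] at this

lemma RibbonData.hatFun_vertexMul (hd : RibbonData R ν) (tw : E × Bool → Bool)
    (φ ψ : DTen F K (E × Bool)) : hatFun Γ hd.rMat tw (Γ.vertexMul R tw φ ψ) =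
      hatFun Γ hd.rMat tw φ * hatFun Γ hd.rMat tw ψ := by
  have key : ∀ k : Ten F K (E × Bool), (hatFun Γ hd.rMat tw (Γ.vertexMul R tw φ ψ)).ofConv k =
      (ofT Γ hd.rMat tw (φ.comp (tenS F K E)) *
        ofT Γ hd.rMat tw (ψ.comp (tenS F K E))).ofConv k := by
    intro k
    rw [ofT_mul_apply, ← dualDistrib_eq_mul, dualDistrib_comp]
    change TensorProduct.dualDistrib F _ _ (φ ⊗ₜ ψ) (Γ.vertexComul R tw (tenS F K E k)) = _
    congr 1
    have h2 : ∀ z : Ten2 F K (E × Bool), tmap (tenS F K E) (tenS F K E)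
        (tmap (tenN F K E) (tenN F K E) z) = z := by
      intro z
      rw [← lcomp_apply, ← tmap_comp]
      have : (tenS F K E).comp (tenN F K E) = lid :=
        lext (fun k => hd.tenS_tenN k)
      rw [this, TensorProduct.map_id]
      rfl
    rw [← h2 (Γ.vertexComul R tw _), hd.map_tenN_vertexComul, hd.tenN_tenS]
  exact congrArg toConv (lext key)

lemma RibbonData.hatFun_counitTen (hd : RibbonData R ν) (tw : E × Bool → Bool) :
    hatFun Γ hd.rMat tw (counitTen (E × Bool)) = 1 := by
  have key : ∀ k : Ten F K (E × Bool), (hatFun Γ hd.rMat tw (counitTen (E × Bool))).ofConv k =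
      epsT k := by
    intro k
    change counitTen (E × Bool) (tenS F K E k) = _
    rw [counitTen_eq]
    change epsT (tenS F K E k) = _
    rw [← hd.epsT_tenN, hd.tenN_tenS]
  exact congrArg toConv (lext key)

lemma RibbonData.hatFun_vertexProd (hd : RibbonData R ν) (tw : E × Bool → Bool)
    (l : List (DTen F K (E × Bool))) : hatFun Γ hd.rMat tw (Γ.vertexProd R tw l) =
      (l.map (hatFun Γ hd.rMat tw)).prod := by
  induction l with
  | nil => exact hd.hatFun_counitTen tw
  | cons φ l ih =>
    rw [map_cons, prod_cons, ← ih, ← hd.hatFun_vertexMul]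
    rfl

lemma RibbonData.hatFun_elt (hd : RibbonData R ν) (tw : E × Bool → Bool) (x : E × Bool)
    (α : Module.Dual F K) : hatFun Γ hd.rMat tw (elt x α) =
      ofT Γ hd.rMat tw ((α.comp (endS F K x.2)).comp (co x).toLinearMap) := by
  refine congrArg toConv (lext (fun k : Ten F K (E × Bool) => ?_))
  change α (coord x (tenS F K E k)) = α (endS F K x.2 (co x k))
  rw [coord_eq]
  change α (co x (tenS F K E k)) = _
  congr 1
  apply co_map
  · intro x
    unfold endS
    split <;> simp
  · intro x k
    unfold endS
    split <;> simp

lemma exists_fun_of_nodup {X A : Type*} [DecidableEq X] (a : A) (l : List (X × A))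
    (h : (l.map Prod.fst).Nodup) : ∃ β : X → A, ∀ p ∈ l, β p.1 = p.2 := by
  induction l with
  | nil => exact ⟨fun _ => a, by simp⟩
  | cons p l ih =>
    rw [map_cons, nodup_cons] at h
    obtain ⟨β, hβ⟩ := ih h.2
    refine ⟨Function.update β p.1 p.2, ?_⟩
    intro q hq
    rcases mem_cons.1 hq with rfl | hq
    · simp
    · grind

lemma nodup_of_ordered {l : List (E × Bool)}
    (h : l.Pairwise (fun x y => Γ.base x ≠ Γ.base y ∨ Γ.Lt x y)) : l.Nodup := by
  refine h.imp ?_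
  rintro x y (h | h) rfl
  · exact h rfl
  · exact CilGraph.lt_irrefl x h

lemma ordered_order : Γ.order.Pairwise (fun x y => Γ.base x ≠ Γ.base y ∨ Γ.Lt x y) := by
  rw [List.pairwise_iff_forall_sublist]
  intro x y h
  by_cases hb : Γ.base x = Γ.base y
  · exact Or.inr ((Γ.isOrder_order).lt_iff.2 ⟨h, hb⟩)
  · exact Or.inl hb

lemma RibbonData.hatFun_vertexProd_elt (hd : RibbonData R ν) (tw : E × Bool → Bool)
    (β : E × Bool → Module.Dual F K) {l : List (E × Bool)}
    (ho : l.Pairwise (fun x y => Γ.base x ≠ Γ.base y ∨ Γ.Lt x y)) :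
    hatFun Γ hd.rMat tw (Γ.vertexProd R tw (l.map (fun x => elt x (β x)))) =
      ofT Γ hd.rMat tw (prodLift (resFam (fun x => (β x).comp (endS F K x.2)) l)) := by
  rw [hd.hatFun_vertexProd, map_map, ← prod_coY Γ hd.rMat tw _ (nodup_of_ordered ho) ho]
  congr 2
  funext x
  exact hd.hatFun_elt tw x (β x)

lemma RibbonData.dual_ext [FiniteDimensional F K] (hd : RibbonData R ν)
    (tw : E × Bool → Bool) {M : Type*} [AddCommGroup M] [Module F M]
    {f₁ f₂ : DTen F K (E × Bool) →ₗ[F] M}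
    (h : ∀ β : E × Bool → Module.Dual F K,
      f₁ (Γ.vertexProd R tw (Γ.order.map (fun x => elt x (β x)))) =
      f₂ (Γ.vertexProd R tw (Γ.order.map (fun x => elt x (β x))))) : f₁ = f₂ := by
  classical
  let b := Module.finBasis F K
  let B := Basis.piTensorProduct (fun _ : E × Bool => b)
  have h1 : f₁.comp (Module.Dual.transpose (R := F) (tenN F K E)) =
      f₂.comp (Module.Dual.transpose (R := F) (tenN F K E)) := by
    refine B.dualBasis.ext (fun p => ?_)
    have h2 := h (fun x => (b.coord (p x)).comp (endN F K x.2))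
    have h3 : Γ.vertexProd R tw (Γ.order.map (fun x => elt x ((b.coord (p x)).comp
        (endN F K x.2)))) = (B.dualBasis p).comp (tenN F K E) := by
      apply hd.hatFun_injective Γ tw
      rw [hd.hatFun_vertexProd_elt tw _ ordered_order]
      refine congrArg toConv (lext (fun k : Ten F K (E × Bool) => ?_))
      change _ = B.dualBasis p (tenN F K E (tenS F K E k))
      rw [hd.tenN_tenS, Module.Basis.coe_dualBasis]
      have h4 : resFam (fun x => ((b.coord (p x)).comp (endN F K x.2)).comp (endS F K x.2))
          Γ.order = fun x => b.coord (p x) := by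
        funext x
        rw [resFam, if_pos ((Γ.isOrder_order).mem x)]
        exact lext (fun k => congrArg (b.coord (p x)) (hd.endN_endS x.2 k))
      rw [h4]
      have h5 : prodLift (fun x => b.coord (p x)) = B.coord p := by
        ext m
        simp only [LinearMap.compMultilinearMap_apply]
        rw [prodLift_tprod isFull_univ _ _ (fun _ _ _ _ _ => Commute.all _ _),
          Module.Basis.coord_apply, Basis.piTensorProduct_repr_tprod_apply, Finset.prod_map_toList]
        rfl
      exact congr($h5 k)
    rw [h3] at h2
    exact h2
  refine lext (fun φ => ?_)
  have h6 := congr($h1 (φ.comp (tenS F K E)))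
  have h7 : Module.Dual.transpose (R := F) (tenN F K E) (φ.comp (tenS F K E)) = φ :=
    lext (fun k => congrArg φ (hd.tenS_tenN k))
  change f₁ (Module.Dual.transpose (R := F) (tenN F K E) (φ.comp (tenS F K E))) =
    f₂ (Module.Dual.transpose (R := F) (tenN F K E) (φ.comp (tenS F K E))) at h6
  rwa [h7] at h6

/-- Linear maps `K^{⊗2E} → K^{⊗2E'}` and `K^{⊗E} → K^{⊗E'}` that are dual to the maps induced by a
graph operation. -/
structure InducingPair (hR : IsRMatrix R) (Γ : CilGraph V E) (Γ' : CilGraph V' E')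
    (tw : E × Bool → Bool) (g : V → Option V')
    (Z : E' × Bool → Ten F K (E × Bool) →ₗ[F] K)
    (fh : Ten F K (E × Bool) →ₗ[F] Ten F K (E' × Bool)) (Fs : Ten F K E →ₗ[F] Ten F K E') :
    Prop where
  vertex : ∀ (β : E' × Bool → Module.Dual F K) (l : List (E' × Bool)),
    l.Pairwise (fun x y => Γ'.base x ≠ Γ'.base y ∨ Γ'.Lt x y) →
    ofT Γ hR tw ((prodLift (resFam β l)).comp fh) =
      (l.map (fun x => ofT Γ hR tw ((β x).comp (Z x)))).prod
  glueH : ∀ k, glueH F K E' (fh k) = Fs (glueH F K E k)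
  deltaD : ∀ d, deltaD Γ' R (Fs d) = tmap Fs Fs (deltaD Γ R d)
  epsT : ∀ d, epsT (Fs d) = epsT d
  actD : ∀ (h : Ten F K V) d, Fs (actD F K E (Γ.gaugeComul h) d) =
    actD F K E' (Γ'.gaugeComul (resVertex g h)) (Fs d)

lemma RibbonData.isVertexMap [FiniteDimensional F K] (hd : RibbonData R ν)
    {tw : E × Bool → Bool} {tw' : E' × Bool → Bool} {g : V → Option V'}
    {Z W : E' × Bool → Ten F K (E × Bool) →ₗ[F] K}
    {fh : Ten F K (E × Bool) →ₗ[F] Ten F K (E' × Bool)} {Fs : Ten F K E →ₗ[F] Ten F K E'}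
    (hp : InducingPair hd.rMat Γ Γ' tw g Z fh Fs)
    (hW : ∀ x k, endN F K x.2 (W x k) = Z x (tenN F K E k)) :
    IsVertexMap R Γ Γ' tw tw' W
      (Module.Dual.transpose (R := F) ((tenS F K E').comp (fh.comp (tenN F K E)))) := by
  intro l hl
  have hn : (l.map Prod.fst).Pairwise (fun x y => Γ'.base x ≠ Γ'.base y ∨ Γ'.Lt x y) :=
    List.pairwise_map.2 hl
  obtain ⟨β, hβ⟩ := exists_fun_of_nodup (0 : Module.Dual F K) l (nodup_of_ordered hn)
  have h1 : l.map (fun p => elt p.1 p.2) = (l.map Prod.fst).map (fun x => elt x (β x)) := by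
    rw [map_map]
    exact map_congr_left (fun p hp => by rw [Function.comp_apply, hβ p hp])
  have h2 : l.map (fun p => p.2.comp (W p.1)) =
      (l.map Prod.fst).map (fun x => (β x).comp (W x)) := by
    rw [map_map]
    exact map_congr_left (fun p hp => by rw [Function.comp_apply, hβ p hp])
  rw [h1, h2]
  generalize l.map Prod.fst = l' at hn
  apply hd.hatFun_injective Γ tw
  have h3 := hp.vertex (fun x => (β x).comp (endS F K x.2)) l' hn
  have h4 : ∀ x, hatFun Γ hd.rMat tw ((β x).comp (W x)) =
      ofT Γ hd.rMat tw (((β x).comp (endS F K x.2)).comp (Z x)) := by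
    intro x
    refine congrArg toConv (lext (fun k : Ten F K (E × Bool) => ?_))
    change β x (W x (tenS F K E k)) = β x (endS F K x.2 (Z x k))
    conv_rhs => rw [← hd.tenN_tenS k, ← hW, hd.endS_endN]
  rw [hd.hatFun_vertexProd, map_map]
  simp only [Function.comp_def, h4]
  rw [← h3]
  refine congrArg toConv (lext (fun k : Ten F K (E × Bool) => ?_))
  change (Γ'.vertexProd R tw' _) (tenS F K E' (fh (tenN F K E (tenS F K E k)))) =
    prodLift (resFam _ l') (fh k)
  rw [hd.tenN_tenS]
  exact congr(($(hd.hatFun_vertexProd_elt tw' β hn)).ofConv (fh k))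

lemma RibbonData.induces [FiniteDimensional F K] (hd : RibbonData R ν) (ρ : E → Bool)
    (ρ' : E' → Bool) {tw : E × Bool → Bool} {g : V → Option V'}
    {Z W : E' × Bool → Ten F K (E × Bool) →ₗ[F] K}
    {fh : Ten F K (E × Bool) →ₗ[F] Ten F K (E' × Bool)} {Fs : Ten F K E →ₗ[F] Ten F K E'}
    (hp : InducingPair hd.rMat Γ Γ' tw g Z fh Fs)
    (hW : ∀ x k, endN F K x.2 (W x k) = Z x (tenN F K E k)) :
    Induces R Γ Γ' ρ ρ' tw g W := by
  have hf := hd.isVertexMap (tw' := twistOf ρ') hp hW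
  have hu : ∀ f, IsVertexMap R Γ Γ' tw (twistOf ρ') W f → f =
      Module.Dual.transpose (R := F) ((tenS F K E').comp (fh.comp (tenN F K E))) := by
    intro f h
    apply hd.dual_ext (Γ := Γ') (twistOf ρ')
    intro β
    have ho : (Γ'.order.map (fun x => (x, β x))).Pairwise
        (fun p q => Γ'.base p.1 ≠ Γ'.base q.1 ∨ Γ'.Lt p.1 q.1) :=
      List.pairwise_map.2 ordered_order
    have h1 := (h _ ho).trans (hf _ ho).symm
    rw [map_map] at h1
    exact h1
  have hg : ∀ x, gStar (Module.Dual.transpose (R := F) Fs x) =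
      Module.Dual.transpose (R := F) ((tenS F K E').comp (fh.comp (tenN F K E))) (gStar x) := by
    intro x
    refine lext (fun k => ?_)
    change x (Fs (glue k)) = x (glue (tenS F K E' (fh (tenN F K E k))))
    rw [← hd.glueH_eq, hp.glueH, hd.glueH_tenN]
  have huΦ : ∀ Φ : DTen F K E' →ₗ[F] DTen F K E, (∀ x, gStar (Φ x) =
      Module.Dual.transpose (R := F) ((tenS F K E').comp (fh.comp (tenN F K E))) (gStar x)) →
      Φ = Module.Dual.transpose (R := F) Fs := by
    intro Φ h
    exact lext (fun x => gStar_injective ((h x).trans (hg x).symm))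
  refine ⟨⟨_, hf, hu⟩, ?_, ?_⟩
  · intro f h
    rw [hu f h]
    exact ⟨_, hg, huΦ⟩
  · intro f h Φ hΦ
    rw [hu f h] at hΦ
    rw [huΦ Φ hΦ]
    refine ⟨?_, ?_, ?_⟩
    · rw [counitTen_eq, counitTen_eq]
      exact lext (fun d => hp.epsT d)
    · intro x y
      refine lext (fun d => ?_)
      change Γ'.edgeMul R ρ' x y (Fs d) = _
      rw [hd.edgeMul_apply, hd.edgeMul_apply, hp.deltaD, ← dualDistrib_comp]
      rfl
    · intro x h
      refine lext (fun d => ?_)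
      change Γ'.edgeAct x (resVertex g h) (Fs d) = _
      rw [hd.edgeAct_apply, hd.edgeAct_apply, ← hp.actD]
      rfl

end EdgeAlgebra

/-! ### Convolution and comultiplicative actions -/

section Translation

/-- A map `K → End C` with `Δ(y ▷ c) = ∑ (y₁ ▷ c₁) ⊗ (y₂ ▷ c₂)`, where `δ y = ∑ y₁ ⊗ y₂`. -/
structure IsTrans (T : K →ₗ[F] C →ₗ[F] C) (δ : K →ₗ[F] K ⊗[F] K) : Prop where
  comul_apply : ∀ y c, comul (R := F) (T y c) = TensorProduct.map₂ T T (δ y) (comul (R := F) c)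

variable {T T' : K →ₗ[F] C →ₗ[F] C} {δ : K →ₗ[F] K ⊗[F] K} {f g : Cv F C B}

lemma IsTrans.mul_apply_left (hT : IsTrans T δ) {a b : K →ₗ[F] B}
    (hf : ∀ y c, f (T y c) = a y * f c) (hg : ∀ y c, g (T y c) = b y * g c)
    (h : ∀ y c, Commute (b y) (f c)) (y : K) (c : C) :
    (f * g : Cv F C B) (T y c) =
      mul' F B (tmap a b (δ y)) * (f * g : Cv F C B) c := by
  rw [convMul_apply, convMul_apply, hT.comul_apply]
  generalize δ y = t
  generalize comul (R := F) c = z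
  induction t with
  | tmul y y' =>
    induction z with
    | zero => simp
    | add s s' hs hs' => simp only [map_add, mul_add, hs, hs']
    | tmul c c' =>
      rw [TensorProduct.map₂_apply_tmul, tmap_tmul, tmap_tmul, tmap_tmul, tmap_tmul]
      simp only [mul'_apply]
      change f (T y c) * g (T y' c') = a y * b y' * (f c * g c')
      rw [hf, hg, mul_assoc, mul_assoc, ← mul_assoc (f c), ← (h y' c).eq, mul_assoc]
  | _ => simp_all [ladd, add_mul]

lemma IsTrans.mul_apply_right (hT : IsTrans T δ) {a b : K →ₗ[F] B}
    (hf : ∀ y c, f (T y c) = f c * a y) (hg : ∀ y c, g (T y c) = g c * b y)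
    (h : ∀ y c, Commute (a y) (g c)) (y : K) (c : C) :
    (f * g : Cv F C B) (T y c) =
      (f * g : Cv F C B) c * mul' F B (tmap a b (δ y)) := by
  rw [convMul_apply, convMul_apply, hT.comul_apply]
  generalize δ y = t
  generalize comul (R := F) c = z
  induction t with
  | tmul y y' =>
    induction z with
    | zero => simp
    | add s s' hs hs' => simp only [map_add, add_mul, hs, hs']
    | tmul c c' =>
      rw [TensorProduct.map₂_apply_tmul, tmap_tmul, tmap_tmul, tmap_tmul, tmap_tmul]
      simp only [mul'_apply]
      change f (T y c) * g (T y' c') = f c * g c' * (a y * b y')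
      rw [hf, hg, mul_assoc, mul_assoc, ← mul_assoc (a y), (h y c').eq, mul_assoc]
  | _ => simp_all [ladd, mul_add]

lemma IsTrans.mul_apply_mid (hT : IsTrans T δ) {a b : K →ₗ[F] B}
    (hf : ∀ y c, f (T y c) = f c * a y) (hg : ∀ y c, g (T y c) = b y * g c) (y : K) (c : C) :
    (f * g : Cv F C B) (T y c) =
      (f * cst (mul' F B (tmap a b (δ y))) * g : Cv F C B) c := by
  have h1 : ∀ (t : B) (c : C), (f * cst t * g : Cv F C B) c = mul' F B
      (tmap ((mulRight F t).comp f.ofConv) g.ofConv (comul (R := F) c)) := by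
    intro t c
    have : (f * cst t : Cv F C B) = toConv ((mulRight F t).comp f.ofConv) := by
      ext c
      exact mul_cst_apply t f c
    rw [this, convMul_apply]
  rw [convMul_apply, hT.comul_apply, h1]
  generalize δ y = t
  generalize comul (R := F) c = z
  induction t with
  | zero => simp
  | add s s' hs hs' =>
    rw [map_add, map_add, map_add, ladd, map_add, map_add, hs, hs', ← map_add,
      ← ladd, ← TensorProduct.map_add_left, ← LinearMap.add_comp]
    congr 4
    ext z
    simp [mul_add]
  | tmul y y' =>
    induction z <;> simp_all [TensorProduct.map₂_apply_tmul, tmap_tmul, mul'_apply, mul_assoc]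

lemma IsTrans.mul_apply_congr (hT : IsTrans T δ) (hT' : IsTrans T' δ)
    (hf : ∀ y c, f (T y c) = f (T' y c)) (hg : ∀ y c, g (T y c) = g (T' y c)) (y : K) (c : C) :
    (f * g : Cv F C B) (T y c) = (f * g : Cv F C B) (T' y c) := by
  rw [convMul_apply, convMul_apply, hT.comul_apply, hT'.comul_apply]
  generalize δ y = t
  generalize comul (R := F) c = z
  induction t with
  | tmul y y' =>
    induction z with
    | zero => simp
    | add s s' hs hs' => simp only [map_add, hs, hs']
    | tmul c c' => simp_all
  | _ => simp_all

lemma mul_map_epsOne_left (hδ : ∀ y, (tlid F K)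
    ((counit (R := F) (A := K)).rTensor K (δ y)) = y) (b : K →ₗ[F] B) (y : K) :
    mul' F B (tmap epsOne b (δ y)) = b y := by
  conv_rhs => rw [← hδ y]
  generalize δ y = t
  induction t <;> simp_all [epsOne, algebraMap_eq_smul_one]

lemma mul_map_epsOne_right (hδ : ∀ y, (trid F K)
    ((counit (R := F) (A := K)).lTensor K (δ y)) = y) (b : K →ₗ[F] B) (y : K) :
    mul' F B (tmap b epsOne (δ y)) = b y := by
  conv_rhs => rw [← hδ y]
  generalize δ y = t
  induction t <;> simp_all [epsOne, algebraMap_eq_smul_one]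

lemma lid_counit_comul (y : K) : (tlid F K)
    ((counit (R := F) (A := K)).rTensor K (comul (R := F) y)) = y := by
  rw [Coalgebra.rTensor_counit_comul]; simp

lemma rid_counit_comul (y : K) : (trid F K)
    ((counit (R := F) (A := K)).lTensor K (comul (R := F) y)) = y := by
  rw [Coalgebra.lTensor_counit_comul]; simp

lemma lid_counit_flip (t : K ⊗[F] K) : (tlid F K)
    ((counit (R := F) (A := K)).rTensor K (flip t)) = (trid F K)
    ((counit (R := F) (A := K)).lTensor K t) := by
  induction t <;> simp_all

lemma rid_counit_flip (t : K ⊗[F] K) : (trid F K)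
    ((counit (R := F) (A := K)).lTensor K (flip t)) = (tlid F K)
    ((counit (R := F) (A := K)).rTensor K t) := by
  induction t <;> simp_all

/-- The comultiplication or the opposite comultiplication of `K`. -/
def comulTw (t : Bool) : K →ₗ[F] K ⊗[F] K := if t then flip.comp comul else comul

lemma comulTw_apply (t : Bool) (y : K) :
    comulTw (F := F) t y = if t then flip (comul (R := F) y) else comul (R := F) y := by
  cases t <;> rfl

lemma lid_counit_comulTw (t : Bool) (y : K) : (tlid F K)
    ((counit (R := F) (A := K)).rTensor K (comulTw t y)) = y := by
  rw [comulTw_apply]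
  split
  · rw [lid_counit_flip, rid_counit_comul]
  · exact lid_counit_comul y

lemma rid_counit_comulTw (t : Bool) (y : K) : (trid F K)
    ((counit (R := F) (A := K)).lTensor K (comulTw t y)) = y := by
  rw [comulTw_apply]
  split
  · rw [rid_counit_flip, lid_counit_comul]
  · exact rid_counit_comul y

end Translation

section HatActions

lemma prod_map_ite {X M : Type*} [Monoid M] (l : List X) (p : X → Prop) [DecidablePred p]
    (f : X → M) : (l.map (fun x => if p x then f x else 1)).prod =
      ((l.filter (fun x => decide (p x))).map f).prod := by
  induction l with
  | nil => simp
  | cons x l ih =>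
    rw [map_cons, prod_cons, ih, List.filter_cons]
    by_cases h : p x <;> simp [h]

lemma toConv_comulList {X : Type*} [DecidableEq X] (l : List X) :
    toConv (comulList l : K →ₗ[F] Ten F K X) = (l.map (fun x =>
      (toConv (sing x).toLinearMap : Cv F K (Ten F K X)))).prod := by
  induction l with
  | nil => rfl
  | cons x l ih => rw [map_cons, prod_cons, ← ih]; rfl

lemma om_eq_filter (base : I → V)
    (a : I → K →ₐ[F] B) (v : V) (l : List I) : toConv (om base a v l) =
      ((l.filter (fun h => decide (base h = v))).map (fun h =>
        (toConv (a h).toLinearMap : Cv F K B))).prod := by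
  rw [toConv_om, ← prod_map_ite]
  congr 2
  funext h
  unfold atV
  split <;> rfl

lemma om_sing_order (v : V) {L : List (E × Bool)} (hL : Γ.IsOrder L) :
    om Γ.base (sing : E × Bool → K →ₐ[F] _) v L = comulList (Γ.cil v) := by
  have h := om_eq_filter Γ.base (sing : E × Bool → K →ₐ[F] _) v L
  rw [hL.filter, ← toConv_comulList] at h
  exact congrArg WithConv.ofConv h

lemma map_om (f : B →ₐ[F] B') (base : I → V) (a : I → K →ₐ[F] B) (v : V) (l : List I) (k : K) :
    f (om base a v l k) = om base (fun i => f.comp (a i)) v l k := by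
  have h : pc f (toConv (om base a v l)) = toConv (om base (fun i => f.comp (a i)) v l) := by
    rw [om_eq_filter, om_eq_filter, map_list_prod, map_map]
    rfl
  exact congr(($h).ofConv k)

lemma dlt_comulList (v : V) (y : K) {L : List (E × Bool)} (hL : Γ.IsOrder L) :
    dlt F K _ (comulList (Γ.cil v) y) =
      om Γ.base (star (s1 F K) (s2 F K) across_s1_s2) v L y := by
  have h : (fun i : E × Bool => (dlt F K (E × Bool)).comp (sing i)) =
      star (s1 F K) (s2 F K) across_s1_s2 :=
    funext (fun i => AlgHom.toLinearMap_injective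
      ((lext (fun k => dlt_sing_eq_rr (F := F) i k)).trans
        (star_toLinearMap (s1 F K) (s2 F K) across_s1_s2 i).symm))
  rw [← om_sing_order v hL, map_om, h]

lemma cmul_om_s1_s2 (v : V) (y : K) {L : List (E × Bool)} (hL : Γ.IsOrder L) :
    cmul (om Γ.base (s1 F K) v L) (om Γ.base (s2 F K) v L) y =
      tmap (comulList (Γ.cil v)) (comulList (Γ.cil v)) (comul (R := F) y) := by
  have h1 : ∀ y : K, om Γ.base (s1 F K) v L y = comulList (Γ.cil v) y ⊗ₜ 1 := by
    intro y
    rw [← om_sing_order v hL]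
    exact (map_om (inL : Ten F K (E × Bool) →ₐ[F] Ten2 F K (E × Bool))
      Γ.base _ v L y).symm
  have h2 : ∀ y : K, om Γ.base (s2 F K) v L y = 1 ⊗ₜ comulList (Γ.cil v) y := by
    intro y
    rw [← om_sing_order v hL]
    exact (map_om (inR : Ten F K (E × Bool) →ₐ[F] Ten2 F K (E × Bool))
      Γ.base _ v L y).symm
  change mul' F _ (tmap _ _ (comul (R := F) y)) = _
  generalize comul (R := F) y = t
  induction t <;> simp_all

lemma hatComul_comulList_mul (hR : IsRMatrix R) (v : V) (y : K) (k : Ten F K (E × Bool)) :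
    hatComul Γ R tw (comulList (Γ.cil v) y * k) =
      tmap (comulList (Γ.cil v)) (comulList (Γ.cil v)) (comul (R := F) y) *
        hatComul Γ R tw k := by
  have hL := Γ.isOrder_order
  rw [hatComul_apply, map_mul, dlt_comulList v y hL, Γ.braid_eq_braidL R hL, ← mul_assoc,
    braidL_mul_om_star hR slots_s1 slots_s2 across_s1_s2 v hL.nodup, cmul_om_s1_s2 v y hL,
    hatComul_apply, Γ.braid_eq_braidL R hL]
  simp only [mul_assoc]

lemma hatComul_mul_sing (hd : RibbonData R ν) (h : E × Bool) (y : K) (k : Ten F K (E × Bool)) :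
    hatComul Γ R tw (k * sing h y) =
      hatComul Γ R tw k * s12 F K h h (comulTw (tw h) y) := by
  rw [hatComul_apply, map_mul, dlt_sing, comulTw_apply, hatComul_apply]
  have h2 := twist_mul_s12 hd tw h y
  rw [mul_assoc _ (twist R tw), h2]
  simp only [mul_assoc]
  rfl

/-- The action of `K` at a vertex on the coalgebra `Hat`. -/
def vertexTrans (Γ : CilGraph V E) (hR : IsRMatrix R) (tw : E × Bool → Bool) (v : V) :
    K →ₗ[F] Hat Γ hR tw →ₗ[F] Hat Γ hR tw :=
  (LinearMap.mul F (Ten F K (E × Bool))).comp (comulList (Γ.cil v))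

lemma isTrans_vertexTrans (hR : IsRMatrix R) (v : V) :
    IsTrans (vertexTrans Γ hR tw v) (comul (R := F) (A := K)) where
  comul_apply y k := by
    have key : ∀ (t : K ⊗[F] K) (z : Ten2 F K (E × Bool)),
        tmap (comulList (Γ.cil v)) (comulList (Γ.cil v)) t * z =
        TensorProduct.map₂ ((LinearMap.mul F (Ten F K (E × Bool))).comp (comulList (Γ.cil v)))
          ((LinearMap.mul F (Ten F K (E × Bool))).comp (comulList (Γ.cil v))) t z := by
      intro t z
      induction t with
      | tmul y y' =>
        induction z using tind with
        | zero => simp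
        | add s s' hs hs' => simp only [map_add, mul_add, hs, hs']
        | tmul k k' => simp
      | _ => simp_all [add_mul, ladd]
    exact (hatComul_comulList_mul hR v y k).trans (key _ _)

/-- The right multiplication of `K` in the tensor factor of an edge end on the coalgebra `Hat`. -/
def endTrans (Γ : CilGraph V E) (hR : IsRMatrix R) (tw : E × Bool → Bool) (h : E × Bool) :
    K →ₗ[F] Hat Γ hR tw →ₗ[F] Hat Γ hR tw :=
  (LinearMap.mul F (Ten F K (E × Bool))).flip.comp (sing h).toLinearMap

lemma isTrans_endTrans (hd : RibbonData R ν) (h : E × Bool) :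
    IsTrans (endTrans Γ hd.rMat tw h) (comulTw (tw h)) where
  comul_apply y k := by
    have key : ∀ (t : K ⊗[F] K) (z : Ten2 F K (E × Bool)), z * s12 F K h h t =
        TensorProduct.map₂ ((LinearMap.mul F (Ten F K (E × Bool))).flip.comp (sing h).toLinearMap)
          ((LinearMap.mul F (Ten F K (E × Bool))).flip.comp (sing h).toLinearMap) t z := by
      intro t z
      induction t with
      | tmul y y' =>
        induction z using tind with
        | zero => simp
        | add s s' hs hs' => simp only [map_add, add_mul, hs, hs']
        | tmul k k' => simp [s12]
      | _ => simp_all [mul_add, ladd]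
    exact (hatComul_mul_sing hd h y k).trans (key _ _)

lemma comulTw_antipodeInv (hd : RibbonData R ν) (t : Bool) (y : K) :
    comulTw (F := F) (!t) (antipodeInv F K y) =
      tmap (antipodeInv F K) (antipodeInv F K) (comulTw t y) := by
  rw [comulTw_apply, comulTw_apply]
  cases t
  · simp [hd.comul_antipodeInv, flip_flip]
  · simp [hd.comul_antipodeInv, RibbonData.flip_map]

/-- The right multiplication by `S⁻¹(y)` in the tensor factor of an outgoing edge end. -/
lemma isTrans_endTrans_antipodeInv (hd : RibbonData R ν) (ρ : E → Bool) (e : E) :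
    IsTrans ((endTrans Γ hd.rMat (twistOf ρ) (e, false)).comp (antipodeInv F K))
      (comulTw (twistOf ρ (e, true))) where
  comul_apply y k := by
    have h1 : twistOf ρ (e, false) = !(twistOf ρ (e, true)) := by
      cases h : ρ e <;> simp [twistOf, h]
    rw [lcomp_apply, (isTrans_endTrans hd (e, false)).comul_apply, h1, comulTw_antipodeInv hd]
    generalize comulTw (F := F) (twistOf ρ (e, true)) y = t
    induction t <;> simp_all

end HatActions

section RelInduces

lemma pull_mul {C' : Type*} [AddCommGroup C'] [Module F C'] [Coalgebra F C'] {φ : C →ₗ[F] C'}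
    (hφ : ∀ c, comul (R := F) (φ c) = tmap φ φ (comul (R := F) c)) (f g : Cv F C' B) : toConv ((f * g).ofConv.comp φ) =
      (toConv (f.ofConv.comp φ) * toConv (g.ofConv.comp φ) : Cv F C B) := by
  ext c
  rw [convMul_apply]
  change (f * g : Cv F C' B) (φ c) = _
  rw [convMul_apply, hφ]
  generalize comul (R := F) c = z
  induction z <;> simp_all

lemma pull_list_prod {C' : Type*} [AddCommGroup C'] [Module F C'] [Coalgebra F C']
    {φ : C →ₗ[F] C'} (hφ : ∀ c, comul (R := F) (φ c) = tmap φ φ (comul (R := F) c))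
    (hε : ∀ c, counit (R := F) (φ c) = counit (R := F) c) (l : List (Cv F C' B)) :
    toConv (l.prod.ofConv.comp φ) =
      ((l.map (fun f => toConv (f.ofConv.comp φ))).prod : Cv F C B) := by
  induction l with
  | nil =>
    ext c
    exact congrArg (algebraMap F B) (hε c)
  | cons f l ih => rw [prod_cons, pull_mul hφ, ih, map_cons, prod_cons]

/-- Values of a vertex neighbourhood map on the edge ends that satisfy the relations of the new
graph, and are compatible with the gauge transformations and the edges. -/
structure RelData (hR : IsRMatrix R) (Γ : CilGraph V E) (Γ' : CilGraph V' E') (ρ : E → Bool)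
    (ρ' : E' → Bool) (g : V → Option V') (Z : E' × Bool → Ten F K (E × Bool) →ₗ[F] K) : Prop where
  inj : ∀ v w, g v = g w → g v ≠ none → v = w
  rel : VertexRel Γ' R (twistOf ρ') (fun x => ofT Γ hR (twistOf ρ) (Z x))
  vertex : ∀ x v y k, Z x (comulList (Γ.cil v) y * k) =
    if g v = some (Γ'.base x) then y * Z x k else counit (R := F) y • Z x k
  edge : ∀ e, (∀ x y k, Z x (k * sing (e, true) y) = Z x (k * sing (e, false) (antipodeInv F K y))) ∨
    ∃ e', ∀ b x y k, Z x (k * sing (e, b) y) =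
      if x = (e', b) then Z x k * y else counit (R := F) y • Z x k

lemma tenN_unglue (hd : RibbonData R ν) (d : E → K) :
    tenN F K E (unglue (ptprod F d)) =
      ptprod F (fun h : E × Bool => if h.2 then d h.1 else 1) := by
  rw [unglue_tprod, tenN, map_tprod]
  congr 1
  funext h
  split
  · rename_i hh
    simp [endN, hh]
  · exact hd.endN_one _

lemma glueH_tprod (m : E × Bool → K) : glueH F K E (ptprod F m) =
    ptprod F (fun e => m (e, true) * apd F (m (e, false))) := by
  rw [glueH_apply]
  have : (1 : Ten F K E) = ptprod F (fun _ => 1) := rfl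
  rw [this, actD_tprod_tprod]
  simp

lemma tprod_ends (m : E × Bool → K) : (ptprod F m : Ten F K (E × Bool)) =
    ((Finset.univ : Finset E).toList.map
      (fun e => sing (e, true) (m (e, true)) * sing (e, false) (m (e, false)))).prod := by
  have hf : IsFull ((Finset.univ : Finset E).toList.flatMap (fun e => [(e, true), (e, false)])) := by
    constructor
    · rw [List.nodup_flatMap]
      refine ⟨fun e _ => by simp, (Finset.nodup_toList _).imp ?_⟩
      intro a b hab x hx hx'
      simp only [mem_cons, List.not_mem_nil, or_false] at hx hx'
      rcases hx with rfl | rfl <;> simp [hab] at hx'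
    · rintro ⟨e, b⟩
      cases b <;> simp
  rw [tprod_eq_prod hf, list_prod_flatMap]
  simp

/-- A map that is invariant under moving elements between the ends of each edge factors
through `glueH`. -/
lemma factor_glueH (hd : RibbonData R ν) {M : Type*} [AddCommGroup M] [Module F M]
    (ξ : Ten F K (E × Bool) →ₗ[F] M) (h : ∀ e y k,
      ξ (k * sing (e, true) y) = ξ (k * sing (e, false) (antipodeInv F K y)))
    (k : Ten F K (E × Bool)) : ξ k = ξ (tenN F K E (unglue (glueH F K E k))) := by
  have key : ∀ (m : E × Bool → K) (l : List E), l.Nodup → ∀ k,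
      ξ (k * (l.map (fun e => sing (e, true) (m (e, true)) *
        sing (e, false) (m (e, false)))).prod) =
      ξ (k * (l.map (fun e => sing (e, true) (m (e, true) *
        apd F (m (e, false))))).prod) := by
    intro m l hl
    induction l with
    | nil => simp
    | cons e l ih =>
      intro k
      rw [nodup_cons] at hl
      have hc : ∀ b y, Commute (sing (e, b) y) ((l.map (fun e => sing (e, true) (m (e, true)) *
          sing (e, false) (m (e, false)))).prod : Ten F K (E × Bool)) := by
        intro b y
        apply list_prod_right
        intro z hz
        obtain ⟨f, hf, rfl⟩ := mem_map.1 hz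
        have hef : e ≠ f := fun h => hl.1 (by rw [h]; exact hf)
        exact (sing_commute (by simp [hef]) _ _).mul_right (sing_commute (by simp [hef]) _ _)
      rw [map_cons, prod_cons, map_cons, prod_cons, mul_assoc (sing (e, true) _),
        (hc false _).eq, ← mul_assoc, ← mul_assoc]
      have h1 := h e (apd F (m (e, false))) (k * sing (e, true) (m (e, true)) *
        (l.map (fun e => sing (e, true) (m (e, true)) * sing (e, false) (m (e, false)))).prod)
      rw [hd.antipodeInv_antipode] at h1
      rw [← h1, mul_assoc, ← (hc true _).eq, ← mul_assoc, mul_assoc k, ← map_mul, ih hl.2, mul_assoc]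
  have h1 : ξ = ξ.comp ((tenN F K E).comp (unglue.comp (glueH F K E))) := by
    ext m
    simp only [LinearMap.compMultilinearMap_apply, lcomp_apply]
    rw [glueH_tprod, tenN_unglue hd, tprod_ends, tprod_ends]
    have := key m _ (Finset.nodup_toList Finset.univ) 1
    rw [one_mul, one_mul] at this
    rw [this]
    simp
  exact congr($h1 k)

lemma glueH_surjective (hd : RibbonData R ν) :
    Function.Surjective (glueH F K E) := by
  intro d
  refine ⟨tenN F K E (unglue d), ?_⟩
  rw [hd.glueH_tenN, glue_unglue]

lemma glueH_mul_sing (hd : RibbonData R ν) (k : Ten F K (E × Bool)) (e : E) (y : K) :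
    glueH F K E (k * sing (e, true) y) = glueH F K E (k * sing (e, false) (antipodeInv F K y)) := by
  have h : ∀ x : Ten F K (E × Bool), glueH F K E (k * x) = actD F K E k (glueH F K E x) :=
    fun x => glueH_mul k x
  rw [h, h, glueH_apply, glueH_apply, actD_sing, actD_sing, endAct_true,
    endAct_false, hd.antipode_antipodeInv, one_mul, mul_one]

section Products

variable {T T' : K →ₗ[F] C →ₗ[F] C} {δ : K →ₗ[F] K ⊗[F] K}

lemma IsTrans.list_prod_left (hT : IsTrans T (comul (R := F) (A := K))) {f : I → Cv F C B}
    {a : I → K →ₗ[F] B} {l : List I} (hl : l.Nodup) (hf : ∀ i y c, f i (T y c) = a i y * f i c)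
    (hε : ∀ y c, counit (R := F) (T y c) = counit (R := F) y * counit (R := F) c)
    (h : ∀ i j, i ≠ j → ∀ y c, Commute (a i y) (f j c)) (y : K) (c : C) :
    (l.map f).prod (T y c) =
      (l.map (fun i => (toConv (a i) : Cv F K B))).prod y * (l.map f).prod c := by
  induction l generalizing y c with
  | cons i l ih =>
    rw [nodup_cons] at hl
    rw [map_cons, prod_cons, map_cons, prod_cons]
    rw [hT.mul_apply_left (hf i) (ih hl.2)]
    · rfl
    · intro y c
      apply Commute.symm
      have h2 : ∀ l' : List I, i ∉ l' → Commute (cst (f i c) : Cv F K B)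
          (l'.map (fun i => (toConv (a i) : Cv F K B))).prod := by
        intro l' hl'
        apply list_prod_right
        intro z hz
        obtain ⟨j, hj, rfl⟩ := mem_map.1 hz
        apply commute_cst
        intro k
        exact (h j i (fun h => hl' (by rw [← h]; exact hj)) k c).symm
      have := congr(($((h2 l hl.1).eq)).ofConv y)
      have h3 := cst_mul_apply (f i c) (l.map (fun i => (toConv (a i) : Cv F K B))).prod y
      have h4 := mul_cst_apply (f i c) (l.map (fun i => (toConv (a i) : Cv F K B))).prod y
      exact h3.symm.trans (this.trans h4)
  | _ => simp_all

lemma IsTrans.list_prod_congr (hT : IsTrans T δ) (hT' : IsTrans T' δ) {l : List (Cv F C B)}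
    (hf : ∀ f ∈ l, ∀ y c, f (T y c) = f (T' y c))
    (hε : ∀ y c, counit (R := F) (T y c) = counit (R := F) (T' y c)) (y : K) (c : C) :
    l.prod (T y c) = l.prod (T' y c) := by
  induction l generalizing y c with
  | cons f l ih =>
    rw [prod_cons]
    exact hT.mul_apply_congr hT' (hf f (by simp)) (ih (fun f hf' => hf f (by simp [hf']))) y c
  | _ => simp_all

lemma IsTrans.list_prod_right (hT : IsTrans T δ)
    (hl : ∀ y, (tlid F K) ((counit (R := F) (A := K)).rTensor K (δ y)) = y)
    (hr : ∀ y, (trid F K) ((counit (R := F) (A := K)).lTensor K (δ y)) = y)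
    [DecidableEq I] {f : I → Cv F C B} {a : K →ₗ[F] B} {i : I} {l : List I} (hn : l.Nodup)
    (hf : ∀ j y c, f j (T y c) = f j c * if j = i then a y else epsOne (F := F) y)
    (hε : ∀ y c, counit (R := F) (T y c) = counit (R := F) y * counit (R := F) c)
    (h : ∀ j, j ≠ i → ∀ y c, Commute (a y) (f j c)) (y : K) (c : C) :
    (l.map f).prod (T y c) = (l.map f).prod c * if i ∈ l then a y else epsOne (F := F) y := by
  have hcomm : ∀ (y : K) (b : B), Commute (epsOne (F := F) y : B) b := by
    intro y b
    exact epsAlg_commute y b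
  induction l generalizing y c with
  | nil => aesop
  | cons j l ih =>
    rw [nodup_cons] at hn
    rw [map_cons, prod_cons]
    have ih' := fun y c => ih hn.2 y c
    by_cases hj : j = i
    · subst hj
      have h1 : ∀ y c, (l.map f).prod (T y c) = (l.map f).prod c * epsOne (F := F) y := by
        intro y c
        rw [ih', if_neg hn.1]
      have h0 : ∀ y c, f j (T y c) = f j c * a y := by
        intro y c
        rw [hf, if_pos rfl]
      rw [hT.mul_apply_right h0 h1, mul_map_epsOne_right hr, if_pos (by simp)]
      intro y c
      have h2 : Commute (cst (a y) : Cv F C B) (l.map f).prod := by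
        apply Commute.list_prod_right
        intro z hz
        obtain ⟨k, hk, rfl⟩ := mem_map.1 hz
        apply commute_cst
        intro c
        exact h k (fun h => hn.1 (by rw [← h]; exact hk)) y c
      have := congr(($(h2.eq)).ofConv c)
      exact (cst_mul_apply (a y) (l.map f).prod c).symm.trans
        (this.trans (mul_cst_apply (a y) (l.map f).prod c))
    · have h0 : ∀ y c, f j (T y c) = f j c * epsOne (F := F) y := by
        intro y c
        rw [hf, if_neg hj]
      by_cases hi : i ∈ l
      · have h1 : ∀ y c, (l.map f).prod (T y c) = (l.map f).prod c * a y := by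
          intro y c
          rw [ih', if_pos hi]
        rw [hT.mul_apply_right h0 h1 (fun y c => hcomm y _), mul_map_epsOne_left hl,
          if_pos (by simp [hi])]
      · have h1 : ∀ y c, (l.map f).prod (T y c) = (l.map f).prod c * epsOne (F := F) y := by
          intro y c
          rw [ih', if_neg hi]
        rw [hT.mul_apply_right h0 h1 (fun y c => hcomm y _), mul_map_epsOne_left hl,
          if_neg (by simp [hi, Ne.symm hj])]

end Products

lemma epsT_comulList (l : List X) (y : K) :
    epsT (comulList l y : Ten F K X) = counit (R := F) y := by
  have h : pc epsT (toConv (comulList l : K →ₗ[F] Ten F K X)) = 1 := by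
    rw [toConv_comulList, map_list_prod, map_map]
    apply prod_eq_one
    intro z hz
    obtain ⟨x, -, rfl⟩ := mem_map.1 hz
    exact congrArg (fun f : K →ₐ[F] F => (toConv f.toLinearMap : Cv F K F)) (epsT_comp_sing x)
  exact congr(($h).ofConv y)

lemma counit_vertexTrans (hR : IsRMatrix R) (tw : E × Bool → Bool) (v : V) (y : K)
    (k : Hat Γ hR tw) : counit (R := F) (vertexTrans Γ hR tw v y k) =
      counit (R := F) y * counit (R := F) k := by
  rw [← epsT_comulList (Γ.cil v) y]
  exact map_mul (epsT : Ten F K (E × Bool) →ₐ[F] F) _ _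

lemma counit_endTrans (hR : IsRMatrix R) (tw : E × Bool → Bool) (h : E × Bool) (y : K)
    (k : Hat Γ hR tw) : counit (R := F) (endTrans Γ hR tw h y k) =
      counit (R := F) y * counit (R := F) k := by
  have h1 : (epsT : Ten F K (E × Bool) →ₐ[F] F) (sing h y) = counit (R := F) y :=
    DFunLike.congr_fun (epsT_comp_sing h) y
  rw [mul_comm, ← h1]
  exact map_mul (epsT : Ten F K (E × Bool) →ₐ[F] F) _ _

lemma exists_gaugeAlg (Γ : CilGraph V E) : ∃ f : Ten F K V →ₐ[F] Ten F K (E × Bool),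
    f.toLinearMap = Γ.gaugeComul ∧ ∀ v y, f (sing v y) = comulList (Γ.cil v) y := by
  have h : ∀ v, ∃ φ : K →ₐ[F] Ten F K (E × Bool), φ.toLinearMap = comulList (Γ.cil v) := by
    intro v
    obtain ⟨φ, hφ⟩ := exists_om (base := Γ.base) (slots_sing (F := F) (K := K)) v
      (Γ.isOrder_order).nodup
    exact ⟨φ, by rw [hφ, om_sing_order v Γ.isOrder_order]⟩
  choose φ hφ using h
  have hc : ∀ v w, v ≠ w → ∀ a b, Commute (φ v a) (φ w b) := by
    intro v w hvw a b
    have h1 : ∀ v a, φ v a = om Γ.base sing v (Γ.order.filter (fun h => decide (Γ.base h = v))) a := by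
      intro v a
      have h2 := om_eq_filter Γ.base (sing : E × Bool → K →ₐ[F] _) v
        (Γ.order.filter (fun h => decide (Γ.base h = v)))
      rw [List.filter_filter] at h2
      simp only [Bool.and_self] at h2
      rw [← om_eq_filter, om_sing_order v Γ.isOrder_order, ← hφ] at h2
      exact congr(($h2).ofConv a).symm
    rw [h1, h1]
    apply commute_om_om
    intro i hi j hj k k'
    rw [List.mem_filter] at hi hj
    apply sing_commute
    rintro rfl
    exact hvw ((by simpa using hi.2 : Γ.base i = v).symm.trans (by simpa using hj.2))
  refine ⟨prodLiftAlg φ hc, (prodLift_eq φ _ hc (fun v => (hφ v).symm)).symm, ?_⟩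
  intro v y
  rw [prodLiftAlg_sing, ← hφ]
  rfl

lemma exists_resAlg (g : V → Option V') (hg : ∀ v w, g v = g w → g v ≠ none → v = w) :
    ∃ f : Ten F K V →ₐ[F] Ten F K V', f.toLinearMap = resVertex g ∧
      ∀ v y, f (sing v y) = (g v).elim (epsOne (F := F) y) (fun v' => sing v' y) := by
  let φ : V → K →ₐ[F] Ten F K V' := fun v => (g v).elim epsAlg sing
  have hc : ∀ v w, v ≠ w → ∀ a b, Commute (φ v a) (φ w b) := by
    intro v w hvw a b
    simp only [φ]
    cases h1 : g v with
    | none => exact epsAlg_commute _ _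
    | some v' =>
      cases h2 : g w with
      | none => exact commute_epsAlg _ _
      | some w' =>
        apply sing_commute
        rintro rfl
        exact hvw (hg v w (h1.trans h2.symm) (by simp [h1]))
  refine ⟨prodLiftAlg φ hc, (prodLift_eq φ _ hc ?_).symm, ?_⟩
  · intro v
    simp only [φ]
    cases g v <;> rfl
  · intro v y
    rw [prodLiftAlg_sing]
    simp only [φ]
    cases g v <;> rfl

namespace RelData

variable {ρ : E → Bool} {ρ₀ : E' → Bool} {g : V → Option V'}
  {Z : E' × Bool → Ten F K (E × Bool) →ₗ[F] K}

/-- The map `K^{⊗2E} → K^{⊗2E'}` with components `Z`. -/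
def hatMap (hR : IsRMatrix R) (Γ : CilGraph V E) (Γ' : CilGraph V' E') (ρ : E → Bool)
    (Z : E' × Bool → Ten F K (E × Bool) →ₗ[F] K) : Ten F K (E × Bool) →ₗ[F] Ten F K (E' × Bool) :=
  (combine Γ' (fun x => ofT Γ hR (twistOf ρ) (Z x))).ofConv

lemma comul_hatMap {hR : IsRMatrix R} (hz : RelData hR Γ Γ' ρ ρ₀ g Z)
    (k : Ten F K (E × Bool)) : hatComul Γ' R (twistOf ρ₀) (hatMap hR Γ Γ' ρ Z k) =
      tmap (hatMap hR Γ Γ' ρ Z) (hatMap hR Γ Γ' ρ Z) (hatComul Γ R (twistOf ρ) k) := by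
  have h := congr(($(hz.rel.comul_combine)).ofConv k)
  refine h.symm.trans ?_
  refine (convMul_apply (C := Hat Γ hR (twistOf ρ)) _ _ k).trans ?_
  change mul' F _ (tmap _ _ (hatComul Γ R (twistOf ρ) k)) = _
  generalize hatComul Γ R (twistOf ρ) k = z
  induction z using tind with
  | tmul a b =>
    simp only [tmap_tmul, mul'_apply]
    change (hatMap hR Γ Γ' ρ Z a ⊗ₜ[F] (1 : Ten F K (E' × Bool))) *
      ((1 : Ten F K (E' × Bool)) ⊗ₜ[F] hatMap hR Γ Γ' ρ Z b) = _
    rw [tmul_mul_tmul, one_mul, mul_one]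
  | _ => simp_all

lemma co_hatMap {hR : IsRMatrix R} (hz : RelData hR Γ Γ' ρ ρ₀ g Z) (x : E' × Bool)
    (k : Ten F K (E × Bool)) : co x (hatMap hR Γ Γ' ρ Z k) = Z x k :=
  congr(($(hz.rel.pc_co_combine x)).ofConv k)

lemma epsT_hatMap {hR : IsRMatrix R} (hz : RelData hR Γ Γ' ρ ρ₀ g Z)
    (k : Ten F K (E × Bool)) : epsT (hatMap hR Γ Γ' ρ Z k) = epsT k :=
  congr(($(hz.rel.pc_epsT_combine)).ofConv k)

lemma hatMap_comulList_mul {hR : IsRMatrix R} (hz : RelData hR Γ Γ' ρ ρ₀ g Z) (v : V) (y : K)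
    (k : Ten F K (E × Bool)) : hatMap hR Γ Γ' ρ Z (comulList (Γ.cil v) y * k) =
      (g v).elim (epsOne (F := F) y) (fun v' => comulList (Γ'.cil v') y) * hatMap hR Γ Γ' ρ Z k := by
  let a : E' × Bool → K →ₗ[F] Ten F K (E' × Bool) := fun x =>
    if g v = some (Γ'.base x) then (sing x).toLinearMap else epsOne
  have hL := Γ'.isOrder_order
  have h := (isTrans_vertexTrans (Γ := Γ) (tw := twistOf ρ) hR v).list_prod_left
    (f := fun x : E' × Bool => pc (sing x) (ofT Γ hR (twistOf ρ) (Z x))) (a := a) hL.nodup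
    ?_ (counit_vertexTrans hR (twistOf ρ) v) ?_ y k
  · refine h.trans ?_
    congr 1
    cases hg : g v with
    | none =>
      have : Γ'.order.map (fun x => (toConv (a x) : Cv F K _)) = Γ'.order.map (fun _ => 1) := by
        aesop
      rw [this]
      simp
      rfl
    | some v' =>
      rw [Option.elim_some, ← om_sing_order v' hL]
      have := om_eq_filter Γ'.base (sing : E' × Bool → K →ₐ[F] _) v' Γ'.order
      have h2 : om Γ'.base (sing : E' × Bool → K →ₐ[F] _) v' Γ'.order y =
        (toConv (om Γ'.base (sing : E' × Bool → K →ₐ[F] _) v' Γ'.order)).ofConv y := rfl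
      rw [h2, toConv_om]
      congr 4
      funext x
      simp only [a, hg, atV, Option.some.injEq, eq_comm (a := v')]
      split <;> rfl
  · intro x y k
    refine (congrArg (sing x) (hz.vertex x v y k)).trans ?_
    simp only [a]
    split
    · rw [map_mul]
      rfl
    · rw [map_smul, Algebra.smul_def]
      rfl
  · intro i j hij y c
    simp only [a]
    split
    · exact sing_commute hij _ _
    · exact epsAlg_commute (F := F) y _

lemma glueH_hatMap_mul_sing {hd : RibbonData R ν} (hz : RelData hd.rMat Γ Γ' ρ ρ₀ g Z)
    (e : E) (y : K) (k : Ten F K (E × Bool)) :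
    glueH F K E' (hatMap hd.rMat Γ Γ' ρ Z (k * sing (e, true) y)) =
      glueH F K E' (hatMap hd.rMat Γ Γ' ρ Z (k * sing (e, false) (antipodeInv F K y))) := by
  rcases hz.edge e with h | ⟨e', h⟩
  · congr 1
    refine IsTrans.list_prod_congr (isTrans_endTrans hd (e, true))
      (isTrans_endTrans_antipodeInv hd ρ e) ?_ ?_ y k
    · intro f hf y k
      obtain ⟨x, -, rfl⟩ := mem_map.1 hf
      exact congrArg (sing x) (h x y k)
    · intro y c
      rw [counit_endTrans, lcomp_apply, counit_endTrans, hd.counit_antipodeInv]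
  · have key : ∀ b (y : K) k, hatMap hd.rMat Γ Γ' ρ Z (k * sing (e, b) y) =
        hatMap hd.rMat Γ Γ' ρ Z k * sing (e', b) y := by
      intro b y k
      have h1 := (isTrans_endTrans (Γ := Γ) (tw := twistOf ρ) hd (e, b)).list_prod_right
        (lid_counit_comulTw _) (rid_counit_comulTw _)
        (f := fun x : E' × Bool => pc (sing x) (ofT Γ hd.rMat (twistOf ρ) (Z x)))
        (a := (sing (e', b)).toLinearMap) (i := (e', b)) (Γ'.isOrder_order).nodup ?_
        (counit_endTrans hd.rMat (twistOf ρ) (e, b)) ?_ y k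
      · rw [if_pos ((Γ'.isOrder_order).mem _)] at h1
        exact h1
      · intro x y k
        refine (congrArg (sing x) (h b x y k)).trans ?_
        split
        · rename_i hx
          rw [map_mul, hx]
          rfl
        · rw [map_smul, Algebra.smul_def, Algebra.commutes]
          rfl
      · intro x hx y c
        exact sing_commute (Ne.symm hx) _ _
    rw [key, key, glueH_mul_sing hd]

lemma inducingPair {hd : RibbonData R ν} (hz : RelData hd.rMat Γ Γ' ρ ρ₀ g Z) :
    InducingPair hd.rMat Γ Γ' (twistOf ρ) g Z (hatMap hd.rMat Γ Γ' ρ Z)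
      ((glueH F K E').comp ((hatMap hd.rMat Γ Γ' ρ Z).comp ((tenN F K E).comp unglue))) := by
  have hglue : ∀ k, glueH F K E' (hatMap hd.rMat Γ Γ' ρ Z k) =
      ((glueH F K E').comp ((hatMap hd.rMat Γ Γ' ρ Z).comp ((tenN F K E).comp unglue)))
        (glueH F K E k) := fun k =>
    factor_glueH hd ((glueH F K E').comp (hatMap hd.rMat Γ Γ' ρ Z))
      (fun e y k => glueH_hatMap_mul_sing (hd := hd) hz e y k) k
  generalize (glueH F K E').comp ((hatMap hd.rMat Γ Γ' ρ Z).comp ((tenN F K E).comp unglue)) =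
    Fs at hglue
  refine ⟨?_, hglue, ?_, ?_, ?_⟩
  · intro β l hl
    have h1 := prod_coY Γ' hd.rMat (twistOf ρ₀) β (nodup_of_ordered hl) hl
    have h2 := pull_list_prod (C := Hat Γ hd.rMat (twistOf ρ))
      (C' := Hat Γ' hd.rMat (twistOf ρ₀)) (B := F)
      (φ := show Hat Γ hd.rMat (twistOf ρ) →ₗ[F] Hat Γ' hd.rMat (twistOf ρ₀) from
        hatMap hd.rMat Γ Γ' ρ Z)
      hz.comul_hatMap hz.epsT_hatMap
      (l.map (fun x => ofT Γ' hd.rMat (twistOf ρ₀) ((β x).comp (co x).toLinearMap)))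
    rw [h1, map_map] at h2
    refine h2.trans ?_
    congr 2
    funext x
    exact congrArg toConv (lext (fun k => congrArg (β x) (hz.co_hatMap x k)))
  · intro d
    obtain ⟨k, rfl⟩ := glueH_surjective hd d
    have h1 : (glueH F K E').comp (hatMap hd.rMat Γ Γ' ρ Z) = Fs.comp (glueH F K E) :=
      lext hglue
    rw [← hglue, ← map_glueH_hatComul hd Γ' ρ₀, ← map_glueH_hatComul hd Γ ρ, hz.comul_hatMap]
    refine (congr($(tmap_comp _ _ _ _) (hatComul Γ R (twistOf ρ) k))).symm.trans ?_
    rw [h1, tmap_comp]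
    rfl
  · intro d
    obtain ⟨k, rfl⟩ := glueH_surjective hd d
    rw [← hglue, RibbonData.epsT_glueH, RibbonData.epsT_glueH, hz.epsT_hatMap]
  · obtain ⟨γ, hγ, hγs⟩ := exists_gaugeAlg (F := F) (K := K) Γ
    obtain ⟨γ', hγ', hγs'⟩ := exists_gaugeAlg (F := F) (K := K) Γ'
    obtain ⟨r, hr, hrs⟩ := exists_resAlg (F := F) (K := K) g hz.inj
    have key : ∀ (h : Ten F K V) k, hatMap hd.rMat Γ Γ' ρ Z (γ h * k) =
        γ' (r h) * hatMap hd.rMat Γ Γ' ρ Z k := by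
      intro h
      induction h using ten_induction with
      | one => simp
      | smul c z hc => intro k; simp only [map_smul, smul_mul_assoc, hc]
      | add z w h1 h2 => intro k; simp only [map_add, add_mul, h1, h2]
      | mul v y z h1 =>
        intro k
        rw [map_mul γ, map_mul r, map_mul γ', mul_assoc, mul_assoc, hγs, hz.hatMap_comulList_mul, h1, hrs]
        congr 1
        cases g v with
        | none => exact (γ'.commutes _).symm
        | some v' => exact (hγs' v' y).symm
    intro h d
    obtain ⟨k, rfl⟩ := glueH_surjective hd d
    rw [← hγ, ← hγ', ← hr, ← glueH_mul, ← hglue, ← hglue, ← glueH_mul]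
    exact congrArg _ (key h k)

lemma induces [FiniteDimensional F K] {hd : RibbonData R ν}
    (hz : RelData hd.rMat Γ Γ' ρ ρ₀ g Z) (ρ' : E' → Bool)
    {W : E' × Bool → Ten F K (E × Bool) →ₗ[F] K}
    (hW : ∀ x k, endN F K x.2 (W x k) = Z x (tenN F K E k)) :
    Induces R Γ Γ' ρ ρ' (twistOf ρ) g W :=
  hd.induces ρ ρ' (inducingPair (hd := hd) hz) hW

end RelData

end RelInduces

/-! ### Relations for antipodes of edge end coordinates -/

section Antipode

variable (F K) in
/-- The flip as an algebra homomorphism. -/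
def flipAlg : K ⊗[F] K →ₐ[F] K ⊗[F] K := (acomm F K K).toAlgHom

lemma pc_flip_inl (f : Cv F C K) : pc (flipAlg F K) (pc inl f) = pc inr f := by
  rw [pc_pc]
  congr 2

lemma pc_flip_inr (f : Cv F C K) : pc (flipAlg F K) (pc inr f) = pc inl f := by
  rw [pc_pc]
  congr 2

lemma pc_flip_cst (t : K ⊗[F] K) :
    pc (flipAlg F K) (cst t : Cv F C (K ⊗[F] K)) = cst (flip t) := pc_cst _ _

/-- Composition with the antipode. -/
def apS (f : Cv F C K) : Cv F C K := toConv ((apd F).comp f.ofConv)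

lemma inr_mul_inl_apS {f g : Cv F C K} {t : K ⊗[F] K}
    (h : pc inr g * pc inl f = cst t * pc inl f * pc inr g) :
    pc inr g * pc inl (apS f) = pc inl (apS f) *
      cst (tmap (apd F) lid t) * pc inr g := by
  have h1 := lin_comp_mul (tmap (apd F) lid)
    (pc inr g) (pc inl f) (pc inr g) (pc inl (apS f)) (by
      intro a b
      change tmap _ _ ((1 ⊗ₜ[F] g a) * (f b ⊗ₜ[F] 1)) =
        (1 ⊗ₜ[F] g a) * (apd F (f b) ⊗ₜ[F] 1)
      simp)
  have h2 := lin_comp_mul ((tmap (apd F) lid).comp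
    (mulLeft F t)) (pc inl f) (pc inr g) (pc inl (apS f) *
      cst (tmap (apd F) lid t)) (pc inr g) (by
      intro a b
      rw [mul_cst_apply]
      change tmap (apd F) lid
          (t * ((f a ⊗ₜ[F] (1 : K)) * ((1 : K) ⊗ₜ[F] g b))) =
        (apd F (f a) ⊗ₜ[F] (1 : K)) * tmap
          (apd F) lid t * ((1 : K) ⊗ₜ[F] g b)
      clear h
      induction t <;> simp_all [add_mul, mul_add, antipode_mul_antidistrib])
  rw [← h1, ← h2, h, mul_assoc]
  ext c
  change tmap _ _ _ = tmap _ _ _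
  congr 1
  exact cst_mul_apply t _ c

lemma inl_mul_inr_apS {f g : Cv F C K} {t : K ⊗[F] K}
    (h : pc inl g * pc inr f = cst t * pc inr f * pc inl g) :
    pc inl g * pc inr (apS f) = pc inr (apS f) *
      cst (tmap lid (apd F) t) * pc inl g := by
  have h1 := congrArg (pc (flipAlg F K)) h
  simp only [map_mul, pc_flip_inl, pc_flip_inr, pc_flip_cst] at h1
  have h2 := congrArg (pc (flipAlg F K)) (inr_mul_inl_apS h1)
  simp only [map_mul, pc_flip_inl, pc_flip_inr, pc_flip_cst] at h2
  have h3 : ∀ t : K ⊗[F] K, flip (tmap (apd F)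
      lid (flip t)) = tmap lid (apd F) t := by
    intro t
    induction t <;> simp_all
  rw [h2, h3]

lemma apS_self {f : Cv F C K} {t : K ⊗[F] K}
    (h : pc inl f * pc inr f = pc (comulAlgHom F K) f * cst t) :
    pc inl (apS f) * pc inr (apS f) =
      cst (tmap (apd F) (apd F) t) *
        pc ((flipAlg F K).comp (comulAlgHom F K)) (apS f) := by
  have h1 := lin_comp_mul (tmap (apd F)
    (apd F)) (pc inl f) (pc inr f) (pc inl (apS f)) (pc inr (apS f)) (by
      intro a b
      change tmap _ _ ((f a ⊗ₜ[F] 1) * (1 ⊗ₜ[F] f b)) =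
        (apd F (f a) ⊗ₜ[F] 1) * (1 ⊗ₜ[F] apd F (f b))
      simp)
  rw [← h1, h]
  ext c
  rw [cst_mul_apply]
  change tmap _ _ ((pc (comulAlgHom F K) f * cst t).ofConv c) =
    _ * flip (comul (R := F) (apd F (f c)))
  rw [mul_cst_apply, comul_antipode, flip_flip]
  change tmap _ _ (comul (R := F) (f c) * t) = _
  have key : ∀ s t : K ⊗[F] K, tmap (apd F)
      (apd F) (s * t) =
      tmap (apd F) (apd F) t *
      tmap (apd F) (apd F) s := by
    intro s t
    induction s with
    | tmul p q =>
      induction t with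
      | zero => simp
      | add s s' hs hs' => simp only [map_add, add_mul, mul_add, hs, hs']
      | tmul p q => simp [antipode_mul_antidistrib]
    | _ => simp_all [add_mul, mul_add]
  exact key _ _

/-- The inverse of the R-matrix. -/
def rInv (R : K ⊗[F] K) : K ⊗[F] K := tmap (apd F) lid R

lemma rInv_eq_rr (R : K ⊗[F] K) : rInv R = rr R ((inl : K →ₐ[F] K ⊗[F] K).toLinearMap.comp
    (apd F)) (inr : K →ₐ[F] K ⊗[F] K).toLinearMap := by
  rw [rInv, map_eq_rr]
  rfl

lemma IsRMatrix.rInv_mul (hR : IsRMatrix R) : rInv R * R = 1 := by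
  have h := hR.rr_antipode_mul (inl : K →ₐ[F] K ⊗[F] K) inr inl_inr_commute
  rwa [rr_inl_inr, ← rInv_eq_rr] at h

lemma IsRMatrix.mul_rInv (hR : IsRMatrix R) : R * rInv R = 1 := by
  have h := hR.rr_mul_antipode (inl : K →ₐ[F] K ⊗[F] K) inr inl_inr_commute
  rwa [rr_inl_inr, ← rInv_eq_rr] at h

lemma IsRMatrix.map_id_antipode_rInv (hR : IsRMatrix R) :
    tmap lid (apd F) (rInv R) = R := by
  conv_rhs => rw [← hR.map_antipode]
  rw [rInv, ← lcomp_apply, ← tmap_comp]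
  rfl

lemma IsRMatrix.cst_rInv_mul (hR : IsRMatrix R) :
    (cst (rInv R) * cst R : Cv F C (K ⊗[F] K)) = 1 := by
  rw [← map_mul, hR.rInv_mul, map_one]

lemma IsRMatrix.cst_flip_rInv_mul (hR : IsRMatrix R) :
    (cst (flip (rInv R)) * cst (flip R) : Cv F C (K ⊗[F] K)) = 1 := by
  rw [← map_mul, ← flip_mul, hR.rInv_mul, flip_one, map_one]

lemma IsRMatrix.cst_mul_flip_rInv (hR : IsRMatrix R) :
    (cst (flip R) * cst (flip (rInv R)) : Cv F C (K ⊗[F] K)) = 1 := by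
  rw [← map_mul, ← flip_mul, hR.mul_rInv, flip_one, map_one]

lemma IsRMatrix.cst_mul_pc_comul (hR : IsRMatrix R) (f : Cv F C K) :
    cst R * pc (comulAlgHom F K) f = pc ((flipAlg F K).comp (comulAlgHom F K)) f * cst R := by
  ext c
  rw [cst_mul_apply, mul_cst_apply]
  exact hR.mul_comul (f c)

lemma IsRMatrix.cst_flip_mul_pc_comul (hR : IsRMatrix R) (f : Cv F C K) :
    cst (flip R) * pc ((flipAlg F K).comp (comulAlgHom F K)) f =
      pc (comulAlgHom F K) f * cst (flip R) := by
  ext c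
  rw [cst_mul_apply, mul_cst_apply]
  have := congrArg flip (hR.mul_comul (f c))
  rw [flip_mul, flip_mul, flip_flip] at this
  exact this

section Pair

/-- The exchange relations between the coordinates `f` and `g` of two edge ends, where the one of
`f` is before the one of `g`. -/
def Exch (R : K ⊗[F] K) (f g : Cv F C K) : Prop := pc inr g * pc inl f = cst R * pc inl f * pc inr g

/-- Commutation of different legs. -/
structure Indep (f g : Cv F C K) : Prop where
  left : Commute (pc inl f) (pc inr g)
  right : Commute (pc inl g) (pc inr f)

lemma Indep.symm {f g : Cv F C K} (h : Indep f g) : Indep g f := ⟨h.right, h.left⟩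

lemma Indep.of_left {f g : Cv F C K} (h : Commute (pc inl f) (pc inr g)) : Indep f g := by
  refine ⟨h, ?_⟩
  have := congrArg (pc (flipAlg F K)) h.eq
  simp only [map_mul, pc_flip_inl, pc_flip_inr] at this
  exact this.symm

lemma Indep.apS {f g : Cv F C K} (h : Indep f g) : Indep (apS f) g := by
  refine (Indep.of_left (Commute.symm ?_)).symm.symm
  have h1 : pc inr g * pc inl f = cst 1 * pc inl f * pc inr g := by rw [map_one, one_mul, h.left.eq]
  have h2 := inr_mul_inl_apS h1
  have h3 : tmap (apd F) lid (1 : K ⊗[F] K) = 1 := by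
    rw [tone_def, tmap_tmul]
    simp
  rw [h3, map_one, mul_one] at h2
  exact h2

lemma Indep.mul {f f' g : Cv F C K} (h : Indep f g) (h' : Indep f' g) : Indep (f * f') g := by
  refine ⟨?_, ?_⟩
  · rw [map_mul]
    exact h.left.mul_left h'.left
  · rw [map_mul]
    exact h.right.mul_right h'.right

lemma commute_inl_inr_cst (f : Cv F C K) (b : K) :
    Commute (pc inl f) (pc inr (cst b : Cv F C K)) := by
  rw [pc_cst]
  exact (commute_cst (fun c => (inl_inr_commute (f c) b).symm)).symm

lemma Indep.cst (b : K) (g : Cv F C K) : Indep (cst b) g :=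
  ⟨by
    rw [pc_cst]
    exact commute_cst (fun c => inl_inr_commute b (g c)), commute_inl_inr_cst g b⟩

lemma exch_apS_right (hR : IsRMatrix R) {f g : Cv F C K} (h : Exch R f g) :
    pc inr g * pc inl (apS f) = pc inl (apS f) * cst (rInv R) * pc inr g :=
  inr_mul_inl_apS h

lemma exch_inv (hR : IsRMatrix R) {f g : Cv F C K} (h : Exch R f g) :
    pc inl f * pc inr g = cst (rInv R) * pc inr g * pc inl f := by
  rw [mul_assoc, h, ← mul_assoc, ← mul_assoc, hR.cst_rInv_mul, one_mul]

lemma exch_apS_left (hR : IsRMatrix R) {f g : Cv F C K} (h : Exch R f g) :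
    pc inl f * pc inr (apS g) = pc inr (apS g) * cst R * pc inl f := by
  rw [inl_mul_inr_apS (exch_inv hR h), hR.map_id_antipode_rInv]

/-- `S(f) * g` for the coordinates `f` and `g` of two edge ends, with that of `f` first. -/
lemma self_apS_mul_gt (hR : IsRMatrix R) {f g : Cv F C K} (h : Exch R f g) :
    pc inl (apS f * g) * pc inr (apS f * g) = pc inl (apS f) * pc inr (apS f) *
      cst (flip (rInv R)) * (pc inl g * pc inr g) := by
  have h1 := congrArg (pc (flipAlg F K)) (exch_apS_right hR h)
  simp only [map_mul, pc_flip_inl, pc_flip_inr, pc_flip_cst] at h1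
  rw [map_mul, map_mul, mul_assoc, ← mul_assoc (pc inl g), h1]
  simp only [mul_assoc]

lemma self_apS_mul_lt (hR : IsRMatrix R) {f g : Cv F C K} (h : Exch R g f) :
    pc inl (apS f * g) * pc inr (apS f * g) = pc inl (apS f) * pc inr (apS f) *
      cst R * (pc inl g * pc inr g) := by
  rw [map_mul, map_mul, mul_assoc, ← mul_assoc (pc inl g), exch_apS_left hR h]
  simp only [mul_assoc]

/-- `f` is the coordinate of an edge end, with a twisted multiplication if `t` is true. -/
def SelfRel (R : K ⊗[F] K) (t : Bool) (f : Cv F C K) : Prop :=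
  pc inl f * pc inr f = pc (comulAlgHom F K) f * cst (if t then flip R else 1)

lemma SelfRel.apS_true (hR : IsRMatrix R) {f : Cv F C K} (h : SelfRel R true f) :
    pc inl (apS f) * pc inr (apS f) = pc (comulAlgHom F K) (apS f) * cst (flip R) := by
  rw [apS_self h, if_pos rfl, ← RibbonData.flip_map, hR.map_antipode, hR.cst_flip_mul_pc_comul]

lemma SelfRel.apS_false {f : Cv F C K} (h : SelfRel R false f) :
    pc inl (apS f) * pc inr (apS f) = pc ((flipAlg F K).comp (comulAlgHom F K)) (apS f) := by
  rw [apS_self h, if_neg (by simp), tone_def, tmap_tmul,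
    HopfAlgebra.antipode_one, ← tone_def, map_one, one_mul]

end Pair

end Antipode

section Evaluate

/-- `(f ⊗ g) ∘ Δ`. -/
def mapDlt (f : Ten F K X →ₐ[F] B) (g : Ten F K X →ₐ[F] B') : Ten F K X →ₐ[F] B ⊗[F] B' :=
  (amap f g).comp (dlt F K X)

lemma mapDlt_sing_left {f : Ten F K X →ₐ[F] B} {g : Ten F K X →ₐ[F] B'} {x : X}
    (h : g.comp (sing x) = epsAlg) : (mapDlt f g).comp (sing x) =
      (inL : B →ₐ[F] B ⊗[F] B').comp (f.comp (sing x)) := by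
  ext k
  have h1 : ∀ k, g (sing x k) = algebraMap F B' (counit (R := F) k) := fun k => congr($h k)
  have h2 := rid_counit_comul (F := F) k
  change tmap f.toLinearMap g.toLinearMap (dlt F K X (sing x k)) =
    f (sing x k) ⊗ₜ[F] 1
  conv_rhs => rw [← h2]
  rw [dlt_sing]
  generalize comul (R := F) k = t
  induction t <;>
    simp_all [TensorProduct.add_tmul, h1, algebraMap_eq_smul_one, TensorProduct.smul_tmul]

lemma mapDlt_sing_right {f : Ten F K X →ₐ[F] B} {g : Ten F K X →ₐ[F] B'} {x : X}
    (h : f.comp (sing x) = epsAlg) : (mapDlt f g).comp (sing x) =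
      (inR : B' →ₐ[F] B ⊗[F] B').comp (g.comp (sing x)) := by
  ext k
  have h1 : ∀ k, f (sing x k) = algebraMap F B (counit (R := F) k) := fun k => congr($h k)
  have h2 := lid_counit_comul (F := F) k
  change tmap f.toLinearMap g.toLinearMap (dlt F K X (sing x k)) =
    1 ⊗ₜ[F] g (sing x k)
  conv_rhs => rw [← h2]
  rw [dlt_sing]
  generalize comul (R := F) k = t
  induction t <;>
    simp_all [TensorProduct.tmul_add, h1, algebraMap_eq_smul_one, TensorProduct.smul_tmul]

lemma map_hatComul_eq_dlt (hR : IsRMatrix R) (f : Ten F K (E × Bool) →ₐ[F] B)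
    (g : Ten F K (E × Bool) →ₐ[F] B')
    (h : ∀ j i, Γ.Lt j i → f.comp (sing i) = epsAlg ∨ g.comp (sing j) = epsAlg)
    (h' : ∀ x, tw x → f.comp (sing x) = epsAlg ∨ g.comp (sing x) = epsAlg)
    (k : Ten F K (E × Bool)) : tmap f.toLinearMap g.toLinearMap (hatComul Γ R tw k) = mapDlt f g k := by
  have hk : mapDlt f g k = tmap f.toLinearMap g.toLinearMap (dlt F K _ k) := rfl
  rw [hk, ← lam_tensor, ← lam_tensor, hatComul_apply, map_mul, map_mul, lam_braid_eq_one,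
    lam_twist_eq_one, one_mul, mul_one]
  · exact fun y hy => (h' y hy).elim (fun h => rr_eq_one_right hR (by rw [comp_assoc, h, comp_epsAlg]))
      fun h => rr_eq_one_left hR (by rw [comp_assoc, h, comp_epsAlg])
  · exact fun j i hji => (h j i hji).elim
      (fun h => rr_eq_one_right hR (by rw [comp_assoc, h, comp_epsAlg]))
      fun h => rr_eq_one_left hR (by rw [comp_assoc, h, comp_epsAlg])

lemma algHom_tprod {l : List X} (hl : IsFull l) (f : Ten F K X →ₐ[F] B) (m : X → K) :
    f (ptprod F m) = (l.map (fun x => f.comp (sing x) (m x))).prod := by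
  rw [tprod_eq_prod hl, map_list_prod, map_map]
  rfl

end Evaluate

/-! ### Coordinates transported along an edge -/

section Transport

lemma Exch.mul_right {f g X : Cv F C K} (h : Exch R f g) (hX : Indep f X) : Exch R f (g * X) := by
  rw [Exch, map_mul, mul_assoc, ← hX.left.eq, ← mul_assoc, h, mul_assoc]

lemma Exch.mul_left {f g X : Cv F C K} (h : Exch R g f) (hX : Indep f X) : Exch R (g * X) f := by
  rw [Exch, map_mul, ← mul_assoc, h, mul_assoc _ _ (pc inl X), ← hX.right.eq]
  simp only [mul_assoc]

lemma commute_cst_of_central {b : B} (hb : ∀ x, Commute b x) (f : Cv F C B) : Commute (cst b) f :=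
  commute_cst fun c => hb (f c)

lemma inl_central {n : K} (hn : ∀ x, Commute n x) (t : K ⊗[F] K) : Commute (inl (F := F) n) t := by
  induction t with
  | tmul p q => exact tmul_commute (hn p) (one_left _)
  | _ => simp_all

lemma inr_central {n : K} (hn : ∀ x, Commute n x) (t : K ⊗[F] K) : Commute (inr (F := F) n) t := by
  induction t with
  | tmul p q => exact tmul_commute (one_left _) (hn q)
  | _ => simp_all

lemma Exch.cst_right {f g : Cv F C K} {n : K} (hn : ∀ x, Commute n x) (h : Exch R f g) :
    Exch R f (cst n * g) := by
  rw [Exch, map_mul, pc_cst, mul_assoc, h, ← mul_assoc,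
    (commute_cst_of_central (inr_central hn) (cst R * pc inl f)).eq, mul_assoc]

lemma Exch.cst_left {f g : Cv F C K} {n : K} (hn : ∀ x, Commute n x) (h : Exch R f g) :
    Exch R (cst n * f) g := by
  rw [Exch, map_mul, pc_cst, ← mul_assoc, ← (commute_cst_of_central (inl_central hn) (pc inr g)).eq,
    mul_assoc, h, ← mul_assoc, ← mul_assoc, ← mul_assoc, (commute_cst_of_central (inl_central hn)
    (cst R)).eq]

lemma self_cst_mul {n : K} (f : Cv F C K) (hn : ∀ x, Commute n x) :
    pc inl (cst n * f) * pc inr (cst n * f) = cst (n ⊗ₜ[F] n) * (pc inl f * pc inr f) := by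
  have h : (n ⊗ₜ[F] n : K ⊗[F] K) = inl n * inr n := by simp
  rw [map_mul, map_mul, pc_cst, pc_cst, h, map_mul, mul_assoc, ← mul_assoc (pc inl f),
    ← (commute_cst_of_central (inr_central hn) (pc inl f)).eq]
  simp only [mul_assoc]

lemma self_mul_indep {f g : Cv F C K} (h : Indep f g) : pc inl (f * g) * pc inr (f * g) =
    pc inl f * pc inr f * (pc inl g * pc inr g) := by
  rw [map_mul, map_mul, mul_assoc, ← mul_assoc (pc inl g), h.right.eq]
  simp only [mul_assoc]

lemma self_cst (c : K) : pc inl (cst c : Cv F C K) * pc inr (cst c) = cst (c ⊗ₜ[F] c) := by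
  rw [pc_cst, pc_cst, ← map_mul]
  simp

/-- `p` transported along an edge with end coordinates `p` and `f`, to an edge end with
coordinate `q` at the vertex of `f`. -/
def transport (n c : K) (p f q : Cv F C K) : Cv F C K := cst n * (p * (cst c * (apS f * q)))

/-- The central factor in `transport`: `1` if the end of `f` is before the one of `q`, and `ν⁻¹` if
it is after it. -/
structure TransportFactor (R : K ⊗[F] K) (ν n : K) (f q : Cv F C K) : Prop where
  or : (Exch R f q ∧ n = 1) ∨ (Exch R q f ∧ n = Ring.inverse ν)

lemma TransportFactor.central (hd : RibbonData R ν) {n : K} {f q : Cv F C K}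
    (h : TransportFactor R ν n f q) (x : K) : Commute n x := by
  rcases h.or with ⟨_, rfl⟩ | ⟨_, rfl⟩
  · exact one_left _
  · exact hd.inverse_central x

lemma TransportFactor.counit (hd : RibbonData R ν) {n : K} {f q : Cv F C K}
    (h : TransportFactor R ν n f q) : counit (R := F) n = 1 := by
  rcases h.or with ⟨_, rfl⟩ | ⟨_, rfl⟩
  · exact Bialgebra.counit_one
  · exact hd.counit_inverse

lemma SelfRel.core (hR : IsRMatrix R) {f : Cv F C K} {t : Bool} (hf : SelfRel R t f) {c : K}
    (hc : comul (R := F) c = c ⊗ₜ[F] c) :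
    cst (if !t then flip R else 1) * cst (c ⊗ₜ[F] c) * (pc inl (apS f) * pc inr (apS f)) =
      pc (comulAlgHom F K) (cst c * apS f) * cst (flip R) := by
  cases t with
  | true =>
    rw [hf.apS_true hR, map_mul, pc_cst]
    have : comulAlgHom F K c = c ⊗ₜ[F] c := hc
    rw [this]
    simp [mul_assoc]
  | false =>
    have h1 : ((flipAlg F K).comp (comulAlgHom F K)) c = c ⊗ₜ[F] c := by
      change flip (comul (R := F) c) = _
      rw [hc, flip_tmul]
    rw [hf.apS_false, ← h1, ← pc_cst, mul_assoc, ← map_mul, if_pos (by simp),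
      hR.cst_flip_mul_pc_comul]

lemma cst_twist_commute (hR : IsRMatrix R) (f : Cv F C K) :
    Commute (cst (flip R * R)) (pc (comulAlgHom F K) f) := by
  rw [Commute, SemiconjBy, map_mul, mul_assoc, hR.cst_mul_pc_comul, ← mul_assoc,
    hR.cst_flip_mul_pc_comul, mul_assoc]

lemma SelfRel.transport (hd : RibbonData R ν) {n c : K} {p f q : Cv F C K} {t t' : Bool}
    (hf : SelfRel R t f) (hp : SelfRel R (!t) p) (hq : SelfRel R t' q)
    (hc : comul (R := F) c = c ⊗ₜ[F] c) (hn : TransportFactor R ν n f q)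
    (h : Indep p (apS f * q)) : SelfRel R t' (transport n c p f q) := by
  have hR := hd.rMat
  have h1 : Indep p (cst c * (apS f * q)) := ((Indep.cst c p).mul h.symm).symm
  have hcore := hf.core hR hc
  have h2 : ∀ A : K ⊗[F] K, pc inl (apS f * q) * pc inr (apS f * q) =
      pc inl (apS f) * pc inr (apS f) * cst A * (pc inl q * pc inr q) →
      pc inl (p * (cst c * (apS f * q))) * pc inr (p * (cst c * (apS f * q))) =
      pc (comulAlgHom F K) (p * (cst c * apS f)) * cst (flip R * A) *
        pc (comulAlgHom F K) q * cst (if t' then flip R else 1) := by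
    intro A hA
    rw [self_mul_indep h1, self_mul_indep (Indep.cst c _), self_cst, hA, hp, hq]
    calc _ = pc (comulAlgHom F K) p * (cst (if !t then flip R else 1) * cst (c ⊗ₜ[F] c) *
          (pc inl (apS f) * pc inr (apS f))) * cst A *
          (pc (comulAlgHom F K) q * cst (if t' then flip R else 1)) := by simp only [mul_assoc]
      _ = _ := by simp_all [map_mul, mul_assoc]
  have hmul : p * (cst c * (apS f * q)) = p * (cst c * apS f) * q := by simp only [mul_assoc]
  rw [SelfRel, HopfGauge.transport, self_cst_mul _ (hn.central hd)]
  rcases hn.or with ⟨hx, rfl⟩ | ⟨hx, rfl⟩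
  · rw [h2 _ (self_apS_mul_gt hR hx), map_mul cst (flip R), hR.cst_mul_flip_rInv, mul_one, hmul, ←
      tone_def, map_one, map_one, one_mul, one_mul, map_mul (pc (comulAlgHom F K)) _ q]
  · have h3 : comulAlgHom F K (Ring.inverse ν) =
        (Ring.inverse ν ⊗ₜ[F] Ring.inverse ν) * (flip R * R) := hd.comul_inverse
    rw [h2 _ (self_apS_mul_lt hR hx), hmul, map_mul (pc (comulAlgHom F K)) (cst _), pc_cst, h3,
      map_mul cst (_ ⊗ₜ _), map_mul (pc (comulAlgHom F K)) (p * _),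
      ← (cst_twist_commute hR (p * (cst c * apS f))).eq]
    simp only [mul_assoc]

lemma pc_counit_apS {f : Cv F C K} (h : pc (counitAlgHom F K) f = 1) :
    pc (counitAlgHom F K) (apS f) = 1 := by
  rw [← h]
  ext c
  exact HopfAlgebra.counit_antipode (R := F) (f c)

lemma pc_counit_transport (hd : RibbonData R ν) {n c : K} {p f q : Cv F C K}
    (hp : pc (counitAlgHom F K) p = 1) (hf : pc (counitAlgHom F K) f = 1)
    (hq : pc (counitAlgHom F K) q = 1) (hc : counit (R := F) c = 1)
    (hn : TransportFactor R ν n f q) : pc (counitAlgHom F K) (transport n c p f q) = 1 := by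
  have h1 : counitAlgHom F K c = 1 := hc
  have h2 : counitAlgHom F K n = 1 := hn.counit hd
  simp only [transport, map_mul, pc_cst, h1, h2, map_one, hp, hq, pc_counit_apS hf, mul_one]

lemma Exch.transport_right (hd : RibbonData R ν) {n c : K} {p f q k : Cv F C K}
    (hn : TransportFactor R ν n f q) (h : Exch R k p) (hk : Indep k (apS f * q)) :
    Exch R k (transport n c p f q) :=
  (h.mul_right ((Indep.cst c k).mul hk.symm).symm).cst_right (hn.central hd)

lemma Exch.transport_left (hd : RibbonData R ν) {n c : K} {p f q k : Cv F C K}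
    (hn : TransportFactor R ν n f q) (h : Exch R p k) (hk : Indep k (apS f * q)) :
    Exch R (transport n c p f q) k :=
  (h.mul_left ((Indep.cst c k).mul hk.symm).symm).cst_left (hn.central hd)

lemma indep_transport {n c : K} {p f q k : Cv F C K} (h : Indep p k) (hk : Indep (apS f * q) k) :
    Indep (transport n c p f q) k :=
  (Indep.cst n k).mul (h.mul ((Indep.cst c k).mul hk))

/-- The coordinates of two adjacent edge ends give an element that commutes with the other ones. -/
lemma indep_adjacent (hR : IsRMatrix R) {f q k : Cv F C K}
    (h : (Exch R k f ∧ Exch R k q) ∨ (Exch R f k ∧ Exch R q k) ∨ (Indep f k ∧ Indep q k)) :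
    Indep (apS f * q) k := by
  rcases h with ⟨h1, h2⟩ | ⟨h1, h2⟩ | ⟨h1, h2⟩
  · refine (Indep.of_left ?_).symm
    rw [map_mul, Commute, SemiconjBy, ← mul_assoc, exch_apS_left hR h1, mul_assoc _ (pc inr q), h2]
    simp only [mul_assoc]
  · refine Indep.of_left ?_
    rw [map_mul, Commute, SemiconjBy, ← mul_assoc (pc inr k), exch_apS_right hR h1, mul_assoc _ (pc
      inr k), h2, mul_assoc, mul_assoc (cst R), mul_assoc _ (cst (rInv R)), ← mul_assoc (cst (rInv
      R)), hR.cst_rInv_mul, one_mul]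
  · exact h1.apS.mul h2

lemma exch_transport_transport_aux (hR : IsRMatrix R) {c : K} {p f q₁ q₂ : Cv F C K} {t : Bool}
    (hf : SelfRel R t f) (hp : SelfRel R (!t) p) (hc : comul (R := F) c = c ⊗ₜ[F] c)
    (hpf : Indep p f) (hp₁ : Indep p q₁) (hp₂ : Indep p q₂) {A₁ A₂ : K ⊗[F] K}
    (h₁ : pc inr q₁ * pc inl (apS f) = pc inl (apS f) * cst A₁ * pc inr q₁)
    (h₂ : pc inr q₂ * pc inl (apS f) = pc inl (apS f) * cst A₂ * pc inr q₂)
    (h : cst A₂ * pc inr q₂ * pc inl q₁ = cst (flip R) * cst (flip A₁) * pc inl q₁ * pc inr q₂) :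
    Exch R (p * (cst c * apS f) * q₁) (p * (cst c * apS f) * q₂) := by
  have hcore := hf.core hR hc
  have hps : Indep p (cst c * apS f) := ((Indep.cst c p).mul hpf.symm.apS).symm
  have hW : pc inl (p * (cst c * apS f)) * pc inr (p * (cst c * apS f)) =
      pc (comulAlgHom F K) (p * (cst c * apS f)) * cst (flip R) := by
    rw [self_mul_indep hps, self_mul_indep (Indep.cst c _), self_cst, hp,
      map_mul (pc (comulAlgHom F K)) p, mul_assoc, mul_assoc, ← hcore]
    simp only [mul_assoc]
  have move : ∀ {q : Cv F C K} {A : K ⊗[F] K}, Indep p q →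
      pc inr q * pc inl (apS f) = pc inl (apS f) * cst A * pc inr q →
      pc inr q * pc inl (p * (cst c * apS f)) =
        pc inl (p * (cst c * apS f)) * cst A * pc inr q := by
    intro q A hq hA
    rw [map_mul, map_mul, ← mul_assoc, ← hq.left.eq, mul_assoc, ← mul_assoc (pc inr q),
      ← (Indep.cst c q).left.eq, mul_assoc _ (pc inr q), hA]
    simp only [mul_assoc]
  generalize p * (cst c * apS f) = W at hW move
  have hW' : pc inr W * pc inl W = pc ((flipAlg F K).comp (comulAlgHom F K)) W * cst R := by
    have := congrArg (pc (flipAlg F K)) hW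
    rw [map_mul, map_mul, pc_flip_inl, pc_flip_inr, pc_flip_cst, flip_flip] at this
    exact this
  have hWW : cst R * (pc inl W * pc inr W) = pc inr W * pc inl W * cst (flip R) := by
    rw [hW, hW', ← mul_assoc, hR.cst_mul_pc_comul]
  have m₂ := move hp₂ h₂
  have m₁ : pc inl q₁ * pc inr W = pc inr W * cst (flip A₁) * pc inl q₁ := by
    have := congrArg (pc (flipAlg F K)) (move hp₁ h₁)
    rw [map_mul, map_mul, map_mul, pc_flip_inl, pc_flip_inr, pc_flip_cst] at this
    exact this
  calc pc inr (W * q₂) * pc inl (W * q₁)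
      = pc inr W * (pc inr q₂ * pc inl W) * pc inl q₁ := by
        rw [map_mul, map_mul]
        simp only [mul_assoc]
    _ = pc inr W * pc inl W * (cst A₂ * pc inr q₂ * pc inl q₁) := by
        rw [m₂]
        simp only [mul_assoc]
    _ = pc inr W * pc inl W * cst (flip R) * cst (flip A₁) * pc inl q₁ * pc inr q₂ := by
        rw [h]
        simp only [mul_assoc]
    _ = cst R * pc inl W * (pc inr W * cst (flip A₁) * pc inl q₁) * pc inr q₂ := by
        rw [← hWW]
        simp only [mul_assoc]
    _ = _ := by
        rw [← m₁, map_mul, map_mul]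
        simp only [mul_assoc]

/-- The exchange relations between two transported coordinates, where the ends that were after the
end of the edge are now before the ones that were before it. -/
lemma exch_transport_transport (hR : IsRMatrix R) {n₁ n₂ c : K} {p f q₁ q₂ : Cv F C K} {t : Bool}
    (hf : SelfRel R t f) (hp : SelfRel R (!t) p) (hc : comul (R := F) c = c ⊗ₜ[F] c)
    (hn₁ : ∀ x, Commute n₁ x) (hn₂ : ∀ x, Commute n₂ x)
    (hpf : Indep p f) (hp₁ : Indep p q₁) (hp₂ : Indep p q₂)
    (h : (Exch R f q₁ ∧ Exch R f q₂ ∧ Exch R q₁ q₂) ∨ (Exch R q₁ f ∧ Exch R q₂ f ∧ Exch R q₁ q₂) ∨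
      (Exch R f q₁ ∧ Exch R q₂ f ∧ Exch R q₂ q₁)) :
    Exch R (transport n₁ c p f q₁) (transport n₂ c p f q₂) := by
  have gt : ∀ {q : Cv F C K}, Exch R f q →
      pc inr q * pc inl (apS f) = pc inl (apS f) * cst (rInv R) * pc inr q :=
    fun h => exch_apS_right hR h
  have lt : ∀ {q : Cv F C K}, Exch R q f →
      pc inr q * pc inl (apS f) = pc inl (apS f) * cst (flip R) * pc inr q := by
    intro q h
    have := congrArg (pc (flipAlg F K)) (exch_apS_left hR h)
    rw [map_mul, map_mul, map_mul, pc_flip_inl, pc_flip_inr, pc_flip_cst] at this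
    exact this
  have hm : ∀ q : Cv F C K, p * (cst c * (apS f * q)) = p * (cst c * apS f) * q := fun q => by
    simp only [mul_assoc]
  rw [transport, transport, hm, hm]
  refine Exch.cst_left hn₁ (Exch.cst_right hn₂ ?_)
  rcases h with ⟨h1, h2, h3⟩ | ⟨h1, h2, h3⟩ | ⟨h1, h2, h3⟩
  · refine exch_transport_transport_aux hR hf hp hc hpf hp₁ hp₂ (gt h1) (gt h2) ?_
    rw [mul_assoc, h3, hR.cst_mul_flip_rInv, ← mul_assoc, ← mul_assoc, hR.cst_rInv_mul]
  · refine exch_transport_transport_aux hR hf hp hc hpf hp₁ hp₂ (lt h1) (lt h2) ?_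
    rw [mul_assoc, h3, flip_flip]
    simp only [mul_assoc]
  · refine exch_transport_transport_aux hR hf hp hc hpf hp₁ hp₂ (gt h1) (lt h2) ?_
    have := congrArg (pc (flipAlg F K)) h3
    simp only [map_mul, pc_flip_inl, pc_flip_inr, pc_flip_cst] at this
    rw [hR.cst_mul_flip_rInv, one_mul, this]

end Transport

/-! ### Transported coordinates of edge ends -/

section Model

lemma co_comulList {l : List X} (hl : l.Nodup) (x : X) (y : K) : co x (comulList l y : Ten F K X) =
      if x ∈ l then y else epsOne (F := F) y := by
  have h1 : (pc (co x) (toConv (comulList l : K →ₗ[F] Ten F K X)) : Cv F K K) =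
      (l.map (fun z => (toConv ((co x).comp (sing z)).toLinearMap : Cv F K K))).prod := by
    rw [toConv_comulList, map_list_prod, map_map]
    rfl
  have h2 : ∀ z, z ≠ x → (toConv ((co x : Ten F K X →ₐ[F] K).comp (sing z)).toLinearMap : Cv F K K) = 1 := by
    intro z hz
    rw [co_comp_sing_ne hz]
    rfl
  refine (congr($(h1).ofConv y) :).trans ?_
  split_ifs with hx
  · rw [list_prod_map_eq_single hl _ hx (fun z _ hz => h2 z hz), co_comp_sing_self]
    rfl
  · rw [prod_eq_one]
    · rfl
    · grind

lemma co_vertex (x : E × Bool) (v : V) (y : K) (k : Ten F K (E × Bool)) :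
    co x (comulList (Γ.cil v) y * k) = (if Γ.base x = v then y else epsOne (F := F) y) * co x k := by
  rw [map_mul, co_comulList (Γ.nodup v)]
  simp only [Γ.mem_cil]

lemma co_end (x z : E × Bool) (y : K) (k : Ten F K (E × Bool)) :
    co x (k * sing z y) = co x k * (if z = x then y else epsOne (F := F) y) := by
  rw [map_mul, co_sing]
  rfl

lemma epsOne_mul (y : K) (b : B) :
    (epsOne (F := F) y : B) * b = counit (R := F) y • b := by
  rw [Algebra.smul_def]
  rfl

lemma mul_epsOne (y : K) (b : B) :
    b * (epsOne (F := F) y : B) = counit (R := F) y • b := by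
  rw [← (commute_epsOne y b).eq, epsOne_mul]

lemma mul_map_antipode_comul (y : K) : mul' F K (tmap
    (apd F) lid (comul (R := F) y)) = epsOne (F := F) y :=
  HopfAlgebra.mul_antipode_rTensor_comul_apply (R := F) y

lemma apS_mul_vertex (hR : IsRMatrix R) {x h : E × Bool} (hxh : Γ.base x = Γ.base h) (v : V)
    (y : K) (k : Hat Γ hR tw) :
    (apS (coY Γ hR tw x) * coY Γ hR tw h).ofConv (vertexTrans Γ hR tw v y k) =
      epsOne (F := F) y * (apS (coY Γ hR tw x) * coY Γ hR tw h).ofConv k := by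
  by_cases hv : Γ.base x = v
  · have := (isTrans_vertexTrans (tw := tw) hR v).mul_apply_mid (f := apS (coY Γ hR tw x))
      (g := coY Γ hR tw h) (a := apd F (A := K)) (b := lid)
      (fun y c => by
        have h1 := co_vertex (Γ := Γ) x v y c
        rw [if_pos hv] at h1
        refine (congrArg (apd F) h1).trans ?_
        rw [antipode_mul_antidistrib]
        rfl)
      (fun y c => by
        have h1 := co_vertex (Γ := Γ) h v y c
        rw [if_pos (hxh.symm.trans hv)] at h1
        exact h1) y k
    refine this.trans ?_
    rw [mul_map_antipode_comul, ← (commute_cst_of_central (commute_epsOne y) _).eq, mul_assoc,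
      cst_mul_apply]
  · have := (isTrans_vertexTrans (tw := tw) hR v).mul_apply_left (f := apS (coY Γ hR tw x))
      (g := coY Γ hR tw h) (a := epsOne) (b := epsOne)
      (fun y c => by
        have h1 := co_vertex (Γ := Γ) x v y c
        rw [if_neg hv] at h1
        refine (congrArg (apd F) h1).trans ?_
        rw [epsOne_mul, epsOne_mul, map_smul]
        rfl)
      (fun y c => by
        have h1 := co_vertex (Γ := Γ) h v y c
        rw [if_neg (fun h' => hv (hxh.trans h'))] at h1
        exact h1) (fun y c => commute_epsOne y _) y k
    refine this.trans ?_
    rw [mul_map_epsOne_left lid_counit_comul]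

lemma transport_vertex (hR : IsRMatrix R) {n c : K} (hn : ∀ x, Commute n x) {y x h : E × Bool}
    (hxh : Γ.base x = Γ.base h) (v : V) (w : K) (k : Ten F K (E × Bool)) :
    (transport n c (coY Γ hR tw y) (coY Γ hR tw x) (coY Γ hR tw h)).ofConv
      (comulList (Γ.cil v) w * k : Ten F K (E × Bool)) =
      if Γ.base y = v then
        w * (transport n c (coY Γ hR tw y) (coY Γ hR tw x) (coY Γ hR tw h)).ofConv k
      else counit (R := F) w •
        (transport n c (coY Γ hR tw y) (coY Γ hR tw x) (coY Γ hR tw h)).ofConv k := by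
  have h1 := (isTrans_vertexTrans (tw := tw) hR v).mul_apply_left (f := coY Γ hR tw y)
      (g := cst c * (apS (coY Γ hR tw x) * coY Γ hR tw h))
      (a := if Γ.base y = v then lid else epsOne) (b := epsOne)
      (fun w c => by
        refine (co_vertex (Γ := Γ) y v w c).trans ?_
        split_ifs <;> rfl)
      (fun w k => by
        refine (cst_mul_apply _ _ _).trans ?_
        refine (congrArg (c * ·) (apS_mul_vertex hR hxh v w k)).trans ?_
        refine Eq.trans ?_ (congrArg (epsOne (F := F) w * ·) (cst_mul_apply _ _ _).symm)
        simp only [← mul_assoc, (commute_epsOne w c).eq]) (fun w c => commute_epsOne w _) w k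
  rw [mul_map_epsOne_right rid_counit_comul] at h1
  rw [transport]
  refine (cst_mul_apply _ _ _).trans ?_
  refine (congrArg (n * ·) h1).trans ?_
  have h2 : ∀ f : Cv F (Hat Γ hR tw) K, (cst n * f).ofConv k = n * f.ofConv k :=
    fun f => cst_mul_apply n f k
  rw [h2]
  split_ifs
  · rw [LinearMap.id_apply, ← mul_assoc, (hn w).eq, mul_assoc]
  · rw [epsOne_mul, mul_smul_comm]

lemma transport_end_of_ne (hd : RibbonData R ν) {n c : K} {y x h z : E × Bool} (hy : z ≠ y)
    (hx : z ≠ x) (w : K) (k : Ten F K (E × Bool)) :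
    (transport n c (coY Γ hd.rMat tw y) (coY Γ hd.rMat tw x)
      (coY Γ hd.rMat tw h)).ofConv (k * sing z w : Ten F K (E × Bool)) =
      if h = z then (transport n c (coY Γ hd.rMat tw y) (coY Γ hd.rMat tw x)
        (coY Γ hd.rMat tw h)).ofConv k * w
      else counit (R := F) w • (transport n c (coY Γ hd.rMat tw y) (coY Γ hd.rMat tw x)
        (coY Γ hd.rMat tw h)).ofConv k := by
  let a : K →ₗ[F] K := if h = z then lid else epsOne
  have hT := isTrans_endTrans (Γ := Γ) (tw := tw) hd z
  have h1 := hT.mul_apply_right (f := apS (coY Γ hd.rMat tw x))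
    (g := coY Γ hd.rMat tw h) (a := epsOne) (b := a)
    (fun w c => by
      have h1 := co_end x z w c
      rw [if_neg hx] at h1
      refine (congrArg (apd F) h1).trans ?_
      rw [mul_epsOne, mul_epsOne, map_smul]
      rfl)
    (fun w c => by
      refine (co_end h z w c).trans ?_
      simp only [a, eq_comm (a := z)]
      split_ifs <;> rfl) (fun w c => commute_epsOne w _)
  have h2 := hT.mul_apply_right (f := coY Γ hd.rMat tw y)
    (g := cst c * (apS (coY Γ hd.rMat tw x) * coY Γ hd.rMat tw h)) (a := epsOne) (b := a)
    (fun w c => by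
      have h1 := co_end y z w c
      rw [if_neg hy] at h1
      exact h1)
    (fun w k => by
      rw [cst_mul_apply, cst_mul_apply, h1, mul_map_epsOne_left (lid_counit_comulTw _), mul_assoc])
    (fun w c => commute_epsOne w _) w k
  rw [mul_map_epsOne_left (lid_counit_comulTw _)] at h2
  rw [transport]
  refine (cst_mul_apply _ _ _).trans ?_
  refine (congrArg (n * ·) h2).trans ?_
  have h3 : ∀ f : Cv F (Hat Γ hd.rMat tw) K, (cst n * f).ofConv k = n * f.ofConv k :=
    fun f => cst_mul_apply n f k
  rw [h3]
  simp only [a]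
  split_ifs
  · rw [mul_assoc]
    rfl
  · rw [mul_epsOne, mul_smul_comm]

lemma transport_edge (hd : RibbonData R ν) {ρ : E → Bool} {n c : K} {e : E} {a : Bool}
    {h : E × Bool} (hh : h.1 ≠ e) (hc : a = false → c = 1)
    (hc' : a = true → ∀ y, c * apd F y = antipodeInv F K y * c) (w : K)
    (k : Ten F K (E × Bool)) :
    (transport n c (coY Γ hd.rMat (twistOf ρ) (e, !a)) (coY Γ hd.rMat (twistOf ρ) (e, a))
      (coY Γ hd.rMat (twistOf ρ) h)).ofConv (k * sing (e, true) w : Ten F K (E × Bool)) =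
    (transport n c (coY Γ hd.rMat (twistOf ρ) (e, !a)) (coY Γ hd.rMat (twistOf ρ) (e, a))
      (coY Γ hd.rMat (twistOf ρ) h)).ofConv
        (k * sing (e, false) (antipodeInv F K w) : Ten F K (E × Bool)) := by
  have hT := isTrans_endTrans (Γ := Γ) (tw := twistOf ρ) hd (e, true)
  have hT' := isTrans_endTrans_antipodeInv (Γ := Γ) hd ρ e
  have hco : ∀ (x z : E × Bool) (w : K) (k : Ten F K (E × Bool)), z ≠ x →
      co x (k * sing z w) = co x k * epsOne (F := F) w := fun x z w k hxz => by
    rw [co_end, if_neg hxz]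
  have hco' : ∀ (x : E × Bool) (w : K) (k : Ten F K (E × Bool)),
      co x (k * sing x w) = co x k * w := fun x w k => by
    rw [co_end, if_pos rfl]
  have hS : ∀ (t w : K), apd F (t * epsOne (F := F) w) =
      epsOne (F := F) w * apd F t := fun t w => by
    rw [mul_epsOne, epsOne_mul, map_smul]
  have hε : ∀ w : K, (epsOne (F := F) (antipodeInv F K w) : K) = epsOne (F := F) w := fun w => by
    change algebraMap F K _ = algebraMap F K _
    rw [hd.counit_antipodeInv]
  have h1 : ∀ w (k : Hat Γ hd.rMat (twistOf ρ)),
      (coY Γ hd.rMat (twistOf ρ) (e, !a) *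
        (cst c * apS (coY Γ hd.rMat (twistOf ρ) (e, a)))).ofConv
        (endTrans Γ hd.rMat (twistOf ρ) (e, true) w k) =
      (coY Γ hd.rMat (twistOf ρ) (e, !a) *
        (cst c * apS (coY Γ hd.rMat (twistOf ρ) (e, a)))).ofConv
        (((endTrans Γ hd.rMat (twistOf ρ) (e, false)).comp (antipodeInv F K)) w k) := by
    intro w k
    cases a with
    | false =>
      have hc1 := hc rfl
      subst hc1
      rw [hT.mul_apply_mid (a := lid) (b := epsOne) (fun w k => hco' _ w k)
        (fun w k => by
          rw [cst_mul_apply, cst_mul_apply, one_mul, one_mul]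
          exact (congrArg (apd F) (hco _ _ w k (by simp))).trans
            (hS _ _)),
        hT'.mul_apply_mid (a := epsOne) (b := lid)
        (fun w k => (hco _ _ _ k (by simp)).trans (congrArg _ (hε w)))
        (fun w k => by
          rw [cst_mul_apply, cst_mul_apply, one_mul, one_mul]
          refine (congrArg (apd F) (hco' _ _ k)).trans ?_
          rw [antipode_mul_antidistrib, hd.antipode_antipodeInv]
          rfl),
        mul_map_epsOne_left (lid_counit_comulTw _), mul_map_epsOne_right (rid_counit_comulTw _)]
    | true =>
      rw [hT.mul_apply_mid (a := epsOne) (b := antipodeInv F K)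
        (fun w k => hco _ _ _ k (by simp))
        (fun w k => by
          rw [cst_mul_apply, cst_mul_apply]
          refine (congrArg (fun t => c * apd F t) (hco' _ _ k)).trans ?_
          rw [antipode_mul_antidistrib, ← mul_assoc, hc' rfl, mul_assoc]
          rfl),
        hT'.mul_apply_mid (a := antipodeInv F K) (b := epsOne)
        (fun w k => hco' _ _ k)
        (fun w k => by
          rw [cst_mul_apply, cst_mul_apply]
          refine (congrArg (fun t => c * apd F t)
            ((hco _ _ _ k (by simp)).trans (congrArg _ (hε w)))).trans ?_
          rw [hS, ← mul_assoc, ← (commute_epsOne w c).eq, mul_assoc]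
          rfl),
        mul_map_epsOne_left (lid_counit_comulTw _), mul_map_epsOne_right (rid_counit_comulTw _)]
  have h2 := hT.mul_apply_congr hT' h1 (g := coY Γ hd.rMat (twistOf ρ) h) (fun w k => by
    refine (hco _ _ w k (fun h' => hh (by rw [← h']))).trans ?_
    exact ((hco h (e, false) (antipodeInv F K w) k (fun h' => hh (by rw [← h']))).trans
      (congrArg _ (hε w))).symm) w k
  have hm : ∀ p f q : Cv F (Hat Γ hd.rMat (twistOf ρ)) K,
      p * (cst c * (f * q)) = p * (cst c * f) * q := fun p f q => by
    simp only [mul_assoc]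
  rw [transport, hm]
  refine (cst_mul_apply _ _ _).trans ?_
  refine (congrArg (n * ·) h2).trans ?_
  exact (cst_mul_apply _ _ _).symm

end Model

/-! ### Values of transported coordinates -/

section Values

lemma mapDlt_comp_sing_eq {f : Ten F K X →ₐ[F] B} {g : Ten F K X →ₐ[F] B'} {x : X}
    (hf : f.comp (sing x) = epsAlg) (hg : g.comp (sing x) = epsAlg) :
    (mapDlt f g).comp (sing x) = epsAlg := by
  rw [mapDlt_sing_left hg, hf, comp_epsAlg]

lemma mapDlt_comm {f : Ten F K X →ₐ[F] B} {g : Ten F K X →ₐ[F] B'}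
    (h : ∀ x, f.comp (sing x) = epsAlg ∨ g.comp (sing x) = epsAlg) (k : Ten F K X) :
    acomm F B B' (mapDlt f g k) = mapDlt g f k := by
  have : ((acomm F B B').toAlgHom.comp (mapDlt f g)) = mapDlt g f := by
    refine ten_algHom_ext (fun x k => ?_)
    rcases h x with h | h
    · have h1 := congr($(mapDlt_sing_right (g := g) h) k)
      have h2 := congr($(mapDlt_sing_left (f := g) h) k)
      refine (congrArg (acomm F B B') h1).trans (Eq.trans ?_ h2.symm)
      exact Algebra.TensorProduct.comm_tmul _ _ _
    · have h1 := congr($(mapDlt_sing_left (f := f) h) k)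
      have h2 := congr($(mapDlt_sing_right (g := f) h) k)
      refine (congrArg (acomm F B B') h1).trans (Eq.trans ?_ h2.symm)
      exact Algebra.TensorProduct.comm_tmul _ _ _
  exact congr($this k)

variable (F K) in
/-- The tensor factors `x`, `y` and `z` of `K^{⊗X}`. -/
def co3 (x y z : X) : Ten F K X →ₐ[F] K ⊗[F] (K ⊗[F] K) := mapDlt (co x) (mapDlt (co y) (co z))

lemma co3_tprod {x y z : X} {l : List X} (hl : IsFull (x :: y :: z :: l)) (m : X → K) :
    co3 F K x y z (ptprod F m) =
      (l.map (fun w => counit (R := F) (m w))).prod • (m x ⊗ₜ[F] (m y ⊗ₜ[F] m z)) := by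
  have hnd := hl.nodup
  simp only [nodup_cons, mem_cons, not_or] at hnd
  obtain ⟨⟨hxy, hxz, hx⟩, ⟨hyz, hy⟩, hz, -⟩ := hnd
  have e0 : ∀ {a b : X}, b ≠ a → (co a : Ten F K X →ₐ[F] K).comp (sing b) = epsAlg :=
    fun h => co_comp_sing_ne h
  have hX : ∀ k, (co3 F K x y z).comp (sing x) k = k ⊗ₜ[F] 1 := fun k => by
    rw [co3, mapDlt_sing_left (mapDlt_comp_sing_eq (e0 hxy) (e0 hxz)), co_comp_sing_self]
    rfl
  have hY : ∀ k, (co3 F K x y z).comp (sing y) k = 1 ⊗ₜ[F] (k ⊗ₜ[F] 1) := fun k => by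
    rw [co3, mapDlt_sing_right (e0 (Ne.symm hxy)), mapDlt_sing_left (e0 hyz), co_comp_sing_self]
    rfl
  have hZ : ∀ k, (co3 F K x y z).comp (sing z) k = 1 ⊗ₜ[F] (1 ⊗ₜ[F] k) := fun k => by
    rw [co3, mapDlt_sing_right (e0 (Ne.symm hxz)), mapDlt_sing_right (e0 (Ne.symm hyz)),
      co_comp_sing_self]
    rfl
  have hL : (l.map (fun w => (co3 F K x y z).comp (sing w) (m w))).prod =
      algebraMap F (K ⊗[F] (K ⊗[F] K)) (l.map (fun w => counit (R := F) (m w))).prod := by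
    rw [map_list_prod, map_map]
    congr 1
    refine map_congr_left (fun w hw => ?_)
    have h1 : w ≠ x := fun h => hx (h ▸ hw)
    have h2 : w ≠ y := fun h => hy (h ▸ hw)
    have h3 : w ≠ z := fun h => hz (h ▸ hw)
    rw [co3, mapDlt_comp_sing_eq (e0 h1) (mapDlt_comp_sing_eq (e0 h2) (e0 h3))]
    rfl
  rw [algHom_tprod hl, map_cons, map_cons, map_cons, prod_cons, prod_cons,
    prod_cons, hX, hY, hZ, hL, algebraMap_eq_smul_one]
  simp

lemma conv_conv_apply (A A' A'' L : K →ₗ[F] K) (x y z : X) (k : Ten F K X) :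
    conv (A.comp (coord x)) (L.comp (conv (A'.comp (coord y)) (A''.comp (coord z)))) k =
      mul' F K (tmap A (L.comp ((mul' F K).comp
        (tmap A' A''))) (co3 F K x y z k)) := by
  have h : conv (A'.comp (coord y)) (A''.comp (coord z)) = ((mul' F K).comp
        (tmap A' A'')).comp (mapDlt (co y) (co z) : Ten F K X →ₐ[F] _).toLinearMap := by
    rw [conv, splitTen_comul_eq, tmap_comp, coord_eq, coord_eq]
    rfl
  have h2 : ∀ (M : K ⊗[F] K →ₗ[F] K ⊗[F] K) (P : Ten F K X →ₗ[F] K ⊗[F] K), L.comp (((mul' F K).comp M).comp P) =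
      (L.comp ((mul' F K).comp M)).comp
        P := fun _ _ => rfl
  rw [h, h2, conv, splitTen_comul_eq, tmap_comp, coord_eq]
  rfl

lemma conv_conv_tprod (A A' A'' L : K →ₗ[F] K) {x y z : X} {l : List X}
    (hl : IsFull (x :: y :: z :: l)) (m : X → K) :
    conv (A.comp (coord x)) (L.comp (conv (A'.comp (coord y)) (A''.comp (coord z))))
      (ptprod F m) = (l.map (fun w => counit (R := F) (m w))).prod •
        (A (m x) * L (A' (m y) * A'' (m z))) := by
  rw [conv_conv_apply, co3_tprod hl, map_smul, map_smul]
  rfl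

lemma pc_mul_apply (hR : IsRMatrix R) (f : Ten F K (E × Bool) →ₗ[F] B)
    (g : Ten F K (E × Bool) →ₗ[F] B') (k : Ten F K (E × Bool)) :
    (pc (inL : B →ₐ[F] B ⊗[F] B') (ofT Γ hR tw f) *
      pc (inR : B' →ₐ[F] B ⊗[F] B') (ofT Γ hR tw g)).ofConv k =
      tmap f g (hatComul Γ R tw k) := by
  have h : (mul' F (B ⊗[F] B')).comp (tmap
      ((inL : B →ₐ[F] B ⊗[F] B').toLinearMap.comp f)
      ((inR : B' →ₐ[F] B ⊗[F] B').toLinearMap.comp g)) =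
      tmap f g := by
    ext x y
    simp
  exact congr($h (hatComul Γ R tw k))

/-- `a ⊗ b ↦ S(a) q b`. -/
def antipodeMul (q : K) : K ⊗[F] K →ₗ[F] K :=
  (mul' F K).comp (tmap (apd F)
    (mulLeft F q))

lemma antipodeMul_drinfeld (R t : K ⊗[F] K) :
    antipodeMul (drinfeld R) t = antipodeMul 1 (flip (R * flip t)) := by
  induction t with
  | tmul p q =>
    rw [drinfeld_eq]
    induction R with
    | zero => simp [antipodeMul]
    | add s s' hs hs' => simp_all [add_mul, antipodeMul, mul_add]
    | tmul a b => simp [antipodeMul, antipode_mul_antidistrib, mul_assoc]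
  | _ => simp_all [mul_add]

lemma apS_mul_apply_of_lt (hR : IsRMatrix R) {x h : E × Bool} (hxh : Γ.Lt x h)
    (k : Ten F K (E × Bool)) : (apS (coY Γ hR tw x) * coY Γ hR tw h).ofConv k =
      antipodeMul 1 (mapDlt (co x) (co h) k) := by
  have hne : x ≠ h := fun e => Γ.lt_irrefl h (e ▸ hxh)
  rw [← map_hatComul_eq_dlt (Γ := Γ) (tw := tw) hR]
  · refine (ofT_mul_apply Γ hR tw ((apd F).comp (co x).toLinearMap)
      (co h).toLinearMap k).trans ?_
    have h1 : tmap ((apd F).comp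
        (co x : Ten F K (E × Bool) →ₐ[F] K).toLinearMap)
        (co h : Ten F K (E × Bool) →ₐ[F] K).toLinearMap =
        (tmap (apd F) lid).comp
          (tmap (co x).toLinearMap (co h).toLinearMap) := by
      rw [← tmap_comp, LinearMap.id_comp]
    rw [antipodeMul, LinearMap.mulLeft_one]
    exact congrArg (mul' F K) congr($h1 (hatComul Γ R tw k))
  · intro j i hji
    by_cases hi : i = x
    · refine Or.inr (co_comp_sing_ne (fun hj => ?_))
      subst hi hj
      exact Γ.lt_asymm hxh hji
    · exact Or.inl (co_comp_sing_ne hi)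
  · intro z _
    by_cases hz : z = x
    · exact Or.inr (co_comp_sing_ne (hz ▸ hne))
    · exact Or.inl (co_comp_sing_ne hz)

lemma apS_mul_apply_of_gt (hR : IsRMatrix R) {x h : E × Bool} (hxh : Γ.Lt h x)
    (k : Ten F K (E × Bool)) : (apS (coY Γ hR tw x) * coY Γ hR tw h).ofConv k =
      antipodeMul (drinfeld R) (mapDlt (co x) (co h) k) := by
  have hne : x ≠ h := fun e => Γ.lt_irrefl h (e ▸ hxh)
  have hE : Exch R (coY Γ hR tw h) (coY Γ hR tw x) := (vertexRel_coY Γ hR tw).exch h x hxh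
  have h1 := lin_comp_mul ((antipodeMul 1).comp flip) (pc inr (coY Γ hR tw x))
    (pc inl (coY Γ hR tw h)) (apS (coY Γ hR tw x)) (coY Γ hR tw h) (fun a b => by
      change antipodeMul 1 (flip ((1 ⊗ₜ[F] (coY Γ hR tw x).ofConv a) *
        ((coY Γ hR tw h).ofConv b ⊗ₜ[F] 1))) = apd F ((coY Γ hR tw x).ofConv a) * _
      simp [antipodeMul])
  rw [← h1, hE, mul_assoc]
  have h2 : (cst R * (pc inl (coY Γ hR tw h) * pc inr (coY Γ hR tw x))).ofConv k =
      R * mapDlt (co h) (co x) k := by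
    refine (cst_mul_apply _ _ _).trans (congrArg (R * ·) ?_)
    refine (pc_mul_apply hR (co h).toLinearMap (co x).toLinearMap k).trans ?_
    refine map_hatComul_eq_dlt hR _ _ ?_ ?_ k
    · intro j i hji
      by_cases hi : i = h
      · refine Or.inr (co_comp_sing_ne (fun hj => ?_))
        subst hi hj
        exact Γ.lt_asymm hxh hji
      · exact Or.inl (co_comp_sing_ne hi)
    · intro z _
      by_cases hz : z = h
      · exact Or.inr (co_comp_sing_ne (hz ▸ hne.symm))
      · exact Or.inl (co_comp_sing_ne hz)
  refine (congrArg (fun t => antipodeMul 1 (flip t)) h2).trans ?_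
  rw [antipodeMul_drinfeld, ← mapDlt_comm (f := co x) (g := co h)]
  · rfl
  · intro z
    by_cases hz : z = x
    · exact Or.inr (co_comp_sing_ne (hz ▸ hne))
    · exact Or.inl (co_comp_sing_ne hz)

lemma mul_antipodeMul {n : K} (hn : ∀ x, Commute n x) (q : K) (t : K ⊗[F] K) :
    n * antipodeMul q t = antipodeMul (n * q) t := by
  induction t with
  | tmul a b =>
    have h : ∀ q : K, antipodeMul q (a ⊗ₜ[F] b) = apd F a * (q * b) := fun _ => rfl
    rw [h, h, ← mul_assoc, (hn _).eq]
    simp only [mul_assoc]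
  | _ => simp_all [mul_add]

/-- The central factor and the group-like factor for a transport from the end `x` to `h`. -/
structure TransportEnds (Γ : CilGraph V E) (R : K ⊗[F] K) (ν n q : K) (x h : E × Bool) : Prop where
  or : (Γ.Lt x h ∧ n = 1 ∧ q = 1) ∨ (Γ.Lt h x ∧ n = Ring.inverse ν ∧ q = grpInv R ν)

lemma TransportEnds.factor (hR : IsRMatrix R) {n q : K} {x h : E × Bool}
    (hn : TransportEnds Γ R ν n q x h) :
    TransportFactor R ν n (coY Γ hR tw x) (coY Γ hR tw h) :=
  ⟨hn.or.imp (fun h => ⟨(vertexRel_coY Γ hR tw).exch _ _ h.1, h.2.1⟩)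
    (fun h => ⟨(vertexRel_coY Γ hR tw).exch _ _ h.1, h.2.1⟩)⟩

lemma transport_apply (hd : RibbonData R ν) {n q c : K} {y x h : E × Bool}
    (hn : TransportEnds Γ R ν n q x h) (hyx : y ≠ x) (hyh : y ≠ h)
    (hy : (¬ Γ.Lt x y ∧ ¬ Γ.Lt h y) ∨ (¬ Γ.Lt y x ∧ ¬ Γ.Lt y h ∧ Indep (coY Γ hd.rMat tw y)
      (apS (coY Γ hd.rMat tw x) * coY Γ hd.rMat tw h))) (k : Ten F K (E × Bool)) :
    (transport n c (coY Γ hd.rMat tw y) (coY Γ hd.rMat tw x)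
      (coY Γ hd.rMat tw h)).ofConv k = mul' F K (tmap lid
        ((mulLeft F c).comp (antipodeMul q)) (co3 F K y x h k)) := by
  have hR := hd.rMat
  have hcen := (hn.factor (tw := tw) hR).central hd
  have hN : cst n * (apS (coY Γ hR tw x) * coY Γ hR tw h) =
      ofT Γ hR tw ((antipodeMul q).comp (mapDlt (co x) (co h)).toLinearMap) := by
    ext k
    refine (cst_mul_apply _ _ _).trans ?_
    rcases hn.or with ⟨hxh, rfl, rfl⟩ | ⟨hxh, rfl, rfl⟩
    · rw [one_mul]
      exact apS_mul_apply_of_lt hR hxh k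
    · refine (congrArg _ (apS_mul_apply_of_gt hR hxh k)).trans ?_
      rw [mul_antipodeMul hcen, ← hd.grpInv_eq]
      rfl
  have hN' : cst c * (cst n * (apS (coY Γ hR tw x) * coY Γ hR tw h)) =
      ofT Γ hR tw (((mulLeft F c).comp (antipodeMul q)).comp
        (mapDlt (co x) (co h)).toLinearMap) := by
    rw [hN]
    ext k
    exact cst_mul_apply _ _ _
  have hZ : transport n c (coY Γ hR tw y) (coY Γ hR tw x) (coY Γ hR tw h) = coY Γ hR tw y *
      (cst c * (cst n * (apS (coY Γ hR tw x) * coY Γ hR tw h))) := by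
    rw [transport, ← mul_assoc (cst n), (commute_cst_of_central hcen (coY Γ hR tw y)).eq, mul_assoc,
      ← mul_assoc (cst n), (commute_cst_of_central hcen (cst c)).eq, mul_assoc]
  set L : K ⊗[F] K →ₗ[F] K := (mulLeft F c).comp (antipodeMul q) with hL
  have hP : ∀ z, z ≠ x → z ≠ h →
      (mapDlt (co x) (co h) : Ten F K (E × Bool) →ₐ[F] _).comp (sing z) = epsAlg :=
    fun z h1 h2 => mapDlt_comp_sing_eq (co_comp_sing_ne h1) (co_comp_sing_ne h2)
  have h1 := lin_comp_mul (mul' F K) (pc inl (coY Γ hR tw y)) (pc inr (ofT Γ hR tw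
      (L.comp (mapDlt (co x) (co h)).toLinearMap))) (coY Γ hR tw y) (ofT Γ hR tw
      (L.comp (mapDlt (co x) (co h)).toLinearMap)) (fun a b => by
    change mul' F K ((_ ⊗ₜ[F] 1) * (1 ⊗ₜ[F] _)) = _
    rw [tmul_mul_tmul, mul_one, one_mul]
    rfl)
  rw [hZ, hN', ← h1]
  refine congrArg (mul' F K) ?_
  rcases hy with ⟨hy1, hy2⟩ | ⟨hy1, hy2, hy3⟩
  · refine (pc_mul_apply hR (co y).toLinearMap (L.comp (mapDlt (co x) (co h)).toLinearMap) k).trans ?_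
    have h2 : tmap (co y : Ten F K (E × Bool) →ₐ[F] K).toLinearMap
        (L.comp (mapDlt (co x) (co h)).toLinearMap) = (tmap lid L).comp
          (tmap (co y).toLinearMap (mapDlt (co x) (co h)).toLinearMap) := by
      rw [← tmap_comp, LinearMap.id_comp]
    rw [h2, lcomp_apply, map_hatComul_eq_dlt hR]
    · rfl
    · intro j i hji
      by_cases hi : i = y
      · subst hi
        exact Or.inr (hP j (fun e => hy1 (e ▸ hji)) (fun e => hy2 (e ▸ hji)))
      · exact Or.inl (co_comp_sing_ne hi)
    · intro z _
      by_cases hz : z = y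
      · exact Or.inr (hP z (hz ▸ hyx) (hz ▸ hyh))
      · exact Or.inl (co_comp_sing_ne hz)
  · have hc : Commute (pc inl (coY Γ hR tw y)) (pc inr (ofT Γ hR tw
        (L.comp (mapDlt (co x) (co h)).toLinearMap))) := by
      rw [← hN']
      exact ((Indep.cst c _).mul ((Indep.cst n _).mul hy3.symm)).right
    have h2 := (pc_mul_apply (Γ := Γ) (tw := tw) hR (L.comp (mapDlt (co x) (co h)).toLinearMap)
      (co y).toLinearMap k)
    have h3 : tmap (L.comp (mapDlt (co x) (co h)).toLinearMap)
        (co y : Ten F K (E × Bool) →ₐ[F] K).toLinearMap = (tmap L lid).comp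
          (tmap (mapDlt (co x) (co h)).toLinearMap (co y).toLinearMap) := by
      rw [← tmap_comp, LinearMap.id_comp]
    rw [h3, lcomp_apply, map_hatComul_eq_dlt hR] at h2
    · have h4 : pc inl (coY Γ hR tw y) * pc inr (ofT Γ hR tw
          (L.comp (mapDlt (co x) (co h)).toLinearMap)) = pc (flipAlg F K) (pc inl (ofT Γ hR tw
          (L.comp (mapDlt (co x) (co h)).toLinearMap)) * pc inr (coY Γ hR tw y)) := by
        rw [hc.eq, map_mul, pc_flip_inl, pc_flip_inr]
      rw [h4]
      refine (congrArg flip h2).trans ?_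
      have h5 : ∀ t : (K ⊗[F] K) ⊗[F] K, flip (tmap L lid t) =
          tmap lid L (acomm F _ _ t) := by
        intro t
        induction t <;> simp_all
      rw [h5, mapDlt_comm]
      · rfl
      · intro z
        by_cases hz : z = y
        · exact Or.inl (hP z (hz ▸ hyx) (hz ▸ hyh))
        · exact Or.inr (co_comp_sing_ne hz)
    · intro j i hji
      by_cases hj : j = y
      · subst hj
        exact Or.inl (hP i (fun e => hy1 (e ▸ hji)) (fun e => hy2 (e ▸ hji)))
      · exact Or.inr (co_comp_sing_ne hj)
    · intro z _
      by_cases hz : z = y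
      · exact Or.inl (hP z (hz ▸ hyx) (hz ▸ hyh))
      · exact Or.inr (co_comp_sing_ne hz)

lemma transport_tprod (hd : RibbonData R ν) {n q c : K} {y x h : E × Bool}
    (hn : TransportEnds Γ R ν n q x h)
    (hy : (¬ Γ.Lt x y ∧ ¬ Γ.Lt h y) ∨ (¬ Γ.Lt y x ∧ ¬ Γ.Lt y h ∧ Indep (coY Γ hd.rMat tw y)
      (apS (coY Γ hd.rMat tw x) * coY Γ hd.rMat tw h))) {l : List (E × Bool)}
    (hl : IsFull (y :: x :: h :: l)) (m : E × Bool → K) :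
    (transport n c (coY Γ hd.rMat tw y) (coY Γ hd.rMat tw x)
      (coY Γ hd.rMat tw h)).ofConv (ptprod F m : Ten F K (E × Bool)) =
      (l.map (fun w => counit (R := F) (m w))).prod •
        (m y * (c * (apd F (m x) * (q * m h)))) := by
  have hnd := hl.nodup
  simp only [nodup_cons, mem_cons, not_or] at hnd
  rw [transport_apply hd hn hnd.1.1 hnd.1.2.1 hy, co3_tprod hl, map_smul, map_smul]
  rfl

end Values

section Grouplike

/-- A graph with a single vertex and a loop. -/
def loopGraph : CilGraph Unit Unit where
  base _ := ()
  cil _ := [((), false), ((), true)]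
  nodup _ := by simp
  mem_cil v h := by
    obtain ⟨_, b⟩ := h
    cases b <;> simp

section Untwisted

lemma self_apS_mul_eq_mul_comul (hR : IsRMatrix R) {f q : Cv F C K} (hE : Exch R q f)
    (sf : SelfRel R false f) (sq : SelfRel R false q) :
    pc inl (apS f * q) * pc inr (apS f * q) = cst R * pc (comulAlgHom F K) (apS f * q) := by
  rw [self_apS_mul_lt hR hE, sf.apS_false, sq, ← hR.cst_mul_pc_comul, map_mul, if_neg (by simp),
    map_one, mul_one, mul_assoc]

lemma self_apS_mul_eq_mul_comul' (hR : IsRMatrix R) {f q : Cv F C K} (hE : Exch R q f)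
    (sf : SelfRel R false f) (sq : SelfRel R false q) :
    pc inl (apS q * f) * pc inr (apS q * f) =
      cst (flip (rInv R)) * pc (comulAlgHom F K) (apS q * f) := by
  rw [self_apS_mul_gt hR hE, sf, sq.apS_false, map_mul, if_neg (by simp), map_one, mul_one,
    ← mul_assoc]
  congr 1
  have := congrArg (fun t => cst (flip (rInv R)) * t * cst (flip (rInv R)))
    (hR.cst_flip_mul_pc_comul (apS q))
  rw [← mul_assoc, hR.cst_flip_rInv_mul, one_mul, mul_assoc _ _ (cst (flip (rInv R))),
    mul_assoc _ (cst (flip R)), hR.cst_mul_flip_rInv, mul_one] at this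
  exact this

end Untwisted

namespace RibbonData

lemma map_map_flip_rInv (hd : RibbonData R ν) :
    tmap (antipodeInv F K) (antipodeInv F K) (flip (rInv R)) = flip (rInv R) := by
  rw [← flip_map, rInv]
  congr 1
  conv_rhs => rw [← hd.map_antipodeInv]
  generalize R = t
  induction t with
  | tmul a b => simp [hd.antipodeInv_antipode, hd.antipode_antipodeInv]
  | _ => simp_all

set_option maxHeartbeats 1000000 in
lemma mul_comul_drinfeld (hd : RibbonData R ν) : R * comul (R := F) (drinfeld R) =
    (drinfeld R ⊗ₜ[F] drinfeld R) * flip (rInv R) := by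
  have hR := hd.rMat
  have hlt : loopGraph.Lt ((), false) ((), true) := Sublist.refl _
  have hv := vertexRel_coY loopGraph hR (fun _ => false)
  set f := coY loopGraph hR (fun _ => false) ((), true) with hf
  set q := coY loopGraph hR (fun _ => false) ((), false) with hq
  have hE : Exch R q f := hv.exch _ _ hlt
  have sf : SelfRel R false f := hv.self _
  have sq : SelfRel R false q := hv.self _
  have h1 := self_apS_mul_eq_mul_comul hR hE sf sq
  have h2 := self_apS_mul_eq_mul_comul' hR hE sf sq
  set g : Cv F (Hat loopGraph hR (fun _ => false)) K :=
    toConv ((antipodeInv F K).comp (apS q * f).ofConv) with hg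
  have h3 : apS f * q = cst (drinfeld R) * g := by
    ext k
    rw [cst_mul_apply]
    refine (apS_mul_apply_of_gt hR hlt k).trans ?_
    have h4 : (apS q * f).ofConv k = antipodeMul 1 (flip (mapDlt (co ((), true))
        (co ((), false)) k)) := by
      refine (apS_mul_apply_of_lt hR hlt k).trans (congrArg _ ?_)
      refine (mapDlt_comm (fun z => ?_) k).symm
      by_cases hz : z = ((), true)
      · exact Or.inr (co_comp_sing_ne (by rw [hz]; simp))
      · exact Or.inl (co_comp_sing_ne hz)
    refine Eq.trans ?_ (congrArg (fun t => drinfeld R * antipodeInv F K t) h4).symm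
    generalize mapDlt (co ((), true)) (co ((), false)) k = t
    induction t with
    | tmul a b =>
      have := hR.antipode_sq_mul (antipodeInv F K a)
      rw [hd.antipode_antipodeInv] at this
      simp only [flip_tmul, antipodeMul, lcomp_apply, tmap_tmul, mulLeft_apply, mul'_apply,
        one_mul, hd.antipodeInv_mul, hd.antipodeInv_antipode]
      rw [← mul_assoc, this, mul_assoc]
    | _ => simp_all [mul_add]
  have h4 := lin_comp_mul (tmap (antipodeInv F K) (antipodeInv F K))
    (pc inl (apS q * f)) (pc inr (apS q * f)) (pc inl g) (pc inr g) (fun a b => by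
      change tmap _ _ ((_ ⊗ₜ[F] 1) * (1 ⊗ₜ[F] _)) =
        (antipodeInv F K _ ⊗ₜ[F] 1) * (1 ⊗ₜ[F] antipodeInv F K _)
      simp only [tmul_mul_tmul, one_mul, mul_one, tmap_tmul])
  have h5 : pc inl (apS f * q) * pc inr (apS f * q) =
      cst (drinfeld R ⊗ₜ[F] drinfeld R) * (pc inl g * pc inr g) := by
    rw [h3, self_mul_indep (Indep.cst _ _), self_cst]
  rw [h1, ← h4, h2] at h5
  have one : ∀ u : K, antipodeMul u (1 : K ⊗[F] K) = u := fun u => by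
    rw [tone_def]
    simp [antipodeMul]
  have h6 : (apS f * q).ofConv (1 : Ten F K (Unit × Bool)) = drinfeld R :=
    (apS_mul_apply_of_gt hR hlt 1).trans (by rw [map_one, one])
  have h7 : (apS q * f).ofConv (1 : Ten F K (Unit × Bool)) = 1 :=
    (apS_mul_apply_of_lt hR hlt 1).trans (by rw [map_one, one])
  have h8 := congr($(h5).ofConv (1 : Ten F K (Unit × Bool)))
  have h9 : (cst R * pc (comulAlgHom F K) (apS f * q)).ofConv (1 : Ten F K (Unit × Bool)) =
      R * comul (R := F) (drinfeld R) :=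
    (cst_mul_apply _ _ _).trans (congrArg (fun t => R * comul (R := F) t) h6)
  have h10 : (cst (flip (rInv R)) * pc (comulAlgHom F K) (apS q * f)).ofConv
      (1 : Ten F K (Unit × Bool)) = flip (rInv R) :=
    (cst_mul_apply _ _ _).trans ((congrArg (fun t => flip (rInv R) * comul (R := F) t) h7).trans
      (by rw [Bialgebra.comul_one, mul_one]))
  exact h9.symm.trans (h8.trans ((cst_mul_apply _ _ _).trans (congrArg _
    ((congrArg (tmap (antipodeInv F K) (antipodeInv F K)) h10).trans
      hd.map_map_flip_rInv))))

lemma comul_grp (hd : RibbonData R ν) : comul (R := F) (grp R ν) = grp R ν ⊗ₜ[F] grp R ν := by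
  have hR := hd.rMat
  have hu := hd.isRibbon.isUnit_drinfeld hR
  have hug : drinfeld R * grp R ν = ν := Ring.mul_inverse_cancel_left _ _ hu
  have h1 : (drinfeld R ⊗ₜ[F] drinfeld R) * flip (rInv R) =
      flip (rInv R) * (drinfeld R ⊗ₜ[F] drinfeld R) := by
    have h2 : ∀ t : K ⊗[F] K, (drinfeld R ⊗ₜ[F] drinfeld R) *
        tmap (antipodeInv F K) (antipodeInv F K)
          (tmap (antipodeInv F K) (antipodeInv F K) t) =
        t * (drinfeld R ⊗ₜ[F] drinfeld R) := by
      intro t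
      have h3 : ∀ a : K, drinfeld R * antipodeInv F K (antipodeInv F K a) = a * drinfeld R := by
        intro a
        rw [← hR.antipode_sq_mul, hd.antipode_antipodeInv, hd.antipode_antipodeInv]
      induction t <;> simp_all [mul_add, add_mul, h3]
    rw [← h2, hd.map_map_flip_rInv, hd.map_map_flip_rInv]
  have h2 : flip R * R * (comul (R := F) (drinfeld R) * comul (R := F) (grp R ν)) =
      (drinfeld R ⊗ₜ[F] drinfeld R) * (grp R ν ⊗ₜ[F] grp R ν) := by
    rw [← Bialgebra.comul_mul, hug, hd.isRibbon.comul, tmul_mul_tmul, hug]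
  rw [← mul_assoc, mul_assoc (flip R), hd.mul_comul_drinfeld, h1, ← mul_assoc (flip R),
    ← flip_mul, hR.mul_rInv, flip_one, one_mul] at h2
  have hu2 : IsUnit (drinfeld R ⊗ₜ[F] drinfeld R : K ⊗[F] K) := by
    have h3 : (drinfeld R ⊗ₜ[F] drinfeld R : K ⊗[F] K) =
      inl (F := F) (drinfeld R) * inr (F := F) (drinfeld R) := by simp
    rw [h3]
    exact (hu.map (inl (F := F) (K := K))).mul (hu.map (inr (F := F) (K := K)))
  exact hu2.mul_left_cancel h2

end RibbonData

end Grouplike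

section Sublist

variable {X : Type*}

lemma pair_sublist_append {a b : X} {l l' : List X} (h : Sublist [a, b] (l ++ l')) :
    Sublist [a, b] l ∨ (a ∈ l ∧ b ∈ l') ∨ Sublist [a, b] l' := by
  rw [List.sublist_append_iff] at h
  obtain ⟨l₁, l₂, h, h1, h2⟩ := h
  match l₁, h, h1 with
  | [], h, _ => simp_all
  | [c], h, h1 => grind
  | [c, d], h, h1 => grind
  | c :: d :: f :: l, h, _ => simp at h

lemma pair_sublist_append_of_mem {a b : X} {l l' : List X} (ha : a ∈ l) (hb : b ∈ l') :
    Sublist [a, b] (l ++ l') :=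
  Sublist.append (singleton_sublist.2 ha) (singleton_sublist.2 hb)

lemma pair_sublist_cons {a b c : X} {l : List X} (h : Sublist [a, b] (c :: l))
    (hac : a ≠ c) : Sublist [a, b] l := by grind

end Sublist

lemma dite_some_inj {V : Type*} {p : V → Prop} [DecidablePred p] {v w : V}
    (h : (if hv : p v then some (⟨v, hv⟩ : Subtype p) else none) =
      if hw : p w then some ⟨w, hw⟩ else none)
    (hv : (if hv : p v then some (⟨v, hv⟩ : Subtype p) else none) ≠ none) : v = w := by simp_all

namespace CilGraph

lemma lt_of_sublist {v : V} {j i : E × Bool} (h : Sublist [j, i] (Γ.cil v)) : Γ.Lt j i := by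
  have hj : Γ.base j = v := (Γ.mem_cil _ _).1 (h.subset (by simp))
  rw [Lt, hj]
  exact h

/-- The edge end of the original graph that corresponds to one of a graph with an edge removed. -/
def unstrip {e : E} (x : {f : E // f ≠ e} × Bool) : E × Bool := (x.1.1, x.2)

lemma map_unstrip (e : E) (l : List (E × Bool)) :
    (l.flatMap (stripEnd e)).map unstrip = l.filter (fun h => decide (h.1 ≠ e)) := by
  induction l with
  | nil => rfl
  | cons h l ih => grind [flatMap_cons, map_append, List.filter_cons, stripEnd, unstrip]

lemma sublist_of_strip {e : E} {l : List (E × Bool)} {j i : {f : E // f ≠ e} × Bool}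
    (h : Sublist [j, i] (l.flatMap (stripEnd e))) :
    Sublist [unstrip j, unstrip i] l := by
  have h1 := h.map unstrip
  rw [map_unstrip] at h1
  exact h1.trans List.filter_sublist

lemma unstrip_eq_iff {e f : E} (hf : f ≠ e) (x : {f : E // f ≠ e} × Bool) (b : Bool) :
    unstrip x = (f, b) ↔ x = (⟨f, hf⟩, b) := by
  simp [unstrip, Prod.ext_iff, Subtype.ext_iff]

end CilGraph

section Delete

open CilGraph

lemma indep_coY (hR : IsRMatrix R) {i j : E × Bool} (h : Γ.base i ≠ Γ.base j) :
    Indep (coY Γ hR tw i) (coY Γ hR tw j) :=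
  ⟨(vertexRel_coY Γ hR tw).comm _ _ h, (vertexRel_coY Γ hR tw).comm _ _ h.symm⟩

namespace RibbonData

lemma endN_coord (hd : RibbonData R ν) (x : E × Bool) (k : Ten F K (E × Bool)) :
    endN F K x.2 (coord x k) = co x (tenN F K E k) := by
  rw [coord_eq]
  exact (co_map (fun _ => hd.endN_one _) (fun _ _ => hd.counit_endN _ _) x k).symm

lemma co_mul_sing_edge (hd : RibbonData R ν) {x : E × Bool} {e : E} (hx : x.1 ≠ e) (y : K)
    (k : Ten F K (E × Bool)) : co x (k * sing (e, true) y) =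
      co x (k * sing (e, false) (antipodeInv F K y)) := by
  rw [co_end, co_end, if_neg (fun h => hx (by rw [← h])), if_neg (fun h => hx (by rw [← h]))]
  congr 1
  change algebraMap F K _ = algebraMap F K _
  rw [hd.counit_antipodeInv]

end RibbonData

lemma co_mul_sing_of_iff {p : Prop} [Decidable p] {x z : E × Bool} (hp : z = x ↔ p) (y : K)
    (k : Ten F K (E × Bool)) : co x (k * sing z y) =
      if p then co x k * y else counit (R := F) y • co x k := by
  simp_all [co_end, if_pos, if_neg, mul_epsOne]

lemma co_vertex_of_iff {p : Prop} [Decidable p] {x : E × Bool} {v : V} (hp : Γ.base x = v ↔ p)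
    (y : K) (k : Ten F K (E × Bool)) : co x (comulList (Γ.cil v) y * k) =
      if p then y * co x k else counit (R := F) y • co x k := by
  simp_all [co_vertex, if_pos, if_neg, epsOne_mul]

lemma relData_delete (hd : RibbonData R ν) (Γ : CilGraph V E) (ρ : E → Bool) (e : E) :
    RelData hd.rMat Γ (Γ.delete e) ρ (fun f => ρ f.1)
      (fun v => if hv : ¬ (Γ.cil v ≠ [] ∧ ∀ h ∈ Γ.cil v, h.1 = e) then some ⟨v, hv⟩ else none)
      (fun x => (co (unstrip x)).toLinearMap) where
  inj v w h hv := by simp_all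
  rel :=
    { self := fun x => (vertexRel_coY Γ hd.rMat (twistOf ρ)).self (unstrip x)
      exch := fun j i h => (vertexRel_coY Γ hd.rMat (twistOf ρ)).exch _ _
        (lt_of_sublist (sublist_of_strip h))
      comm := fun j i h => (vertexRel_coY Γ hd.rMat (twistOf ρ)).comm _ _
        (fun h' => h (Subtype.ext h'))
      counit := fun x => (vertexRel_coY Γ hd.rMat (twistOf ρ)).counit (unstrip x) }
  vertex x v y k := by
    refine co_vertex_of_iff ?_ y k
    constructor
    · rintro rfl
      rw [dif_pos]
      · rfl
    · intro h
      split_ifs at h with hv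
      rw [Option.some.injEq] at h
      exact (congrArg Subtype.val h).symm
  edge f := by
    by_cases hf : f = e
    · subst hf
      exact Or.inl (fun x y k => hd.co_mul_sing_edge x.1.2 y k)
    · refine Or.inr ⟨⟨f, hf⟩, fun b x y k => ?_⟩
      exact co_mul_sing_of_iff (eq_comm.trans (unstrip_eq_iff hf x b)) y k

lemma RibbonData.induces_delete [FiniteDimensional F K] (hd : RibbonData R ν) (Γ : CilGraph V E)
    (ρ : E → Bool) (e : E) (ρ' : {f : E // f ≠ e} → Bool) :
    Induces R Γ (Γ.delete e) ρ ρ' (twistOf ρ)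
      (fun v => if hv : ¬ (Γ.cil v ≠ [] ∧ ∀ h ∈ Γ.cil v, h.1 = e) then some ⟨v, hv⟩ else none)
      (deleteVal e) :=
  (relData_delete hd Γ ρ e).induces (hd := hd) ρ' (fun x k => hd.endN_coord (unstrip x) k)

end Delete

namespace CilGraph

lemma flatMap_ite_eq_self {X : Type*} [DecidableEq X] {l m : List X} {y : X} (hy : y ∉ l) :
    l.flatMap (fun h => if h = y then m else [h]) = l := by
  induction l with
  | nil => rfl
  | cons z l ih => grind

lemma exists_mergedCil (Γ : CilGraph V E) (e : E) (a : Bool) : ∃ l₁ l₂ m₁ m₂,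
    Γ.cil (Γ.base (e, !a)) = l₁ ++ (e, !a) :: l₂ ∧ Γ.cil (Γ.base (e, a)) = m₁ ++ (e, a) :: m₂ ∧
    Γ.mergedCil e a = l₁ ++ ((e, a) :: (m₂ ++ m₁)) ++ l₂ := by
  obtain ⟨l₁, l₂, hl⟩ := List.append_of_mem ((Γ.mem_cil (Γ.base (e, !a)) (e, !a)).2 rfl)
  obtain ⟨m₁, m₂, hm⟩ := List.append_of_mem ((Γ.mem_cil (Γ.base (e, a)) (e, a)).2 rfl)
  refine ⟨l₁, l₂, m₁, m₂, hl, hm, ?_⟩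
  have h1 := Γ.nodup (Γ.base (e, !a))
  rw [hl, List.nodup_middle, nodup_cons, mem_append, not_or] at h1
  have h2 := Γ.nodup (Γ.base (e, a))
  rw [hm, List.nodup_middle, nodup_cons, mem_append, not_or] at h2
  have h3 : (m₁ ++ (e, a) :: m₂).rotate ((m₁ ++ (e, a) :: m₂).idxOf (e, a)) =
      (e, a) :: (m₂ ++ m₁) := by
    rw [List.idxOf_append_of_notMem h2.1.1, List.idxOf_cons_self, Nat.add_zero,
      List.rotate_append_length_eq, cons_append]
  rw [mergedCil, hl, hm, h3, List.flatMap_append, flatMap_cons, flatMap_ite_eq_self h1.1.1,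
    flatMap_ite_eq_self h1.1.2, if_pos rfl, List.append_assoc]

lemma base_contract {e : E} {a : Bool} {hl : Γ.base (e, !a) ≠ Γ.base (e, a)}
    (x : {f : E // f ≠ e} × Bool) : ((Γ.contract e a hl).base x).1 =
      if Γ.base (unstrip x) = Γ.base (e, a) then Γ.base (e, !a) else Γ.base (unstrip x) := by
  change (dite _ _ _ : {v : V // v ≠ Γ.base (e, a)}).1 = _
  unfold unstrip
  split_ifs <;> rfl

/-- The relative positions of two edge ends in the ordering after a contraction. -/
lemma lt_contract {e : E} {a : Bool} {hl : Γ.base (e, !a) ≠ Γ.base (e, a)}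
    {j i : {f : E // f ≠ e} × Bool} (h : (Γ.contract e a hl).Lt j i) :
    (Γ.base (unstrip j) ≠ Γ.base (e, a) ∧ Γ.base (unstrip i) ≠ Γ.base (e, a) ∧
      Γ.Lt (unstrip j) (unstrip i)) ∨
    (Γ.base (unstrip j) ≠ Γ.base (e, a) ∧ Γ.base (unstrip i) = Γ.base (e, a) ∧
      Γ.Lt (unstrip j) (e, !a)) ∨
    (Γ.base (unstrip j) = Γ.base (e, a) ∧ Γ.base (unstrip i) ≠ Γ.base (e, a) ∧
      Γ.Lt (e, !a) (unstrip i)) ∨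
    (Γ.base (unstrip j) = Γ.base (e, a) ∧ Γ.base (unstrip i) = Γ.base (e, a) ∧
      ((Γ.Lt (e, a) (unstrip j) ∧ Γ.Lt (e, a) (unstrip i) ∧ Γ.Lt (unstrip j) (unstrip i)) ∨
      (Γ.Lt (unstrip j) (e, a) ∧ Γ.Lt (unstrip i) (e, a) ∧ Γ.Lt (unstrip j) (unstrip i)) ∨
      (Γ.Lt (e, a) (unstrip j) ∧ Γ.Lt (unstrip i) (e, a) ∧ Γ.Lt (unstrip i) (unstrip j)))) := by
  have h1 := sublist_of_strip (l := if ((Γ.contract e a hl).base j).1 = Γ.base (e, !a) then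
    Γ.mergedCil e a else Γ.cil ((Γ.contract e a hl).base j).1) h
  have hne : ∀ (x : {f : E // f ≠ e} × Bool) b, unstrip x ≠ (e, b) :=
    fun x b h => x.1.2 (congrArg Prod.fst h)
  have hb : ∀ {x : E × Bool} {v}, x ∈ Γ.cil v → Γ.base x = v := fun h => (Γ.mem_cil _ _).1 h
  have hI := hne i
  have hJ := hne j
  rw [base_contract] at h1
  generalize unstrip i = I at h1 hI ⊢
  generalize unstrip j = J at h1 hJ ⊢
  by_cases hw : Γ.base J ≠ Γ.base (e, a) ∧ Γ.base J ≠ Γ.base (e, !a)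
  · grind
  · have h2 : (if Γ.base J = Γ.base (e, a) then Γ.base (e, !a) else Γ.base J) =
        Γ.base (e, !a) := by simp_all
    rw [h2, if_pos rfl] at h1
    obtain ⟨l₁, l₂, m₁, m₂, hl', hm', hmerge⟩ := Γ.exists_mergedCil e a
    rw [hmerge] at h1
    have bl₁ : ∀ {x}, x ∈ l₁ → Γ.base x = Γ.base (e, !a) := fun h => hb (by rw [hl']; simp [h])
    have bl₂ : ∀ {x}, x ∈ l₂ → Γ.base x = Γ.base (e, !a) := fun h => hb (by rw [hl']; simp [h])
    have bm₁ : ∀ {x}, x ∈ m₁ → Γ.base x = Γ.base (e, a) := fun h => hb (by rw [hm']; simp [h])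
    have bm₂ : ∀ {x}, x ∈ m₂ → Γ.base x = Γ.base (e, a) := fun h => hb (by rw [hm']; simp [h])
    have bm : ∀ {x}, x ∈ (e, a) :: (m₂ ++ m₁) → x ≠ (e, a) → Γ.base x = Γ.base (e, a) := by grind
    have ltl : ∀ {x y}, Sublist [x, y] (l₁ ++ (e, !a) :: l₂) → Γ.Lt x y :=
      fun h => lt_of_sublist (hl' ▸ h)
    have ltm : ∀ {x y}, Sublist [x, y] (m₁ ++ (e, a) :: m₂) → Γ.Lt x y :=
      fun h => lt_of_sublist (hm' ▸ h)
    have gt₂ : ∀ {x}, x ∈ m₂ → Γ.Lt (e, a) x := fun h =>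
      ltm ((List.cons_sublist_cons.2 (singleton_sublist.2 h)).trans
        (List.sublist_append_right _ _))
    have lt₁ : ∀ {x}, x ∈ m₁ → Γ.Lt x (e, a) := fun h =>
      ltm (pair_sublist_append_of_mem h (by simp))
    rcases pair_sublist_append h1 with h1 | ⟨h1, h1'⟩ | h1
    · rcases pair_sublist_append h1 with h1 | ⟨h1, h1'⟩ | h1
      · grind
      · grind
      · have h2 := pair_sublist_cons h1 (hJ a)
        refine Or.inr (Or.inr (Or.inr ⟨bm (h1.subset (by simp)) (hJ a),
          bm (h1.subset (by simp)) (hI a), ?_⟩))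
        rcases pair_sublist_append h2 with h | ⟨h, h'⟩ | h
        · grind
        · grind
        · grind
    · have bI : Γ.base I ≠ Γ.base (e, a) := by
        rw [bl₂ h1']
        exact hl
      rcases mem_append.1 h1 with h1 | h1
      · refine Or.inl ⟨?_, bI, ltl (pair_sublist_append_of_mem h1 (mem_cons_of_mem _ h1'))⟩
        rw [bl₁ h1]
        exact hl
      · exact Or.inr (Or.inr (Or.inl ⟨bm h1 (hJ a), bI,
          ltl ((List.cons_sublist_cons.2 (singleton_sublist.2 h1')).trans
            (List.sublist_append_right _ _))⟩))
    · refine Or.inl ⟨?_, ?_, ltl ((h1.cons _).trans (List.sublist_append_right _ _))⟩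
      · rw [bl₂ (h1.subset (by simp))]
        exact hl
      · rw [bl₂ (h1.subset (by simp))]
        exact hl

end CilGraph

section Contract

open CilGraph

/-- The factors for a transport from `x` to `h`. -/
def transportN (Γ : CilGraph V E) (ν : K) (x h : E × Bool) : K :=
  if Γ.Lt h x then Ring.inverse ν else 1

lemma transportEnds {x h : E × Bool} (hb : Γ.base h = Γ.base x) (hne : h ≠ x) :
    TransportEnds Γ R ν (transportN Γ ν x h) (if Γ.Lt h x then grpInv R ν else 1) x h := by
  unfold transportN
  by_cases h1 : Γ.Lt h x
  · rw [if_pos h1, if_pos h1]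
    exact ⟨Or.inr ⟨h1, rfl, rfl⟩⟩
  · rw [if_neg h1, if_neg h1]
    exact ⟨Or.inl ⟨(Γ.lt_total hb hne).resolve_left h1, rfl, rfl⟩⟩

namespace RibbonData

lemma transportN_central (hd : RibbonData R ν) (x h : E × Bool) (k : K) :
    Commute (transportN Γ ν x h) k := by
  unfold transportN
  split_ifs
  · exact hd.inverse_central k
  · exact one_left k

lemma grp_mul_antipode (hd : RibbonData R ν) (y : K) :
    grp R ν * apd F y = antipodeInv F K y * grp R ν := by
  have hu := hd.isRibbon.isUnit_drinfeld hd.rMat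
  have h1 := hd.rMat.antipode_sq_mul (antipodeInv F K y)
  rw [hd.antipode_antipodeInv] at h1
  rw [grp, mul_assoc, hd.isRibbon.central, ← mul_assoc, ← mul_assoc]
  congr 1
  have h2 := Ring.inverse_mul_cancel _ hu
  have h3 := Ring.mul_inverse_cancel _ hu
  calc Ring.inverse (drinfeld R) * apd F y
      = Ring.inverse (drinfeld R) * (apd F y * drinfeld R) *
          Ring.inverse (drinfeld R) := by rw [mul_assoc, mul_assoc, h3, mul_one]
    _ = _ := by rw [h1, ← mul_assoc, h2, one_mul]

lemma antipodeInv_grp (hd : RibbonData R ν) : antipodeInv F K (grp R ν) = grpInv R ν := by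
  rw [← hd.antipode_grpInv, hd.antipodeInv_antipode]

lemma isUnit_grp (hd : RibbonData R ν) : IsUnit (grp R ν) :=
  (hd.isRibbon.isUnit_drinfeld hd.rMat).ringInverse.mul hd.isRibbon.isUnit

lemma antipodeInv_grpInv (hd : RibbonData R ν) : antipodeInv F K (grpInv R ν) = grp R ν := by
  have h := hd.grp_mul_antipode (grpInv R ν)
  rw [hd.antipode_grpInv] at h
  exact (hd.isUnit_grp.mul_right_cancel h).symm

lemma counit_grp (hd : RibbonData R ν) : counit (R := F) (grp R ν) = 1 := by
  have h := lid_counit_comul (F := F) (grp R ν)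
  rw [hd.comul_grp, LinearMap.rTensor_tmul, TensorProduct.lid_tmul] at h
  have h2 := congrArg (fun t => counit (R := F) (t * grpInv R ν)) h
  rw [smul_mul_assoc, grpInv, Ring.mul_inverse_cancel _ hd.isUnit_grp, map_smul,
    Bialgebra.counit_one, smul_eq_mul, mul_one] at h2
  exact h2

end RibbonData

/-- The factor for a contraction at the end `(e, a)` of an edge. -/
def contractC (R : K ⊗[F] K) (ν : K) (a : Bool) : K := if a then grp R ν else 1

lemma RibbonData.comul_contractC (hd : RibbonData R ν) (a : Bool) :
    comul (R := F) (contractC R ν a) = contractC R ν a ⊗ₜ[F] contractC R ν a := by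
  cases a
  · exact Bialgebra.comul_one
  · exact hd.comul_grp

lemma RibbonData.counit_contractC (hd : RibbonData R ν) (a : Bool) :
    counit (R := F) (contractC R ν a) = 1 := by
  cases a
  · exact Bialgebra.counit_one
  · exact hd.counit_grp

variable (Γ) in
/-- A transported coordinate as a map on `K^{⊗2E}`. -/
def transportEnd (hR : IsRMatrix R) (tw : E × Bool → Bool) (n c : K) (y x h : E × Bool) :
    Ten F K (E × Bool) →ₗ[F] K :=
  (transport n c (coY Γ hR tw y) (coY Γ hR tw x) (coY Γ hR tw h)).ofConv

variable (Γ) in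
/-- The coordinates of the edge ends after a contraction. -/
def contractZ (hR : IsRMatrix R) (ν : K) (ρ : E → Bool) (e : E) (a : Bool)
    (x : {f : E // f ≠ e} × Bool) : Ten F K (E × Bool) →ₗ[F] K :=
  if Γ.base (unstrip x) = Γ.base (e, a) then
    transportEnd Γ hR (twistOf ρ) (transportN Γ ν (e, a) (unstrip x)) (contractC R ν a) (e, !a) (e, a)
      (unstrip x)
  else (co (unstrip x)).toLinearMap

lemma ofT_contractZ_pos (hR : IsRMatrix R) {ρ : E → Bool} {e : E} {a : Bool}
    {x : {f : E // f ≠ e} × Bool} (hx : Γ.base (unstrip x) = Γ.base (e, a)) :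
    ofT Γ hR (twistOf ρ) (contractZ Γ hR ν ρ e a x) =
      transport (transportN Γ ν (e, a) (unstrip x)) (contractC R ν a)
        (coY Γ hR (twistOf ρ) (e, !a)) (coY Γ hR (twistOf ρ) (e, a))
        (coY Γ hR (twistOf ρ) (unstrip x)) := by
  rw [contractZ, if_pos hx]
  rfl

lemma ofT_contractZ_neg (hR : IsRMatrix R) {ρ : E → Bool} {e : E} {a : Bool}
    {x : {f : E // f ≠ e} × Bool} (hx : Γ.base (unstrip x) ≠ Γ.base (e, a)) :
    ofT Γ hR (twistOf ρ) (contractZ Γ hR ν ρ e a x) = coY Γ hR (twistOf ρ) (unstrip x) := by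
  rw [contractZ, if_neg hx]
  rfl

lemma twistOf_not (ρ : E → Bool) (e : E) (a : Bool) :
    twistOf ρ (e, !a) = !twistOf ρ (e, a) := by
  unfold twistOf
  cases a <;> cases ρ e <;> rfl

lemma unstrip_ne {e : E} (x : {f : E // f ≠ e} × Bool) (b : Bool) : unstrip x ≠ (e, b) :=
  fun h => x.1.2 (congrArg Prod.fst h)

lemma vertexRel_contract (hd : RibbonData R ν) (Γ : CilGraph V E) (ρ : E → Bool) (e : E)
    (a : Bool) (hl : Γ.base (e, !a) ≠ Γ.base (e, a)) :
    VertexRel (Γ.contract e a hl) R (twistOf fun f => ρ f.1) (fun x =>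
      ofT Γ hd.rMat (twistOf ρ) (contractZ Γ hd.rMat ν ρ e a x)) := by
  have hR := hd.rMat
  have hv := vertexRel_coY Γ hR (twistOf ρ)
  have sf : SelfRel R (twistOf ρ (e, a)) (coY Γ hR (twistOf ρ) (e, a)) := hv.self _
  have sp : SelfRel R (!twistOf ρ (e, a)) (coY Γ hR (twistOf ρ) (e, !a)) := by
    rw [← twistOf_not]
    exact hv.self _
  have hpf : Indep (coY Γ hR (twistOf ρ) (e, !a)) (coY Γ hR (twistOf ρ) (e, a)) := indep_coY hR hl
  have hn : ∀ {x : {f : E // f ≠ e} × Bool}, Γ.base (unstrip x) = Γ.base (e, a) →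
      TransportFactor R ν (transportN Γ ν (e, a) (unstrip x)) (coY Γ hR (twistOf ρ) (e, a))
        (coY Γ hR (twistOf ρ) (unstrip x)) :=
    fun hx => (transportEnds hx (unstrip_ne _ _)).factor hR
  have hq : ∀ {y : E × Bool} {x : {f : E // f ≠ e} × Bool},
      Γ.base (unstrip x) = Γ.base (e, a) → Γ.base y ≠ Γ.base (e, a) →
      Indep (coY Γ hR (twistOf ρ) y) (apS (coY Γ hR (twistOf ρ) (e, a)) *
        coY Γ hR (twistOf ρ) (unstrip x)) := fun hx hy =>
    ((indep_coY hR (Ne.symm hy)).apS.mul (indep_coY hR (by rw [hx]; exact Ne.symm hy))).symm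
  have hcomm : ∀ j i, (Γ.contract e a hl).base j ≠ (Γ.contract e a hl).base i →
      Indep (ofT Γ hR (twistOf ρ) (contractZ Γ hR ν ρ e a j))
        (ofT Γ hR (twistOf ρ) (contractZ Γ hR ν ρ e a i)) := by
    intro j i h
    rw [Ne, Subtype.ext_iff, base_contract, base_contract] at h
    by_cases hj : Γ.base (unstrip j) = Γ.base (e, a)
    · by_cases hi : Γ.base (unstrip i) = Γ.base (e, a)
      · simp_all
      · rw [if_pos hj, if_neg hi] at h
        rw [ofT_contractZ_pos hR hj, ofT_contractZ_neg hR hi]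
        exact indep_transport (indep_coY hR h) (hq hj hi).symm
    · by_cases hi : Γ.base (unstrip i) = Γ.base (e, a)
      · rw [if_neg hj, if_pos hi] at h
        rw [ofT_contractZ_neg hR hj, ofT_contractZ_pos hR hi]
        exact (indep_transport (indep_coY hR (Ne.symm h)) (hq hi hj).symm).symm
      · rw [if_neg hj, if_neg hi] at h
        rw [ofT_contractZ_neg hR hj, ofT_contractZ_neg hR hi]
        exact indep_coY hR h
  refine ⟨fun x => ?_, fun j i h => ?_, fun j i h => (hcomm j i h).left, fun x => ?_⟩
  · by_cases hx : Γ.base (unstrip x) = Γ.base (e, a)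
    · rw [ofT_contractZ_pos hR hx]
      exact sf.transport hd sp (hv.self (unstrip x)) (hd.comul_contractC a) (hn hx) (hq hx hl)
    · rw [ofT_contractZ_neg hR hx]
      exact hv.self (unstrip x)
  · change Exch R (ofT Γ hR (twistOf ρ) (contractZ Γ hR ν ρ e a j))
      (ofT Γ hR (twistOf ρ) (contractZ Γ hR ν ρ e a i))
    rcases lt_contract h with ⟨hj, hi, h1⟩ | ⟨hj, hi, h1⟩ | ⟨hj, hi, h1⟩ | ⟨hj, hi, h1⟩
    · rw [ofT_contractZ_neg hR hj, ofT_contractZ_neg hR hi]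
      exact hv.exch _ _ h1
    · rw [ofT_contractZ_neg hR hj, ofT_contractZ_pos hR hi]
      exact Exch.transport_right hd (hn hi) (hv.exch _ _ h1) (hq hi hj)
    · rw [ofT_contractZ_pos hR hj, ofT_contractZ_neg hR hi]
      exact Exch.transport_left hd (hn hj) (hv.exch _ _ h1) (hq hj hi)
    · rw [ofT_contractZ_pos hR hj, ofT_contractZ_pos hR hi]
      refine exch_transport_transport hR sf sp (hd.comul_contractC a) (hd.transportN_central _ _)
        (hd.transportN_central _ _) hpf (indep_coY hR (by rw [hj]; exact hl))
        (indep_coY hR (by rw [hi]; exact hl)) ?_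
      rcases h1 with ⟨h1, h2, h3⟩ | ⟨h1, h2, h3⟩ | ⟨h1, h2, h3⟩
      · exact Or.inl ⟨hv.exch _ _ h1, hv.exch _ _ h2, hv.exch _ _ h3⟩
      · exact Or.inr (Or.inl ⟨hv.exch _ _ h1, hv.exch _ _ h2, hv.exch _ _ h3⟩)
      · exact Or.inr (Or.inr ⟨hv.exch _ _ h1, hv.exch _ _ h2, hv.exch _ _ h3⟩)
  · by_cases hx : Γ.base (unstrip x) = Γ.base (e, a)
    · rw [ofT_contractZ_pos hR hx]
      exact pc_counit_transport hd (hv.counit _) (hv.counit _) (hv.counit _)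
        (hd.counit_contractC a) (hn hx)
    · rw [ofT_contractZ_neg hR hx]
      exact hv.counit (unstrip x)

lemma contract_map_eq_some_iff {e : E} {a : Bool} {hl : Γ.base (e, !a) ≠ Γ.base (e, a)} (v : V)
    (x : {f : E // f ≠ e} × Bool) :
    (if hv : v ≠ Γ.base (e, a) then some (⟨v, hv⟩ : {v : V // v ≠ Γ.base (e, a)}) else none) =
      some ((Γ.contract e a hl).base x) ↔
    (if Γ.base (unstrip x) = Γ.base (e, a) then Γ.base (e, !a) else Γ.base (unstrip x)) = v := by
  rw [← base_contract]
  constructor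
  · intro h
    split_ifs at h with hv
    rw [Option.some.injEq] at h
    exact (congrArg Subtype.val h).symm
  · rintro rfl
    rw [dif_pos]

lemma relData_contract (hd : RibbonData R ν) (Γ : CilGraph V E) (ρ : E → Bool) (e : E)
    (a : Bool) (hl : Γ.base (e, !a) ≠ Γ.base (e, a)) :
    RelData hd.rMat Γ (Γ.contract e a hl) ρ (fun f => ρ f.1)
      (fun v => if hv : v ≠ Γ.base (e, a) then some ⟨v, hv⟩ else none)
      (contractZ Γ hd.rMat ν ρ e a) where
  inj v w h hv := dite_some_inj (p := fun v => v ≠ Γ.base (e, a)) h hv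
  rel := vertexRel_contract hd Γ ρ e a hl
  vertex x v y k := by
    by_cases hx : Γ.base (unstrip x) = Γ.base (e, a)
    · rw [contractZ, if_pos hx]
      have h1 := contract_map_eq_some_iff (hl := hl) v x
      rw [if_pos hx] at h1
      refine (transport_vertex hd.rMat (hd.transportN_central _ _) hx.symm v y k).trans ?_
      by_cases h2 : Γ.base (e, !a) = v
      · rw [if_pos h2, if_pos (h1.2 h2)]
        rfl
      · aesop
    · rw [contractZ, if_neg hx]
      refine co_vertex_of_iff ?_ y k
      rw [contract_map_eq_some_iff, if_neg hx]
  edge f := by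
    by_cases hf : f = e
    · subst hf
      refine Or.inl (fun x y k => ?_)
      by_cases hx : Γ.base (unstrip x) = Γ.base (f, a)
      · rw [contractZ, if_pos hx]
        refine transport_edge hd (ρ := ρ) x.1.2 ?_ ?_ y k
        · rintro rfl
          rfl
        · rintro rfl
          exact hd.grp_mul_antipode
      · rw [contractZ, if_neg hx]
        exact hd.co_mul_sing_edge x.1.2 y k
    · refine Or.inr ⟨⟨f, hf⟩, fun b x y k => ?_⟩
      by_cases hx : Γ.base (unstrip x) = Γ.base (e, a)
      · rw [contractZ, if_pos hx]
        refine (transport_end_of_ne hd (z := (f, b)) (fun h => hf (congrArg Prod.fst h))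
          (fun h => hf (congrArg Prod.fst h)) y k).trans ?_
        by_cases h2 : unstrip x = (f, b)
        · rw [if_pos h2, if_pos ((unstrip_eq_iff hf x b).1 h2)]
          rfl
        · rw [if_neg h2, if_neg (fun h => h2 ((unstrip_eq_iff hf x b).2 h))]
          rfl
      · rw [contractZ, if_neg hx]
        exact co_mul_sing_of_iff (eq_comm.trans (unstrip_eq_iff hf x b)) y k

section Values

lemma exists_isFull {x y z : X} (hxy : x ≠ y) (hxz : x ≠ z) (hyz : y ≠ z) : ∃ l, IsFull (x :: y :: z :: l) := by
  refine ⟨(((Finset.univ.erase x).erase y).erase z).toList, ⟨?_, fun w => ?_⟩⟩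
  · simp [hxy, hxz, hyz, Finset.nodup_toList]
  · simp only [mem_cons, Finset.mem_toList, Finset.mem_erase, Finset.mem_univ, and_true]
    tauto

variable {l : List (E × Bool)}

lemma prod_counit_endN (hd : RibbonData R ν) (m : E × Bool → K) :
    (l.map (fun w => counit (R := F) (endN F K w.2 (m w)))).prod =
      (l.map (fun w => counit (R := F) (m w))).prod := by
  simp only [hd.counit_endN]

/-- The value of a transported coordinate on the normalized tensors. -/
lemma transportEnd_tenN (hd : RibbonData R ν) {n q c : K} {y x h : E × Bool}
    (hn : TransportEnds Γ R ν n q x h)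
    (hy : (¬ Γ.Lt x y ∧ ¬ Γ.Lt h y) ∨ (¬ Γ.Lt y x ∧ ¬ Γ.Lt y h ∧ Indep (coY Γ hd.rMat tw y)
      (apS (coY Γ hd.rMat tw x) * coY Γ hd.rMat tw h)))
    (hl : IsFull (y :: x :: h :: l)) (m : E × Bool → K) :
    transportEnd Γ hd.rMat tw n c y x h (tenN F K E (ptprod F m)) =
      (l.map (fun w => counit (R := F) (m w))).prod •
        (endN F K y.2 (m y) * (c * (apd F (endN F K x.2 (m x)) *
          (q * endN F K h.2 (m h))))) := by
  rw [tenN, map_tprod, ← prod_counit_endN hd m]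
  exact transport_tprod hd hn hy hl (fun w => endN F K w.2 (m w))

lemma ten_linearMap_ext {M : Type*} [AddCommGroup M] [Module F M] {X : Type*}
    {f g : Ten F K X →ₗ[F] M}
    (h : ∀ m, f (ptprod F m) = g (ptprod F m)) (k : Ten F K X) :
    f k = g k :=
  congr($(PiTensorProduct.ext (MultilinearMap.ext h)) k)

/-- The value at an outgoing edge end transported against the direction of an edge. -/
lemma transportEnd_value (hd : RibbonData R ν) {e : E} {h : E} (hhe : h ≠ e)
    (hb : Γ.base (h, false) = Γ.base (e, true))
    (hy : (¬ Γ.Lt (e, true) (e, false) ∧ ¬ Γ.Lt (h, false) (e, false)) ∨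
      (¬ Γ.Lt (e, false) (e, true) ∧ ¬ Γ.Lt (e, false) (h, false) ∧
        Indep (coY Γ hd.rMat tw (e, false)) (apS (coY Γ hd.rMat tw (e, true)) *
          coY Γ hd.rMat tw (h, false))))
    (k : Ten F K (E × Bool)) : endN F K false (conv (coord (h, false))
        ((mulLeft F (if Γ.Lt (e, true) (h, false) then grpInv R ν else 1)).comp
          (conv (coord (e, true)) (coord (e, false)))) k) =
      transportEnd Γ hd.rMat tw (transportN Γ ν (e, true) (h, false)) (grp R ν) (e, false)
        (e, true) (h, false) (tenN F K E k) := by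
  have h1 : (e, false) ≠ (e, true) := by simp
  have h2 : (e, false) ≠ (h, false) := by simpa using Ne.symm hhe
  have h3 : (e, true) ≠ (h, false) := by simp
  obtain ⟨l, hl⟩ := exists_isFull h1 h2 h3
  have hl' : IsFull ((h, false) :: (e, true) :: (e, false) :: l) := by
    refine ⟨?_, fun w => ?_⟩
    · have := hl.nodup
      simp only [nodup_cons, mem_cons, not_or] at this ⊢
      tauto
    · have := hl.mem w
      simp only [mem_cons] at this ⊢
      tauto
  refine ten_linearMap_ext (f := (endN F K false).comp (conv (coord (h, false))
        ((mulLeft F (if Γ.Lt (e, true) (h, false) then grpInv R ν else 1)).comp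
          (conv (coord (e, true)) (coord (e, false))))))
    (g := (transportEnd Γ hd.rMat tw (transportN Γ ν (e, true) (h, false)) (grp R ν) (e, false)
        (e, true) (h, false)).comp (tenN F K E)) (fun m => ?_) k
  rw [lcomp_apply, lcomp_apply,
    transportEnd_tenN hd (transportEnds hb h3.symm) hy hl]
  have hv := conv_conv_tprod (F := F) (K := K) lid lid lid
    (mulLeft F (if Γ.Lt (e, true) (h, false) then grpInv R ν else 1)) hl' m
  simp only [LinearMap.id_comp, LinearMap.id_apply, mulLeft_apply] at hv
  rw [hv, map_smul]
  congr 1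
  change antipodeInv F K _ = antipodeInv F K _ * (grp R ν * (apd F (m (e, true)) *
    (_ * antipodeInv F K _)))
  rw [← mul_assoc (grp R ν), hd.grp_mul_antipode, hd.antipodeInv_mul, hd.antipodeInv_mul,
    hd.antipodeInv_mul]
  rcases Γ.lt_total hb h3.symm with h4 | h4
  · rw [if_neg (Γ.lt_asymm h4), if_pos h4, hd.antipodeInv_one, mul_one]
    simp only [mul_assoc]
    rw [← mul_assoc (grp R ν), grpInv, Ring.mul_inverse_cancel _ hd.isUnit_grp, one_mul]
  · rw [if_pos h4, if_neg (Γ.lt_asymm h4), hd.antipodeInv_grpInv, one_mul]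
    simp only [mul_assoc]

end Values

end Contract

section ContractValues

lemma IsFull.of_perm {X : Type*} {l l' : List X} (h : l.Perm l') (hl : IsFull l) : IsFull l' :=
  ⟨h.nodup_iff.1 hl.nodup, fun x => h.mem_iff.1 (hl.mem x)⟩

lemma eq_transportEnd_tenN (hd : RibbonData R ν) {n q c : K} {y x h : E × Bool} (hyx : y ≠ x)
    (hyh : y ≠ h) (hxh : x ≠ h) (hn : TransportEnds Γ R ν n q x h)
    (hy : (¬ Γ.Lt x y ∧ ¬ Γ.Lt h y) ∨ (¬ Γ.Lt y x ∧ ¬ Γ.Lt y h ∧ Indep (coY Γ hd.rMat tw y)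
      (apS (coY Γ hd.rMat tw x) * coY Γ hd.rMat tw h)))
    {f : Ten F K (E × Bool) →ₗ[F] K} (hf : ∀ l, IsFull (y :: x :: h :: l) → ∀ m,
      f (ptprod F m) = (l.map (fun w => counit (R := F) (m w))).prod •
        (endN F K y.2 (m y) * (c * (apd F (endN F K x.2 (m x)) *
          (q * endN F K h.2 (m h)))))) (k : Ten F K (E × Bool)) :
    f k = transportEnd Γ hd.rMat tw n c y x h (tenN F K E k) := by
  obtain ⟨l, hl⟩ := exists_isFull hyx hyh hxh
  exact ten_linearMap_ext (g := (transportEnd Γ hd.rMat tw n c y x h).comp (tenN F K E))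
    (fun m => (hf l hl m).trans (transportEnd_tenN hd hn hy hl m).symm) k

lemma endN_contractVal (hd : RibbonData R ν) (Γ : CilGraph V E) (ρ : E → Bool) (e : E)
    (a : Bool) (hl : Γ.base (e, !a) ≠ Γ.base (e, a)) (x : {f : E // f ≠ e} × Bool)
    (k : Ten F K (E × Bool)) : endN F K x.2 (contractVal R ν Γ e a x k) =
      contractZ Γ hd.rMat ν ρ e a x (tenN F K E k) := by
  obtain ⟨⟨f, hf⟩, b⟩ := x
  by_cases hx : Γ.base (f, b) = Γ.base (e, a)
  swap
  · rw [contractZ, if_neg (show ¬ Γ.base (CilGraph.unstrip (⟨f, hf⟩, b)) = Γ.base (e, a) from hx)]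
    refine (congrArg (endN F K b) ?_).trans (hd.endN_coord (f, b) k)
    have h1 : contractVal R ν Γ e a (⟨f, hf⟩, b) = coord (f, b) := if_pos hx
    exact congr($h1 k)
  have hZ : contractZ Γ hd.rMat ν ρ e a (⟨f, hf⟩, b) =
      transportEnd Γ hd.rMat (twistOf ρ) (transportN Γ ν (e, a) (f, b)) (contractC R ν a)
        (e, !a) (e, a) (f, b) := if_pos hx
  have hy1 : ¬ Γ.Lt (e, a) (e, !a) := fun h => hl (CilGraph.base_eq_of_lt h).symm
  have hy2 : ¬ Γ.Lt (f, b) (e, !a) := fun h => hl ((CilGraph.base_eq_of_lt h).symm.trans hx)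
  have hne : ∀ b', (e, b') ≠ (f, b) := fun b' h => hf (congrArg Prod.fst h).symm
  have hex : (e, !a) ≠ (e, a) := by simp
  have hW : ∀ W : Ten F K (E × Bool) →ₗ[F] K,
      contractVal R ν Γ e a (⟨f, hf⟩, b) = W → (∀ l, IsFull ((e, !a) :: (e, a) :: (f, b) :: l) →
      ∀ m, endN F K b (W (ptprod F m)) =
        (l.map (fun w => counit (R := F) (m w))).prod • (endN F K (!a) (m (e, !a)) *
          (contractC R ν a * (apd F (endN F K a (m (e, a))) *
          ((if Γ.Lt (f, b) (e, a) then grpInv R ν else 1) * endN F K b (m (f, b))))))) →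
      endN F K b (contractVal R ν Γ e a (⟨f, hf⟩, b) k) =
        contractZ Γ hd.rMat ν ρ e a (⟨f, hf⟩, b) (tenN F K E k) := by
    intro W hW hv
    rw [hZ, hW]
    exact eq_transportEnd_tenN (f := (endN F K b).comp W) hd hex (hne _) (hne _)
      (transportEnds hx (hne _).symm) (Or.inl ⟨hy1, hy2⟩) hv k
  rcases a with _ | _ <;> rcases b with _ | _
  · refine hW _ (if_neg (not_not.2 hx)) (fun l hl m => ?_)
    have hv := conv_conv_tprod (F := F) (K := K) lid (apd F)
      (apd F)
      (mulLeft F (if Γ.Lt (f, false) (e, false) then grp R ν else 1))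
      (hl.of_perm (((List.reverse_perm [(f, false), (e, false), (e, true)]).append_right l))) m
    simp only [LinearMap.id_comp, LinearMap.id_apply, mulLeft_apply] at hv
    refine (congrArg (endN F K false) hv).trans ?_
    rw [map_smul]
    congr 1
    change antipodeInv F K _ = m (e, true) * (1 * (apd F (antipodeInv F K _) *
      (_ * antipodeInv F K _)))
    rw [hd.antipodeInv_mul, hd.antipodeInv_mul, hd.antipodeInv_mul, hd.antipodeInv_antipode,
      hd.antipodeInv_antipode, hd.antipode_antipodeInv, one_mul]
    split_ifs
    · rw [hd.antipodeInv_grp]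
      simp only [mul_assoc]
    · rw [hd.antipodeInv_one]
      simp only [mul_assoc]
  · refine hW _ (if_neg (not_not.2 hx)) (fun l hl m => ?_)
    have hv := conv_conv_tprod (F := F) (K := K) lid lid
      (mulLeft F (if Γ.Lt (f, true) (e, false) then grpInv R ν else 1)) lid hl m
    simp only [LinearMap.id_comp, LinearMap.id_apply, mulLeft_apply] at hv
    refine hv.trans ?_
    congr 1
    change _ = m (e, true) * (1 * (apd F (antipodeInv F K _) * (_ * m (f, true))))
    rw [hd.antipode_antipodeInv, one_mul]
    rfl
  · refine hW _ (if_neg (not_not.2 hx)) (fun l hl m => ?_)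
    exact (transportEnd_value (tw := twistOf ρ) hd hf hx (Or.inl ⟨hy1, hy2⟩) _).trans
      (transportEnd_tenN hd (transportEnds hx (hne _).symm) (Or.inl ⟨hy1, hy2⟩) hl m)
  · refine hW _ (if_neg (not_not.2 hx)) (fun l hl m => ?_)
    have hv := conv_conv_tprod (F := F) (K := K) (antipodeInv F K) (antipodeInv F K)
      (mulLeft F (if Γ.Lt (e, true) (f, true) then grp R ν else 1)) lid hl m
    simp only [LinearMap.id_comp, LinearMap.id_apply, mulLeft_apply] at hv
    refine hv.trans ?_
    congr 1
    change _ = antipodeInv F K (m (e, false)) * (grp R ν * (apd F (m (e, true)) *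
      (_ * m (f, true))))
    rw [← mul_assoc (grp R ν), hd.grp_mul_antipode, mul_assoc (antipodeInv F K (m (e, true)))]
    rcases Γ.lt_total hx (hne true).symm with h4 | h4
    · rw [if_neg (Γ.lt_asymm h4), if_pos h4, one_mul, ← mul_assoc (grp R ν), grpInv,
        Ring.mul_inverse_cancel _ hd.isUnit_grp, one_mul]
      rfl
    · rw [if_pos h4, if_neg (Γ.lt_asymm h4), one_mul]
      rfl

lemma RibbonData.induces_contract [FiniteDimensional F K] (hd : RibbonData R ν)
    (Γ : CilGraph V E) (ρ : E → Bool) (e : E) (a : Bool) (hl : Γ.base (e, !a) ≠ Γ.base (e, a))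
    (ρ' : {f : E // f ≠ e} → Bool) :
    Induces R Γ (Γ.contract e a hl) ρ ρ' (twistOf ρ)
      (fun v => if hv : v ≠ Γ.base (e, a) then some ⟨v, hv⟩ else none) (contractVal R ν Γ e a) :=
  (relData_contract hd Γ ρ e a hl).induces (hd := hd) ρ' (endN_contractVal hd Γ ρ e a hl)

end ContractValues

namespace CilGraph

variable {e₁ e₂ : E}

lemma flatMap_sublist_self {X : Type*} {c : X → List X} (hc : ∀ x, Sublist (c x) [x])
    (l : List X) : Sublist (l.flatMap c) l := by
  induction l with
  | cons x l ih =>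
    rw [flatMap_cons]
    exact (hc x).append ih
  | _ => simp_all

/-- Any other edge end is on the same side of two adjacent ones. -/
lemma lt_or_lt_of_block {u w k : E × Bool} {v : V} (h : [u, w] <:+: Γ.cil v) (hu : k ≠ u)
    (hw : k ≠ w) : (Γ.Lt k u ∧ Γ.Lt k w) ∨ (Γ.Lt u k ∧ Γ.Lt w k) ∨
      (Γ.base u ≠ Γ.base k ∧ Γ.base w ≠ Γ.base k) := by
  obtain ⟨l, l', h⟩ := h
  have hv : ∀ {x}, x ∈ l ++ [u, w] ++ l' → Γ.base x = v := fun hx => (Γ.mem_cil _ _).1 (h ▸ hx)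
  have hlt : ∀ {x y}, Sublist [x, y] (l ++ [u, w] ++ l') → Γ.Lt x y :=
    fun hx => lt_of_sublist (h ▸ hx)
  by_cases hk : Γ.base k = v
  · have hk' : k ∈ l ++ [u, w] ++ l' := by
      rw [h]
      exact (Γ.mem_cil _ _).2 hk
    simp only [mem_append, mem_cons, List.not_mem_nil, or_false, hu, hw] at hk'
    rcases hk' with hk' | hk'
    · grind
    · exact Or.inr (Or.inl ⟨hlt (pair_sublist_append_of_mem (by simp) hk'),
        hlt (pair_sublist_append_of_mem (by simp) hk')⟩)
  · grind

/-- The edge end of the original graph in the place of an edge end after detaching. -/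
def undetach (x : DetEdge e₁ e₂ × Bool) : E × Bool :=
  x.1.elim (if x.2 then (e₂, true) else (e₁, false)) (fun f => (f.1, x.2))

lemma lt_undetach {hne : e₁ ≠ e₂} {j i : DetEdge e₁ e₂ × Bool} (h : (Γ.detach e₁ e₂ hne).Lt j i) :
    Γ.Lt (undetach j) (undetach i) := by
  have h1 := h.map undetach
  rw [detach, replaceEnds, List.map_flatMap] at h1
  refine h1.trans (flatMap_sublist_self (fun x => ?_) _)
  split_ifs with h1 h2 h3
  · exact Sublist.refl _
  · rw [h2]
    exact Sublist.refl _
  · rw [h3]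
    exact Sublist.refl _
  · simp

lemma undetach_ne_true (hne : e₁ ≠ e₂) (x : DetEdge e₁ e₂ × Bool) : undetach x ≠ (e₁, true) := by
  obtain ⟨f, b⟩ := x
  cases f with
  | none => cases b <;> simp [undetach, hne.symm]
  | some f => exact fun h => f.2.1 (congrArg Prod.fst h)

lemma undetach_ne_false (hne : e₁ ≠ e₂) (x : DetEdge e₁ e₂ × Bool) :
    undetach x ≠ (e₂, false) := by
  obtain ⟨f, b⟩ := x
  cases f with
  | none => cases b <;> simp [undetach, hne]
  | some f => exact fun h => f.2.2 (congrArg Prod.fst h)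

lemma undetach_fst_ne (hne : e₁ ≠ e₂) {x : DetEdge e₁ e₂ × Bool} (hx : x ≠ (none, false)) :
    (undetach x).1 ≠ e₁ := by
  obtain ⟨f, b⟩ := x
  cases f with
  | none => cases b <;> simp_all [undetach, hne.symm]
  | some f => exact f.2.1

lemma undetach_eq_some_iff {f : E} (hf : f ≠ e₁ ∧ f ≠ e₂) (x : DetEdge e₁ e₂ × Bool)
    (b : Bool) : undetach x = (f, b) ↔ x = (some ⟨f, hf⟩, b) := by
  obtain ⟨g, b'⟩ := x
  cases g with
  | none => cases b' <;> simp [undetach, hf.1.symm, hf.2.symm]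
  | some g => simp [undetach, Subtype.ext_iff]

lemma undetach_eq_none_iff (hne : e₁ ≠ e₂) {x : DetEdge e₁ e₂ × Bool} (hx : x ≠ (none, false))
    (b : Bool) : undetach x = (e₂, b) ↔ x = (none, b) := by
  obtain ⟨g, b'⟩ := x
  cases g with
  | none => cases b' <;> simp_all [undetach]
  | some g => simp [undetach, g.2.2]

end CilGraph

section Detach

variable {e₁ e₂ : E}

open CilGraph

variable (Γ) in
/-- The coordinates of the edge ends after detaching. -/
def detachZ (hR : IsRMatrix R) (ν : K) (ρ : E → Bool) (x : DetEdge e₁ e₂ × Bool) :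
    Ten F K (E × Bool) →ₗ[F] K :=
  if x = (none, false) then
    transportEnd Γ hR (twistOf ρ) (transportN Γ ν (e₁, true) (e₂, false)) (grp R ν) (e₁, false)
      (e₁, true) (e₂, false)
  else (co (undetach x)).toLinearMap

lemma ofT_detachZ_none (hR : IsRMatrix R) {ρ : E → Bool} {x : DetEdge e₁ e₂ × Bool}
    (hx : x = (none, false)) : ofT Γ hR (twistOf ρ) (detachZ Γ hR ν ρ x) =
      transport (transportN Γ ν (e₁, true) (e₂, false)) (grp R ν)
        (coY Γ hR (twistOf ρ) (e₁, false)) (coY Γ hR (twistOf ρ) (e₁, true))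
        (coY Γ hR (twistOf ρ) (e₂, false)) := by
  rw [detachZ, if_pos hx]
  rfl

lemma ofT_detachZ_of_ne (hR : IsRMatrix R) {ρ : E → Bool} {x : DetEdge e₁ e₂ × Bool}
    (hx : x ≠ (none, false)) :
    ofT Γ hR (twistOf ρ) (detachZ Γ hR ν ρ x) = coY Γ hR (twistOf ρ) (undetach x) := by
  rw [detachZ, if_neg hx]
  rfl

lemma lt_or_lt_of_adjacent (hadj : [(e₁, true), (e₂, false)] <:+: Γ.cil (Γ.ta e₁) ∨
      [(e₂, false), (e₁, true)] <:+: Γ.cil (Γ.ta e₁)) {k : E × Bool} (h1 : k ≠ (e₁, true))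
    (h2 : k ≠ (e₂, false)) :
    (Γ.Lt k (e₁, true) ∧ Γ.Lt k (e₂, false)) ∨ (Γ.Lt (e₁, true) k ∧ Γ.Lt (e₂, false) k) ∨
      (Γ.base (e₁, true) ≠ Γ.base k ∧ Γ.base (e₂, false) ≠ Γ.base k) := by
  rcases hadj with h | h
  · exact lt_or_lt_of_block h h1 h2
  · have := lt_or_lt_of_block h h2 h1
    tauto

lemma indep_of_adjacent (hR : IsRMatrix R)
    (hadj : [(e₁, true), (e₂, false)] <:+: Γ.cil (Γ.ta e₁) ∨
      [(e₂, false), (e₁, true)] <:+: Γ.cil (Γ.ta e₁)) {k : E × Bool} (h1 : k ≠ (e₁, true))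
    (h2 : k ≠ (e₂, false)) :
    Indep (coY Γ hR tw k) (apS (coY Γ hR tw (e₁, true)) * coY Γ hR tw (e₂, false)) := by
  have hv := vertexRel_coY Γ hR tw
  refine (indep_adjacent hR ?_).symm
  rcases lt_or_lt_of_adjacent hadj h1 h2 with h | h | h
  · exact Or.inl ⟨hv.exch _ _ h.1, hv.exch _ _ h.2⟩
  · exact Or.inr (Or.inl ⟨hv.exch _ _ h.1, hv.exch _ _ h.2⟩)
  · exact Or.inr (Or.inr ⟨indep_coY hR h.1, indep_coY hR h.2⟩)

/-- The selection of edge ends after detaching. -/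
def detachRho (ρ : E → Bool) (f : DetEdge e₁ e₂) : Bool := f.elim (ρ e₂) (fun f => ρ f.1)

lemma twistOf_detachRho {ρ : E → Bool} {x : DetEdge e₁ e₂ × Bool} (hx : x ≠ (none, false)) :
    twistOf (detachRho ρ) x = twistOf ρ (undetach x) := by
  obtain ⟨f, b⟩ := x
  cases f with
  | none => cases b <;> simp_all [undetach, twistOf, detachRho]
  | some f => rfl

lemma vertexRel_detach (hd : RibbonData R ν) (Γ : CilGraph V E) (ρ : E → Bool)
    (hne : e₁ ≠ e₂) (hb : Γ.ta e₁ = Γ.st e₂)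
    (hadj : [(e₁, true), (e₂, false)] <:+: Γ.cil (Γ.ta e₁) ∨
      [(e₂, false), (e₁, true)] <:+: Γ.cil (Γ.ta e₁)) :
    VertexRel (Γ.detach e₁ e₂ hne) R (twistOf (detachRho ρ)) (fun x =>
      ofT Γ hd.rMat (twistOf ρ) (detachZ Γ hd.rMat ν ρ x)) := by
  have hR := hd.rMat
  have hv := vertexRel_coY Γ hR (twistOf ρ)
  have sf : SelfRel R (twistOf ρ (e₁, true)) (coY Γ hR (twistOf ρ) (e₁, true)) := hv.self _
  have sp : SelfRel R (!twistOf ρ (e₁, true)) (coY Γ hR (twistOf ρ) (e₁, false)) := by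
    rw [← twistOf_not]
    exact hv.self _
  have hn : TransportFactor R ν (transportN Γ ν (e₁, true) (e₂, false))
      (coY Γ hR (twistOf ρ) (e₁, true)) (coY Γ hR (twistOf ρ) (e₂, false)) :=
    (transportEnds hb.symm (by simp)).factor hR
  have hq : ∀ x : DetEdge e₁ e₂ × Bool, Indep (coY Γ hR (twistOf ρ) (undetach x))
      (apS (coY Γ hR (twistOf ρ) (e₁, true)) * coY Γ hR (twistOf ρ) (e₂, false)) :=
    fun x => indep_of_adjacent hR hadj (undetach_ne_true hne x) (undetach_ne_false hne x)
  have hcomm : ∀ j i, (Γ.detach e₁ e₂ hne).base j ≠ (Γ.detach e₁ e₂ hne).base i →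
      Indep (ofT Γ hR (twistOf ρ) (detachZ Γ hR ν ρ j))
        (ofT Γ hR (twistOf ρ) (detachZ Γ hR ν ρ i)) := by
    intro j i h
    change Γ.base (undetach j) ≠ Γ.base (undetach i) at h
    by_cases hj : j = (none, false)
    · by_cases hi : i = (none, false)
      · exact absurd (by rw [hi, hj]) h
      · rw [ofT_detachZ_none hR hj, ofT_detachZ_of_ne hR hi]
        subst hj
        exact indep_transport (indep_coY hR h) (hq i).symm
    · by_cases hi : i = (none, false)
      · rw [ofT_detachZ_of_ne hR hj, ofT_detachZ_none hR hi]
        subst hi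
        exact (indep_transport (indep_coY hR h.symm) (hq j).symm).symm
      · rw [ofT_detachZ_of_ne hR hj, ofT_detachZ_of_ne hR hi]
        exact indep_coY hR h
  refine ⟨fun x => ?_, fun j i h => ?_, fun j i h => (hcomm j i h).left, fun x => ?_⟩
  · by_cases hx : x = (none, false)
    · rw [ofT_detachZ_none hR hx]
      subst hx
      exact sf.transport hd sp (hv.self (e₂, false)) hd.comul_grp hn (hq (none, false))
    · rw [ofT_detachZ_of_ne hR hx, twistOf_detachRho hx]
      exact hv.self (undetach x)
  · change Exch R (ofT Γ hR (twistOf ρ) (detachZ Γ hR ν ρ j))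
      (ofT Γ hR (twistOf ρ) (detachZ Γ hR ν ρ i))
    have h1 := lt_undetach h
    by_cases hj : j = (none, false)
    · by_cases hi : i = (none, false)
      · rw [hi, hj] at h1
        exact absurd h1 (CilGraph.lt_irrefl _)
      · rw [ofT_detachZ_none hR hj, ofT_detachZ_of_ne hR hi]
        subst hj
        exact Exch.transport_left hd hn (hv.exch _ _ h1) (hq i)
    · by_cases hi : i = (none, false)
      · rw [ofT_detachZ_of_ne hR hj, ofT_detachZ_none hR hi]
        subst hi
        exact Exch.transport_right hd hn (hv.exch _ _ h1) (hq j)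
      · rw [ofT_detachZ_of_ne hR hj, ofT_detachZ_of_ne hR hi]
        exact hv.exch _ _ h1
  · by_cases hx : x = (none, false)
    · rw [ofT_detachZ_none hR hx]
      exact pc_counit_transport hd (hv.counit _) (hv.counit _) (hv.counit _) hd.counit_grp hn
    · rw [ofT_detachZ_of_ne hR hx]
      exact hv.counit (undetach x)

lemma relData_detach (hd : RibbonData R ν) (Γ : CilGraph V E) (ρ : E → Bool)
    (hne : e₁ ≠ e₂) (hb : Γ.ta e₁ = Γ.st e₂)
    (hadj : [(e₁, true), (e₂, false)] <:+: Γ.cil (Γ.ta e₁) ∨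
      [(e₂, false), (e₁, true)] <:+: Γ.cil (Γ.ta e₁)) :
    RelData hd.rMat Γ (Γ.detach e₁ e₂ hne) ρ (detachRho ρ) some
      (detachZ Γ hd.rMat ν ρ) where
  inj v w h _ := Option.some.inj h
  rel := vertexRel_detach hd Γ ρ hne hb hadj
  vertex x v y k := by
    have hbase : (Γ.detach e₁ e₂ hne).base x = Γ.base (undetach x) := rfl
    rw [hbase]
    by_cases hx : x = (none, false)
    · rw [detachZ, if_pos hx]
      subst hx
      refine (transport_vertex hd.rMat (hd.transportN_central _ _) hb v y k).trans ?_
      by_cases h2 : Γ.base (e₁, false) = v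
      · rw [if_pos h2, if_pos (show some v = some (Γ.base (undetach ((none, false) : DetEdge e₁ e₂ × Bool)))
          from congrArg some h2.symm)]
        rfl
      · rw [if_neg h2, if_neg (show ¬ some v = some (Γ.base (undetach ((none, false) : DetEdge e₁ e₂ × Bool)))
          from fun h => h2 (Option.some.inj h).symm)]
        rfl
    · rw [detachZ, if_neg hx]
      refine co_vertex_of_iff ?_ y k
      rw [Option.some.injEq, eq_comm]
  edge f := by
    by_cases hf : f = e₁
    · subst hf
      refine Or.inl (fun x y k => ?_)
      by_cases hx : x = (none, false)
      · rw [detachZ, if_pos hx]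
        exact transport_edge hd (ρ := ρ) (a := true) (h := (e₂, false)) hne.symm (by simp)
          (fun _ => hd.grp_mul_antipode) y k
      · rw [detachZ, if_neg hx]
        exact hd.co_mul_sing_edge (undetach_fst_ne hne hx) y k
    · have key : ∀ e' : DetEdge e₁ e₂,
          (∀ x, x ≠ (none, false) → ∀ b, undetach x = (f, b) ↔ x = (e', b)) →
          (∀ b, (e₂, false) = (f, b) ↔ ((none : DetEdge e₁ e₂), false) = (e', b)) →
          ∀ b x y k, detachZ Γ hd.rMat ν ρ x (k * sing (f, b) y) =
            if x = (e', b) then detachZ Γ hd.rMat ν ρ x k * y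
            else counit (R := F) y • detachZ Γ hd.rMat ν ρ x k := by
        intro e' h1 h2 b x y k
        by_cases hx : x = (none, false)
        · rw [detachZ, if_pos hx]
          refine (transport_end_of_ne hd (z := (f, b)) (fun h => hf (congrArg Prod.fst h))
            (fun h => hf (congrArg Prod.fst h)) y k).trans ?_
          by_cases h3 : (e₂, false) = (f, b)
          · aesop
          · aesop
        · rw [detachZ, if_neg hx]
          exact co_mul_sing_of_iff (eq_comm.trans (h1 x hx b)) y k
      by_cases hf' : f = e₂
      · subst hf'
        exact Or.inr ⟨none, key none (fun x hx => undetach_eq_none_iff hne hx) (by simp)⟩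
      · exact Or.inr ⟨some ⟨f, hf, hf'⟩, key _ (fun x _ => undetach_eq_some_iff ⟨hf, hf'⟩ x)
          (by simp [Ne.symm hf'])⟩

lemma endN_detachVal (hd : RibbonData R ν) (Γ : CilGraph V E) (ρ : E → Bool)
    (hne : e₁ ≠ e₂) (hb : Γ.ta e₁ = Γ.st e₂)
    (hadj : [(e₁, true), (e₂, false)] <:+: Γ.cil (Γ.ta e₁) ∨
      [(e₂, false), (e₁, true)] <:+: Γ.cil (Γ.ta e₁)) (x : DetEdge e₁ e₂ × Bool)
    (k : Ten F K (E × Bool)) : endN F K x.2 (detachVal R ν Γ e₁ e₂ x k) =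
      detachZ Γ hd.rMat ν ρ x (tenN F K E k) := by
  by_cases hx : x = (none, false)
  · subst hx
    rw [detachZ, if_pos rfl]
    refine transportEnd_value hd hne.symm hb.symm ?_ k
    have h1 : (e₁, false) ≠ (e₁, true) := by simp
    have h2 : (e₁, false) ≠ (e₂, false) := by simpa using hne
    rcases lt_or_lt_of_adjacent hadj h1 h2 with h | h | h
    · exact Or.inl ⟨Γ.lt_asymm h.1, Γ.lt_asymm h.2⟩
    · exact Or.inr ⟨Γ.lt_asymm h.1, Γ.lt_asymm h.2, indep_of_adjacent hd.rMat hadj h1 h2⟩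
    · exact Or.inl ⟨fun h' => h.1 (base_eq_of_lt h'), fun h' => h.2 (base_eq_of_lt h')⟩
  · rw [detachZ, if_neg hx]
    have h1 : detachVal R ν Γ e₁ e₂ x = coord (undetach x) := by
      obtain ⟨f, b⟩ := x
      cases f with
      | none =>
        cases b
        · exact absurd rfl hx
        · rfl
      | some f => rfl
    have h2 : x.2 = (undetach x).2 := by
      obtain ⟨f, b⟩ := x
      cases f with
      | none => cases b <;> rfl
      | some f => rfl
    rw [h1, h2]
    exact hd.endN_coord (undetach x) k

lemma RibbonData.induces_detach [FiniteDimensional F K] (hd : RibbonData R ν)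
    (Γ : CilGraph V E) (ρ : E → Bool) (e₁ e₂ : E) (hne : e₁ ≠ e₂) (ρ' : DetEdge e₁ e₂ → Bool)
    (hb : Γ.ta e₁ = Γ.st e₂) (hadj : [(e₁, true), (e₂, false)] <:+: Γ.cil (Γ.ta e₁) ∨
      [(e₂, false), (e₁, true)] <:+: Γ.cil (Γ.ta e₁)) :
    Induces R Γ (Γ.detach e₁ e₂ hne) ρ ρ' (twistOf ρ) some (detachVal R ν Γ e₁ e₂) :=
  (relData_detach hd Γ ρ hne hb hadj).induces (hd := hd) ρ' (endN_detachVal hd Γ ρ hne hb hadj)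

end Detach

section Algebra

lemma om_sing (l : List X) :
    om (fun _ => ()) (sing : X → K →ₐ[F] Ten F K X) () l = comulList l := by
  have h := om_eq_filter (fun _ => ()) (sing : X → K →ₐ[F] Ten F K X) () l
  simp only [decide_true, List.filter_true, ← toConv_comulList] at h
  exact congrArg WithConv.ofConv h

lemma exists_comulListAlg {l : List X} (hl : l.Nodup) :
    ∃ φ : K →ₐ[F] Ten F K X, φ.toLinearMap = comulList l := by
  obtain ⟨φ, hφ⟩ := exists_om (base := fun _ => ()) (slots_sing (F := F) (K := K) (X := X)) () hl
  exact ⟨φ, hφ.trans (om_sing l)⟩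

variable (F K) in
/-- The iterated comultiplication as an algebra homomorphism. -/
def comulListAlg {l : List X} (hl : l.Nodup) : K →ₐ[F] Ten F K X := (exists_comulListAlg hl).choose

lemma comulListAlg_toLinearMap {l : List X} (hl : l.Nodup) :
    (comulListAlg F K hl).toLinearMap = comulList l := (exists_comulListAlg hl).choose_spec

lemma comulListAlg_apply {l : List X} (hl : l.Nodup) (k : K) :
    comulListAlg F K hl k = comulList l k := congr($(comulListAlg_toLinearMap hl) k)

lemma comulList_commute {l l' : List X} (h : ∀ x ∈ l, x ∉ l') (a b : K) :
    Commute (comulList l a : Ten F K X) (comulList l' b) := by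
  rw [← om_sing, ← om_sing]
  refine commute_om_om (fun i hi j hj _ _ => sing_commute (fun hij => ?_) _ _) a b
  rw [← hij] at hj
  exact h i hi hj

lemma toConv_comp_comulListAlg {l : List X} (hl : l.Nodup) (f : Ten F K X →ₐ[F] B) :
    (toConv (f.comp (comulListAlg F K hl)).toLinearMap : Cv F K B) =
      (l.map (fun x => (toConv (f.comp (sing x)).toLinearMap : Cv F K B))).prod := by
  have h : (toConv (f.comp (comulListAlg F K hl)).toLinearMap : Cv F K B) =
      pc f (toConv (comulList l)) := by
    rw [← comulListAlg_toLinearMap hl]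
    rfl
  rw [h, toConv_comulList, map_list_prod, map_map]
  rfl

lemma algHom_eq_of_toConv {f g : K →ₐ[F] B}
    (h : (toConv f.toLinearMap : Cv F K B) = toConv g.toLinearMap) : f = g :=
  AlgHom.toLinearMap_injective (congrArg WithConv.ofConv h)

lemma toConv_mapDlt_comp_sing (f : Ten F K X →ₐ[F] B) (g : Ten F K X →ₐ[F] B') (x : X) :
    (toConv ((mapDlt f g).comp (sing x)).toLinearMap : Cv F K (B ⊗[F] B')) =
      pc (inL : B →ₐ[F] B ⊗[F] B')
        (toConv (f.comp (sing x)).toLinearMap) *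
      pc (inR : B' →ₐ[F] B ⊗[F] B')
        (toConv (g.comp (sing x)).toLinearMap) := by
  ext k
  refine Eq.trans ?_ (convMul_apply _ _ k).symm
  change tmap f.toLinearMap g.toLinearMap (dlt F K X (sing x k)) = _
  rw [dlt_sing]
  generalize comul (R := F) k = t
  induction t <;> simp_all

/-- Pairwise disjoint lists without repetitions. -/
structure ListSplit {Y : Type*} (c : X → List Y) : Prop where
  nodup : ∀ x, (c x).Nodup
  disjoint : ∀ x y, x ≠ y → ∀ z ∈ c x, z ∉ c y

namespace ListSplit

variable {Y : Type*} [Fintype Y] [DecidableEq Y] {c : X → List Y} (hc : ListSplit c)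

lemma commute (x y : X) (hne : x ≠ y) (a b : K) :
    Commute (comulListAlg F K (hc.nodup x) a) (comulListAlg F K (hc.nodup y) b) := by
  rw [comulListAlg_apply, comulListAlg_apply]
  exact comulList_commute (hc.disjoint x y hne) a b

variable (F K) in
/-- The iterated comultiplications `K → K^{⊗ c(x)}` in all tensor factors. -/
def hom : Ten F K X →ₐ[F] Ten F K Y :=
  prodLiftAlg (fun x => comulListAlg F K (hc.nodup x)) hc.commute

lemma hom_comp_sing (x : X) : (hc.hom F K).comp (sing x) = comulListAlg F K (hc.nodup x) :=
  AlgHom.ext (fun k => prodLiftAlg_sing _ hc.commute x k)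

lemma hom_sing (x : X) (k : K) : hc.hom F K (sing x k) = comulList (c x) k :=
  congr($(hc.hom_comp_sing x) k).trans (comulListAlg_apply _ k)

lemma toConv_comp_hom (f : Ten F K Y →ₐ[F] B) (x : X) :
    (toConv ((f.comp (hc.hom F K)).comp (sing x)).toLinearMap : Cv F K B) =
      ((c x).map (fun y => (toConv (f.comp (sing y)).toLinearMap : Cv F K B))).prod := by
  rw [comp_assoc, hom_comp_sing, toConv_comp_comulListAlg]

lemma comp_hom_eq_epsAlg {f : Ten F K Y →ₐ[F] B} {x : X}
    (hf : ∀ y ∈ c x, f.comp (sing y) = epsAlg) : (f.comp (hc.hom F K)).comp (sing x) = epsAlg := by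
  apply algHom_eq_of_toConv
  rw [toConv_comp_hom, epsAlg_toLinearMap, toConv_epsOne]
  apply prod_eq_one
  intro z hz
  obtain ⟨y, hy, rfl⟩ := mem_map.1 hz
  rw [hf y hy, epsAlg_toLinearMap, toConv_epsOne]

lemma hom_comulList (l : List X) (k : K) :
    hc.hom F K (comulList l k) = comulList (l.flatMap c) k := by
  have h : pc (hc.hom F K) (toConv (comulList l)) =
      (toConv (comulList (l.flatMap c)) : Cv F K (Ten F K Y)) := by
    rw [toConv_comulList, toConv_comulList, list_prod_flatMap, map_list_prod, map_map]
    congr 2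
    funext x
    exact (hc.toConv_comp_hom (AlgHom.id F _) x)
  exact congr(($h).ofConv k)

lemma epsT_hom (k : Ten F K X) : epsT (hc.hom F K k) = epsT k := by
  have h : epsT.comp (hc.hom F K) = (epsT : Ten F K X →ₐ[F] F) := by
    refine ten_algHom_ext (fun x k => ?_)
    have h1 := hc.comp_hom_eq_epsAlg (f := epsT) (x := x)
      (fun y _ => epsT_comp_sing (F := F) (K := K) y)
    rw [← epsT_comp_sing (F := F) (K := K) x] at h1
    exact congr($h1 k)
  exact congr($h k)

end ListSplit

end Algebra

/-! ### Replacing edge ends by lists of adjacent ones -/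

/-- The edge ends of the first graph correspond to disjoint lists of edge ends of the second one,
compatibly with the orderings at the vertices. -/
structure EndSplit {V E E' : Type*} (Γ : CilGraph V E) (Γ' : CilGraph V E')
    (c : E × Bool → List (E' × Bool)) : Prop where
  sublist : ∀ v, Sublist ((Γ.cil v).flatMap c) (Γ'.cil v)

namespace EndSplit

section Graph

variable {Γ' : CilGraph V E'} {c : E × Bool → List (E' × Bool)}

lemma base_eq (hc : EndSplit Γ Γ' c) {h : E × Bool} {x : E' × Bool} (hx : x ∈ c h) :
    Γ'.base x = Γ.base h :=
  (Γ'.mem_cil _ _).1 ((hc.sublist _).subset (List.mem_flatMap.2 ⟨h, (Γ.mem_cil _ _).2 rfl, hx⟩))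

lemma nodup (hc : EndSplit Γ Γ' c) (h : E × Bool) : (c h).Nodup :=
  (List.nodup_flatMap.1 ((Γ'.nodup (Γ.base h)).sublist (hc.sublist _))).1 h ((Γ.mem_cil _ _).2 rfl)

lemma disjoint (hc : EndSplit Γ Γ' c) {h h' : E × Bool} (hne : h ≠ h') {x : E' × Bool}
    (hx : x ∈ c h) : x ∉ c h' := by
  intro hx'
  have hb : Γ.base h' = Γ.base h := (hc.base_eq hx').symm.trans (hc.base_eq hx)
  have h1 := (List.nodup_flatMap.1 ((Γ'.nodup (Γ.base h)).sublist (hc.sublist _))).2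
  have h2 : Std.Symm (Function.onFun List.Disjoint c) := ⟨fun _ _ h => h.symm⟩
  exact h1.forall ((Γ.mem_cil _ _).2 rfl) ((Γ.mem_cil _ _).2 hb) hne hx hx'

lemma lt_of_lt (hc : EndSplit Γ Γ' c) {j i : E × Bool} (h : Γ.Lt j i) {x y : E' × Bool}
    (hx : x ∈ c j) (hy : y ∈ c i) : Γ'.Lt x y := by
  refine CilGraph.lt_of_sublist (v := Γ.base j) (Sublist.trans ?_ ((h.flatMap c).trans (hc.sublist _)))
  simpa using Sublist.append (singleton_sublist.2 hx) (singleton_sublist.2 hy)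

lemma lt_of_sublist (hc : EndSplit Γ Γ' c) {h : E × Bool} {x y : E' × Bool}
    (hxy : Sublist [x, y] (c h)) : Γ'.Lt x y := by
  refine CilGraph.lt_of_sublist (v := Γ.base h) (hxy.trans (Sublist.trans ?_ (hc.sublist _)))
  simpa using (singleton_sublist.2 ((Γ.mem_cil _ _).2 rfl) :
    Sublist [h] (Γ.cil (Γ.base h))).flatMap c

end Graph

variable {Γ' : CilGraph V E'} {c : E × Bool → List (E' × Bool)}

lemma split (hc : EndSplit Γ Γ' c) : ListSplit c := ⟨hc.nodup, fun _ _ h _ hz => hc.disjoint h hz⟩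

variable (F K) in
/-- The iterated comultiplications `K → K^{⊗ c(h)}` for all edge ends `h`. -/
abbrev theta (hc : EndSplit Γ Γ' c) : Ten F K (E × Bool) →ₐ[F] Ten F K (E' × Bool) :=
  hc.split.hom F K

lemma mapDlt_theta (hc : EndSplit Γ Γ' c) {x : E' × Bool} {l : List (E' × Bool)} (hx : x ∉ l)
    (hl : ∀ y ∈ l, Γ'.base x ≠ Γ'.base y ∨ Γ'.Lt x y) :
    mapDlt ((co x).comp (hc.theta F K)) ((pj l).comp (hc.theta F K)) =
      (mapDlt (co x) (pj l)).comp (hc.theta F K) := by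
  refine ten_algHom_ext (fun h k => ?_)
  have hpj : ∀ y, y ≠ x → (toConv ((mapDlt (co x) (pj l)).comp (sing y)).toLinearMap :
      Cv F K (K ⊗[F] Ten F K (E' × Bool))) = pc (inR :
        Ten F K (E' × Bool) →ₐ[F] K ⊗[F] Ten F K (E' × Bool))
        (toConv ((pj l).comp (sing y)).toLinearMap) := by
    intro y hy
    rw [mapDlt_sing_right (co_comp_sing_ne hy)]
    rfl
  have hself : (toConv ((mapDlt (co x) (pj l)).comp (sing x)).toLinearMap :
      Cv F K (K ⊗[F] Ten F K (E' × Bool))) = pc (inL :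
        K →ₐ[F] K ⊗[F] Ten F K (E' × Bool)) (toConv ((co x).comp (sing x)).toLinearMap) := by
    rw [mapDlt_sing_left (pj_comp_sing_of_notMem hx)]
    rfl
  have hone : ∀ {f : Ten F K (E' × Bool) →ₐ[F] K} {L : List (E' × Bool)},
      (∀ y ∈ L, f.comp (sing y) = epsAlg) →
      (L.map (fun y => (toConv (f.comp (sing y)).toLinearMap : Cv F K _))).prod = 1 := by
    intro f L hL
    apply prod_eq_one
    intro z hz
    obtain ⟨y, hy, rfl⟩ := mem_map.1 hz
    rw [hL y hy, epsAlg_toLinearMap, toConv_epsOne]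
  have hone' : ∀ {f : Ten F K (E' × Bool) →ₐ[F] Ten F K (E' × Bool)} {L : List (E' × Bool)},
      (∀ y ∈ L, f.comp (sing y) = epsAlg) →
      (L.map (fun y => (toConv (f.comp (sing y)).toLinearMap : Cv F K _))).prod = 1 := by
    intro f L hL
    apply prod_eq_one
    intro z hz
    obtain ⟨y, hy, rfl⟩ := mem_map.1 hz
    rw [hL y hy, epsAlg_toLinearMap, toConv_epsOne]
  have key : (toConv ((mapDlt ((co x).comp (hc.theta F K)) ((pj l).comp (hc.theta F K))).comp
      (sing h)).toLinearMap : Cv F K (K ⊗[F] Ten F K (E' × Bool))) =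
      toConv (((mapDlt (co x) (pj l)).comp (hc.theta F K)).comp (sing h)).toLinearMap := by
    rw [toConv_mapDlt_comp_sing, hc.split.toConv_comp_hom, hc.split.toConv_comp_hom, hc.split.toConv_comp_hom]
    have hnd := hc.nodup h
    by_cases hxh : x ∈ c h
    · obtain ⟨l₁, l₂, hl'⟩ := List.append_of_mem hxh
      have h1 : ∀ y ∈ l₁, Γ'.Lt y x := fun y hy => hc.lt_of_sublist (h := h)
        (hl' ▸ pair_sublist_append_of_mem hy (by simp))
      have h2 : ∀ y ∈ l₁, y ∉ l := by
        intro y hy hyl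
        rcases hl y hyl with h | h
        · exact h (CilGraph.base_eq_of_lt (h1 y hy)).symm
        · exact CilGraph.lt_asymm h (h1 y hy)
      rw [hl'] at hnd ⊢
      have h3 : ∀ y ∈ l₁, y ≠ x := fun y hy h => by
        subst h
        exact CilGraph.lt_irrefl _ (h1 y hy)
      have h4 : ∀ y ∈ l₂, y ≠ x := fun y hy h => by
        subst h
        exact (nodup_cons.1 (nodup_append.1 hnd).2.1).1 hy
      simp only [map_append, map_cons, prod_append, prod_cons, hself]
      rw [hone (fun y hy => co_comp_sing_ne (h3 y hy)), hone (fun y hy => co_comp_sing_ne (h4 y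
        hy)), hone' (fun y hy => pj_comp_sing_of_notMem (h2 y hy)), pj_comp_sing_of_notMem hx,
        epsAlg_toLinearMap, toConv_epsOne, one_mul, mul_one, one_mul, one_mul, map_congr_left (fun y
        hy => hpj y (h3 y hy)), map_congr_left (fun y hy => hpj y (h4 y hy)), map_list_prod,
        map_map]
      have h5 : (l₁.map (fun y => pc (inR :
          Ten F K (E' × Bool) →ₐ[F] K ⊗[F] Ten F K (E' × Bool))
          (toConv ((pj l).comp (sing y)).toLinearMap : Cv F K _))).prod = 1 := by
        have := congrArg (pc (inR :
          Ten F K (E' × Bool) →ₐ[F] K ⊗[F] Ten F K (E' × Bool)))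
          (hone' (f := pj l) (L := l₁) (fun y hy => pj_comp_sing_of_notMem (h2 y hy)))
        rw [map_list_prod, map_map, map_one] at this
        exact this
      rw [h5, one_mul]
      rfl
    · have h3 : ∀ y ∈ c h, y ≠ x := fun y hy h => hxh (h ▸ hy)
      rw [hone (fun y hy => co_comp_sing_ne (h3 y hy)), map_one, one_mul,
        map_congr_left (fun y hy => hpj y (h3 y hy)), map_list_prod, map_map]
      rfl
  exact congr(($key).ofConv k)

/-- Ordered products of elements at single edge ends. -/
lemma prod_theta (hc : EndSplit Γ Γ' c) (hR : IsRMatrix R)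
    (htw : ∀ h, tw h → ∀ x ∈ c h, ∀ y ∈ c h, x = y) (β : E' × Bool → K →ₗ[F] F)
    {l : List (E' × Bool)} (ho : l.Pairwise (fun x y => Γ'.base x ≠ Γ'.base y ∨ Γ'.Lt x y)) :
    (l.map (fun x => ofT Γ hR tw ((β x).comp ((co x).comp (hc.theta F K)).toLinearMap))).prod =
      ofT Γ hR tw ((prodLift (resFam β l)).comp (hc.theta F K).toLinearMap) := by
  have hβ : ∀ x y, x ≠ y → ∀ a b, Commute (β x a) (β y b) := fun _ _ _ _ _ => Commute.all _ _
  induction l with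
  | nil =>
    ext k
    refine Eq.trans ?_ (prodLift_resFam_nil β (hc.theta F K k)).symm
    exact congrArg (algebraMap F F) (hc.split.epsT_hom k).symm
  | cons x l ih =>
    have hl := nodup_of_ordered ho
    rw [nodup_cons] at hl
    rw [List.pairwise_cons] at ho
    rw [map_cons, prod_cons, ih ho.2]
    ext k
    refine (ofT_mul_apply Γ hR tw _ _ k).trans ?_
    have hg : prodLift (resFam β l) = (prodLift (resFam β l)).comp (pj l).toLinearMap :=
      lext (fun z => (prodLift_resFam_pj hβ l z).symm)
    rw [hg, LinearMap.comp_assoc, tmap_comp]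
    have h1 : ∀ k : Ten F K (E × Bool),
        tmap ((co x).comp (hc.theta F K)).toLinearMap
          ((pj l).comp (hc.theta F K)).toLinearMap (hatComul Γ R tw k) =
        mapDlt ((co x).comp (hc.theta F K)) ((pj l).comp (hc.theta F K)) k := by
      refine map_hatComul_eq_dlt hR _ _ (fun j i hji => ?_) (fun i hi => ?_)
      · by_cases hi : x ∈ c i
        · refine Or.inr (hc.split.comp_hom_eq_epsAlg (fun y hy => pj_comp_sing_of_notMem (fun hyl => ?_)))
          have h2 := hc.lt_of_lt hji hy hi
          rcases ho.1 y hyl with h | h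
          · exact h (CilGraph.base_eq_of_lt h2).symm
          · exact CilGraph.lt_asymm h h2
        · exact Or.inl (hc.split.comp_hom_eq_epsAlg (fun y hy => co_comp_sing_ne (fun h => hi (h ▸ hy))))
      · by_cases hx : x ∈ c i
        · refine Or.inr (hc.split.comp_hom_eq_epsAlg (fun y hy => pj_comp_sing_of_notMem ?_))
          rw [htw i hi y hy x hx]
          exact hl.1
        · exact Or.inl (hc.split.comp_hom_eq_epsAlg (fun y hy => co_comp_sing_ne (fun h => hx (h ▸ hy))))
    refine (congrArg (mul' F F) (congrArg (tmap (β x)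
      (prodLift (resFam β l))) ((h1 k).trans congr($(hc.mapDlt_theta hl.1 ho.1) k)))).trans ?_
    exact mul_prodLift_resFam_dlt β hl.1 (hc.theta F K k)

end EndSplit

/-! ### Products of R-matrices after replacing edge ends -/

section BraidFlatMap

variable {base' : I' → V} {c : I → List I'}

lemma om_flatMap {a : I' → K →ₐ[F] B} {A : I → K →ₐ[F] B}
    (hA : ∀ h, (toConv (A h).toLinearMap : Cv F K B) =
      ((c h).map (fun x => (toConv (a x).toLinearMap : Cv F K B))).prod)
    (hbase : ∀ h, ∀ x ∈ c h, base' x = base h) (v : V) (l : List I) :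
    om base' a v (l.flatMap c) = om base A v l := by
  apply WithConv.toConv_injective
  rw [toConv_om, toConv_om, list_prod_flatMap]
  refine congrArg List.prod (map_congr_left (fun h _ => ?_))
  by_cases hv : base h = v
  · rw [atV, if_pos hv, hA]
    refine congrArg List.prod (map_congr_left (fun x hx => ?_))
    rw [atV, if_pos ((hbase h x hx).trans hv)]
  · rw [atV, if_neg hv, epsAlg_toLinearMap, toConv_epsOne]
    apply prod_eq_one
    intro z hz
    obtain ⟨x, hx, rfl⟩ := mem_map.1 hz
    rw [atV, if_neg (fun h' => hv ((hbase h x hx).symm.trans h')), epsAlg_toLinearMap,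
      toConv_epsOne]

lemma braidL_singleton (a b : I' → K →ₐ[F] B) (x : I') : braidL base' R a b [x] = 1 := rfl

lemma braidL_pair (a b : I' → K →ₐ[F] B) {x y : I'} (h : base' x = base' y) :
    braidL base' R a b [x, y] = rr R (b x).toLinearMap (a y).toLinearMap := by
  simp [braidL, pairsOf, h]

lemma braidL_cons_cons (hR : IsRMatrix R) {a b : I' → K →ₐ[F] B} (ha : Slots a) (hb : Slots b)
    (hab : Across a b) {y z : I'} {l : List I'} (hl : (y :: z :: l).Nodup)
    (hyz : base' y = base' z) : braidL base' R a b (y :: z :: l) =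
      rr R (cmul (b y).toLinearMap (b z).toLinearMap) (om base' a (base' y) l) *
        braidL base' R a b l * rr R (b y).toLinearMap (a z).toLinearMap := by
  have hl1 := (nodup_cons.1 hl).2
  have hl2 := (nodup_cons.1 hl1).2
  have hz : z ∉ l := (nodup_cons.1 hl1).1
  have hy : y ∉ l := fun h => (nodup_cons.1 hl).1 (mem_cons_of_mem _ h)
  have hne : y ≠ z := fun h => (nodup_cons.1 hl).1 (by simp [h])
  rw [braidL_cons hR ha hab hl1, braidL_cons hR ha hab hl2, om_cons, atV, if_pos hyz.symm, ← hyz]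
  obtain ⟨ω, hω⟩ := exists_om (base := base') ha (base' y) hl2
  have hωc : ∀ (u : B), (∀ i ∈ l, ∀ k, Commute u (a i k)) → ∀ k, Commute u (ω k) := by
    intro u hu k
    have := commute_om (base := base') (v := base' y) hu k
    rw [← hω] at this
    exact this
  have hbω : ∀ i x k, Commute (b i x) (ω k) := fun i x k =>
    hωc _ (fun j _ k => (hab.commute _ _ _ _).symm) k
  have haω : ∀ x k, Commute (a z x) (ω k) := fun x k =>
    hωc _ (fun j hj k => ha.commute _ _ (fun h => hz (by rw [h]; exact hj)) _ _) k
  rw [← hω, hR.rr_cmul_right _ _ _ (fun x k => (hbω y k x).symm) (fun x k => haω x k),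
    hR.rr_cmul_left _ _ _ (fun x k => hbω z x k)]
  have h1 : Commute (rr R (b y).toLinearMap (a z).toLinearMap)
      (rr R (b z).toLinearMap ω.toLinearMap) :=
    commute_rr_rr (fun x k => hb.commute _ _ hne _ _) (fun x k => hbω y x k)
      (fun x k => hab.commute _ _ _ _) (fun x k => haω x k)
  have h2 : Commute (rr R (b y).toLinearMap (a z).toLinearMap) (braidL base' R a b l) := by
    refine commute_braidL (fun i hi k => ?_) (fun i hi k => ?_)
    · exact (commute_rr (fun x => hab.commute _ _ _ _)
        (fun x => ha.commute _ _ (fun h => hz (by rw [← h]; exact hi)) _ _)).symm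
    · exact (commute_rr (fun x => hb.commute _ _ (fun h => hy (by rw [← h]; exact hi)) _ _)
        (fun x => (hab.commute _ _ _ _).symm)).symm
  rw [mul_assoc, ← mul_assoc (rr R (b y).toLinearMap (a z).toLinearMap), h1.eq]
  simp only [mul_assoc]
  rw [h2.eq]

lemma braidL_flatMap (hR : IsRMatrix R) {a b : I' → K →ₐ[F] B} {A B' : I → K →ₐ[F] B}
    (ha : Slots a) (hb : Slots b) (hab : Across a b) (hA' : Slots A) (hAB : Across A B')
    (hA : ∀ h, (toConv (A h).toLinearMap : Cv F K B) =
      ((c h).map (fun x => (toConv (a x).toLinearMap : Cv F K B))).prod)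
    (hB : ∀ h, (toConv (B' h).toLinearMap : Cv F K B) =
      ((c h).map (fun x => (toConv (b x).toLinearMap : Cv F K B))).prod)
    (hbase : ∀ h, ∀ x ∈ c h, base' x = base h)
    (hc : ∀ h, (∃ y, c h = [y]) ∨ ∃ y z, c h = [y, z]) {l : List I} (hl : l.Nodup)
    (hn : (l.flatMap c).Nodup) : braidL base' R a b (l.flatMap c) =
      braidL base R A B' l * (l.reverse.map (fun h => braidL base' R a b (c h))).prod := by
  induction l with
  | nil => simp [braidL, pairsOf]
  | cons h l ih =>
    rw [nodup_cons] at hl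
    have hA0 := om_flatMap hA hbase (base h) l
    rw [flatMap_cons] at hn ⊢
    have hn' := (nodup_append.1 hn).2.1
    rw [reverse_cons, map_append, prod_append, braidL_cons hR hA' hAB hl.2]
    rcases hc h with ⟨y, hy⟩ | ⟨y, z, hy⟩
    · have hby := hbase h y (by simp [hy])
      have h1 : B' h = b y := algHom_eq_of_toConv (by rw [hB, hy]; simp)
      rw [hy, cons_append, nil_append, braidL_cons hR ha hab hn', hby, hA0, h1, ih hl.2 hn',
        map_singleton, prod_singleton, hy, braidL_singleton, mul_one, mul_assoc]
    · have hby := hbase h y (by simp [hy])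
      have hbz := hbase h z (by simp [hy])
      have h1 : (B' h).toLinearMap = cmul (b y).toLinearMap (b z).toLinearMap := by grind
      rw [hy] at hn ⊢
      rw [cons_append, cons_append, nil_append] at hn ⊢
      rw [braidL_cons_cons hR ha hb hab hn (hby.trans hbz.symm), hby, hA0, ← h1, ih hl.2 hn',
        map_singleton, prod_singleton, hy, braidL_pair _ _ (hby.trans hbz.symm)]
      simp only [mul_assoc]

end BraidFlatMap

namespace EndSplit

variable {Γ' : CilGraph V E'} {c : E × Bool → List (E' × Bool)}

lemma co_comp_theta (hc : EndSplit Γ Γ' c) {x : E' × Bool} {h : E × Bool} (hx : x ∈ c h) :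
    (co x).comp (hc.theta F K) = co h := by
  refine ten_algHom_ext (fun h' k => ?_)
  by_cases hh : h' = h
  · subst hh
    have h1 : ((co x).comp (hc.theta F K)).comp (sing h') = AlgHom.id F K := by
      apply algHom_eq_of_toConv
      rw [hc.split.toConv_comp_hom, list_prod_map_eq_single (hc.nodup h') _ hx, co_comp_sing_self]
      intro y _ hy
      rw [co_comp_sing_ne hy, epsAlg_toLinearMap, toConv_epsOne]
    rw [← co_comp_sing_self (F := F) (K := K) h'] at h1
    exact congr($h1 k)
  · have h1 := hc.split.comp_hom_eq_epsAlg (F := F) (K := K) (f := co x) (x := h') (fun y hy =>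
      co_comp_sing_ne (fun h => hc.disjoint (Ne.symm hh) hx (h ▸ hy)))
    rw [← co_comp_sing_ne (F := F) (K := K) hh] at h1
    exact congr($h1 k)

lemma co_comp_theta_of_forall (hc : EndSplit Γ Γ' c) {x : E' × Bool} (hx : ∀ h, x ∉ c h) :
    (co x).comp (hc.theta F K) = (Algebra.ofId F K).comp epsT := by
  refine ten_algHom_ext (fun h k => ?_)
  have h1 := hc.split.comp_hom_eq_epsAlg (F := F) (K := K) (f := co x) (x := h) (fun y hy =>
    co_comp_sing_ne (fun h' => hx h (h' ▸ hy)))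
  refine congr($h1 k).trans ?_
  rw [comp_apply, epsT_sing]
  rfl

/-- A homomorphism between the tensor powers for the edges that is compatible with the actions of
the edge ends. -/
structure EdgeHom (hc : EndSplit Γ Γ' c) (Fs : Ten F K E →ₐ[F] Ten F K E') : Prop where
  act : ∀ h k d, Fs (actD F K E (sing h k) d) = actD F K E' (hc.theta F K (sing h k)) (Fs d)
  eps : ∀ e k, epsT (Fs (sing e k)) = counit (R := F) k

namespace EdgeHom

variable {hc : EndSplit Γ Γ' c} {Fs : Ten F K E →ₐ[F] Ten F K E'}

lemma map_actD (hF : EdgeHom hc Fs) (k : Ten F K (E × Bool)) (d : Ten F K E) :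
    Fs (actD F K E k d) = actD F K E' (hc.theta F K k) (Fs d) := by
  induction k using ten_induction generalizing d <;> simp_all [map_mul, mul_apply, hF.act]

lemma map_actD2 (hF : EdgeHom hc Fs) (z : Ten2 F K (E × Bool)) (d : Ten2 F K E) :
    amap Fs Fs (actD2 F K E z d) =
      actD2 F K E' (amap (hc.theta F K) (hc.theta F K) z)
        (amap Fs Fs d) := by
  induction z using tind with
  | tmul x y =>
    rw [amap_tmul, actD2_tmul, actD2_tmul]
    induction d using tind with
    | zero => simp
    | add a b ha hb => simp only [map_add, ha, hb]
    | tmul a b => simp [hF.map_actD]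
  | _ => simp_all

lemma map_glueH (hF : EdgeHom hc Fs) (k : Ten F K (E × Bool)) :
    glueH F K E' (hc.theta F K k) = Fs (glueH F K E k) := by
  simp [glueH_apply, hF.map_actD, map_one]

lemma epsT_map (hF : EdgeHom hc Fs) (d : Ten F K E) : epsT (Fs d) = epsT d := by
  have h : epsT.comp Fs = (epsT : Ten F K E →ₐ[F] F) :=
    ten_algHom_ext (fun e k => (hF.eps e k).trans (epsT_sing e k).symm)
  exact congr($h d)

lemma map_gauge (hF : EdgeHom hc Fs) (h : ∀ v y d,
      actD F K E' (comulList ((Γ.cil v).flatMap c) y) (Fs d) =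
        actD F K E' (comulList (Γ'.cil v) y) (Fs d)) (y : Ten F K V) (d : Ten F K E) :
    Fs (actD F K E (Γ.gaugeComul y) d) =
      actD F K E' (Γ'.gaugeComul (resVertex some y)) (Fs d) := by
  obtain ⟨f, hf, hf'⟩ := exists_gaugeAlg (F := F) (K := K) Γ
  obtain ⟨f', hg, hg'⟩ := exists_gaugeAlg (F := F) (K := K) Γ'
  obtain ⟨r, hr, hr'⟩ := exists_resAlg (F := F) (K := K) (some : V → Option V)
    (fun v w h _ => Option.some.inj h)
  rw [← hf, ← hg, ← hr]
  change Fs (actD F K E (f y) d) = actD F K E' (f' (r y)) (Fs d)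
  clear hf hg hr
  induction y using ten_induction generalizing d with
  | mul v k z hz =>
    rw [map_mul, map_mul, map_mul, map_mul, map_mul, mul_apply, mul_apply,
      hf', hr', Option.elim_some, hg', ← hz, ← h, ← hc.split.hom_comulList, hF.map_actD]
  | _ => simp_all

lemma inducingPair (hF : EdgeHom hc Fs) (hR : IsRMatrix R)
    (htw : ∀ h, tw h → ∀ x ∈ c h, ∀ y ∈ c h, x = y)
    (hΔ : ∀ d, deltaD Γ' R (Fs d) = amap Fs Fs (deltaD Γ R d))
    (h : ∀ v y d, actD F K E' (comulList ((Γ.cil v).flatMap c) y) (Fs d) =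
      actD F K E' (comulList (Γ'.cil v) y) (Fs d)) :
    InducingPair hR Γ Γ' tw some (fun x => ((co x).comp (hc.theta F K)).toLinearMap)
      (hc.theta F K).toLinearMap Fs.toLinearMap where
  vertex β l ho := (hc.prod_theta hR htw β ho).symm
  glueH := hF.map_glueH
  deltaD := hΔ
  epsT := hF.epsT_map
  actD := hF.map_gauge h

end EdgeHom

lemma endN_coord (hc : EndSplit Γ Γ' c) (hd : RibbonData R ν) {x : E' × Bool} {h : E × Bool}
    (hx : x ∈ c h) (hb : x.2 = h.2) (k : Ten F K (E × Bool)) : endN F K x.2 (coord h k) =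
      ((co x).comp (hc.theta F K)).toLinearMap (tenN F K E k) := by
  rw [hc.co_comp_theta hx, hb]
  exact hd.endN_coord h k

end EndSplit

/-! ### Doubling an edge -/

section EdgeMap

lemma comulList_singleton {X : Type*} [DecidableEq X] (x : X) :
    (comulList [x] : K →ₗ[F] Ten F K X) = (sing x).toLinearMap := by
  grind [toConv_comulList, map_singleton, prod_singleton]

lemma comulList_pair {X : Type*} [DecidableEq X] (x y : X) :
    (comulList [x, y] : K →ₗ[F] Ten F K X) = cmul (sing x).toLinearMap (sing y).toLinearMap := by
  grind [toConv_comulList]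

lemma actD_rr_true (x y : E) (t : K ⊗[F] K) (d : Ten F K E) :
    actD F K E (rr t (sing (x, true)).toLinearMap (sing (y, true)).toLinearMap) d =
      rr t (sing x).toLinearMap (sing y).toLinearMap * d := by
  induction t <;>
    simp_all [rr_zero, rr_add, ladd, add_mul, rr_tmul, toLinearMap_apply, map_mul, mul_apply, actD_sing, endAct_true, mul_assoc]

lemma actD_rr_false (x y : E) (t : K ⊗[F] K) (d : Ten F K E) :
    actD F K E (rr t (sing (x, false)).toLinearMap (sing (y, false)).toLinearMap) d =
      d * rr (flip (tmap (apd F) (apd F) t))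
        (sing y).toLinearMap (sing x).toLinearMap := by
  induction t <;>
    simp_all [rr_zero, rr_add, ladd, mul_add, rr_tmul, toLinearMap_apply, map_mul, mul_apply, actD_sing, endAct_false, mul_assoc, tmap_tmul, flip, LinearEquiv.coe_coe, TensorProduct.comm_tmul]

lemma actD2_rr_true (x y : E) (t : K ⊗[F] K) (d : Ten2 F K E) :
    actD2 F K E (rr t (s2 F K (x, true)).toLinearMap (s1 F K (y, true)).toLinearMap) d =
      rr t (s2 F K x).toLinearMap (s1 F K y).toLinearMap * d := by
  induction t <;>
    simp_all [rr_zero, rr_add, ladd, add_mul, rr_tmul, toLinearMap_apply, map_mul, mul_apply, actD2_s1_true, actD2_s2_true, mul_assoc]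

lemma actD2_rr_false (x y : E) (t : K ⊗[F] K) (d : Ten2 F K E) :
    actD2 F K E (rr t (s2 F K (x, false)).toLinearMap (s1 F K (y, false)).toLinearMap) d =
      d * rr (tmap (apd F) (apd F) t)
        (s2 F K x).toLinearMap (s1 F K y).toLinearMap := by
  induction t with
  | tmul a b =>
    simp only [rr_tmul, toLinearMap_apply, map_mul, mul_apply, actD2_s1_false,
      actD2_s2_false, mul_assoc, tmap_tmul, (s1_s2_commute F _ _ _ _).eq]
  | _ => simp_all [rr_zero, rr_add, ladd, mul_add]

lemma mul_map_eq_map_mul {f g : Ten F K E →ₐ[F] B} {r : B}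
    (h : ∀ x k, r * f (sing x k) = g (sing x k) * r) (d : Ten F K E) : r * f d = g d * r := by
  induction d using ten_induction with
  | mul x k z hz => rw [map_mul, map_mul, ← mul_assoc, h, mul_assoc, hz, mul_assoc]
  | _ => simp_all [mul_add, add_mul]

lemma pc_toConv (f : B →ₐ[F] B') (φ : K →ₐ[F] B) :
    pc f (toConv φ.toLinearMap : Cv F K B) = toConv (f.comp φ).toLinearMap := rfl

/-- The R-matrices between the two parts of a tensor factor. -/
lemma IsRMatrix.rr_cmul_cmul (hR : IsRMatrix R) {a b a' b' : K →ₐ[F] B}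
    (haa : ∀ x y, Commute (a x) (a' y)) (hbb : ∀ x y, Commute (b x) (b' y))
    (h : ∀ x y, Commute (b x) (a y)) (h' : ∀ x y, Commute (b x) (a' y))
    (h2 : ∀ x y, Commute (b' x) (a y)) (h3 : ∀ x y, Commute (b' x) (a' y)) :
    rr R (cmul b.toLinearMap b'.toLinearMap) (cmul a.toLinearMap a'.toLinearMap) =
      rr R b.toLinearMap a'.toLinearMap * rr R b.toLinearMap a.toLinearMap *
        (rr R b'.toLinearMap a'.toLinearMap * rr R b'.toLinearMap a.toLinearMap) := by
  rw [← cmulAlg_toLinearMap a a' haa, hR.rr_cmul_left, cmulAlg_toLinearMap, hR.rr_cmul_right _ _ _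
    (fun x y => (h' y x).symm) haa, hR.rr_cmul_right _ _ _ (fun x y => (h3 y x).symm) haa]
  intro x y
  rw [cmulAlg_apply]
  exact commute_cmul (fun k => h2 x k) (fun k => h3 x k) y

end EdgeMap

namespace EndSplit

variable {Γ' : CilGraph V E'} {c : E × Bool → List (E' × Bool)}

lemma braidL_eq (hc : EndSplit Γ Γ' c) (hR : IsRMatrix R)
    (h12 : ∀ h, (∃ y, c h = [y]) ∨ ∃ y z, c h = [y, z]) {L : List (E × Bool)} (hL : Γ.IsOrder L)
    (hL' : (L.flatMap c).Nodup) : braidL Γ'.base R (s1 F K) (s2 F K) (L.flatMap c) =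
      amap (hc.theta F K) (hc.theta F K) (Γ.braid R) *
        (L.reverse.map (fun h => braidL Γ'.base R (s1 F K) (s2 F K) (c h))).prod := by
  have e1 : ∀ h, (amap (hc.theta F K) (hc.theta F K)).comp (s1 F K h) =
      (inL.comp (hc.theta F K)).comp (sing h) := fun h =>
    AlgHom.ext (fun k => by simp [s1_apply])
  have e2 : ∀ h, (amap (hc.theta F K) (hc.theta F K)).comp (s2 F K h) =
      (inR.comp (hc.theta F K)).comp (sing h) := fun h =>
    AlgHom.ext (fun k => by simp [s2_apply])
  rw [CilGraph.braid_eq_braidL R hL, map_braidL]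
  refine braidL_flatMap hR slots_s1 slots_s2 across_s1_s2
    (slots_comp slots_s1 (amap (hc.theta F K) (hc.theta F K)))
    (across_comp across_s1_s2 _) (fun h => ?_) (fun h => ?_) (fun h x hx => hc.base_eq hx) h12
    hL.nodup hL'
  · rw [e1]
    exact hc.split.toConv_comp_hom _ h
  · rw [e2]
    exact hc.split.toConv_comp_hom _ h

end EndSplit

section Double

variable (Γ) (e : E)

/-- The edge ends that replace an edge end when `e` is doubled. -/
def doubleEnd (h : E × Bool) : List (Option E × Bool) :=
  if h = (e, true) then [(some e, true), (none, true)]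
  else if h = (e, false) then [(none, false), (some e, false)]
  else [(some h.1, h.2)]

/-- The edges that replace an edge when `e` is doubled. -/
def doubleEdge (f : E) : List (Option E) := if f = e then [some e, none] else [some f]

lemma doubleEnd_true : doubleEnd e (e, true) = [(some e, true), (none, true)] := if_pos rfl

lemma doubleEnd_false : doubleEnd e (e, false) = [(none, false), (some e, false)] := by
  rw [doubleEnd, if_neg (by simp), if_pos rfl]

lemma doubleEnd_of_ne {h : E × Bool} (hh : h.1 ≠ e) : doubleEnd e h = [(some h.1, h.2)] := by
  rw [doubleEnd, if_neg (fun h' => hh (by rw [h'])), if_neg (fun h' => hh (by rw [h']))]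

lemma doubleEdge_self : doubleEdge e e = [some e, none] := if_pos rfl

lemma doubleEdge_of_ne {f : E} (h : f ≠ e) : doubleEdge e f = [some f] := if_neg h

lemma endSplit_double : EndSplit Γ (Γ.double e) (doubleEnd e) := ⟨fun _ => Sublist.refl _⟩

lemma split_doubleEdge : ListSplit (doubleEdge e) := by
  refine ⟨fun x => ?_, fun x y hxy z hz hz' => ?_⟩
  · unfold doubleEdge
    split_ifs <;> simp
  · unfold doubleEdge at hz hz'
    split_ifs at hz hz' <;> simp at hz hz' <;> aesop

lemma edgeHom_double : (endSplit_double Γ e).EdgeHom ((split_doubleEdge e).hom F K) := by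
  refine ⟨fun h k d => ?_, fun x k => ((split_doubleEdge e).epsT_hom _).trans (epsT_sing x k)⟩
  obtain ⟨x, b⟩ := h
  rw [EndSplit.theta, ListSplit.hom_sing, actD_sing]
  by_cases hx : x = e
  · subst hx
    cases b
    · rw [doubleEnd_false, comulList_pair, cmul_eq_rr, actD_rr_false, endAct_false,
        ← comul_antipode, map_mul, ListSplit.hom_sing, doubleEdge_self, comulList_pair, cmul_eq_rr]
    · rw [doubleEnd_true, comulList_pair, cmul_eq_rr, actD_rr_true, endAct_true, map_mul,
        ListSplit.hom_sing, doubleEdge_self, comulList_pair, cmul_eq_rr]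
  · rw [doubleEnd_of_ne e hx, comulList_singleton, toLinearMap_apply, actD_sing]
    cases b
    · simp_all [endAct_false, map_mul, ListSplit.hom_sing, doubleEdge_of_ne, comulList_singleton]
    · simp_all [endAct_true, map_mul, ListSplit.hom_sing, doubleEdge_of_ne, comulList_singleton]

lemma braid_double (hR : IsRMatrix R) : (Γ.double e).braid R =
    amap ((endSplit_double Γ e).theta F K) ((endSplit_double Γ e).theta F K)
      (Γ.braid R) *
    (rr R (s2 F K (some e, true)).toLinearMap (s1 F K (none, true)).toLinearMap *
      rr R (s2 F K (none, false)).toLinearMap (s1 F K (some e, false)).toLinearMap) := by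
  have hL' : (Γ.double e).IsOrder (Γ.order.flatMap (doubleEnd e)) := by
    have := (Γ.double e).isOrder_order
    rwa [CilGraph.order, show (Γ.double e).cil = fun v => (Γ.cil v).flatMap (doubleEnd e) from rfl,
      ← List.flatMap_assoc] at this
  rw [CilGraph.braid_eq_braidL R hL',
    (endSplit_double Γ e).braidL_eq hR (fun h => ?_) Γ.isOrder_order hL'.nodup]
  · congr 1
    obtain ⟨l, hl⟩ : ∃ l, (Γ.order.reverse).Perm ((e, true) :: (e, false) :: l) :=
      ⟨_, ((List.perm_cons_erase (by simp [Γ.isOrder_order.mem])).trans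
        ((List.perm_cons_erase ((List.mem_erase_of_ne (by simp)).2
          (by simp [Γ.isOrder_order.mem]))).cons _))⟩
    have hn := hl.nodup_iff.1 (nodup_reverse.2 Γ.isOrder_order.nodup)
    have h1 : ∀ h : E × Bool, h ≠ (e, true) → h ≠ (e, false) →
        braidL (Γ.double e).base R (s1 F K) (s2 F K) (doubleEnd e h) = 1 := by
      simp_all [doubleEnd_of_ne, braidL_singleton]
    have ht : braidL (Γ.double e).base R (s1 F K) (s2 F K) (doubleEnd e (e, true)) =
        rr R (s2 F K (some e, true)).toLinearMap (s1 F K (none, true)).toLinearMap := by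
      rw [doubleEnd_true]
      exact braidL_pair _ _ rfl
    have hf : braidL (Γ.double e).base R (s1 F K) (s2 F K) (doubleEnd e (e, false)) =
        rr R (s2 F K (none, false)).toLinearMap (s1 F K (some e, false)).toLinearMap := by
      rw [doubleEnd_false]
      exact braidL_pair _ _ rfl
    have hc : Commute
        (rr R (s2 F K (some e, true)).toLinearMap (s1 F K ((none : Option E), true)).toLinearMap)
        (rr R (s2 F K ((none : Option E), false)).toLinearMap
          (s1 F K (some e, false)).toLinearMap) :=
      commute_rr_rr (fun x y => s2_commute F (by simp) _ _)
        (fun x y => (s1_s2_commute F _ _ _ _).symm) (fun x y => s1_s2_commute F _ _ _ _)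
        (fun x y => s1_commute F (by simp) _ _)
    rw [list_prod_perm (nodup_reverse.2 Γ.isOrder_order.nodup) hl, map_cons,
      map_cons, prod_cons, prod_cons, ht, hf, prod_eq_one, mul_one]
    · intro z hz
      obtain ⟨h, hh, rfl⟩ := mem_map.1 hz
      simp only [nodup_cons, mem_cons, not_or] at hn
      exact h1 h (fun h' => hn.1.2 (by rw [← h']; exact hh)) (fun h' => hn.2.1 (by rw [← h']; exact hh))
    · intro x _ y _ hxy
      by_cases hxt : x = (e, true)
      · by_cases hyf : y = (e, false)
        · rw [hxt, hyf, ht, hf]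
          exact hc
        · rw [h1 y (fun h => hxy (hxt.trans h.symm)) hyf]
          exact one_right _
      · by_cases hxf : x = (e, false)
        · by_cases hyt : y = (e, true)
          · rw [hxf, hyt, ht, hf]
            exact hc.symm
          · rw [h1 y hyt (fun h => hxy (hxf.trans h.symm))]
            exact one_right _
        · rw [h1 x hxt hxf]
          exact one_left _
  · by_cases ht : h = (e, true)
    · simp_all [doubleEnd_true]
    · by_cases hf : h = (e, false)
      · simp_all [doubleEnd_false]
      · simp_all [doubleEnd, if_neg]

lemma dlt_doubleEdge (hR : IsRMatrix R) (d : Ten F K E) :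
    rr R (s2 F K (some e)).toLinearMap (s1 F K none).toLinearMap *
      dlt F K (Option E) ((split_doubleEdge e).hom F K d) =
    amap ((split_doubleEdge e).hom F K)
      ((split_doubleEdge e).hom F K) (dlt F K E d) *
      rr R (s2 F K (some e)).toLinearMap (s1 F K none).toLinearMap := by
  refine mul_map_eq_map_mul (f := (dlt F K (Option E)).comp ((split_doubleEdge e).hom F K))
    (g := (amap ((split_doubleEdge e).hom F K)
      ((split_doubleEdge e).hom F K)).comp (dlt F K E)) (fun x k => ?_) d
  have hg : (toConv (((amap ((split_doubleEdge e).hom F K)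
      ((split_doubleEdge e).hom F K)).comp (dlt F K E)).comp (sing x)).toLinearMap :
        Cv F K (Ten2 F K (Option E))) =
      ((doubleEdge e x).map (fun y => (toConv (s1 F K y).toLinearMap : Cv F K _))).prod *
      ((doubleEdge e x).map (fun y => (toConv (s2 F K y).toLinearMap : Cv F K _))).prod := by
    have h1 := toConv_mapDlt_comp_sing ((split_doubleEdge e).hom F K)
      ((split_doubleEdge e).hom F K) x
    refine h1.trans ?_
    rw [pc_toConv, pc_toConv, ← comp_assoc, ← comp_assoc, ListSplit.toConv_comp_hom,
      ListSplit.toConv_comp_hom]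
    rfl
  have hf := (split_doubleEdge e).toConv_comp_hom (dlt F K (Option E)) x
  have hs : ∀ y : Option E, (toConv ((dlt F K (Option E)).comp (sing y)).toLinearMap :
      Cv F K (Ten2 F K (Option E))) = toConv (s1 F K y).toLinearMap *
        toConv (s2 F K y).toLinearMap := by
    intro y
    ext k
    exact dlt_sing_eq_rr y k
  set r := rr R (s2 F K (some e)).toLinearMap (s1 F K none).toLinearMap with hr
  suffices h : cst r * ((doubleEdge e x).map (fun y => (toConv ((dlt F K (Option E)).comp
      (sing y)).toLinearMap : Cv F K _))).prod =
      ((doubleEdge e x).map (fun y => (toConv (s1 F K y).toLinearMap : Cv F K _))).prod *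
      ((doubleEdge e x).map (fun y => (toConv (s2 F K y).toLinearMap : Cv F K _))).prod *
        cst r by
    rw [← hf, ← hg] at h
    have := congr(($h).ofConv k)
    exact ((cst_mul_apply _ _ k).symm.trans this).trans (mul_cst_apply _ _ k)
  simp only [hs]
  by_cases hx : x = e
  · subst hx
    have h1 : Commute (cst r) (toConv (s1 F K (some x)).toLinearMap :
        Cv F K (Ten2 F K (Option E))) := commute_cst (fun c =>
      commute_rr (fun y => s1_s2_commute F _ _ _ _) (fun y => s1_commute F (by simp) _ _)
        |>.symm)
    have h2 : Commute (cst r) (toConv (s2 F K (none : Option E)).toLinearMap :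
        Cv F K (Ten2 F K (Option E))) := commute_cst (fun c =>
      commute_rr (fun y => s2_commute F (by simp) _ _) (fun y => (s1_s2_commute F _ _ _ _).symm)
        |>.symm)
    have h3 : cst r * (toConv (s2 F K (some x)).toLinearMap * toConv (s1 F K none).toLinearMap) =
        (toConv (s1 F K none).toLinearMap * toConv (s2 F K (some x)).toLinearMap :
          Cv F K (Ten2 F K (Option E))) * cst r := by
      ext k
      refine (cst_mul_apply _ _ k).trans (Eq.trans ?_ (mul_cst_apply _ _ k).symm)
      exact hR.exchange (s2 F K (some x)) (s1 F K none)
        (fun _ _ => (s1_s2_commute F _ _ _ _).symm) k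
    rw [doubleEdge_self]
    simp only [map_cons, List.map_nil, prod_cons, List.prod_nil, mul_one]
    calc _ = cst r * toConv (s1 F K (some x)).toLinearMap * (toConv (s2 F K (some x)).toLinearMap *
          toConv (s1 F K none).toLinearMap) * toConv (s2 F K none).toLinearMap := by
          simp only [mul_assoc]
      _ = _ := by
          rw [h1.eq, mul_assoc (toConv (s1 F K (some x)).toLinearMap), h3]
          simp only [mul_assoc]
          rw [h2.eq]
  · rw [doubleEdge_of_ne e hx, map_singleton, prod_singleton, map_singleton,
      prod_singleton, map_singleton, prod_singleton]
    refine commute_cst (fun c => ?_)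
    refine commute_cmul (fun k => (commute_rr (fun y => ?_) (fun y => ?_)).symm)
      (fun k => (commute_rr (fun y => ?_) (fun y => ?_)).symm) c
    · exact s1_s2_commute F _ _ _ _
    · exact s1_commute F (by simp) _ _
    · exact s2_commute F (by simpa using hx) _ _
    · exact (s1_s2_commute F _ _ _ _).symm

lemma exists_isFull_cons (x : X) :
    ∃ l, IsFull (x :: l) :=
  ⟨_, isFull_univ.of_perm (List.perm_cons_erase (by simp))⟩

lemma isFull_option {l : List X} (h : IsFull l) :
    IsFull (none :: l.map some) :=
  ⟨by simpa using h.nodup.map (Option.some_injective _), fun y => by cases y <;> simp [h.mem]⟩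

lemma commute_s12 {φ ψ : K →ₗ[F] Ten2 F K X} {x y : X} (h1 : ∀ a b, Commute (φ a) (s1 F K x b))
    (h2 : ∀ a b, Commute (φ a) (s2 F K y b)) (h3 : ∀ a b, Commute (ψ a) (s1 F K x b))
    (h4 : ∀ a b, Commute (ψ a) (s2 F K y b)) (R t : K ⊗[F] K) : Commute (rr R φ ψ) (s12 F K x y t) := by
  rw [s12_apply]
  exact commute_rr_rr h1 h2 h3 h4

lemma mul_twist_double (hR : IsRMatrix R) (d : Ten F K E) :
    rr R (s2 F K (some e)).toLinearMap (s1 F K none).toLinearMap *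
      (dlt F K (Option E) ((split_doubleEdge e).hom F K d) * twist R (fun _ => true)) *
      rr R (s2 F K none).toLinearMap (s1 F K (some e)).toLinearMap =
    amap ((split_doubleEdge e).hom F K)
      ((split_doubleEdge e).hom F K) (dlt F K E d * twist R (fun _ => true)) := by
  obtain ⟨l, hl⟩ := exists_isFull_cons e
  have hl' : IsFull (some e :: none :: l.map some) :=
    (isFull_option hl).of_perm (List.Perm.swap _ _ _)
  have hle : e ∉ l := (nodup_cons.1 hl.nodup).1
  rw [twist_eq_prod_s12 R _ hl, twist_eq_prod_s12 R _ hl']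
  simp only [if_true, map_cons, prod_cons, map_map, map_mul (_ : Ten2 F K E →ₐ[F] _),
    map_list_prod, Function.comp_def]
  have hc : ∀ (x : E) (t : K ⊗[F] K), amap ((split_doubleEdge e).hom F K)
      ((split_doubleEdge e).hom F K) (s12 F K x x t) = tmap
        (comulList (doubleEdge e x)) (comulList (doubleEdge e x)) t := by
    intro x t
    induction t <;> simp_all [s12, ListSplit.hom_sing]
  have h1 : ∀ x ∈ l, amap ((split_doubleEdge e).hom F K)
      ((split_doubleEdge e).hom F K) (s12 F K x x (flip R)) =
      s12 F K (some x) (some x) (flip R) := by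
    intro x hx
    rw [hc, doubleEdge_of_ne e (fun h => hle (by rw [← h]; exact hx)), comulList_singleton]
    rfl
  have h2 : amap ((split_doubleEdge e).hom F K)
      ((split_doubleEdge e).hom F K) (s12 F K e e (flip R)) =
      rr R (s2 F K (some e)).toLinearMap (s1 F K none).toLinearMap *
        s12 F K (some e) (some e) (flip R) * (s12 F K none none (flip R) *
        rr R (s2 F K none).toLinearMap (s1 F K (some e)).toLinearMap) := by
    rw [s12_flip, s12_flip, s12_flip, s21_apply, s21_apply, s21_apply, map_rr, ← hR.rr_cmul_cmul
      (fun x y => s1_commute F (by simp) _ _) (fun x y => s2_commute F (by simp) _ _) (fun x y =>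
      (s1_s2_commute F _ _ _ _).symm) (fun x y => (s1_s2_commute F _ _ _ _).symm) (fun x y =>
      (s1_s2_commute F _ _ _ _).symm) (fun x y => (s1_s2_commute F _ _ _ _).symm)]
    congr 1
    · apply WithConv.toConv_injective
      refine (congrArg toConv ?_).trans (((split_doubleEdge e).toConv_comp_hom (F := F) (K := K)
        inR e).trans ?_)
      · ext k; simp [s2_apply]
      · rw [doubleEdge_self]; simp; rfl
    · apply WithConv.toConv_injective
      refine (congrArg toConv ?_).trans (((split_doubleEdge e).toConv_comp_hom (F := F) (K := K)
        inL e).trans ?_)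
      · ext k; simp [s1_apply]
      · rw [doubleEdge_self]; simp; rfl
  rw [h2, map_congr_left h1, ← mul_assoc, dlt_doubleEdge e hR]
  have h3 : Commute (rr R (s2 F K (none : Option E)).toLinearMap (s1 F K (some e)).toLinearMap)
      (l.map (fun x => s12 F K (some x) (some x) (flip R))).prod := by
    refine list_prod_right _ _ (fun z hz => ?_)
    obtain ⟨x, hx, rfl⟩ := mem_map.1 hz
    have hxe : some e ≠ some x := fun h => hle (by rw [Option.some.inj h]; exact hx)
    exact commute_s12 (fun _ _ => (s1_s2_commute F _ _ _ _).symm)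
      (fun _ _ => s2_commute F (by simp) _ _) (fun _ _ => s1_commute F hxe _ _)
      (fun _ _ => s1_s2_commute F _ _ _ _) _ _
  simp only [mul_assoc]
  rw [h3.eq]

lemma deltaD_double (hR : IsRMatrix R) (d : Ten F K E) :
    deltaD (Γ.double e) R ((split_doubleEdge e).hom F K d) =
      amap ((split_doubleEdge e).hom F K)
        ((split_doubleEdge e).hom F K) (deltaD Γ R d) := by
  rw [deltaD_apply, deltaD_apply, (edgeHom_double Γ e).map_actD2, braid_double Γ e hR, map_mul (actD2 F K (Option E)),
    map_mul (actD2 F K (Option E)), mul_apply, mul_apply, actD2_rr_false, hR.map_antipode,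
    actD2_rr_true, ← mul_assoc, mul_twist_double e hR]

/-- Doubling an edge. -/
lemma RibbonData.induces_double [FiniteDimensional F K] (hd : RibbonData R ν) (ρ : E → Bool)
    (ρ' : Option E → Bool) : Induces R Γ (Γ.double e) ρ ρ'
      (fun h => if h.1 = e then false else twistOf ρ h) some (doubleVal e) := by
  refine hd.induces ρ ρ' ((edgeHom_double Γ e).inducingPair hd.rMat (fun h hh x hx y hy => ?_)
    (deltaD_double Γ e hd.rMat) (fun _ _ _ => rfl)) (fun x k => ?_)
  · simp_all [doubleEnd_of_ne, mem_singleton]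
  · refine (endSplit_double Γ e).endN_coord hd (h := (x.1.getD e, x.2)) ?_ rfl k
    obtain ⟨f, b⟩ := x
    cases f with
    | none => cases b <;> simp [doubleEnd]
    | some f => grind [doubleEnd, doubleEnd_of_ne]

end Double

/-! ### Adding a loop -/

section Insert

variable {M : Type*} [AddCommGroup M] [Module F M] {S : Submodule F M}

/-- The endomorphisms that map a submodule to itself. -/
def stab (S : Submodule F M) : Subalgebra F (Module.End F M) where
  carrier := {f | ∀ u ∈ S, f u ∈ S}
  mul_mem' hf hg u hu := hf _ (hg u hu)
  add_mem' hf hg u hu := S.add_mem (hf u hu) (hg u hu)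
  algebraMap_mem' c u hu := S.smul_mem c hu

lemma rr_mem {Q : Subalgebra F B} {φ ψ : K →ₗ[F] B} (h : ∀ k, φ k ∈ Q) (h' : ∀ k, ψ k ∈ Q)
    (t : K ⊗[F] K) : rr t φ ψ ∈ Q := by
  induction t with
  | zero => rw [rr_zero]; exact Q.zero_mem
  | add s t hs ht => rw [rr_add]; exact Q.add_mem hs ht
  | tmul x y => rw [rr_tmul]; exact Q.mul_mem (h x) (h' y)

lemma epsOne_mem (Q : Subalgebra F B) (k : K) :
    (epsOne (F := F) k : B) ∈ Q := Q.algebraMap_mem _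

lemma om_mem {Q : Subalgebra F B} {a : I → K →ₐ[F] B} {v : V} {l : List I}
    (h : ∀ i ∈ l, ∀ k, a i k ∈ Q) (k : K) : om base a v l k ∈ Q := by
  induction l generalizing k with
  | nil => exact epsOne_mem Q k
  | cons x l ih =>
    rw [om_cons, cmul_eq_rr]
    refine rr_mem (fun k => ?_) (ih (fun i hi => h i (mem_cons_of_mem _ hi))) _
    rw [toLinearMap_apply, atV]
    split_ifs
    · exact h x mem_cons_self k
    · exact epsOne_mem Q k

lemma braidL_mem {Q : Subalgebra F B} {a b : I → K →ₐ[F] B} {l : List I}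
    (ha : ∀ i ∈ l, ∀ k, a i k ∈ Q) (hb : ∀ i ∈ l, ∀ k, b i k ∈ Q) : braidL base R a b l ∈ Q := by
  refine Q.list_prod_mem (fun z hz => ?_)
  obtain ⟨p, hp, rfl⟩ := mem_map.1 hz
  have := mem_of_mem_pairsOf hp
  split_ifs
  · exact rr_mem (hb _ this.1) (ha _ this.2) R
  · exact Q.one_mem

lemma rr_congr_right {φ φ' ψ : K →ₗ[F] Module.End F M}
    (h : ∀ k, ∀ u ∈ S, φ k u = φ' k u) (t : K ⊗[F] K) {u : M} (hu : u ∈ S) :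
    rr t ψ φ u = rr t ψ φ' u := by
  induction t <;> simp_all [rr_zero, rr_add, ladd, rr_tmul, mul_apply]

lemma rr_congr_left {φ φ' ψ : K →ₗ[F] Module.End F M} (hψ : ∀ k, ψ k ∈ stab S)
    (h : ∀ k, ∀ u ∈ S, φ k u = φ' k u) (t : K ⊗[F] K) {u : M} (hu : u ∈ S) :
    rr t φ ψ u = rr t φ' ψ u := by
  induction t with
  | tmul x y => simp only [rr_tmul, mul_apply, h x _ (hψ y u hu)]
  | _ => simp_all [rr_zero, rr_add, ladd]

variable {a b : I → K →ₐ[F] Module.End F M} {v : V} {t s : I} {Y : List I}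

lemma om_insert (ht : base t = v) (hs : base s = v)
    (ha : ∀ k, ∀ u ∈ S, cmul (a t).toLinearMap (a s).toLinearMap k u =
      (epsOne (F := F) k : Module.End F M) u)
    (hY : ∀ i ∈ Y, ∀ k, a i k ∈ stab S) (X : List I) (k : K) {u : M} (hu : u ∈ S) :
    om base a v (X ++ t :: s :: Y) k u = om base a v (X ++ Y) k u := by
  induction X generalizing k u with
  | nil =>
    have h1 : om base a v (t :: s :: Y) =
        cmul (cmul (a t).toLinearMap (a s).toLinearMap) (om base a v Y) := by
      apply WithConv.toConv_injective
      rw [om_cons, om_cons, atV, if_pos ht, atV, if_pos hs]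
      exact (mul_assoc _ _ _).symm
    rw [nil_append, nil_append, h1, cmul_eq_rr, rr_congr_left (om_mem hY) ha _ hu,
      ← cmul_eq_rr, epsOne_cmul]
  | cons x X ih =>
    rw [cons_append, cons_append, om_cons, om_cons, cmul_eq_rr, cmul_eq_rr]
    exact rr_congr_right (fun k u hu => ih k hu) _ hu

lemma braidL_insert (hR : IsRMatrix R) (ha : Slots a) (hb : Slots b) (hab : Across a b)
    (ht : base t = v) (hs : base s = v)
    (hat : ∀ k, ∀ u ∈ S, cmul (a t).toLinearMap (a s).toLinearMap k u =
      (epsOne (F := F) k : Module.End F M) u)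
    (hbt : ∀ k, ∀ u ∈ S, cmul (b t).toLinearMap (b s).toLinearMap k u =
      (epsOne (F := F) k : Module.End F M) u) {X : List I} (hX : ∀ i ∈ X, base i = v)
    (haY : ∀ i ∈ X ++ Y, ∀ k, a i k ∈ stab S) (hbY : ∀ i ∈ X ++ Y, ∀ k, b i k ∈ stab S)
    (hn : (X ++ t :: s :: Y).Nodup) {w u : M} (hu : u ∈ S)
    (hw : rr R (b t).toLinearMap (a s).toLinearMap w = u) :
    braidL base R a b (X ++ t :: s :: Y) w = braidL base R a b (X ++ Y) u := by
  induction X with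
  | nil =>
    rw [nil_append] at hn haY hbY ⊢
    obtain ⟨ω, hω⟩ := exists_om (base := base) ha v
      (nodup_cons.1 (nodup_cons.1 hn).2).2
    rw [nil_append, braidL_cons_cons hR ha hb hab hn (ht.trans hs.symm), mul_apply, mul_apply, hw,
      ht, rr_congr_left (om_mem haY) hbt R (braidL_mem haY hbY u hu), ← hω, hR.rr_eps_left]
    rfl
  | cons x X ih =>
    simp only [cons_append, mem_cons, forall_eq_or_imp] at hn haY hbY hX ⊢
    have hn1 := (nodup_cons.1 hn).2
    have hsub : Sublist (X ++ Y) (X ++ t :: s :: Y) :=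
      Sublist.append_left (((Sublist.refl Y).cons s).cons t) X
    rw [braidL_cons hR ha hab hn1, braidL_cons hR ha hab (hn1.sublist hsub),
      mul_apply, mul_apply, ih hX.2 haY.2 hbY.2 hn1, hX.1]
    exact rr_congr_right (fun k u hu => om_insert ht hs hat
      (fun i hi => haY.2 i (List.mem_append_right _ hi)) X k hu) R (braidL_mem haY.2 hbY.2 u hu)

end Insert

section LoopAction

variable {φ ψ : K →ₐ[F] A} {p q : K →ₐ[F] Module.End F A} {u : A}

lemma rr_loop (hp : ∀ k u, p k u = φ k * u)
    (hq : ∀ k u, q k u = u * ψ (apd F k)) (hu : ∀ k, Commute (φ k) u) (r : A)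
    (t : K ⊗[F] K) : rr t p.toLinearMap q.toLinearMap (u * r) =
      u * rr t ((mulRight F r).comp φ.toLinearMap)
        (ψ.toLinearMap.comp (apd F)) := by
  induction t with
  | tmul x y =>
    simp only [rr_tmul, toLinearMap_apply, mul_apply, hp, hq,
      lcomp_apply, mulRight_apply, ← mul_assoc, (hu x).eq]
  | _ => simp_all [rr_zero, rr_add, ladd, mul_add]

lemma cmul_loop (hp : ∀ k u, p k u = φ k * u)
    (hq : ∀ k u, q k u = u * φ (apd F k)) (hu : ∀ k, Commute (φ k) u) (k : K) :
    cmul p.toLinearMap q.toLinearMap k u = (epsOne (F := F) k : Module.End F A) u := by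
  have h := rr_loop hp hq hu 1 (comul (R := F) k)
  rw [mul_one, show (mulRight F (1 : A)).comp φ.toLinearMap = φ.toLinearMap from
    lext (fun _ => mul_one _), ← cmul_eq_rr, ← cmul_eq_rr, cmul_antipode_right] at h
  rw [h]
  simp [epsOne, algebraMap_eq_smul_one]

end LoopAction

section AddLoop

variable (Γ) (v : V) (n : ℕ)

/-- An edge end in the graph with an added loop. -/
def someEnd (h : E × Bool) : List (Option E × Bool) := [(some h.1, h.2)]

lemma flatMap_someEnd (l : List (E × Bool)) :
    l.flatMap someEnd = l.map (fun h => (some h.1, h.2)) := by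
  induction l with
  | nil => rfl
  | cons x l ih => rw [flatMap_cons, ih]; rfl

lemma addLoop_cil_self : (Γ.addLoop v n).cil v = ((Γ.cil v).take n).flatMap someEnd ++
    (none, true) :: (none, false) :: ((Γ.cil v).drop n).flatMap someEnd := by
  simp [flatMap_someEnd, CilGraph.addLoop]

lemma addLoop_cil_of_ne {w : V} (hw : w ≠ v) :
    (Γ.addLoop v n).cil w = (Γ.cil w).flatMap someEnd := by
  rw [flatMap_someEnd]
  exact if_neg hw

lemma endSplit_addLoop : EndSplit Γ (Γ.addLoop v n) someEnd := by
  refine ⟨fun w => ?_⟩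
  by_cases hw : w = v
  · subst hw
    rw [addLoop_cil_self]
    nth_rw 1 [← List.take_append_drop n (Γ.cil w)]
    rw [List.flatMap_append]
    exact Sublist.append_left (((Sublist.refl _).cons _).cons _) _
  · rw [addLoop_cil_of_ne Γ v n hw]

lemma listSplit_some : ListSplit (fun f : E => [some f]) :=
  ⟨fun _ => List.nodup_singleton _, fun x y h z hz hz' => h (by simp_all)⟩

variable (F K E) in
/-- The embedding of the tensor factors of the edges other than the loop. -/
def someHom : Ten F K E →ₐ[F] Ten F K (Option E) := listSplit_some.hom F K

lemma someHom_sing (x : E) (k : K) : someHom F K E (sing x k) = sing (some x) k := by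
  rw [someHom, ListSplit.hom_sing, comulList_singleton]
  rfl

lemma edgeHom_addLoop : (endSplit_addLoop Γ v n).EdgeHom (someHom F K E) := by
  refine ⟨fun h k d => ?_, fun x k => by rw [someHom_sing, epsT_sing]⟩
  obtain ⟨x, b⟩ := h
  rw [EndSplit.theta, ListSplit.hom_sing, someEnd, comulList_singleton, toLinearMap_apply,
    actD_sing, actD_sing]
  cases b
  · simp [endAct_false, map_mul, someHom_sing]
  · simp [endAct_true, map_mul, someHom_sing]

lemma commute_someHom (k : K) (d : Ten F K E) : Commute (sing none k) (someHom F K E d) := by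
  induction d using ten_induction with
  | one => rw [map_one]; exact one_right _
  | smul c z hz => rw [map_smul]; exact hz.smul_right c
  | add z w hz hw => rw [map_add]; exact hz.add_right hw
  | mul x k z hz =>
    rw [map_mul, someHom_sing]
    exact (sing_commute (by simp) _ _).mul_right hz

variable (F K E) in
/-- Two copies of this embedding. -/
abbrev someHom2 : Ten2 F K E →ₐ[F] Ten2 F K (Option E) := amap (someHom F K E) (someHom F K E)

lemma commute_someHom2 (k : K) (z : Ten2 F K E) :
    Commute (s1 F K none k) (someHom2 F K E z) ∧ Commute (s2 F K none k) (someHom2 F K E z) := by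
  induction z using tind with
  | tmul x y =>
    exact ⟨tmul_commute (commute_someHom k x) (one_left _),
      tmul_commute (one_left _) (commute_someHom k y)⟩
  | _ => simp_all

lemma dlt_someHom (d : Ten F K E) :
    dlt F K (Option E) (someHom F K E d) = someHom2 F K E (dlt F K E d) := by
  have h : (dlt F K (Option E)).comp (someHom F K E) = (someHom2 F K E).comp (dlt F K E) := by
    refine ten_algHom_ext (fun x k => ?_)
    rw [comp_apply, comp_apply, someHom_sing, dlt_sing, dlt_sing]
    generalize comul (R := F) k = t
    induction t <;> simp_all [someHom_sing]
  exact congr($h d)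

lemma twist_option (R : K ⊗[F] K) : twist R (fun _ : Option E => true) =
    s12 F K none none (flip R) * someHom2 F K E (twist R (fun _ => true)) := by
  rw [twist_eq_prod_s12 R _ (isFull_option isFull_univ), twist_eq_prod_s12 R _ isFull_univ]
  simp only [if_true, map_cons, prod_cons, map_map, map_list_prod]
  congr 3
  funext x
  have h : (someHom2 F K E).comp (s12 F K x x) = s12 F K (some x) (some x) := by
    ext k <;> simp [s12, someHom_sing]
  exact congr($h (flip R)).symm

lemma gaugeAct_addLoop (w : V) (y : K) (d : Ten F K E) :
    actD F K (Option E) (comulList ((Γ.cil w).flatMap someEnd) y) (someHom F K E d) =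
      actD F K (Option E) (comulList ((Γ.addLoop v n).cil w) y) (someHom F K E d) := by
  by_cases hw : w = v
  · subst hw
    rw [addLoop_cil_self, ← om_sing, ← om_sing, map_om, map_om]
    nth_rw 1 [← List.take_append_drop n (Γ.cil w)]
    rw [List.flatMap_append]
    refine (om_insert (S := LinearMap.range (someHom F K E).toLinearMap) (base := fun _ => ())
      (a := fun i => (actD F K (Option E)).comp (sing i)) (v := ()) rfl rfl (fun k u hu => ?_)
      (fun i hi k u hu => ?_) _ y ⟨d, rfl⟩).symm
    · obtain ⟨z, rfl⟩ := hu
      exact cmul_loop (φ := sing none) (fun k u => by rw [comp_apply, actD_sing, endAct_true])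
        (fun k u => by rw [comp_apply, actD_sing, endAct_false])
        (fun k => commute_someHom k z) k
    · obtain ⟨z, rfl⟩ := hu
      obtain ⟨h, _, hh⟩ := List.mem_flatMap.1 hi
      rw [someEnd, mem_singleton] at hh
      subst hh
      refine ⟨actD F K E (sing h k) z, ((edgeHom_addLoop Γ w n).map_actD _ z).trans ?_⟩
      rw [EndSplit.theta, ListSplit.hom_sing, someEnd, comulList_singleton]
      rfl
  · rw [addLoop_cil_of_ne Γ v n hw]

lemma actD2_braid_addLoop (hR : IsRMatrix R) (z : Ten2 F K E) :
    actD2 F K (Option E) ((Γ.addLoop v n).braid R)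
      (someHom2 F K E z * s12 F K none none (flip R)) =
      someHom2 F K E (actD2 F K E (Γ.braid R) z) := by
  obtain ⟨vs, hvs⟩ := exists_isFull_cons v
  have hv : v ∉ vs := (nodup_cons.1 hvs.nodup).1
  have hL := Γ.isOrder_flatMap hvs.nodup hvs.mem
  have hL' := (Γ.addLoop v n).isOrder_flatMap hvs.nodup hvs.mem
  have hrest : vs.flatMap (Γ.addLoop v n).cil = (vs.flatMap Γ.cil).flatMap someEnd := by
    rw [List.flatMap_assoc]
    refine List.flatMap_congr (fun w hw => ?_)
    exact addLoop_cil_of_ne Γ v n (fun h => hv (by rw [← h]; exact hw))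
  have hsplit : ((v :: vs).flatMap Γ.cil).flatMap someEnd = ((Γ.cil v).take n).flatMap someEnd ++
      (((Γ.cil v).drop n).flatMap someEnd ++ (vs.flatMap Γ.cil).flatMap someEnd) := by
    grind [List.take_append_drop]
  rw [flatMap_cons, addLoop_cil_self, hrest, List.append_assoc, cons_append, cons_append] at hL'
  have hmem : ∀ i ∈ ((v :: vs).flatMap Γ.cil).flatMap someEnd, ∃ h : E × Bool, i = (some h.1, h.2) := by
    intro i hi
    obtain ⟨h, _, hh⟩ := List.mem_flatMap.1 hi
    exact ⟨h, mem_singleton.1 hh⟩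
  have e1 : ∀ (x : E × Bool) k, amap ((endSplit_addLoop Γ v n).theta F K)
      ((endSplit_addLoop Γ v n).theta F K) (s1 F K x k) = s1 F K (some x.1, x.2) k := fun x k => by
    rw [s1_apply, amap_tmul, ListSplit.hom_sing, someEnd, comulList_singleton, map_one]
    rfl
  have e2 : ∀ (x : E × Bool) k, amap ((endSplit_addLoop Γ v n).theta F K)
      ((endSplit_addLoop Γ v n).theta F K) (s2 F K x k) = s2 F K (some x.1, x.2) k := fun x k => by
    rw [s2_apply, amap_tmul, ListSplit.hom_sing, someEnd, comulList_singleton, map_one]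
    rfl
  have hbr := (endSplit_addLoop Γ v n).braidL_eq hR (fun h => Or.inl ⟨_, rfl⟩) hL
    (hL'.nodup.sublist (by
      rw [hsplit]
      exact Sublist.append_left (((Sublist.refl _).cons _).cons _) _))
  rw [prod_eq_one, mul_one] at hbr
  · rw [(edgeHom_addLoop Γ v n).map_actD2, ← hbr, hsplit, CilGraph.braid_eq_braidL R hL']
    have hmap := map_braidL (B := Ten2 F K (Option E × Bool)) (B' := Module.End F (Ten2 F K (Option E)))
      (base := (Γ.addLoop v n).base) (actD2 F K (Option E)) R (s1 F K) (s2 F K)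
    rw [hmap, hmap]
    refine braidL_insert (v := v) (S := LinearMap.range (someHom2 F K E).toLinearMap) hR
      (slots_comp slots_s1 _) (slots_comp slots_s2 _) (across_comp across_s1_s2 _) rfl rfl
      (fun k u hu => ?_) (fun k u hu => ?_) (fun i hi => ?_) (fun i hi k u hu => ?_)
      (fun i hi k u hu => ?_) hL'.nodup ⟨z, rfl⟩ ?_
    · obtain ⟨z, rfl⟩ := hu
      exact cmul_loop (φ := s1 F K none) (fun k u => actD2_s1_true none k u)
        (fun k u => actD2_s1_false none k u)
        (fun k => (commute_someHom2 k z).1) k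
    · obtain ⟨z, rfl⟩ := hu
      exact cmul_loop (φ := s2 F K none) (fun k u => actD2_s2_true none k u)
        (fun k u => actD2_s2_false none k u) (fun k => (commute_someHom2 k z).2) k
    · obtain ⟨h, hh, hi'⟩ := List.mem_flatMap.1 hi
      rw [mem_singleton.1 hi']
      exact (Γ.mem_cil _ _).1 (List.mem_of_mem_take hh)
    · obtain ⟨z, rfl⟩ := hu
      rw [← hsplit] at hi
      obtain ⟨h, rfl⟩ := hmem i hi
      refine ⟨actD2 F K E (s1 F K h k) z, ((edgeHom_addLoop Γ v n).map_actD2 _ z).trans ?_⟩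
      rw [e1]
      rfl
    · obtain ⟨z, rfl⟩ := hu
      rw [← hsplit] at hi
      obtain ⟨h, rfl⟩ := hmem i hi
      refine ⟨actD2 F K E (s2 F K h k) z, ((edgeHom_addLoop Γ v n).map_actD2 _ z).trans ?_⟩
      rw [e2]
      rfl
    · rw [s12_flip, s21_apply]
      refine (rr_loop (φ := s2 F K none) (ψ := s1 F K none) (fun k u => actD2_s2_true none k u)
        (fun k u => actD2_s1_false none k u) (fun k => (commute_someHom2 k z).2) _ R).trans ?_
      rw [hR.rr_sandwich _ _ (fun _ _ => (s1_s2_commute F _ _ _ _).symm), mul_one]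
  · intro x hx
    obtain ⟨h, _, rfl⟩ := mem_map.1 hx
    exact braidL_singleton _ _ _

lemma deltaD_addLoop (hR : IsRMatrix R) (d : Ten F K E) :
    deltaD (Γ.addLoop v n) R (someHom F K E d) = someHom2 F K E (deltaD Γ R d) := by
  rw [deltaD_apply, deltaD_apply, ← actD2_braid_addLoop Γ v n hR, dlt_someHom, twist_option,
    map_mul (someHom2 F K E), mul_assoc]
  congr 2
  rw [s12_flip, s21_apply]
  exact (commute_rr (fun x => (commute_someHom2 x _).2.symm)
    (fun x => (commute_someHom2 x _).1.symm)).symm.eq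

/-- Adding a loop. -/
lemma RibbonData.induces_addLoop [FiniteDimensional F K] (hd : RibbonData R ν) (ρ : E → Bool)
    (ρ' : Option E → Bool) :
    Induces R Γ (Γ.addLoop v n) ρ ρ' (twistOf ρ) some loopVal := by
  refine hd.induces ρ ρ' ((edgeHom_addLoop Γ v n).inducingPair hd.rMat
    (fun h _ x hx y hy => ?_) (deltaD_addLoop Γ v n hd.rMat) (gaugeAct_addLoop Γ v n))
    (fun x k => ?_)
  · exact (mem_singleton.1 hx).trans (mem_singleton.1 hy).symm
  · obtain ⟨f, b⟩ := x
    cases f with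
    | none =>
      rw [(endSplit_addLoop Γ v n).co_comp_theta_of_forall (fun h => by simp [someEnd])]
      refine Eq.trans ?_ (congrArg (algebraMap F K) (hd.epsT_tenN k)).symm
      rw [algebraMap_eq_smul_one]
      change endN F K b (counitTen (E × Bool) k • (1 : K)) = _
      rw [map_smul, counitTen_eq]
      congr 1
      cases b
      · exact hd.antipodeInv_one
      · rfl
    | some f => exact (endSplit_addLoop Γ v n).endN_coord hd (h := (f, b)) (by simp [someEnd]) rfl k

end AddLoop

end HopfGauge

end

theorem mainTheorem6 {F K V E : Type*} [Field F] [CharZero F] [Ring K] [HopfAlgebra F K]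
    [FiniteDimensional F K] [Fintype V] [DecidableEq V] [Fintype E] [DecidableEq E]
    (R : K ⊗[F] K) (ν : K) (hR : HopfGauge.IsRMatrix R) (hν : HopfGauge.IsRibbon R ν)
    (Γ : HopfGauge.CilGraph V E) (ρ : E → Bool) :
    -- the algebra and module structures of the gauge theory on the graph are induced by `G*`
    Γ.GStarHom R ρ ∧
    -- deleting an edge
    (∀ (e : E) (ρ' : {f : E // f ≠ e} → Bool),
      HopfGauge.Induces R Γ (Γ.delete e) ρ ρ' (HopfGauge.twistOf ρ)
        (fun v => if hv : ¬ (Γ.cil v ≠ [] ∧ ∀ h ∈ Γ.cil v, h.1 = e) then some ⟨v, hv⟩ else none)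
        (HopfGauge.deleteVal e)) ∧
    -- contracting an edge that is not a loop towards its target vertex (`a = false`) or its
    -- starting vertex (`a = true`)
    (∀ (e : E) (a : Bool) (hl : Γ.base (e, !a) ≠ Γ.base (e, a)) (ρ' : {f : E // f ≠ e} → Bool),
      HopfGauge.Induces R Γ (Γ.contract e a hl) ρ ρ' (HopfGauge.twistOf ρ)
        (fun v => if hv : v ≠ Γ.base (e, a) then some ⟨v, hv⟩ else none)
        (HopfGauge.contractVal R ν Γ e a)) ∧
    -- adding a loop
    (∀ (v : V) (n : ℕ) (ρ' : Option E → Bool),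
      HopfGauge.Induces R Γ (Γ.addLoop v n) ρ ρ' (HopfGauge.twistOf ρ) some
        HopfGauge.loopVal) ∧
    -- detaching adjacent edge ends from a vertex that is at least trivalent
    (∀ (e₁ e₂ : E) (hne : e₁ ≠ e₂) (ρ' : HopfGauge.CilGraph.DetEdge e₁ e₂ → Bool),
      Γ.ta e₁ = Γ.st e₂ → 3 ≤ (Γ.cil (Γ.ta e₁)).length →
      ([(e₁, true), (e₂, false)] <:+: Γ.cil (Γ.ta e₁) ∨
        [(e₂, false), (e₁, true)] <:+: Γ.cil (Γ.ta e₁)) →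
      HopfGauge.Induces R Γ (Γ.detach e₁ e₂ hne) ρ ρ' (HopfGauge.twistOf ρ) some
        (HopfGauge.detachVal R ν Γ e₁ e₂)) ∧
    -- doubling an edge; the products at the ends of this edge are the untwisted ones
    (∀ (e : E) (ρ' : Option E → Bool),
      HopfGauge.Induces R Γ (Γ.double e) ρ ρ'
        (fun h => if h.1 = e then false else HopfGauge.twistOf ρ h) some
        (HopfGauge.doubleVal e)) := by
  have hd : HopfGauge.RibbonData R ν := ⟨hR, hν⟩
  exact ⟨hd.gStarHom Γ ρ, hd.induces_delete Γ ρ, hd.induces_contract Γ ρ,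
    fun v n => hd.induces_addLoop Γ v n ρ,
    fun e₁ e₂ hne ρ' hb _ hadj => hd.induces_detach Γ ρ e₁ e₂ hne ρ' hb hadj,
    fun e => hd.induces_double Γ e ρ⟩
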